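/- A thick edge graph (under the interval assumption) consists of a vertex set $V$, time stamps $1,\dots,t_{\max}$, and a finite set $E$ of thick edges $e=(u,v,t_u,t_v,\ell)$ with $u\ne v$, $\ell\ge 0$, $1\le t_u$, $1\le t_v$, $t_u+\ell\le t_{\max}$, $t_v+\ell\le t_{\max}$; the edge $e$ joins the super-vertices $(u,t_u+k)$ and $(v,t_v+k)$ for $0\le k\le \ell$. Parallel thick edges are allowed, but any two super-vertices are joined by at most one thick edge. Let $\Delta$ be the maximum, over the vertices, of the number of incident thick edges. A clique is a pair $(K,s)$ of a non-empty edge set $K\subseteq E$, with set of endpoints $V(K)$, such that any two distinct vertices of $V(K)$ are joined by an edge of $K$, and a shift function $s:V(K)\to\mathbb Z$. Its active time stamp set $\tau(K,s)$ is the set of all $t$ such that every edge $e\in K$ with ends $u,v$ joins $(u,s(u)+t)$ and $(v,s(v)+t)$. The clique $(K,s)$ is a closed active clique if $\tau(K,s)\neq\emptyset$ and there is no clique $(K',s')$ with $K\subsetneq K'$, $s'|_{V(K)}=s$ and $\tau(K',s')=\tau(K,s)$. Cliques that differ by a common translation of all shifts are identified, by taking the representative with $\min s=0$. Statement. There is an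 algorithm (a fixed program for a unit-cost random access machine with addition, subtraction, comparison with $0$, indirect addressing and a write-only output, whose words have $O(\log(|V|+|E|+t_{\max}+\sigma+2))$ bits) which, given a thick edge graph and an integer $\sigma\ge 0$, outputs every closed active clique $(K,s)$ with $|\tau(K,s)|\ge\sigma$ exactly once (listing $K$ and $s$) and halts. Its running time is $O\bigl(\min\{\Delta^5,|E|^2\Delta\}\bigr)$ per clique, that is, the total time is $O\bigl(|V|+|E|+1+N\min\{\Delta^5,|E|^2\Delta\}\bigr)$ where $N$ is the number of cliques in the output, and it uses $O(|V|+|E|+1)$ memory cells. -/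

import Mathlib

/-! ### Thick edge graphs -/

/-- A thick edge `(u, v, t_u, t_v, ℓ)` on the vertex set `{0, …, n-1}`. -/
structure ThickEdge (n : ℕ) where
  u : Fin n
  v : Fin n
  tu : ℤ
  tv : ℤ
  len : ℕ

/-- The thick edge `e` joins the super-vertices `x = (vertex, time stamp)` and `y`: for some
`0 ≤ k ≤ ℓ` they are `(u, t_u + k)` and `(v, t_v + k)`, in one order or the other. -/
def ThickEdge.Joins {n : ℕ} (e : ThickEdge n) (x y : Fin n × ℤ) : Prop :=
  ∃ k : ℕ, k ≤ e.len ∧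
    ((x = (e.u, e.tu + k) ∧ y = (e.v, e.tv + k)) ∨
     (y = (e.u, e.tu + k) ∧ x = (e.v, e.tv + k)))

/-- A thick edge graph under the interval assumption: `n` vertices, time stamps `1, …, tmax`, and
`m` thick edges, each of which is active on one interval of time stamps.  Parallel thick edges are
allowed, but a pair of super-vertices is joined by at most one of them. -/
structure ThickEdgeGraph where
  n : ℕ
  m : ℕ
  tmax : ℕ
  edge : Fin m → ThickEdge n
  loopless : ∀ j, (edge j).u ≠ (edge j).v
  tu_pos : ∀ j, 1 ≤ (edge j).tu
  tv_pos : ∀ j, 1 ≤ (edge j).tv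
  tu_le : ∀ j, (edge j).tu + (edge j).len ≤ tmax
  tv_le : ∀ j, (edge j).tv + (edge j).len ≤ tmax
  simple : ∀ i j x y, (edge i).Joins x y → (edge j).Joins x y → i = j

namespace ThickEdgeGraph

variable (G : ThickEdgeGraph)

/-- Degree of a vertex: the number of thick edges incident to it. -/
def degree (x : Fin G.n) : ℕ :=
  (Finset.univ.filter fun j : Fin G.m => (G.edge j).u = x ∨ (G.edge j).v = x).card

/-- The maximum degree `Δ` (`0` if there is no vertex). -/
def maxDegree : ℕ := Finset.univ.sup G.degree

/-- `V(K)`: the set of endpoints of the edges in `K`. -/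
def vertexSet (K : Finset (Fin G.m)) : Finset (Fin G.n) :=
  K.image (fun j => (G.edge j).u) ∪ K.image (fun j => (G.edge j).v)

/-- `K` is the edge set of a clique (two or more vertices, any two distinct ones adjacent by an
edge of `K`), and `S` is the graph of a function `s : V(K) → ℤ`, the shifts of its vertices. -/
structure IsShiftedClique (K : Finset (Fin G.m)) (S : Finset (Fin G.n × ℤ)) : Prop where
  nonempty : K.Nonempty
  complete : ∀ x ∈ G.vertexSet K, ∀ y ∈ G.vertexSet K, x ≠ y →
    ∃ j ∈ K, ((G.edge j).u = x ∧ (G.edge j).v = y) ∨ ((G.edge j).u = y ∧ (G.edge j).v = x)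
  shift_mem : ∀ p ∈ S, p.1 ∈ G.vertexSet K
  shift_unique : ∀ x ∈ G.vertexSet K, ∃! s : ℤ, (x, s) ∈ S

/-- The active time stamp set of `(K, S)`: all `t` such that the vertices `x` of `V(K)`, taken at
the time stamps `s(x) + t`, form a clique through the edges of `K`. -/
def activeTimes (K : Finset (Fin G.m)) (S : Finset (Fin G.n × ℤ)) : Set ℤ :=
  {t | ∀ j ∈ K, ∀ a b : ℤ, ((G.edge j).u, a) ∈ S → ((G.edge j).v, b) ∈ S →
    (G.edge j).Joins ((G.edge j).u, a + t) ((G.edge j).v, b + t)}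

/-- `(K, S)` is a closed active clique: its active time stamp set is non-empty, and no clique that
properly includes `K`, with the same shifts on `V(K)`, has the same active time stamp set. -/
structure IsClosedActiveClique (K : Finset (Fin G.m)) (S : Finset (Fin G.n × ℤ)) : Prop where
  clique : G.IsShiftedClique K S
  active : (G.activeTimes K S).Nonempty
  closed : ∀ (K' : Finset (Fin G.m)) (S' : Finset (Fin G.n × ℤ)),
    G.IsShiftedClique K' S' → K ⊂ K' → S ⊆ S' → G.activeTimes K' S' ≠ G.activeTimes K S

/-- Shifts matter only up to a common translation; the representative that is listed has
non-negative shifts, one of which is `0`. -/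
def Normalized {n : ℕ} (S : Finset (Fin n × ℤ)) : Prop :=
  (∀ p ∈ S, 0 ≤ p.2) ∧ ∃ p ∈ S, p.2 = 0

/-- The objects to enumerate: the closed active cliques (with normalized shifts) whose active time
stamp set has at least `σ` elements. -/
def longClosedActiveCliques (σ : ℕ) : Set (Finset (Fin G.m) × Finset (Fin G.n × ℤ)) :=
  {c | G.IsClosedActiveClique c.1 c.2 ∧ Normalized c.2 ∧ σ ≤ (G.activeTimes c.1 c.2).ncard}

/-- The input: `n, m, tmax, σ`, and then the five numbers of each thick edge. -/
def input (σ : ℕ) : List ℤ :=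
  [(G.n : ℤ), (G.m : ℤ), (G.tmax : ℤ), (σ : ℤ)] ++
    (List.finRange G.m).flatMap fun j =>
      [((G.edge j).u : ℤ), ((G.edge j).v : ℤ), (G.edge j).tu, (G.edge j).tv, ((G.edge j).len : ℤ)]

/-- How one clique is written: the number of edges, the edges, the number of vertices, and each
vertex followed by its shift. -/
def record (c : List (Fin G.m) × List (Fin G.n × ℤ)) : List ℤ :=
  (c.1.length : ℤ) :: c.1.map (fun j => (j : ℤ)) ++
    (c.2.length : ℤ) :: c.2.flatMap (fun p => [(p.1 : ℤ), p.2])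

/-- The word list `out` lists the members of `A`, each exactly once, in some order; the edges and
the vertices of each member are written in some order without repetition. -/
def Enumerates (out : List ℤ) (A : Set (Finset (Fin G.m) × Finset (Fin G.n × ℤ))) : Prop :=
  ∃ L : List (List (Fin G.m) × List (Fin G.n × ℤ)),
    out = L.flatMap G.record ∧
    (∀ c ∈ L, c.1.Nodup ∧ c.2.Nodup) ∧
    (L.map fun c => (c.1.toFinset, c.2.toFinset)).Nodup ∧
    ∀ d, d ∈ L.map (fun c => (c.1.toFinset, c.2.toFinset)) ↔ d ∈ A

end ThickEdgeGraph

/-! ### The machine model: a random access machine with unit-cost instructions -/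

/-- Programs.  The numbers `r`, `a`, `b` name registers; a program mentions finitely many. -/
inductive RamProg where
  | skip : RamProg
  | const (r : ℕ) (c : ℤ) : RamProg
  | add (r a b : ℕ) : RamProg
  | sub (r a b : ℕ) : RamProg
  | load (r a : ℕ) : RamProg
  | store (a b : ℕ) : RamProg
  | emit (a : ℕ) : RamProg
  | seq (p q : RamProg) : RamProg
  | ifPos (a : ℕ) (p q : RamProg) : RamProg
  | whilePos (a : ℕ) (p : RamProg) : RamProg

/-- Registers, memory, and the write-only output. -/
structure RamState where
  reg : ℕ → ℤ
  mem : ℕ → ℤ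
  out : List ℤ

/-- Write a value into a register. -/
def RamState.setReg (s : RamState) (r : ℕ) (x : ℤ) : RamState :=
  { s with reg := Function.update s.reg r x }

/-- Write a value into a memory cell. -/
def RamState.setMem (s : RamState) (i : ℕ) (x : ℤ) : RamState :=
  { s with mem := Function.update s.mem i x }

/-- The initial state: the input fills the first memory cells; everything else is `0`. -/
def RamState.init (input : List ℤ) : RamState where
  reg := fun _ => 0
  mem := fun i => input.getD i 0
  out := []

/-- `RamRun M W p s s' t`: started in state `s`, the program `p` halts in state `s'` after `t`
steps, on a machine whose memory consists of the cells `0, …, M-1` only and whose words hold the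
integers of absolute value at most `W` only (a run that needs more does not exist). -/
inductive RamRun (M W : ℕ) : RamProg → RamState → RamState → ℕ → Prop where
  | skip (s : RamState) : RamRun M W .skip s s 1
  | const (s : RamState) (r : ℕ) (c : ℤ) (h : |c| ≤ W) :
      RamRun M W (.const r c) s (s.setReg r c) 1
  | add (s : RamState) (r a b : ℕ) (h : |s.reg a + s.reg b| ≤ W) :
      RamRun M W (.add r a b) s (s.setReg r (s.reg a + s.reg b)) 1
  | sub (s : RamState) (r a b : ℕ) (h : |s.reg a - s.reg b| ≤ W) :
      RamRun M W (.sub r a b) s (s.setReg r (s.reg a - s.reg b)) 1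
  | load (s : RamState) (r a i : ℕ) (ha : s.reg a = i) (hi : i < M) (h : |s.mem i| ≤ W) :
      RamRun M W (.load r a) s (s.setReg r (s.mem i)) 1
  | store (s : RamState) (a b i : ℕ) (ha : s.reg a = i) (hi : i < M) :
      RamRun M W (.store a b) s (s.setMem i (s.reg b)) 1
  | emit (s : RamState) (a : ℕ) :
      RamRun M W (.emit a) s { s with out := s.out ++ [s.reg a] } 1
  | seq {p q : RamProg} {s s₁ s₂ : RamState} {t₁ t₂ : ℕ}
      (hp : RamRun M W p s s₁ t₁) (hq : RamRun M W q s₁ s₂ t₂) :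
      RamRun M W (.seq p q) s s₂ (t₁ + t₂)
  | ifPos_true {a : ℕ} {p q : RamProg} {s s' : RamState} {t : ℕ} (h : 0 < s.reg a)
      (hp : RamRun M W p s s' t) : RamRun M W (.ifPos a p q) s s' (t + 1)
  | ifPos_false {a : ℕ} {p q : RamProg} {s s' : RamState} {t : ℕ} (h : ¬ 0 < s.reg a)
      (hq : RamRun M W q s s' t) : RamRun M W (.ifPos a p q) s s' (t + 1)
  | while_done {a : ℕ} {p : RamProg} {s : RamState} (h : ¬ 0 < s.reg a) :
      RamRun M W (.whilePos a p) s s 1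
  | while_step {a : ℕ} {p : RamProg} {s s₁ s₂ : RamState} {t₁ t₂ : ℕ} (h : 0 < s.reg a)
      (hp : RamRun M W p s s₁ t₁) (hw : RamRun M W (.whilePos a p) s₁ s₂ t₂) :
      RamRun M W (.whilePos a p) s s₂ (t₁ + t₂ + 1)

/-! The cliques are listed by their states at the first active time stamp. At that moment a closed
active clique is a finite set `Q` of super-vertices. Let `R x y` be the remaining length of the edge
that joins `x` and `y`, or `-1`. Then being closed and active is a static condition on `Q` (`Sol`):
all values of `R` within `Q` are at least some `b`, the value `b` is attained, an edge of `Q` starts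
there, and no further super-vertex has `R` at least `b` to all of `Q`. The active set has `b + 1`
elements, so the bound `σ` becomes `b ≥ σ - 1`, which also allows shorter edges to be dropped at the
outset. `exists_sol`, `Sol.cliqueOf_mem` and `Sol.cliqueOf_inj` turn this into a bijection between
such sets and the normalized cliques.

An edge of `Q` that starts there leaves some `(u, T)` of `Q`, so `Q` lies in the neighbourhood of
`(u, T)`, a weighted graph with at most `deg u + 1` vertices, in which `Q` is a clique that is
maximal for its own least weight. These are enumerated by reverse search (`LocalGraph`). The nodes
of level `i` are the corresponding cliques on the first `i` vertices. The parent of a node `K` of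
level `i + 1` that contains `i` is the greedy extension of `K \ {i}` at the threshold of `K`; a node
that avoids `i` is its own parent. Parents exist and are unique (`exists_parent`, `parent_unique`),
so the tree visits every leaf once. A node that contains a neighbour by a starting edge always has a
leaf below it (`exists_below`), so the search time can be charged to leaves.

A set `Q` can be found from several of its vertices; it is written only from the smallest vertex
that has a starting edge in `Q`, and each pair `(u, T)` is searched only for one canonical
half-edge. Hence no output has to be remembered (`Sol.exists_assigned`, `Sol.assigned_unique`).

For the time let `q = min (Δ², m)`. Finding the weights from a vertex to a clique by scanning
adjacency lists costs the sum of the degrees over the clique, which is `O(q)` (`sum_adj_clique_le`).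
A node costs `O(q)` for each local vertex and the tree has `w ≤ deg u + 1` levels, so a leaf costs
`O(q w²)`. Summed over the vertices from which `Q` is found, one factor `deg u` is bounded by `Δ`
and the other is summed over the clique (`sum_anchored_le`), which gives `O(q² Δ)` for each clique,
that is `O(min (Δ⁵, m² Δ))`.

The algorithm is written in a small imperative language with a weakest precondition for total
correctness and a clock. `Cmd.code_run` compiles it to the machine with boundedly many steps for
each tick of the clock. No recursion stack is needed: one number for each local vertex and one for
each level encode the whole path from the root, which keeps the memory linear. -/

/-! ### A structured language over the random access machine -/

/-- The variables of the enumeration program. -/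
inductive Var
  | n | m | bm | top | j | p | u | h | T | f | g | wn | r | i | b0 | best | k | c
  | zv | zt | yv | yt | res | rh | jj | cc | y | ay | e | xa | xl | fl | q | ec | mt | s1 | s2
deriving DecidableEq

/-- The arrays of the enumeration program. -/
inductive Arr
  | inp | head | nxt | dst | ts | td | len | eid | wv | wt | st | bs | ll | d | hh | a | ok
deriving DecidableEq

namespace Var
theorem ctorIdx_injective : Function.Injective Var.ctorIdx := fun x x' h => by
  simpa [Var.ofNat_ctorIdx] using congrArg Var.ofNat h
end Var

namespace Arr
theorem ctorIdx_injective : Function.Injective Arr.ctorIdx := fun x y h => by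
  simpa [Arr.ofNat_ctorIdx] using congrArg Arr.ofNat h

/-- The number of arrays. -/
def count : ℕ := 17

theorem ctorIdx_lt (x : Arr) : x.ctorIdx < count := by cases x <;> decide
end Arr

/-- States of the structured language: variables, arrays, output, and a clock that counts executed
statements. -/
structure St where
  v : Var → ℤ
  a : Arr → ℕ → ℤ
  out : List ℤ
  clk : ℕ

namespace St

def tick (s : St) : St := { s with clk := s.clk + 1 }

def set (s : St) (x : Var) (z : ℤ) : St :=
  { s with v := Function.update s.v x z, clk := s.clk + 1 }

def put (s : St) (b : Arr) (i : ℕ) (z : ℤ) : St :=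
  { s with a := Function.update s.a b (Function.update (s.a b) i z), clk := s.clk + 1 }

def write (s : St) (z : ℤ) : St := { s with out := s.out ++ [z], clk := s.clk + 1 }

@[simp] theorem tick_v (s : St) : s.tick.v = s.v := rfl
@[simp] theorem tick_a (s : St) : s.tick.a = s.a := rfl
@[simp] theorem tick_out (s : St) : s.tick.out = s.out := rfl
@[simp] theorem tick_clk (s : St) : s.tick.clk = s.clk + 1 := rfl
@[simp] theorem set_v (s : St) (x x' : Var) (z : ℤ) :
    (s.set x z).v x' = if x' = x then z else s.v x' := by simp [set, Function.update_apply]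
@[simp] theorem set_a (s : St) (x : Var) (z : ℤ) : (s.set x z).a = s.a := rfl
@[simp] theorem set_out (s : St) (x : Var) (z : ℤ) : (s.set x z).out = s.out := rfl
@[simp] theorem set_clk (s : St) (x : Var) (z : ℤ) : (s.set x z).clk = s.clk + 1 := rfl
@[simp] theorem put_v (s : St) (b : Arr) (i : ℕ) (z : ℤ) : (s.put b i z).v = s.v := rfl
@[simp] theorem put_a (s : St) (b c : Arr) (i : ℕ) (z : ℤ) :
    (s.put b i z).a c = if c = b then Function.update (s.a b) i z else s.a c := by
  simp only [put, Function.update_apply]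
@[simp] theorem put_out (s : St) (b : Arr) (i : ℕ) (z : ℤ) : (s.put b i z).out = s.out := rfl
@[simp] theorem put_clk (s : St) (b : Arr) (i : ℕ) (z : ℤ) : (s.put b i z).clk = s.clk + 1 := rfl
@[simp] theorem write_v (s : St) (z : ℤ) : (s.write z).v = s.v := rfl
@[simp] theorem write_a (s : St) (z : ℤ) : (s.write z).a = s.a := rfl
@[simp] theorem write_out (s : St) (z : ℤ) : (s.write z).out = s.out ++ [z] := rfl
@[simp] theorem write_clk (s : St) (z : ℤ) : (s.write z).clk = s.clk + 1 := rfl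

/-- All stored numbers have absolute value at most `B`. -/
def Bdd (B : ℤ) (s : St) : Prop :=
  (∀ x, -B ≤ s.v x ∧ s.v x ≤ B) ∧ ∀ b i, -B ≤ s.a b i ∧ s.a b i ≤ B

end St

/-- Integer expressions. -/
inductive Expr
  | var (x : Var)
  | lit (z : ℤ)
  | add (e f : Expr)
  | sub (e f : Expr)
  | ld (b : Arr) (e : Expr)

namespace Expr

instance : Add Expr := ⟨add⟩
instance : Sub Expr := ⟨sub⟩
instance (k : ℕ) : OfNat Expr k := ⟨lit k⟩
instance : Coe Var Expr := ⟨var⟩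

def eval : Expr → St → ℤ
  | var x, s => s.v x
  | lit z, _ => z
  | add e f, s => e.eval s + f.eval s
  | sub e f, s => e.eval s - f.eval s
  | ld b e, s => s.a b (e.eval s).toNat

/-- All array accesses are in range. -/
def Ok (Z : ℕ) : Expr → St → Prop
  | var _, _ => True
  | lit _, _ => True
  | add e f, s => e.Ok Z s ∧ f.Ok Z s
  | sub e f, s => e.Ok Z s ∧ f.Ok Z s
  | ld _ e, s => e.Ok Z s ∧ 0 ≤ e.eval s ∧ e.eval s < Z

variable (Z : ℕ) (s : St) (e f : Expr)

@[simp] theorem eval_var (x : Var) : (var x).eval s = s.v x := rfl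
@[simp] theorem eval_lit (z : ℤ) : (lit z).eval s = z := rfl
@[simp] theorem eval_zero : (0 : Expr).eval s = 0 := rfl
@[simp] theorem eval_one : (1 : Expr).eval s = 1 := rfl
@[simp] theorem eval_two : (2 : Expr).eval s = 2 := rfl
@[simp] theorem eval_three : (3 : Expr).eval s = 3 := rfl
@[simp] theorem eval_four : (4 : Expr).eval s = 4 := rfl
@[simp] theorem eval_five : (5 : Expr).eval s = 5 := rfl
@[simp] theorem eval_add : (e + f).eval s = e.eval s + f.eval s := rfl
@[simp] theorem eval_sub : (e - f).eval s = e.eval s - f.eval s := rfl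
@[simp] theorem eval_ld (b : Arr) : (ld b e).eval s = s.a b (e.eval s).toNat := rfl
@[simp] theorem ok_var (x : Var) : (var x).Ok Z s ↔ True := Iff.rfl
@[simp] theorem ok_lit (z : ℤ) : (lit z).Ok Z s ↔ True := Iff.rfl
@[simp] theorem ok_zero : (0 : Expr).Ok Z s ↔ True := Iff.rfl
@[simp] theorem ok_one : (1 : Expr).Ok Z s ↔ True := Iff.rfl
@[simp] theorem ok_two : (2 : Expr).Ok Z s ↔ True := Iff.rfl
@[simp] theorem ok_three : (3 : Expr).Ok Z s ↔ True := Iff.rfl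
@[simp] theorem ok_four : (4 : Expr).Ok Z s ↔ True := Iff.rfl
@[simp] theorem ok_five : (5 : Expr).Ok Z s ↔ True := Iff.rfl
@[simp] theorem ok_add : (e + f).Ok Z s ↔ e.Ok Z s ∧ f.Ok Z s := Iff.rfl
@[simp] theorem ok_sub : (e - f).Ok Z s ↔ e.Ok Z s ∧ f.Ok Z s := Iff.rfl
@[simp] theorem ok_ld (b : Arr) :
    (ld b e).Ok Z s ↔ e.Ok Z s ∧ 0 ≤ e.eval s ∧ e.eval s < Z := Iff.rfl

/-- One measure for two purposes: it bounds the number of machine instructions, and `size * B`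
bounds the value on states bounded by `B`. The second use is why a literal contributes its absolute
value. -/
def size : Expr → ℕ
  | var _ => 1
  | lit z => 1 + z.natAbs
  | add e f => e.size + f.size + 1
  | sub e f => e.size + f.size + 1
  | ld _ e => e.size + 1

end Expr

/-- Boolean conditions. -/
inductive Cond
  | lt (e f : Expr)
  | eq (e f : Expr)
  | and (c d : Cond)
  | not (c : Cond)

namespace Cond

def Holds : Cond → St → Prop
  | lt e f, s => e.eval s < f.eval s
  | eq e f, s => e.eval s = f.eval s
  | and c d, s => c.Holds s ∧ d.Holds s
  | not c, s => ¬ c.Holds s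

def Ok (Z : ℕ) : Cond → St → Prop
  | lt e f, s => e.Ok Z s ∧ f.Ok Z s
  | eq e f, s => e.Ok Z s ∧ f.Ok Z s
  | and c d, s => c.Ok Z s ∧ (c.Holds s → d.Ok Z s)
  | not c, s => c.Ok Z s

variable (Z : ℕ) (s : St) (e f : Expr) (c d : Cond)

@[simp] theorem holds_lt : (lt e f).Holds s ↔ e.eval s < f.eval s := Iff.rfl
@[simp] theorem holds_eq : (eq e f).Holds s ↔ e.eval s = f.eval s := Iff.rfl
@[simp] theorem holds_and : (and c d).Holds s ↔ c.Holds s ∧ d.Holds s := Iff.rfl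
@[simp] theorem holds_not : (not c).Holds s ↔ ¬ c.Holds s := Iff.rfl
@[simp] theorem ok_lt : (lt e f).Ok Z s ↔ e.Ok Z s ∧ f.Ok Z s := Iff.rfl
@[simp] theorem ok_eq : (eq e f).Ok Z s ↔ e.Ok Z s ∧ f.Ok Z s := Iff.rfl
@[simp] theorem ok_and : (and c d).Ok Z s ↔ c.Ok Z s ∧ (c.Holds s → d.Ok Z s) := Iff.rfl
@[simp] theorem ok_not : (not c).Ok Z s ↔ c.Ok Z s := Iff.rfl

def size : Cond → ℕ
  | lt e f => e.size + f.size + 1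
  | eq e f => e.size + f.size + 2
  | and c d => c.size + d.size + 1
  | not c => c.size + 1

end Cond

/-- Statements. -/
inductive Cmd
  | skip
  | assign (x : Var) (e : Expr)
  | store (b : Arr) (i e : Expr)
  | emit (e : Expr)
  | seq (p q : Cmd)
  | ite (c : Cond) (p q : Cmd)
  | loop (c : Cond) (p : Cmd)

namespace Cmd

infixr:60 " ;; " => Cmd.seq
infix:62 " ::= " => Cmd.assign

/-- The weakest precondition for total correctness, on arrays of length `Z` and for numbers of
absolute value at most `B`; loops are least fixed points. -/
def wp (Z : ℕ) (B : ℤ) : Cmd → (St → Prop) → St → Prop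
  | skip, Q, s => Q s.tick
  | assign x e, Q, s => e.Ok Z s ∧ (-B ≤ e.eval s ∧ e.eval s ≤ B) ∧ Q (s.set x (e.eval s))
  | store b i e, Q, s => i.Ok Z s ∧ e.Ok Z s ∧ (0 ≤ i.eval s ∧ i.eval s < Z) ∧
      (-B ≤ e.eval s ∧ e.eval s ≤ B) ∧ Q (s.put b (i.eval s).toNat (e.eval s))
  | emit e, Q, s => e.Ok Z s ∧ Q (s.write (e.eval s))
  | seq p q, Q, s => wp Z B p (wp Z B q Q) s
  | ite c p q, Q, s => c.Ok Z s ∧ (c.Holds s → wp Z B p Q s.tick) ∧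
      (¬ c.Holds s → wp Z B q Q s.tick)
  -- The least fixed point is the intersection of all predicates closed under the two unfolding
  -- rules; in this form `wp` stays a plain recursion on statements. Being least is what expresses
  -- termination.
  | loop c p, Q, s => ∀ P : St → Prop,
      (∀ s', c.Ok Z s' → ¬ c.Holds s' → Q s'.tick → P s') →
      (∀ s', c.Ok Z s' → c.Holds s' → wp Z B p P s'.tick → P s') → P s

variable {Z : ℕ} {B : ℤ}

theorem wp_mono {c : Cmd} {Q Q' : St → Prop} (h : ∀ s, Q s → Q' s) {s : St} :
    wp Z B c Q s → wp Z B c Q' s := by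
  induction c generalizing Q Q' s with
  | skip => exact h _
  | assign x e => exact fun ⟨a, b, c⟩ => ⟨a, b, h _ c⟩
  | store b i e => exact fun ⟨a, b, c, d, f⟩ => ⟨a, b, c, d, h _ f⟩
  | emit e => exact fun ⟨a, b⟩ => ⟨a, h _ b⟩
  | seq p q hp hq => exact hp fun s => hq h
  | ite c p q hp hq => exact fun ⟨a, b, c⟩ => ⟨a, fun x => hp h (b x), fun x => hq h (c x)⟩
  | loop c p hp => exact fun H P h1 h2 => H P (fun s' a b d => h1 s' a b (h _ d)) h2

theorem wp_loop_done {c : Cond} {p : Cmd} {Q : St → Prop} {s : St} (h : c.Ok Z s)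
    (hc : ¬ c.Holds s) (hQ : Q s.tick) : wp Z B (loop c p) Q s := fun _ h1 _ => h1 s h hc hQ

theorem wp_loop_step {c : Cond} {p : Cmd} {Q : St → Prop} {s : St} (h : c.Ok Z s)
    (hc : c.Holds s) (hQ : wp Z B p (wp Z B (loop c p) Q) s.tick) :
    wp Z B (loop c p) Q s :=
  fun P h1 h2 => h2 s h hc (wp_mono (fun _ H => H P h1 h2) hQ)

/-- A loop that runs `N` times. -/
theorem wp_loop_count {c : Cond} {p : Cmd} {Q : St → Prop} (N : ℕ) (I : ℕ → St → Prop)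
    (hstep : ∀ k < N, ∀ s, I k s → c.Ok Z s ∧ c.Holds s ∧ wp Z B p (I (k + 1)) s.tick)
    (hdone : ∀ s, I N s → c.Ok Z s ∧ ¬ c.Holds s ∧ Q s.tick) {s : St} (h0 : I 0 s) :
    wp Z B (loop c p) Q s := by
  have key : ∀ d k, k + d = N → ∀ s, I k s → wp Z B (loop c p) Q s := by
    intro d
    induction d with
    | zero =>
      intro k hk s hI
      obtain rfl : k = N := by omega
      obtain ⟨a, b, d⟩ := hdone s hI
      exact wp_loop_done a b d
    | succ d ih =>
      intro k hk s hI
      obtain ⟨a, b, d⟩ := hstep k (by omega) s hI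
      exact wp_loop_step a b (wp_mono (fun s' => ih (k + 1) (by omega) s') d)
  exact key N 0 (by omega) s h0

section Simp
variable (Q : St → Prop) (s : St)
@[simp] theorem wp_skip : wp Z B skip Q s ↔ Q s.tick := Iff.rfl
@[simp] theorem wp_assign (x : Var) (e : Expr) : wp Z B (assign x e) Q s ↔
    e.Ok Z s ∧ (-B ≤ e.eval s ∧ e.eval s ≤ B) ∧ Q (s.set x (e.eval s)) := Iff.rfl
@[simp] theorem wp_store (b : Arr) (i e : Expr) : wp Z B (store b i e) Q s ↔
    i.Ok Z s ∧ e.Ok Z s ∧ (0 ≤ i.eval s ∧ i.eval s < Z) ∧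
      (-B ≤ e.eval s ∧ e.eval s ≤ B) ∧ Q (s.put b (i.eval s).toNat (e.eval s)) := Iff.rfl
@[simp] theorem wp_emit (e : Expr) : wp Z B (emit e) Q s ↔
    e.Ok Z s ∧ Q (s.write (e.eval s)) := Iff.rfl
@[simp] theorem wp_seq (p q : Cmd) : wp Z B (seq p q) Q s ↔ wp Z B p (wp Z B q Q) s := Iff.rfl
@[simp] theorem wp_ite (c : Cond) (p q : Cmd) : wp Z B (ite c p q) Q s ↔
    c.Ok Z s ∧ (c.Holds s → wp Z B p Q s.tick) ∧ (¬ c.Holds s → wp Z B q Q s.tick) := Iff.rfl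
end Simp

end Cmd

/-! ### Compilation -/

/-- The registers that hold temporaries, variables, and base addresses of arrays. -/
def treg (d : ℕ) : ℕ := 3 * d + 1
-- The residues modulo 3 separate variables (0), temporaries (1) and base addresses (2), so that all
-- disjointness questions are settled by `omega`.
def Var.reg (x : Var) : ℕ := 3 * x.ctorIdx
def Arr.reg (b : Arr) : ℕ := 3 * b.ctorIdx + 2

/-- The temporaries serve as an evaluation stack: at depth `d` the value ends up in `treg d`, and
only temporaries from the `d`-th on are overwritten. -/
def Expr.code : Expr → ℕ → RamProg
  | var x, d => .seq (.const (treg d) 0) (.add (treg d) (treg d) x.reg)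
  | lit z, d => .const (treg d) z
  | add e f, d => .seq (e.code d) (.seq (f.code (d + 1)) (.add (treg d) (treg d) (treg (d + 1))))
  | sub e f, d => .seq (e.code d) (.seq (f.code (d + 1)) (.sub (treg d) (treg d) (treg (d + 1))))
  | ld b e, d => .seq (e.code d) (.seq (.add (treg d) (treg d) b.reg) (.load (treg d) (treg d)))

/-- The machine can only test for positivity, so truth is a positive value in `treg d`. An equation
is tested by the signs of both differences. -/
def Cond.code : Cond → ℕ → RamProg
  | lt e f, d => .seq (f.code d) (.seq (e.code (d + 1)) (.sub (treg d) (treg d) (treg (d + 1))))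
  | eq e f, d => .seq (e.code d) (.seq (f.code (d + 1)) (.seq (.sub (treg d) (treg d) (treg (d + 1)))
      (.ifPos (treg d) (.const (treg d) 0) (.seq (.const (treg (d + 1)) 0)
        (.seq (.sub (treg d) (treg (d + 1)) (treg d))
          (.ifPos (treg d) (.const (treg d) 0) (.const (treg d) 1)))))))
  | and c e, d => .seq (c.code d) (.ifPos (treg d) (e.code d) .skip)
  | not c, d => .seq (c.code d) (.ifPos (treg d) (.const (treg d) 0) (.const (treg d) 1))

def Cmd.code : Cmd → RamProg
  | skip => .skip
  -- The machine has no instruction that copies a register; a zero is added instead.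
  | assign x e => .seq (e.code 0) (.seq (.const (treg 1) 0) (.add x.reg (treg 0) (treg 1)))
  | store b i e => .seq (i.code 0) (.seq (.add (treg 0) (treg 0) b.reg)
      (.seq (e.code 1) (.store (treg 0) (treg 1))))
  | emit e => .seq (e.code 0) (.emit (treg 0))
  | seq p q => .seq p.code q.code
  | ite c p q => .seq (c.code 0) (.ifPos (treg 0) p.code q.code)
  | loop c p => .seq (c.code 0) (.whilePos (treg 0) (.seq p.code (c.code 0)))

/-- Only two properties matter: the number depends on the program alone, and it dominates the
machine steps between two ticks as well as the size of every expression that occurs. -/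
def Cmd.cost : Cmd → ℕ
  | skip => 1
  | assign _ e => 6 * e.size + 6
  | store _ i e => 6 * i.size + 6 * e.size + 6
  | emit e => 6 * e.size + 6
  | seq p q => p.cost + q.cost
  | ite c p q => 6 * c.size + 6 + p.cost + q.cost
  | loop c p => 6 * c.size + 6 + p.cost

/-- The machine state `r` represents the state `s`. -/
structure Sim (Z : ℕ) (s : St) (r : RamState) : Prop where
  var : ∀ x : Var, r.reg x.reg = s.v x
  base : ∀ b : Arr, r.reg b.reg = ((b.ctorIdx * Z : ℕ) : ℤ)
  mem : ∀ b : Arr, ∀ i < Z, r.mem (b.ctorIdx * Z + i) = s.a b i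
  out : r.out = s.out

/-- The machine states differ in the temporaries from the `d`-th on only. -/
structure SameBelow (d : ℕ) (r r' : RamState) : Prop where
  mem : r'.mem = r.mem
  out : r'.out = r.out
  reg : ∀ x, (x % 3 ≠ 1 ∨ x < 3 * d + 1) → r'.reg x = r.reg x

namespace SameBelow
variable {d : ℕ} {r r' r'' : RamState}

theorem trans (h : SameBelow d r r') (h' : SameBelow d r' r'') : SameBelow d r r'' :=
  ⟨h'.mem.trans h.mem, h'.out.trans h.out, fun x hx => (h'.reg x hx).trans (h.reg x hx)⟩

theorem mono {e : ℕ} (hde : d ≤ e) (h : SameBelow e r r') : SameBelow d r r' :=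
  ⟨h.mem, h.out, fun x hx => h.reg x (by omega)⟩

theorem set_treg {e : ℕ} (hde : d ≤ e) (r : RamState) (z : ℤ) :
    SameBelow d r (r.setReg (treg e) z) :=
  ⟨rfl, rfl, fun x hx => Function.update_of_ne (by unfold treg; omega) _ _⟩

theorem treg_eq {e : ℕ} (h : SameBelow d r r') (hde : e < d) : r'.reg (treg e) = r.reg (treg e) :=
  h.reg _ (by unfold treg; omega)

theorem var_eq (h : SameBelow d r r') (x : Var) : r'.reg x.reg = r.reg x.reg :=
  h.reg _ (by unfold Var.reg; omega)

theorem arr_eq (h : SameBelow d r r') (b : Arr) : r'.reg b.reg = r.reg b.reg :=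
  h.reg _ (by unfold Arr.reg; omega)

theorem sim {Z : ℕ} {s : St} (h : SameBelow d r r') (hs : Sim Z s r) : Sim Z s r' :=
  ⟨fun x => (h.var_eq x).trans (hs.var x), fun b => (h.arr_eq b).trans (hs.base b),
    fun b i hi => by rw [h.mem]; exact hs.mem b i hi, h.out.trans hs.out⟩

end SameBelow

@[simp] theorem setReg_reg_self (r : RamState) (x : ℕ) (z : ℤ) : (r.setReg x z).reg x = z := by
  simp [RamState.setReg]

theorem setReg_reg_ne (r : RamState) {x y : ℕ} (z : ℤ) (h : y ≠ x) :
    (r.setReg x z).reg y = r.reg y := by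
  simp [RamState.setReg, h]

/-! ### Soundness of the compilation -/

section Soundness

variable {Z M W : ℕ} {B : ℤ}

theorem Expr.abs_eval_le (hB : 1 ≤ B) {s : St} (hb : s.Bdd B) (e : Expr) :
    |e.eval s| ≤ e.size * B := by
  induction e with
  | var x => simpa [Expr.size] using abs_le.2 (hb.1 x)
  | lit z =>
    simp only [Expr.eval, Expr.size]
    push_cast
    nlinarith [abs_nonneg z]
  | add e f he hf =>
    simp only [Expr.eval, Expr.size]
    push_cast
    linarith [abs_add_le (e.eval s) (f.eval s)]
  | sub e f he hf =>
    simp only [Expr.eval, Expr.size]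
    push_cast
    linarith [abs_sub (e.eval s) (f.eval s)]
  | ld b e he =>
    have h1 := abs_le.2 (hb.2 b (e.eval s).toNat)
    have h2 : (0 : ℤ) ≤ (e.size : ℤ) * B := by positivity
    simp only [Expr.eval, Expr.size]
    push_cast
    linarith

theorem arr_index_lt (hM : Arr.count * Z ≤ M) (b : Arr) {i : ℕ} (hi : i < Z) :
    b.ctorIdx * Z + i < M := by
  have := b.ctorIdx_lt
  nlinarith [Nat.mul_le_mul_right Z (Nat.succ_le_of_lt this)]

/-- The left operand survives the evaluation of the right one because the latter changes temporaries
from `d + 1` on only. The width hypothesis leaves room for intermediate values (`size * B`) and for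
absolute addresses (`Arr.count * Z`). -/
theorem Expr.code_run (hB : 1 ≤ B) (hM : Arr.count * Z ≤ M) {s : St} (hb : s.Bdd B) (e : Expr) :
    ∀ (d : ℕ) (r : RamState), (e.size : ℤ) * B + Arr.count * Z ≤ W → e.Ok Z s → Sim Z s r →
    ∃ r' t, RamRun M W (e.code d) r r' t ∧ r'.reg (treg d) = e.eval s ∧ SameBelow d r r' ∧
      t ≤ 3 * e.size := by
  have hpos : (0 : ℤ) ≤ Arr.count * Z := by positivity
  induction e with
  | var x =>
    intro d r hW _ hr
    have h0 : x.reg ≠ treg d := by unfold Var.reg treg; omega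
    have hW1 : B + Arr.count * Z ≤ W := by simpa [Expr.size] using hW
    have hx := abs_le.2 (hb.1 x)
    have h1 : (r.setReg (treg d) 0).reg (treg d) + (r.setReg (treg d) 0).reg x.reg = s.v x := by
      rw [setReg_reg_ne _ _ h0, setReg_reg_self, hr.var]; ring
    refine ⟨_, _, .seq (.const _ _ _ (by simp)) (.add _ _ _ _ (by rw [h1]; linarith)), ?_, ?_, ?_⟩
    · rw [h1]; simp
    · exact (SameBelow.set_treg le_rfl _ _).trans (SameBelow.set_treg le_rfl _ _)
    · simp [Expr.size]
  | lit z =>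
    intro d r hW _ hr
    have := Expr.abs_eval_le hB hb (.lit z)
    refine ⟨_, _, .const _ _ _ (by simp only [Expr.eval] at this; linarith), by simp,
      SameBelow.set_treg le_rfl _ _, ?_⟩
    simp only [Expr.size]; omega
  | add e f he hf =>
    intro d r hW hok hr
    have hv := Expr.abs_eval_le hB hb (.add e f)
    have hes : (e.size : ℤ) * B + Arr.count * Z ≤ W := by
      simp only [Expr.size] at hW; push_cast at hW; nlinarith [mul_nonneg (Nat.cast_nonneg (α := ℤ) f.size) (by linarith : (0:ℤ) ≤ B)]
    have hfs : (f.size : ℤ) * B + Arr.count * Z ≤ W := by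
      simp only [Expr.size] at hW; push_cast at hW; nlinarith [mul_nonneg (Nat.cast_nonneg (α := ℤ) e.size) (by linarith : (0:ℤ) ≤ B)]
    obtain ⟨r1, t1, h1, v1, s1, c1⟩ := he d r hes hok.1 hr
    obtain ⟨r2, t2, h2, v2, s2, c2⟩ := hf (d + 1) r1 hfs hok.2 (s1.sim hr)
    have v3 : r2.reg (treg d) = e.eval s := by rw [s2.treg_eq (by omega), v1]
    simp only [Expr.eval] at hv
    refine ⟨_, _, .seq h1 (.seq h2 (.add _ _ _ _ (by rw [v3, v2]; linarith))), ?_, ?_, ?_⟩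
    · simp [v3, v2, Expr.eval]
    · exact s1.trans ((s2.mono (by omega)).trans (SameBelow.set_treg le_rfl _ _))
    · simp only [Expr.size]; omega
  | sub e f he hf =>
    intro d r hW hok hr
    have hv := Expr.abs_eval_le hB hb (.sub e f)
    have hes : (e.size : ℤ) * B + Arr.count * Z ≤ W := by
      simp only [Expr.size] at hW; push_cast at hW; nlinarith [mul_nonneg (Nat.cast_nonneg (α := ℤ) f.size) (by linarith : (0:ℤ) ≤ B)]
    have hfs : (f.size : ℤ) * B + Arr.count * Z ≤ W := by
      simp only [Expr.size] at hW; push_cast at hW; nlinarith [mul_nonneg (Nat.cast_nonneg (α := ℤ) e.size) (by linarith : (0:ℤ) ≤ B)]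
    obtain ⟨r1, t1, h1, v1, s1, c1⟩ := he d r hes hok.1 hr
    obtain ⟨r2, t2, h2, v2, s2, c2⟩ := hf (d + 1) r1 hfs hok.2 (s1.sim hr)
    have v3 : r2.reg (treg d) = e.eval s := by rw [s2.treg_eq (by omega), v1]
    simp only [Expr.eval] at hv
    refine ⟨_, _, .seq h1 (.seq h2 (.sub _ _ _ _ (by rw [v3, v2]; linarith))), ?_, ?_, ?_⟩
    · simp [v3, v2, Expr.eval]
    · exact s1.trans ((s2.mono (by omega)).trans (SameBelow.set_treg le_rfl _ _))
    · simp only [Expr.size]; omega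
  | ld b e he =>
    intro d r hW hok hr
    have hes : (e.size : ℤ) * B + Arr.count * Z ≤ W := by
      simp only [Expr.size] at hW; push_cast at hW; linarith
    have hBW : B ≤ W := by
      simp only [Expr.size] at hW; push_cast at hW; nlinarith [mul_nonneg (Nat.cast_nonneg (α := ℤ) e.size) (by linarith : (0:ℤ) ≤ B)]
    obtain ⟨r1, t1, h1, v1, s1, c1⟩ := he d r hes hok.1 hr
    obtain ⟨i, hi⟩ := Int.eq_ofNat_of_zero_le hok.2.1
    have hiZ : i < Z := by have := hok.2.2; rw [hi] at this; exact_mod_cast this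
    have hlt := arr_index_lt hM b hiZ
    have haddr : r1.reg (treg d) + r1.reg b.reg = ((b.ctorIdx * Z + i : ℕ) : ℤ) := by
      rw [v1, (s1.sim hr).base, hi]; push_cast; ring
    have hcW : ((b.ctorIdx * Z + i : ℕ) : ℤ) ≤ W := by
      have h2 := arr_index_lt (le_refl (Arr.count * Z)) b hiZ
      have h3 : ((b.ctorIdx * Z + i : ℕ) : ℤ) ≤ ((Arr.count * Z : ℕ) : ℤ) := by exact_mod_cast h2.le
      push_cast at h3 ⊢
      nlinarith [mul_nonneg (Nat.cast_nonneg (α := ℤ) e.size) (by linarith : (0:ℤ) ≤ B)]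
    have hmem : (r1.setReg (treg d) (r1.reg (treg d) + r1.reg b.reg)).mem (b.ctorIdx * Z + i)
        = s.a b i := (s1.sim hr).mem b i hiZ
    refine ⟨_, _, .seq h1 (.seq (.add _ _ _ _ ?_) (.load _ _ _ (b.ctorIdx * Z + i) ?_ hlt ?_)),
      ?_, ?_, ?_⟩
    · rw [haddr, abs_of_nonneg (by positivity)]; exact hcW
    · rw [setReg_reg_self, haddr]
    · rw [hmem]; exact (abs_le.2 (hb.2 b i)).trans hBW
    · rw [hmem]; simp [Expr.eval, hi]
    · exact s1.trans ((SameBelow.set_treg le_rfl _ _).trans (SameBelow.set_treg le_rfl _ _))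
    · simp only [Expr.size]; omega

theorem Cond.code_run (hB : 1 ≤ B) (hM : Arr.count * Z ≤ M) {s : St} (hb : s.Bdd B) (c : Cond) :
    ∀ (d : ℕ) (r : RamState), (c.size : ℤ) * B + Arr.count * Z ≤ W → c.Ok Z s → Sim Z s r →
    ∃ r' t, RamRun M W (c.code d) r r' t ∧ (0 < r'.reg (treg d) ↔ c.Holds s) ∧ SameBelow d r r' ∧
      t ≤ 4 * c.size := by
  have hB0 : (0 : ℤ) ≤ B := by linarith
  have hpos : (0 : ℤ) ≤ Arr.count * Z := by positivity
  induction c with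
  | lt e f =>
    intro d r hW hok hr
    have hv := Expr.abs_eval_le hB hb (.sub f e)
    simp only [Expr.eval, Expr.size] at hv
    simp only [Cond.size] at hW
    push_cast at hW hv
    have h1 := mul_nonneg (Nat.cast_nonneg (α := ℤ) e.size) hB0
    have h2 := mul_nonneg (Nat.cast_nonneg (α := ℤ) f.size) hB0
    obtain ⟨r1, t1, h1, v1, s1, c1⟩ := f.code_run (W := W) hB hM hb d r (by nlinarith) hok.2 hr
    obtain ⟨r2, t2, h2, v2, s2, c2⟩ := e.code_run (W := W) hB hM hb (d + 1) r1 (by nlinarith) hok.1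
      (s1.sim hr)
    have v3 : r2.reg (treg d) = f.eval s := by rw [s2.treg_eq (by omega), v1]
    refine ⟨_, _, .seq h1 (.seq h2 (.sub _ _ _ _ (by rw [v3, v2]; nlinarith))), ?_, ?_, ?_⟩
    · simp [v3, v2, Cond.Holds]
    · exact s1.trans ((s2.mono (by omega)).trans (SameBelow.set_treg le_rfl _ _))
    · simp only [Cond.size]; omega
  | eq e f =>
    intro d r hW hok hr
    have hv := Expr.abs_eval_le hB hb (.sub e f)
    simp only [Expr.eval, Expr.size] at hv
    simp only [Cond.size] at hW
    push_cast at hW hv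
    have h1 := mul_nonneg (Nat.cast_nonneg (α := ℤ) e.size) hB0
    have h2 := mul_nonneg (Nat.cast_nonneg (α := ℤ) f.size) hB0
    have hd : treg d ≠ treg (d + 1) := by unfold treg; omega
    obtain ⟨r1, t1, h1, v1, s1, c1⟩ := e.code_run (W := W) hB hM hb d r (by nlinarith) hok.1 hr
    obtain ⟨r2, t2, h2, v2, s2, c2⟩ := f.code_run (W := W) hB hM hb (d + 1) r1 (by nlinarith) hok.2
      (s1.sim hr)
    have v3 : r2.reg (treg d) = e.eval s := by rw [s2.treg_eq (by omega), v1]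
    have hsub : |r2.reg (treg d) - r2.reg (treg (d + 1))| ≤ W := by rw [v3, v2]; nlinarith
    have s12 := s1.trans (s2.mono (Nat.le_succ d))
    have hW1 : (1 : ℤ) ≤ W := by nlinarith
    by_cases hp : 0 < e.eval s - f.eval s
    · refine ⟨_, _, .seq h1 (.seq h2 (.seq (.sub _ _ _ _ hsub) (.ifPos_true (by simpa [v3, v2] using hp)
        (.const _ _ _ (by simp))))), ?_, ?_, ?_⟩
      · simp only [setReg_reg_self, Cond.Holds]; constructor <;> intro <;> omega
      · exact s12.trans ((SameBelow.set_treg le_rfl _ _).trans (SameBelow.set_treg le_rfl _ _))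
      · simp only [Cond.size]; omega
    · have v4 : ((r2.setReg (treg d) (e.eval s - f.eval s)).setReg (treg (d + 1)) 0).reg
          (treg (d + 1)) - ((r2.setReg (treg d) (e.eval s - f.eval s)).setReg (treg (d + 1)) 0).reg
          (treg d) = f.eval s - e.eval s := by
        rw [setReg_reg_self, setReg_reg_ne _ _ hd, setReg_reg_self]; ring
      by_cases hq : 0 < f.eval s - e.eval s
      · refine ⟨_, _, .seq h1 (.seq h2 (.seq (.sub _ _ _ _ hsub) (.ifPos_false
          (by simpa [v3, v2] using hp) (.seq (.const _ _ _ (by simp)) (.seq (.sub _ _ _ _ ?_)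
            (.ifPos_true ?_ (.const _ _ _ (by simp)))))))), ?_, ?_, ?_⟩
        · rw [v3, v2, v4, abs_sub_comm]; nlinarith
        · rw [v3, v2, v4]; simpa using hq
        · simp only [setReg_reg_self, Cond.Holds]; constructor <;> intro <;> omega
        · exact s12.trans ((SameBelow.set_treg le_rfl _ _).trans
            ((SameBelow.set_treg (Nat.le_succ d) _ _).trans ((SameBelow.set_treg le_rfl _ _).trans
              (SameBelow.set_treg le_rfl _ _))))
        · simp only [Cond.size]; omega
      · refine ⟨_, _, .seq h1 (.seq h2 (.seq (.sub _ _ _ _ hsub) (.ifPos_false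
          (by simpa [v3, v2] using hp) (.seq (.const _ _ _ (by simp)) (.seq (.sub _ _ _ _ ?_)
            (.ifPos_false ?_ (.const _ _ _ (by simpa using hW1)))))))), ?_, ?_, ?_⟩
        · rw [v3, v2, v4, abs_sub_comm]; nlinarith
        · rw [v3, v2, v4]; simpa using hq
        · simp only [setReg_reg_self, Cond.Holds]; constructor <;> intro <;> omega
        · exact s12.trans ((SameBelow.set_treg le_rfl _ _).trans
            ((SameBelow.set_treg (Nat.le_succ d) _ _).trans ((SameBelow.set_treg le_rfl _ _).trans
              (SameBelow.set_treg le_rfl _ _))))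
        · simp only [Cond.size]; omega
  | and c e hc he =>
    intro d r hW hok hr
    simp only [Cond.size] at hW
    push_cast at hW
    have h1 := mul_nonneg (Nat.cast_nonneg (α := ℤ) c.size) hB0
    have h2 := mul_nonneg (Nat.cast_nonneg (α := ℤ) e.size) hB0
    obtain ⟨r1, t1, h1, v1, s1, c1⟩ := hc d r (by nlinarith) hok.1 hr
    by_cases hp : c.Holds s
    · obtain ⟨r2, t2, h2, v2, s2, c2⟩ := he d r1 (by nlinarith) (hok.2 hp) (s1.sim hr)
      exact ⟨_, _, .seq h1 (.ifPos_true (v1.2 hp) h2), by simp [v2, Cond.Holds, hp], s1.trans s2,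
        by simp only [Cond.size]; omega⟩
    · exact ⟨_, _, .seq h1 (.ifPos_false (fun h => hp (v1.1 h)) (.skip _)),
        by simp [v1, Cond.Holds, hp], s1, by simp only [Cond.size]; omega⟩
  | not c hc =>
    intro d r hW hok hr
    simp only [Cond.size] at hW
    push_cast at hW
    have h1 := mul_nonneg (Nat.cast_nonneg (α := ℤ) c.size) hB0
    have hW1 : (1 : ℤ) ≤ W := by nlinarith
    obtain ⟨r1, t1, h1, v1, s1, c1⟩ := hc d r (by nlinarith) hok hr
    by_cases hp : c.Holds s
    · exact ⟨_, _, .seq h1 (.ifPos_true (v1.2 hp) (.const _ _ _ (by simp))), by simp [Cond.Holds, hp],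
        s1.trans (SameBelow.set_treg le_rfl _ _), by simp only [Cond.size]; omega⟩
    · exact ⟨_, _, .seq h1 (.ifPos_false (fun h => hp (v1.1 h)) (.const _ _ _ (by simpa using hW1))),
        by simp [Cond.Holds, hp], s1.trans (SameBelow.set_treg le_rfl _ _),
        by simp only [Cond.size]; omega⟩

theorem Sim.tick {s : St} {r : RamState} (h : Sim Z s r) : Sim Z s.tick r :=
  ⟨h.var, h.base, h.mem, h.out⟩

theorem St.Bdd.set {s : St} (h : s.Bdd B) (x : Var) {z : ℤ} (hz : -B ≤ z ∧ z ≤ B) :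
    (s.set x z).Bdd B :=
  ⟨fun x' => by rw [St.set_v]; split <;> [exact hz; exact h.1 x'], h.2⟩

theorem St.Bdd.put {s : St} (h : s.Bdd B) (b : Arr) (i : ℕ) {z : ℤ} (hz : -B ≤ z ∧ z ≤ B) :
    (s.put b i z).Bdd B := by
  refine ⟨h.1, fun c k => ?_⟩
  rw [St.put_a]
  split
  · rw [Function.update_apply]; split <;> [exact hz; exact h.2 _ _]
  · exact h.2 _ _

theorem Sim.set {s : St} {r r' : RamState} (h : Sim Z s r') (x : Var) (z : ℤ)
    (hr : r = r'.setReg x.reg z) : Sim Z (s.set x z) r := by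
  subst hr
  refine ⟨fun x' => ?_, fun b => ?_, h.mem, h.out⟩
  · rw [St.set_v]
    split
    · next hy => rw [hy, setReg_reg_self]
    · next hy =>
      rw [setReg_reg_ne _ _ (fun hh => hy (Var.ctorIdx_injective (by unfold Var.reg at hh; omega))),
        h.var]
  · rw [setReg_reg_ne _ _ (by unfold Var.reg Arr.reg; omega), h.base]

theorem Sim.put {s : St} {r : RamState} (h : Sim Z s r) (b : Arr) {i : ℕ} (hi : i < Z) (z : ℤ) :
    Sim Z (s.put b i z) (r.setMem (b.ctorIdx * Z + i) z) := by
  refine ⟨h.var, h.base, fun c k hk => ?_, h.out⟩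
  rw [St.put_a]
  simp only [RamState.setMem, Function.update_apply]
  by_cases hcb : c = b
  · subst hcb
    by_cases hki : k = i
    · simp [hki]
    · simp [hki, h.mem c k hk]
  · have hne : c.ctorIdx * Z + k ≠ b.ctorIdx * Z + i := by
      intro hh
      apply hcb
      apply Arr.ctorIdx_injective
      rcases lt_trichotomy c.ctorIdx b.ctorIdx with hl | hl | hl
      · nlinarith [Nat.mul_le_mul_right Z (Nat.succ_le_of_lt hl)]
      · exact hl
      · nlinarith [Nat.mul_le_mul_right Z (Nat.succ_le_of_lt hl)]
    simp [hcb, hne, h.mem c k hk]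

/-- The compiled program runs as the weakest precondition says, with a constant number of machine
steps for each statement. -/
theorem Cmd.code_run (hB : 1 ≤ B) (hM : Arr.count * Z ≤ M) (κ : ℕ)
    (hW : (κ : ℤ) * B + Arr.count * Z ≤ W) (c : Cmd) : c.cost ≤ κ → ∀ (Q : St → Prop) (s : St),
    c.wp Z B Q s → s.Bdd B → ∀ r, Sim Z s r →
    ∃ r' t s', RamRun M W c.code r r' t ∧ Sim Z s' r' ∧ s'.Bdd B ∧ Q s' ∧
      t + κ * s.clk ≤ κ * s'.clk := by
  have hB0 : (0 : ℤ) ≤ B := by linarith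
  have hpos : (0 : ℤ) ≤ Arr.count * Z := by positivity
  have size_le : ∀ k : ℕ, k ≤ κ → (k : ℤ) * B + Arr.count * Z ≤ W := fun k hk => by
    have : (k : ℤ) ≤ κ := by exact_mod_cast hk
    nlinarith
  induction c with
  | skip =>
    intro hκ Q s hwp hb r hr
    refine ⟨r, 1, s.tick, .skip _, hr.tick, hb, hwp, ?_⟩
    simp only [Cmd.cost] at hκ
    simp only [St.tick_clk]; linarith
  | assign x e =>
    intro hκ Q s hwp hb r hr
    simp only [Cmd.cost] at hκ
    obtain ⟨r1, t1, h1, v1, s1, c1⟩ := e.code_run hB hM hb 0 r (size_le _ (by omega)) hwp.1 hr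
    have hv := Expr.abs_eval_le hB hb e
    have h2 : (r1.setReg (treg 1) 0).reg (treg 0) + (r1.setReg (treg 1) 0).reg (treg 1)
        = e.eval s := by
      rw [setReg_reg_self, setReg_reg_ne _ _ (by decide), v1, add_zero]
    refine ⟨_, _, _, .seq h1 (.seq (.const _ _ _ (by simp)) (.add _ _ _ _ ?_)),
      Sim.set ((s1.trans (SameBelow.set_treg (e := 1) (Nat.zero_le 1) _ 0)).sim hr) x (e.eval s) (by rw [h2]),
      hb.set x hwp.2.1, hwp.2.2, ?_⟩
    · rw [h2]; linarith [size_le e.size (by omega)]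
    · simp only [St.set_clk]; linarith
  | store b i e =>
    intro hκ Q s hwp hb r hr
    simp only [Cmd.cost] at hκ
    obtain ⟨hiok, heok, ⟨hi0, hiZ⟩, hbd, hQ⟩ := hwp
    obtain ⟨r1, t1, h1, v1, s1, c1⟩ := i.code_run hB hM hb 0 r (size_le _ (by omega)) hiok hr
    obtain ⟨k, hk⟩ := Int.eq_ofNat_of_zero_le hi0
    have hkZ : k < Z := by rw [hk] at hiZ; exact_mod_cast hiZ
    have haddr : r1.reg (treg 0) + r1.reg b.reg = ((b.ctorIdx * Z + k : ℕ) : ℤ) := by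
      rw [v1, (s1.sim hr).base, hk]; push_cast; ring
    have s12 := s1.trans (SameBelow.set_treg le_rfl r1 (r1.reg (treg 0) + r1.reg b.reg))
    obtain ⟨r2, t2, h2, v2, s2, c2⟩ := e.code_run hB hM hb 1 _ (size_le _ (by omega)) heok
      (s12.sim hr)
    have hcW : ((b.ctorIdx * Z + k : ℕ) : ℤ) ≤ W := by
      have h2 := arr_index_lt (le_refl (Arr.count * Z)) b hkZ
      have h3 : ((b.ctorIdx * Z + k : ℕ) : ℤ) ≤ ((Arr.count * Z : ℕ) : ℤ) := by exact_mod_cast h2.le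
      push_cast at h3 ⊢
      nlinarith
    refine ⟨_, _, _, .seq h1 (.seq (.add _ _ _ _ ?_) (.seq h2 (.store _ _ _ (b.ctorIdx * Z + k) ?_
      (arr_index_lt hM b hkZ)))), ?_, hb.put b k hbd, ?_, ?_⟩
    · rw [haddr, abs_of_nonneg (by positivity)]; exact hcW
    · rw [s2.treg_eq (by omega), setReg_reg_self, haddr]
    · rw [v2]; exact (s2.sim (s12.sim hr)).put b hkZ _
    · simpa [hk] using hQ
    · simp only [St.put_clk]; linarith
  | emit e =>
    intro hκ Q s hwp hb r hr
    simp only [Cmd.cost] at hκ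
    obtain ⟨r1, t1, h1, v1, s1, c1⟩ := e.code_run hB hM hb 0 r (size_le _ (by omega)) hwp.1 hr
    have hs := s1.sim hr
    refine ⟨_, _, s.write (e.eval s), .seq h1 (.emit _ _), ⟨hs.var, hs.base, hs.mem, ?_⟩, hb,
      hwp.2, ?_⟩
    · simp [hs.out, v1]
    · simp only [St.write_clk]; linarith
  | seq p q hp hq =>
    intro hκ Q s hwp hb r hr
    simp only [Cmd.cost] at hκ
    obtain ⟨r1, t1, s1, h1, i1, b1, q1, c1⟩ := hp (by omega) _ s hwp hb r hr
    obtain ⟨r2, t2, s2, h2, i2, b2, q2, c2⟩ := hq (by omega) _ s1 q1 b1 r1 i1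
    exact ⟨_, _, s2, .seq h1 h2, i2, b2, q2, by linarith⟩
  | ite c p q hp hq =>
    intro hκ Q s hwp hb r hr
    simp only [Cmd.cost] at hκ
    obtain ⟨r1, t1, h1, v1, i1, c1⟩ := c.code_run hB hM hb 0 r (size_le _ (by omega)) hwp.1 hr
    by_cases hc : c.Holds s
    · obtain ⟨r2, t2, s2, h2, i2, b2, q2, c2⟩ := hp (by omega) _ _ (hwp.2.1 hc) hb r1 (i1.sim hr).tick
      refine ⟨_, _, s2, .seq h1 (.ifPos_true (v1.2 hc) h2), i2, b2, q2, ?_⟩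
      simp only [St.tick_clk] at c2; linarith
    · obtain ⟨r2, t2, s2, h2, i2, b2, q2, c2⟩ := hq (by omega) _ _ (hwp.2.2 hc) hb r1 (i1.sim hr).tick
      refine ⟨_, _, s2, .seq h1 (.ifPos_false (fun h => hc (v1.1 h)) h2), i2, b2, q2, ?_⟩
      simp only [St.tick_clk] at c2; linarith
  | loop c p hp =>
    intro hκ Q s hwp
    simp only [Cmd.cost] at hκ
    -- The least fixed point is applied to the predicate that a terminating run with the required
    -- properties exists.
    refine hwp (fun s => s.Bdd B → ∀ r, Sim Z s r → ∃ r' t s',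
      RamRun M W (Cmd.loop c p).code r r' t ∧ Sim Z s' r' ∧ s'.Bdd B ∧ Q s' ∧
      t + κ * s.clk ≤ κ * s'.clk) ?_ ?_
    · intro s hok hc hQ hb r hr
      obtain ⟨r1, t1, h1, v1, i1, c1⟩ := c.code_run hB hM hb 0 r (size_le _ (by omega)) hok hr
      refine ⟨_, _, s.tick, .seq h1 (.while_done (fun h => hc (v1.1 h))), (i1.sim hr).tick, hb, hQ, ?_⟩
      simp only [St.tick_clk]; linarith
    · intro s hok hc hpP hb r hr
      obtain ⟨r1, t1, h1, v1, i1, c1⟩ := c.code_run hB hM hb 0 r (size_le _ (by omega)) hok hr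
      obtain ⟨r2, t2, s2, h2, i2, b2, q2, c2⟩ := hp (by omega) _ _ hpP hb r1 (i1.sim hr).tick
      obtain ⟨r3, t3, s3, h3, i3, b3, q3, c3⟩ := q2 b2 r2 i2
      -- The remaining run starts with an evaluation of the condition. Moved to the end of the loop
      -- body just executed, it is the re-evaluation that the compiled loop performs there.
      cases h3 with
      | seq ha hb' =>
        refine ⟨_, _, s3, .seq h1 (.while_step (v1.2 hc) (.seq h2 ha) hb'), i3, b3, q3, ?_⟩
        simp only [St.tick_clk] at c2; linarith

end Soundness

/-! ### The search tree of a weighted graph -/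

/-- A graph with symmetric edge weights on `{0, …, w-1}`, in which the cliques that contain `0` and
one of `1, …, r` are to be enumerated; negative weights stand for missing edges. -/
structure LocalGraph where
  wt : ℕ → ℕ → ℤ
  w : ℕ
  r : ℕ
  bm : ℤ
  top : ℤ
  symm : ∀ x y, wt x y = wt y x
  lt_top : ∀ x y, wt x y < top
  bm_nonneg : 0 ≤ bm
  r_pos : 1 ≤ r
  r_lt : r < w
  bm_le_wt : ∀ x, 1 ≤ x → x ≤ r → bm ≤ wt 0 x

namespace LocalGraph

variable (Γ : LocalGraph)

def Clique (L : Finset ℕ) (b : ℤ) : Prop := ∀ x ∈ L, ∀ y ∈ L, x ≠ y → b ≤ Γ.wt x y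

/-- `b` is the least weight within `L`, or `top` if `L` is the singleton of `0`. -/
def HasMin (L : Finset ℕ) (b : ℤ) : Prop :=
  Γ.Clique L b ∧ ((L = {0} ∧ b = Γ.top) ∨ ∃ x ∈ L, ∃ y ∈ L, x ≠ y ∧ Γ.wt x y = b)

/-- The vertices `1, …, r` will be the neighbours of the anchor `0` by edges that start at its time
stamp; a clique that misses them all does not start at this anchor. -/
def Meets (L : Finset ℕ) : Prop := ∃ x ∈ L, 1 ≤ x ∧ x ≤ Γ.r

/-- The nodes of level `i`: the sets `L ⊆ {0, …, i-1}` of least weight `b` to which no further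
vertex below `i` can be added without lowering the least weight. -/
structure Node (i : ℕ) (L : Finset ℕ) (b : ℤ) : Prop where
  lt : ∀ x ∈ L, x < i
  zero : 0 ∈ L
  min : Γ.HasMin L b
  bm_le : Γ.bm ≤ b
  closed : ∀ y < i, y ∉ L → ∃ x ∈ L, Γ.wt x y < b
  meets : Γ.Meets L ∨ i ≤ Γ.r

/-- The neighbours of `i` in `L` by edges of weight at least `c`, together with `i`. -/
def up (i : ℕ) (L : Finset ℕ) (c : ℤ) : Finset ℕ := insert i (L.filter fun x => c ≤ Γ.wt x i)

/-- The vertex `y` prevents `up i L c` from being a child of `L`. -/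
def Bad (i : ℕ) (L : Finset ℕ) (c : ℤ) (y : ℕ) : Prop :=
  -- The first clause says that `y` fits all members of the new node other than `i`. If `y` also
  -- fits `i`, the new node is not closed; if it fits all smaller members of `L`, the greedy
  -- extension would have taken `y`, and `L` is not the parent.
  (∀ x ∈ L, c ≤ Γ.wt x i → c ≤ Γ.wt x y) ∧ (c ≤ Γ.wt y i ∨ ∀ x ∈ L, x < y → c ≤ Γ.wt x y)

/-- The first clause keeps the set closed when `i` becomes available. The second prunes branches
that can no longer reach `1, …, r`. -/
def Keep (i : ℕ) (L : Finset ℕ) (b : ℤ) : Prop :=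
  (∃ x ∈ L, Γ.wt x i < b) ∧ (Γ.Meets L ∨ i + 1 ≤ Γ.r)

/-- Exactly what makes `up i L c` a node with threshold `c` whose parent is `L`. The least weight
`c` is attained either at an edge of `i` or, if `c = b`, at an old pair of which both ends remain.
-/
structure Add (i : ℕ) (L : Finset ℕ) (b c : ℤ) : Prop where
  bm_le : Γ.bm ≤ c
  le : c ≤ b
  le_zero : c ≤ Γ.wt 0 i
  meets : i ≤ Γ.r ∨ ∃ x ∈ L, 1 ≤ x ∧ x ≤ Γ.r ∧ c ≤ Γ.wt x i
  attained : (∃ x ∈ L, Γ.wt x i = c) ∨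
    (c = b ∧ ∃ x ∈ L, ∃ y ∈ L, x ≠ y ∧ Γ.wt x y = b ∧ b ≤ Γ.wt x i ∧ b ≤ Γ.wt y i)
  good : ∀ y < i, y ∉ L → ¬ Γ.Bad i L c y

/-- The children of `L`, with the keys by which they are ordered. -/
inductive Child (i : ℕ) (L : Finset ℕ) (b : ℤ) : ℤ → Finset ℕ → ℤ → Prop
  | keep (h : Γ.Keep i L b) : Child i L b (-1) L b
  | add {c : ℤ} (h : Γ.Add i L b c) : Child i L b c (Γ.up i L c) c

/-- The leaves below a node. -/
inductive Below : ℕ → Finset ℕ → ℤ → Finset ℕ → Prop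
  | leaf (L : Finset ℕ) (b : ℤ) : Below Γ.w L b L
  | step {i : ℕ} {L : Finset ℕ} {b key : ℤ} {K : Finset ℕ} {c : ℤ} {F : Finset ℕ} (hi : i < Γ.w)
      (h : Γ.Child i L b key K c) (hF : Below (i + 1) K c F) : Below i L b F

variable {Γ} {i : ℕ} {L L' K K' F : Finset ℕ} {b b' c c' key key' : ℤ}

theorem mem_up {x : ℕ} : x ∈ Γ.up i L c ↔ x = i ∨ x ∈ L ∧ c ≤ Γ.wt x i := by
  simp [up, Finset.mem_insert, Finset.mem_filter]

theorem HasMin.unique (h : Γ.HasMin L b) (h' : Γ.HasMin L b') : b = b' := by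
  obtain ⟨hc, h⟩ := h
  obtain ⟨hc', h'⟩ := h'
  rcases h with ⟨rfl, rfl⟩ | ⟨x, hx, y, hy, hxy, hw⟩ <;>
    rcases h' with ⟨h1, h2⟩ | ⟨x', hx', y', hy', hxy', hw'⟩
  · exact h2.symm
  · simp only [Finset.mem_singleton] at hx' hy'; omega
  · subst h1; simp only [Finset.mem_singleton] at hx hy; omega
  · exact le_antisymm (hw' ▸ hc x' hx' y' hy' hxy') (hw ▸ hc' x hx y hy hxy)

theorem Clique.exists_hasMin (h : Γ.Clique L c) (h0 : 0 ∈ L) (hc : c ≤ Γ.top) :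
    ∃ b, Γ.HasMin L b ∧ c ≤ b := by
  by_cases hL : L = {0}
  · exact ⟨Γ.top, ⟨by subst hL; intro x hx y hy; simp_all, .inl ⟨hL, rfl⟩⟩, hc⟩
  · obtain ⟨z, hz, hz0⟩ : ∃ z ∈ L, z ≠ 0 := by
      by_contra! hcon
      exact hL (Finset.eq_singleton_iff_unique_mem.2 ⟨h0, hcon⟩)
    obtain ⟨p, hp, hmin⟩ := Finset.exists_min_image L.offDiag (fun p => Γ.wt p.1 p.2)
      ⟨(z, 0), by simp [hz, h0, hz0]⟩
    rw [Finset.mem_offDiag] at hp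
    exact ⟨Γ.wt p.1 p.2, ⟨fun x hx y hy hxy => hmin (x, y) (by simp [hx, hy, hxy]),
      .inr ⟨p.1, hp.1, p.2, hp.2.1, hp.2.2, rfl⟩⟩, h _ hp.1 _ hp.2.1 hp.2.2⟩

theorem root_node : Γ.Node 1 {0} Γ.top where
  lt := by simp
  zero := by simp
  min := ⟨by intro x hx y hy; simp_all, .inl ⟨rfl, rfl⟩⟩
  bm_le := (Γ.bm_le_wt 1 le_rfl Γ.r_pos).trans (Γ.lt_top _ _).le
  closed := by simp
  meets := .inr Γ.r_pos

theorem Node.eq_root (h : Γ.Node 1 L b) : L = {0} ∧ b = Γ.top := by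
  have hL : L = {0} := Finset.eq_singleton_iff_unique_mem.2 ⟨h.zero, fun x hx => by
    have := h.lt x hx; omega⟩
  subst hL
  exact ⟨rfl, h.min.unique root_node.min⟩

/-- The key is a function of the child itself, so a search that returns from a child can recover
where it stands among the siblings without having stored it. -/
theorem Child.key_eq (h : Γ.Child i L b key K c) (hL : ∀ x ∈ L, x < i) :
    key = if i ∈ K then c else -1 := by
  cases h with
  | keep h => rw [if_neg (fun hi => lt_irrefl _ (hL i hi))]
  | add h => rw [if_pos (mem_up.2 (.inl rfl))]

theorem Child.key_ge (h : Γ.Child i L b key K c) : -1 ≤ key := by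
  cases h with
  | keep h => rfl
  | add h => linarith [h.bm_le, Γ.bm_nonneg]

/-- Siblings are told apart by their keys: added thresholds are at least `bm ≥ 0`, which leaves `-1`
for the unchanged set. -/
theorem Child.ext (h : Γ.Child i L b key K c) (h' : Γ.Child i L b key K' c') : K = K' ∧ c = c' := by
  cases h with
  | keep h =>
    cases h' with
    | keep _ => exact ⟨rfl, rfl⟩
    | add h' => linarith [h'.bm_le, Γ.bm_nonneg]
  | add h =>
    cases h' with
    | keep _ => linarith [h.bm_le, Γ.bm_nonneg]
    | add h' => exact ⟨rfl, rfl⟩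

/-- When `i` is added, a vertex `y` outside is blocked by `i` itself if its weight to `i` is below
`c`. Otherwise the second clause of `Bad` holds, so goodness denies the first one and supplies a
remaining member that blocks `y`. -/
theorem Child.node (hN : Γ.Node i L b) (hi : 1 ≤ i) (h : Γ.Child i L b key K c) :
    Γ.Node (i + 1) K c := by
  cases h with
  | keep h =>
    refine ⟨fun x hx => (hN.lt x hx).trans (Nat.lt_succ_self i), hN.zero, hN.min, hN.bm_le, ?_, h.2⟩
    intro y hy hyL
    rcases Nat.lt_succ_iff_lt_or_eq.1 hy with hy | rfl
    · exact hN.closed y hy hyL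
    · exact h.1
  | add h =>
    refine ⟨?_, mem_up.2 (.inr ⟨hN.zero, h.le_zero⟩), ⟨?_, .inr ?_⟩, h.bm_le, ?_, ?_⟩
    · intro x hx
      rcases mem_up.1 hx with rfl | hx
      · exact Nat.lt_succ_self _
      · exact (hN.lt x hx.1).trans (Nat.lt_succ_self i)
    · intro x hx y hy hxy
      rcases mem_up.1 hx with rfl | hx <;> rcases mem_up.1 hy with rfl | hy
      · exact absurd rfl hxy
      · rw [Γ.symm]; exact hy.2
      · exact hx.2
      · exact h.le.trans (hN.min.1 x hx.1 y hy.1 hxy)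
    · rcases h.attained with ⟨x, hx, hw⟩ | ⟨rfl, x, hx, y, hy, hxy, hw, hxi, hyi⟩
      · exact ⟨x, mem_up.2 (.inr ⟨hx, hw.ge⟩), i, mem_up.2 (.inl rfl), (hN.lt x hx).ne, hw⟩
      · exact ⟨x, mem_up.2 (.inr ⟨hx, hxi⟩), y, mem_up.2 (.inr ⟨hy, hyi⟩), hxy, hw⟩
    · intro y hy hyK
      have hyi : y < i := by
        rcases Nat.lt_succ_iff_lt_or_eq.1 hy with hy | rfl
        · exact hy
        · exact absurd (mem_up.2 (.inl rfl)) hyK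
      by_cases hyc : c ≤ Γ.wt y i
      · have hyL : y ∉ L := fun hyL => hyK (mem_up.2 (.inr ⟨hyL, hyc⟩))
        have := h.good y hyi hyL
        simp only [Bad, hyc, true_or, and_true, not_forall, not_le] at this
        obtain ⟨x, hx, hxc, hxy⟩ := this
        exact ⟨x, mem_up.2 (.inr ⟨hx, hxc⟩), hxy⟩
      · exact ⟨i, mem_up.2 (.inl rfl), by rw [Γ.symm]; exact not_le.1 hyc⟩
    · rcases h.meets with hr | ⟨x, hx, h1, h2, h3⟩
      · exact .inl ⟨i, mem_up.2 (.inl rfl), hi, hr⟩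
      · exact .inl ⟨x, mem_up.2 (.inr ⟨hx, h3⟩), h1, h2⟩

theorem Child.meets (hi : 1 ≤ i) (h : Γ.Child i L b key K c) :
    (key = -1 ∧ K = L ∧ c = b) ∨ Γ.Meets K := by
  cases h with
  | keep h => exact .inl ⟨rfl, rfl, rfl⟩
  | add h =>
    rcases h.meets with hr | ⟨x, hx, h1, h2, h3⟩
    · exact .inr ⟨i, mem_up.2 (.inl rfl), hi, hr⟩
    · exact .inr ⟨x, mem_up.2 (.inr ⟨hx, h3⟩), h1, h2⟩

/-- There is no dead end: if some member has weight below `b` to `i`, the set can be kept; otherwise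
`i` joins all of `L` at the threshold `b`, and the closedness of `L` rules out bad vertices. -/
theorem exists_child (hN : Γ.Node i L b) (hL : Γ.Meets L) :
    ∃ key K c, Γ.Child i L b key K c := by
  by_cases h : ∃ x ∈ L, Γ.wt x i < b
  · exact ⟨_, _, _, .keep ⟨h, .inl hL⟩⟩
  · push Not at h
    obtain ⟨z, hz, hz1, hzr⟩ := hL
    refine ⟨_, _, _, .add (c := b) ⟨hN.bm_le, le_rfl, h 0 hN.zero, .inr ⟨z, hz, hz1, hzr, h z hz⟩,
      .inr ⟨rfl, ?_⟩, ?_⟩⟩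
    · rcases hN.min.2 with ⟨h0, -⟩ | ⟨x, hx, y, hy, hxy, hw⟩
      · rw [h0, Finset.mem_singleton] at hz; omega
      · exact ⟨x, hx, y, hy, hxy, hw, h x hx, h y hy⟩
    · rintro y hy hyL ⟨hb, -⟩
      obtain ⟨x, hx, hxy⟩ := hN.closed y hy hyL
      exact absurd (hb x hx (h x hx)) (not_le.2 hxy)

/-- The greedy extension of `S` within `{0, …, i-1}` at threshold `c`. -/
theorem exists_greedy (S : Finset ℕ) (hS : Γ.Clique S c) (i : ℕ) (hSi : ∀ x ∈ S, x < i) :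
    ∃ L : Finset ℕ, S ⊆ L ∧ (∀ x ∈ L, x < i) ∧ Γ.Clique L c ∧
      ∀ y < i, y ∉ L → ∃ x ∈ L, (x ∈ S ∨ x < y) ∧ Γ.wt x y < c := by
  classical
  have key : ∀ j ≤ i, ∃ L : Finset ℕ, S ⊆ L ∧ (∀ x ∈ L, x ∈ S ∨ x < j) ∧ Γ.Clique L c ∧
      ∀ y < j, y ∉ L → ∃ x ∈ L, (x ∈ S ∨ x < y) ∧ Γ.wt x y < c := by
    intro j
    induction j with
    | zero => exact fun _ => ⟨S, subset_rfl, fun x hx => .inl hx, hS, by simp⟩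
    | succ j ih =>
      intro hj
      obtain ⟨L, h1, h2, h3, h4⟩ := ih (by omega)
      by_cases hjL : j ∈ L
      · exact ⟨L, h1, fun x hx => (h2 x hx).imp_right (by omega), h3, fun y hy hyL =>
          h4 y (by rcases Nat.lt_succ_iff_lt_or_eq.1 hy with hy | rfl <;> [exact hy; exact absurd hjL hyL]) hyL⟩
      by_cases hcomp : ∀ x ∈ L, c ≤ Γ.wt x j
      · refine ⟨insert j L, h1.trans (Finset.subset_insert _ _), ?_, ?_, ?_⟩
        · intro x hx
          rcases Finset.mem_insert.1 hx with rfl | hx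
          · exact .inr (Nat.lt_succ_self _)
          · exact (h2 x hx).imp_right (by omega)
        · intro x hx y hy hxy
          rcases Finset.mem_insert.1 hx with rfl | hx' <;>
            rcases Finset.mem_insert.1 hy with rfl | hy'
          · exact absurd rfl hxy
          · rw [Γ.symm]; exact hcomp y hy'
          · exact hcomp x hx'
          · exact h3 x hx' y hy' hxy
        · intro y hy hyL
          rw [Finset.mem_insert, not_or] at hyL
          obtain ⟨x, hx, hx'⟩ := h4 y (by omega) hyL.2
          exact ⟨x, Finset.mem_insert_of_mem hx, hx'⟩
      · push Not at hcomp
        -- At this stage the set consists of `S` and of vertices below `j`, so the obstacle found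
        -- for `j` is of one of these two kinds.
        obtain ⟨x, hx, hxj⟩ := hcomp
        refine ⟨L, h1, fun x hx => (h2 x hx).imp_right (by omega), h3, fun y hy hyL => ?_⟩
        rcases Nat.lt_succ_iff_lt_or_eq.1 hy with hy | rfl
        · exact h4 y hy hyL
        · exact ⟨x, hx, h2 x hx, hxj⟩
  obtain ⟨L, h1, h2, h3, h4⟩ := key i le_rfl
  exact ⟨L, h1, fun x hx => (h2 x hx).elim (hSi x) id, h3, h4⟩

/-- A node that avoids `i` is its own parent. Otherwise the parent is the greedy extension of `K \
{i}` below `i` at the threshold `c`, whose own least weight `b` is at least `c`. -/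
theorem exists_parent (hi : 1 ≤ i) (hK : Γ.Node (i + 1) K c) :
    ∃ L b key, Γ.Node i L b ∧ Γ.Child i L b key K c := by
  classical
  by_cases hiK : i ∈ K
  · set S := K.erase i with hSdef
    have hSK : ∀ x ∈ S, x ∈ K := fun x hx => Finset.mem_of_mem_erase hx
    have hSi : ∀ x ∈ S, x < i := fun x hx => by
      have := hK.lt x (hSK x hx); have := Finset.ne_of_mem_erase hx; omega
    have hKS : ∀ x ∈ K, x ≠ i → x ∈ S := fun x hx hxi => Finset.mem_erase.2 ⟨hxi, hx⟩
    have h0S : 0 ∈ S := hKS 0 hK.zero (by omega)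
    have hcl : Γ.Clique S c := fun x hx y hy hxy => hK.min.1 x (hSK x hx) y (hSK y hy) hxy
    obtain ⟨L, hSL, hLi, hLc, hg⟩ := exists_greedy S hcl i hSi
    have hci : ∀ x ∈ S, c ≤ Γ.wt x i := fun x hx => hK.min.1 x (hSK x hx) i hiK (hSi x hx).ne
    have hctop : c ≤ Γ.top := (hci 0 h0S).trans (Γ.lt_top _ _).le
    obtain ⟨b, hb, hcb⟩ := hLc.exists_hasMin (hSL h0S) hctop
    -- The greedy extension brings in no new vertex of weight at least `c` to `i`: it would fit all
    -- of `K`, against the closedness of `K`. Hence `K` is recovered from `L` by `up`.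
    have hLS : ∀ x ∈ L, c ≤ Γ.wt x i → x ∈ S := by
      intro x hx hxc
      by_contra hxS
      have hxi := hLi x hx
      obtain ⟨z, hz, hzw⟩ := hK.closed x (by omega) (fun hxK => hxS (hKS x hxK hxi.ne))
      by_cases hzi : z = i
      · subst hzi; rw [Γ.symm] at hzw; omega
      · have hzS := hKS z hz hzi
        exact absurd (hLc z (hSL hzS) x hx (fun h => hxS (h ▸ hzS))) (not_le.2 hzw)
    have hup : Γ.up i L c = K := by
      ext x
      rw [mem_up]
      constructor
      · rintro (rfl | ⟨hx, hxc⟩)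
        · exact hiK
        · exact hSK x (hLS x hx hxc)
      · intro hx
        by_cases hxi : x = i
        · exact .inl hxi
        · exact .inr ⟨hSL (hKS x hx hxi), hci x (hKS x hx hxi)⟩
    have hadd : Γ.Add i L b c := by
      refine ⟨hK.bm_le, hcb, hci 0 h0S, ?_, ?_, ?_⟩
      · rcases hK.meets with ⟨x, hx, h1, h2⟩ | h
        · by_cases hxi : x = i
          · exact .inl (hxi ▸ h2)
          · exact .inr ⟨x, hSL (hKS x hx hxi), h1, h2, hci x (hKS x hx hxi)⟩
        · exact .inl (by omega)
      · rcases hK.min.2 with ⟨h0, -⟩ | ⟨x, hx, y, hy, hxy, hw⟩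
        · rw [h0, Finset.mem_singleton] at hiK; omega
        · by_cases hxi : x = i
          · subst hxi
            exact .inl ⟨y, hSL (hKS y hy hxy.symm), by rw [Γ.symm]; exact hw⟩
          · by_cases hyi : y = i
            · subst hyi
              exact .inl ⟨x, hSL (hKS x hx hxi), hw⟩
            · have hxS := hKS x hx hxi
              have hyS := hKS y hy hyi
              have hbc : c = b := le_antisymm hcb (hw ▸ hb.1 x (hSL hxS) y (hSL hyS) hxy)
              exact .inr ⟨hbc, x, hSL hxS, y, hSL hyS, hxy, hbc ▸ hw, hbc ▸ hci x hxS,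
                hbc ▸ hci y hyS⟩
      -- The greedy choice refused `y` because of some `x`, which by the first half of badness is
      -- not in `S` and is therefore smaller than `y`. This refutes the greedy alternative; the
      -- other one would let `y` extend `K`.
      · rintro y hy hyL ⟨hb1, hb2⟩
        obtain ⟨x, hx, hxS, hxy⟩ := hg y hy hyL
        have hnS : x ∉ S := fun hxS => absurd (hb1 x hx (hci x hxS)) (not_le.2 hxy)
        rcases hb2 with hyi | hb2
        · obtain ⟨z, hz, hzw⟩ := hK.closed y (by omega)
            (fun hyK => hyL (hSL (hKS y hyK hy.ne)))
          by_cases hzi : z = i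
          · subst hzi; rw [Γ.symm] at hzw; omega
          · have hzS := hKS z hz hzi
            exact absurd (hb1 z (hSL hzS) (hci z hzS)) (not_le.2 hzw)
        · exact absurd (hb2 x hx (hxS.resolve_left hnS)) (not_le.2 hxy)
    refine ⟨L, b, c, ⟨hLi, hSL h0S, hb, hK.bm_le.trans hcb, ?_, ?_⟩, hup ▸ .add hadd⟩
    · intro y hy hyL
      obtain ⟨x, hx, -, hxy⟩ := hg y hy hyL
      exact ⟨x, hx, hxy.trans_le hcb⟩
    · rcases hadd.meets with h | ⟨x, hx, h1, h2, -⟩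
      · exact .inr h
      · exact .inl ⟨x, hx, h1, h2⟩
  · refine ⟨K, c, -1, ⟨fun x hx => ?_, hK.zero, hK.min, hK.bm_le,
      fun y hy => hK.closed y (by omega), hK.meets.imp_right (by omega)⟩,
      .keep ⟨hK.closed i (Nat.lt_succ_self i) hiK, hK.meets⟩⟩
    have := hK.lt x hx
    have : x ≠ i := fun h => hiK (h ▸ hx)
    omega

/-- Two parents of a set that contains `i` agree on the vertices of weight at least `c` to `i`. By
strong induction they agree everywhere: a least vertex that is in one only would be bad for the
other. -/
theorem parent_unique (hL : Γ.Node i L b) (hL' : Γ.Node i L' b') (h : Γ.Child i L b key K c)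
    (h' : Γ.Child i L' b' key' K c) : L = L' ∧ b = b' := by
  suffices hs : L = L' by
    subst hs
    exact ⟨rfl, hL.min.unique hL'.min⟩
  cases h with
  | keep h =>
    generalize hK : L = K at h'
    cases h' with
    | keep h' => rfl
    | add h' => exact absurd (hL.lt i (hK ▸ mem_up.2 (.inl rfl))) (lt_irrefl _)
  | add h =>
    generalize hK : Γ.up i L c = K at h'
    cases h' with
    | keep h' => exact absurd (hL'.lt i (hK ▸ mem_up.2 (.inl rfl))) (lt_irrefl _)
    | add h' =>
      have hS : ∀ x, x < i → ((x ∈ L ∧ c ≤ Γ.wt x i) ↔ (x ∈ L' ∧ c ≤ Γ.wt x i)) := by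
        intro x hx
        have := Finset.ext_iff.1 hK x
        rw [mem_up, mem_up] at this
        constructor
        · exact fun hh => (this.1 (.inr hh)).resolve_left hx.ne
        · exact fun hh => (this.2 (.inr hh)).resolve_left hx.ne
      -- One direction of the inductive step. The vertex that shows `y` not to be bad for `L'` also
      -- lies in `L`, either as a common neighbour of `i` or by induction, and contradicts that `L`
      -- is a clique at the threshold `c`.
      have aux : ∀ {L L' : Finset ℕ} {b b' : ℤ}, Γ.Node i L b → Γ.Node i L' b' → Γ.Add i L b c →
          Γ.Add i L' b' c →
          (∀ x, x < i → ((x ∈ L ∧ c ≤ Γ.wt x i) ↔ (x ∈ L' ∧ c ≤ Γ.wt x i))) → ∀ y < i,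
          (∀ x < y, x ∈ L ↔ x ∈ L') → y ∈ L → y ∈ L' := by
        intro L L' b b' hL hL' h h' hS y hy ih hyL
        by_contra hyL'
        have := h'.good y hy hyL'
        simp only [Bad, not_and_or, not_forall, not_or, not_le] at this
        rcases this with ⟨x, hx, hxi, hxy⟩ | ⟨-, x, hx, hxlt, hxy⟩
        · have hxL := ((hS x (hL'.lt x hx)).2 ⟨hx, hxi⟩).1
          exact absurd (h.le.trans (hL.min.1 x hxL y hyL (fun hh => hyL' (hh ▸ hx)))) (not_le.2 hxy)
        · exact absurd (h.le.trans (hL.min.1 x ((ih x hxlt).2 hx) y hyL hxlt.ne)) (not_le.2 hxy)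
      have main : ∀ y, y < i → (y ∈ L ↔ y ∈ L') := by
        intro y
        induction y using Nat.strong_induction_on with
        | _ y ih =>
          intro hy
          exact ⟨aux hL hL' h h' hS y hy fun x hx => ih x hx (hx.trans hy),
            aux hL' hL h' h (fun x hx => (hS x hx).symm) y hy fun x hx =>
              (ih x hx (hx.trans hy)).symm⟩
      ext y
      exact ⟨fun hy => (main y (hL.lt y hy)).1 hy, fun hy => (main y (hL'.lt y hy)).2 hy⟩

theorem Below.le (h : Γ.Below i L b F) : i ≤ Γ.w := by
  cases h with
  | leaf => exact le_rfl
  | step hi _ _ => exact hi.le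

theorem Below.node_leaf (h : Γ.Below i L b F) (hi : 1 ≤ i) (hN : Γ.Node i L b) :
    ∃ c, Γ.Node Γ.w F c := by
  induction h with
  | leaf L b => exact ⟨b, hN⟩
  | step _ h _ ih => exact ih (by omega) (h.node hN hi)

theorem below_leaf_iff : Γ.Below Γ.w L b F ↔ F = L := by
  constructor
  · intro h
    generalize hw : Γ.w = i at h
    cases h with
    | leaf => rfl
    | step hi _ _ => omega
  · rintro rfl; exact .leaf _ _

theorem below_step_iff (hi : i < Γ.w) :
    Γ.Below i L b F ↔ ∃ key K c, Γ.Child i L b key K c ∧ Γ.Below (i + 1) K c F := by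
  constructor
  · intro h
    cases h with
    | leaf => omega
    | step _ h hF => exact ⟨_, _, _, h, hF⟩
  · rintro ⟨key, K, c, h, hF⟩
    exact .step hi h hF

/-- A leaf lies below one node of each level. -/
theorem Below.unique (h : Γ.Below i L b F) (h' : Γ.Below i L' b' F) (hi : 1 ≤ i)
    (hN : Γ.Node i L b) (hN' : Γ.Node i L' b') : L = L' ∧ b = b' := by
  induction h generalizing L' b' with
  | leaf L b =>
    obtain rfl := below_leaf_iff.1 h'
    exact ⟨rfl, hN.min.unique hN'.min⟩
  | step hlt h hF ih =>
    obtain ⟨key', K', c', h2, hF'⟩ := (below_step_iff hlt).1 h'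
    obtain ⟨rfl, rfl⟩ := ih hF' (by omega) (h.node hN hi) (h2.node hN' hi)
    exact parent_unique hN hN' h h2

/-- A node of the last level is traced back to the root through its parents, so the tree reaches all
of them. -/
theorem below_root_iff : Γ.Below 1 {0} Γ.top F ↔ ∃ c, Γ.Node Γ.w F c := by
  refine ⟨fun h => h.node_leaf le_rfl root_node, ?_⟩
  have key : ∀ i, 1 ≤ i → ∀ L b, Γ.Node i L b → Γ.Below i L b F → Γ.Below 1 {0} Γ.top F := by
    intro i hi
    induction i, hi using Nat.le_induction with
    | base =>
      intro L b hN hF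
      obtain ⟨rfl, rfl⟩ := hN.eq_root
      exact hF
    | succ i hi ih =>
      intro K c hK hF
      obtain ⟨L, b, key, hL, hc⟩ := exists_parent hi hK
      exact ih L b hL (.step (by have := hF.le; omega) hc hF)
  rintro ⟨c, hc⟩
  exact key Γ.w (by have := Γ.r_pos; have := Γ.r_lt; omega) F c hc (.leaf _ _)

/-- For the running time: visits to nodes that meet `1, …, r` can be charged to leaves. -/
theorem exists_below (hi : 1 ≤ i) (hiw : i ≤ Γ.w) (hN : Γ.Node i L b) (hL : Γ.Meets L) :
    ∃ F, Γ.Below i L b F := by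
  induction hd : Γ.w - i generalizing i L b with
  | zero =>
    obtain rfl : i = Γ.w := by omega
    exact ⟨L, .leaf _ _⟩
  | succ d ih =>
    obtain ⟨key, K, c, hc⟩ := exists_child hN hL
    have hK : Γ.Meets K := by
      rcases hc.meets hi with ⟨-, rfl, -⟩ | h
      · exact hL
      · exact h
    obtain ⟨F, hF⟩ := ih (by omega) (by omega) (hc.node hN hi) hK (by omega)
    exact ⟨F, .step (by omega) hc hF⟩

/-- The root `{0}` does not meet `1, …, r`, so `exists_below` is applied to its child `{0, 1}`. -/
theorem exists_below_root : ∃ F, Γ.Below 1 {0} Γ.top F := by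
  have hr := Γ.r_pos
  have hc : Γ.Child 1 {0} Γ.top (Γ.wt 0 1) (Γ.up 1 {0} (Γ.wt 0 1)) (Γ.wt 0 1) := by
    refine .add ⟨Γ.bm_le_wt 1 le_rfl hr, (Γ.lt_top _ _).le, le_rfl, .inl hr, .inl ⟨0, by simp⟩, ?_⟩
    intro y hy hy0
    simp only [Finset.mem_singleton] at hy0
    omega
  have h1w : 1 < Γ.w := by have := Γ.r_lt; omega
  obtain ⟨F, hF⟩ := exists_below (i := 2) (by omega) (by omega) (hc.node root_node le_rfl)
    ⟨1, mem_up.2 (.inl rfl), le_rfl, hr⟩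
  exact ⟨F, .step h1w hc hF⟩

end LocalGraph

/-! ### Half-edges and adjacency lists -/

namespace ThickEdgeGraph

variable (G : ThickEdgeGraph)

/-- A half-edge is a thick edge with a direction. -/
abbrev Half := Fin G.m × Bool

/-- A super-vertex is a vertex with a time stamp. -/
abbrev SV := Fin G.n × ℤ

variable {G}

def src (a : G.Half) : Fin G.n := if a.2 then (G.edge a.1).v else (G.edge a.1).u
def dst (a : G.Half) : Fin G.n := if a.2 then (G.edge a.1).u else (G.edge a.1).v
def ts (a : G.Half) : ℤ := if a.2 then (G.edge a.1).tv else (G.edge a.1).tu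
def td (a : G.Half) : ℤ := if a.2 then (G.edge a.1).tu else (G.edge a.1).tv
def len (a : G.Half) : ℤ := (G.edge a.1).len
def flip (a : G.Half) : G.Half := (a.1, !a.2)
/-- The numbers of the half-edges are `1, …, 2m`. -/
def id (a : G.Half) : ℕ := 2 * a.1 + 1 + a.2.toNat

theorem id_pos (a : G.Half) : 0 < id a := by unfold id; omega

theorem id_le (a : G.Half) : id a ≤ 2 * G.m := by
  have := a.1.2
  have := a.2.toNat_le
  unfold id; omega

theorem id_inj {a a' : G.Half} (h : id a = id a') : a = a' := by
  obtain ⟨⟨j, hj⟩, β⟩ := a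
  obtain ⟨⟨j', hj'⟩, β'⟩ := a'
  unfold id at h
  have h1 := β.toNat_le
  have h2 := β'.toNat_le
  dsimp only at h h1 h2
  obtain rfl : j = j' := by omega
  have : β.toNat = β'.toNat := by omega
  cases β <;> cases β' <;> simp_all

theorem src_ne_dst (a : G.Half) : src a ≠ dst a := by
  have := G.loopless a.1
  unfold src dst
  split
  · exact this.symm
  · exact this

theorem src_inj {a a' : G.Half} (h : src a = src a') (h1 : a.1 = a'.1) : a = a' := by
  obtain ⟨j, β⟩ := a
  obtain ⟨j', β'⟩ := a'
  obtain rfl : j = j' := h1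
  have := G.loopless j
  cases β <;> cases β' <;> simp_all [src]

@[simp] theorem src_flip (a : G.Half) : src (flip a) = dst a := by
  rcases a with ⟨j, _ | _⟩ <;> rfl
@[simp] theorem dst_flip (a : G.Half) : dst (flip a) = src a := by
  rcases a with ⟨j, _ | _⟩ <;> rfl
@[simp] theorem ts_flip (a : G.Half) : ts (flip a) = td a := by
  rcases a with ⟨j, _ | _⟩ <;> rfl
@[simp] theorem td_flip (a : G.Half) : td (flip a) = ts a := by
  rcases a with ⟨j, _ | _⟩ <;> rfl
@[simp] theorem len_flip (a : G.Half) : len (flip a) = len a := rfl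

theorem len_nonneg (a : G.Half) : 0 ≤ len a := Int.natCast_nonneg _

theorem ts_pos (a : G.Half) : 1 ≤ ts a := by
  unfold ts; split <;> [exact G.tv_pos _; exact G.tu_pos _]

theorem ts_add_len_le (a : G.Half) : ts a + len a ≤ G.tmax := by
  unfold ts len; split <;> [exact G.tv_le _; exact G.tu_le _]

theorem td_pos (a : G.Half) : 1 ≤ td a := by rw [← ts_flip]; exact ts_pos _

theorem td_add_len_le (a : G.Half) : td a + len a ≤ G.tmax := by
  rw [← ts_flip, ← len_flip]; exact ts_add_len_le _

/-- The half-edge `a` leads from `x` to `y`. -/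
def Fits (a : G.Half) (x y : G.SV) : Prop :=
  src a = x.1 ∧ dst a = y.1 ∧ td a + x.2 - ts a = y.2 ∧ ts a ≤ x.2 ∧ x.2 ≤ ts a + len a

instance (a : G.Half) (x y : G.SV) : Decidable (Fits a x y) := by unfold Fits; infer_instance

theorem Fits.flip {a : G.Half} {x y : G.SV} (h : Fits a x y) : Fits (flip a) y x := by
  obtain ⟨h1, h2, h3, h4, h5⟩ := h
  refine ⟨by simpa, by simpa, ?_, ?_, ?_⟩ <;> simp only [ts_flip, td_flip, len_flip] <;> omega

theorem joins_iff {j : Fin G.m} {x y : G.SV} :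
    (G.edge j).Joins x y ↔ ∃ β, Fits (j, β) x y := by
  obtain ⟨x, s⟩ := x
  obtain ⟨y, t⟩ := y
  constructor
  · rintro ⟨k, hk, h | h⟩
    · simp only [Prod.mk.injEq] at h
      obtain ⟨⟨rfl, rfl⟩, rfl, rfl⟩ := h
      exact ⟨false, by refine ⟨rfl, rfl, ?_, ?_, ?_⟩ <;> simp [ts, td, len] <;> omega⟩
    · simp only [Prod.mk.injEq] at h
      obtain ⟨⟨rfl, rfl⟩, rfl, rfl⟩ := h
      exact ⟨true, by refine ⟨rfl, rfl, ?_, ?_, ?_⟩ <;> simp [ts, td, len] <;> omega⟩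
  · rintro ⟨_ | _, h1, h2, h3, h4, h5⟩
    · simp only [src, dst, td, ts, len, Bool.false_eq_true, if_false] at *
      subst h1 h2
      obtain ⟨k, hk⟩ := Int.eq_ofNat_of_zero_le (sub_nonneg.2 h4)
      refine ⟨k, by omega, .inl ⟨?_, ?_⟩⟩ <;> simp only [Prod.mk.injEq, true_and] <;> omega
    · simp only [src, dst, td, ts, len, if_true] at *
      subst h1 h2
      obtain ⟨k, hk⟩ := Int.eq_ofNat_of_zero_le (sub_nonneg.2 h4)
      refine ⟨k, by omega, .inr ⟨?_, ?_⟩⟩ <;> simp only [Prod.mk.injEq, true_and] <;> omega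

theorem Fits.joins {a : G.Half} {x y : G.SV} (h : Fits a x y) : (G.edge a.1).Joins x y :=
  joins_iff.2 ⟨a.2, h⟩

theorem Fits.ne {a : G.Half} {x y : G.SV} (h : Fits a x y) : x.1 ≠ y.1 := by
  rw [← h.1, ← h.2.1]; exact src_ne_dst a

/-- The assumption that two super-vertices are joined by at most one thick edge enters here;
looplessness then fixes the direction. -/
theorem Fits.unique {a a' : G.Half} {x y : G.SV} (h : Fits a x y) (h' : Fits a' x y) : a = a' :=
  src_inj (h.1.trans h'.1.symm) (G.simple _ _ x y h.joins h'.joins)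

theorem Fits.eq_right {a : G.Half} {x y y' : G.SV} (h : Fits a x y) (h' : Fits a x y') : y = y' :=
  Prod.ext (h.2.1.symm.trans h'.2.1) (h.2.2.1.symm.trans h'.2.2.1)

/-- The remaining length of a half-edge at a time stamp of its source. -/
def rem (a : G.Half) (t : ℤ) : ℤ := len a - (t - ts a)

theorem Fits.rem_flip {a : G.Half} {x y : G.SV} (h : Fits a x y) :
    rem (ThickEdgeGraph.flip a) y.2 = rem a x.2 := by
  have := h.2.2.1
  simp only [rem, len_flip, ts_flip]; omega

theorem Fits.rem_nonneg {a : G.Half} {x y : G.SV} (h : Fits a x y) : 0 ≤ rem a x.2 := by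
  have := h.2.2.2.2
  simp only [rem]; omega

theorem Fits.rem_le {a : G.Half} {x y : G.SV} (h : Fits a x y) : rem a x.2 ≤ len a := by
  have := h.2.2.2.1
  simp only [rem]; omega

/-- The half-edges of length at least `bm` that leave `x`, among those of the edges below `j`. -/
def adjTo (bm : ℕ) : ℕ → Fin G.n → List G.Half
  | 0, _ => []
  | j + 1, x =>
    if h : j < G.m then
      if bm ≤ (G.edge ⟨j, h⟩).len then
        -- Without loops at most one direction leaves `x`, so the second test may be skipped.
        -- Prepending gives the order of a linked list that is filled at its head.
        if (G.edge ⟨j, h⟩).v = x then (⟨j, h⟩, true) :: adjTo bm j x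
        else if (G.edge ⟨j, h⟩).u = x then (⟨j, h⟩, false) :: adjTo bm j x
        else adjTo bm j x
      else adjTo bm j x
    else adjTo bm j x

variable (G) in
/-- The half-edges of length at least `bm` that leave `x`. -/
def adj (bm : ℕ) (x : Fin G.n) : List G.Half := adjTo bm G.m x

variable {bm : ℕ}

theorem mem_adjTo {j : ℕ} {x : Fin G.n} {a : G.Half} :
    a ∈ adjTo bm j x ↔ (a.1 : ℕ) < j ∧ src a = x ∧ (bm : ℤ) ≤ len a := by
  induction j with
  | zero => simp [adjTo]
  | succ j ih =>
    obtain ⟨⟨i, hi⟩, β⟩ := a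
    unfold adjTo
    by_cases hj : j < G.m
    · have hl := G.loopless ⟨j, hj⟩
      have hlt : i < j + 1 ↔ i = j ∨ i < j := by omega
      rw [dif_pos hj]
      dsimp only at ih ⊢
      by_cases hij : i = j
      · subst hij
        split_ifs with h1 h2 h3 <;> cases β <;> simp_all [src, len]
      · split_ifs <;> simp [ih, hlt, hij]
    · rw [dif_neg hj, ih]
      dsimp only
      have : i < j ↔ i < j + 1 := by omega
      rw [this]

theorem mem_adj {x : Fin G.n} {a : G.Half} : a ∈ G.adj bm x ↔ src a = x ∧ (bm : ℤ) ≤ len a := by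
  rw [adj, mem_adjTo]
  simp

theorem nodup_adjTo (j : ℕ) (x : Fin G.n) : (adjTo (G := G) bm j x).Nodup := by
  induction j with
  | zero => simp [adjTo]
  | succ j ih =>
    unfold adjTo
    split_ifs <;> simp [ih, mem_adjTo]

theorem nodup_adj (x : Fin G.n) : (G.adj bm x).Nodup := nodup_adjTo _ _

theorem length_adj_le_degree (x : Fin G.n) : (G.adj bm x).length ≤ G.degree x := by
  rw [← List.toFinset_card_of_nodup (nodup_adj x)]
  refine Finset.card_le_card_of_injOn Prod.fst ?_ ?_
  · intro a ha
    rw [Finset.mem_coe, List.mem_toFinset, mem_adj] at ha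
    simp only [Finset.coe_filter, Finset.mem_univ, true_and, Set.mem_ofPred_eq]
    rw [← ha.1]
    unfold src
    split <;> simp
  · intro a ha a' ha' h
    rw [Finset.mem_coe, List.mem_toFinset, mem_adj] at ha ha'
    exact src_inj (ha.1.trans ha'.1.symm) h

theorem degree_le_maxDegree (x : Fin G.n) : G.degree x ≤ G.maxDegree :=
  Finset.le_sup (f := G.degree) (Finset.mem_univ x)

theorem maxDegree_le : G.maxDegree ≤ G.m :=
  Finset.sup_le fun x _ => (Finset.card_le_univ _).trans (by simp)

theorem length_adj_le (x : Fin G.n) : (G.adj bm x).length ≤ G.maxDegree :=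
  (length_adj_le_degree x).trans (degree_le_maxDegree x)

theorem sum_length_adj_le (s : Finset (Fin G.n)) :
    ∑ x ∈ s, (G.adj bm x).length ≤ 2 * G.m := by
  calc ∑ x ∈ s, (G.adj bm x).length = ∑ x ∈ s, (G.adj bm x).toFinset.card :=
        Finset.sum_congr rfl fun x _ => (List.toFinset_card_of_nodup (nodup_adj x)).symm
    _ = (s.biUnion fun x => (G.adj bm x).toFinset).card := by
        rw [Finset.card_biUnion]
        intro x _ y _ hxy
        refine Finset.disjoint_left.2 ?_
        intro a ha ha'
        rw [List.mem_toFinset, mem_adj] at ha ha'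
        exact hxy (ha.1.symm.trans ha'.1)
    _ ≤ Fintype.card G.Half := Finset.card_le_univ _
    _ = 2 * G.m := by simp [mul_comm]

/-! ### Remaining lengths -/

/-- The remaining length of the edge of length at least `bm` that joins `x` and `y`, or `-1`. -/
def R (bm : ℕ) (x y : G.SV) : ℤ :=
  match (G.adj bm x.1).find? fun a => Fits a x y with
  | some a => rem a x.2
  | none => -1

theorem find_eq_some {x y : G.SV} {a : G.Half} (h : Fits a x y) (hb : (bm : ℤ) ≤ len a) :
    (G.adj bm x.1).find? (fun a => Fits a x y) = some a := by
  have hmem : a ∈ G.adj bm x.1 := mem_adj.2 ⟨h.1, hb⟩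
  cases hf : (G.adj bm x.1).find? (fun a => Fits a x y) with
  | none =>
    rw [List.find?_eq_none] at hf
    exact absurd h (by simpa using hf a hmem)
  | some a' =>
    have := List.find?_some hf
    simp only [decide_eq_true_eq] at this
    rw [this.unique h]

theorem R_of_fits {x y : G.SV} {a : G.Half} (h : Fits a x y) (hb : (bm : ℤ) ≤ len a) :
    R bm x y = rem a x.2 := by
  rw [R, find_eq_some h hb]

theorem R_cases (bm : ℕ) (x y : G.SV) : (∃ a, Fits a x y ∧ (bm : ℤ) ≤ len a ∧ R bm x y = rem a x.2) ∨
    (R bm x y = -1 ∧ ∀ a, Fits a x y → len a < bm) := by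
  by_cases h : ∃ a, Fits a x y ∧ (bm : ℤ) ≤ len a
  · obtain ⟨a, h1, h2⟩ := h
    exact .inl ⟨a, h1, h2, R_of_fits h1 h2⟩
  · push Not at h
    refine .inr ⟨?_, h⟩
    have : (G.adj bm x.1).find? (fun a => Fits a x y) = none := by
      rw [List.find?_eq_none]
      intro a ha
      rw [mem_adj] at ha
      simp only [decide_eq_true_eq]
      exact fun hf => absurd (h a hf) (not_lt.2 ha.2)
    rw [R, this]

theorem R_symm (x y : G.SV) : R bm x y = R bm y x := by
  rcases R_cases bm x y with ⟨a, h1, h2, h3⟩ | ⟨h1, h2⟩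
  · rw [h3, R_of_fits h1.flip (by simpa), h1.rem_flip]
  · rcases R_cases bm y x with ⟨a, h1', h2', -⟩ | ⟨h1', -⟩
    · exact absurd (h2 _ h1'.flip) (by simpa)
    · rw [h1, h1']

/-- Strict because time stamps start at `1`; thus `tmax` can serve as the least weight of a
singleton. -/
theorem R_lt_top (x y : G.SV) : R bm x y < G.tmax := by
  rcases R_cases bm x y with ⟨a, h1, -, h3⟩ | ⟨h1, -⟩
  · have := h1.rem_le
    have := ts_add_len_le a
    have := ts_pos a
    omega
  · omega

theorem neg_one_le_R (x y : G.SV) : -1 ≤ R bm x y := by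
  rcases R_cases bm x y with ⟨a, h1, -, h3⟩ | ⟨h1, -⟩
  · have := h1.rem_nonneg
    omega
  · omega

/-- Ignoring the edges shorter than `bm` is harmless at thresholds from `bm` on, since a remaining
length never exceeds the length. -/
theorem le_R_iff {x y : G.SV} {b : ℤ} (hb : (bm : ℤ) ≤ b) :
    b ≤ R bm x y ↔ ∃ a, Fits a x y ∧ b ≤ rem a x.2 := by
  constructor
  · intro h
    rcases R_cases bm x y with ⟨a, h1, -, h3⟩ | ⟨h1, -⟩
    · exact ⟨a, h1, h3 ▸ h⟩
    · omega
  · rintro ⟨a, h1, h2⟩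
    rw [R_of_fits h1 (by have := h1.rem_le; omega)]
    exact h2

theorem exists_fits_of_R_nonneg {x y : G.SV} (h : 0 ≤ R bm x y) :
    ∃ a, Fits a x y ∧ (bm : ℤ) ≤ len a ∧ R bm x y = rem a x.2 := by
  rcases R_cases bm x y with h' | ⟨h1, -⟩
  · exact h'
  · omega

/-- The edge that joins `x` and `y` starts there. -/
def Start (x y : G.SV) : Prop := ∃ a, Fits a x y ∧ ts a = x.2

/-! ### Degree sums over cliques -/

theorem fst_injOn_of_clique {P : Finset G.SV}
    (hP : ∀ x ∈ P, ∀ y ∈ P, x ≠ y → 0 ≤ R bm x y) : Set.InjOn Prod.fst (P : Set G.SV) := by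
  intro x hx y hy hxy
  by_contra hne
  obtain ⟨a, ha, -⟩ := exists_fits_of_R_nonneg (hP x hx y hy hne)
  exact ha.ne hxy

variable (G) in
/-- A bound for the squared size and for the sum of the degrees of a clique. -/
def cliqueBound : ℕ := 4 * min (G.maxDegree ^ 2) G.m

theorem card_clique_le {P : Finset G.SV} (hP : ∀ x ∈ P, ∀ y ∈ P, x ≠ y → 0 ≤ R bm x y)
    {x : G.SV} (hx : x ∈ P) : P.card ≤ (G.adj bm x.1).length + 1 := by
  classical
  have h : P.erase x ⊆ (G.adj bm x.1).toFinset.image fun a => (dst a, td a + x.2 - ts a) := by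
    intro y hy
    obtain ⟨a, ha, hb, -⟩ := exists_fits_of_R_nonneg
      (hP x hx y (Finset.mem_of_mem_erase hy) (Finset.ne_of_mem_erase hy).symm)
    exact Finset.mem_image.2 ⟨a, List.mem_toFinset.2 (mem_adj.2 ⟨ha.1, hb⟩),
      Prod.ext ha.2.1 ha.2.2.1⟩
  have := (Finset.card_le_card h).trans Finset.card_image_le
  rw [List.toFinset_card_of_nodup (nodup_adj _), Finset.card_erase_of_mem hx] at this
  omega

/-- The members of a clique belong to distinct vertices, so their degrees sum to at most `2m`. The
clique has at most `deg x + 1 ≤ 2 * deg x` members for each `x` in it, so the sum is also at most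
`2Δ²`, and adding these inequalities over `x` bounds the square of the size. Positive degrees absorb
the summands `1`. -/
theorem sum_adj_clique_le {P : Finset G.SV} (hP : ∀ x ∈ P, ∀ y ∈ P, x ≠ y → 0 ≤ R bm x y)
    (hd : ∀ x ∈ P, 1 ≤ (G.adj bm x.1).length) :
    ∑ x ∈ P, ((G.adj bm x.1).length + 1) ≤ G.cliqueBound ∧ P.card ^ 2 ≤ G.cliqueBound := by
  rcases P.eq_empty_or_nonempty with rfl | ⟨x0, hx0⟩
  · simp
  have h1 : ∑ x ∈ P, (G.adj bm x.1).length ≤ 2 * G.m := by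
    rw [← Finset.sum_image (f := fun x => (G.adj bm x).length) (fst_injOn_of_clique hP)]
    exact sum_length_adj_le _
  have hc : ∀ x ∈ P, P.card ≤ 2 * (G.adj bm x.1).length := fun x hx => by
    have := card_clique_le hP hx; have := hd x hx; omega
  have h2 : ∑ x ∈ P, (G.adj bm x.1).length ≤ 2 * G.maxDegree ^ 2 := by
    calc ∑ x ∈ P, (G.adj bm x.1).length ≤ P.card * G.maxDegree := by
          simpa using Finset.sum_le_card_nsmul P _ _ fun x _ => length_adj_le x.1
      _ ≤ (2 * G.maxDegree) * G.maxDegree :=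
          Nat.mul_le_mul_right _ ((hc x0 hx0).trans (Nat.mul_le_mul_left 2 (length_adj_le _)))
      _ = 2 * G.maxDegree ^ 2 := by ring
  have h3 : ∑ x ∈ P, ((G.adj bm x.1).length + 1) ≤ 2 * ∑ x ∈ P, (G.adj bm x.1).length := by
    rw [Finset.mul_sum]
    exact Finset.sum_le_sum fun x hx => by have := hd x hx; omega
  have h4 : P.card ^ 2 ≤ 2 * ∑ x ∈ P, (G.adj bm x.1).length := by
    rw [Finset.mul_sum, pow_two]
    simpa using Finset.card_nsmul_le_sum P _ _ hc
  unfold cliqueBound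
  constructor <;> omega

/-! ### Cliques at their starting time -/

/-- The clique of super-vertices `Q`, the state of a closed active clique at its first active time
stamp; it stays active for `b` further time stamps. -/
structure Sol (bm : ℕ) (Q : Finset G.SV) (b : ℤ) : Prop where
  clique : ∀ x ∈ Q, ∀ y ∈ Q, x ≠ y → b ≤ R bm x y
  bm_le : (bm : ℤ) ≤ b
  attained : ∃ x ∈ Q, ∃ y ∈ Q, x ≠ y ∧ R bm x y = b
  start : ∃ x ∈ Q, ∃ y ∈ Q, Start x y
  closed : ∀ y, y ∉ Q → ∃ x ∈ Q, R bm x y < b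

/-- Translation in time. -/
def shift (δ : ℤ) (Q : Finset G.SV) : Finset G.SV := Q.image fun x => (x.1, x.2 + δ)

theorem mem_shift {δ : ℤ} {Q : Finset G.SV} {x : G.SV} : x ∈ shift δ Q ↔ (x.1, x.2 - δ) ∈ Q := by
  simp only [shift, Finset.mem_image]
  constructor
  · rintro ⟨y, hy, rfl⟩; simpa using hy
  · intro h; exact ⟨_, h, by simp⟩

theorem shift_shift (δ ε : ℤ) (Q : Finset G.SV) : shift δ (shift ε Q) = shift (δ + ε) Q := by
  ext x
  rw [mem_shift, mem_shift, mem_shift, sub_sub]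

theorem shift_zero (Q : Finset G.SV) : shift 0 Q = Q := by
  ext x; rw [mem_shift]; simp

/-- The edges that join members of `Q`. -/
def edgesOf (Q : Finset G.SV) : Finset (Fin G.m) :=
  Finset.univ.filter fun j => ∃ x ∈ Q, ∃ y ∈ Q, ∃ β, Fits (j, β) x y

theorem mem_edgesOf {Q : Finset G.SV} {j : Fin G.m} :
    j ∈ edgesOf Q ↔ ∃ x ∈ Q, ∃ y ∈ Q, ∃ β, Fits (j, β) x y := by simp [edgesOf]

/-- The least time stamp in `Q`. -/
def base (Q : Finset G.SV) : ℤ :=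
  if h : Q.Nonempty then Q.inf' h Prod.snd else 0

theorem base_eq {Q : Finset G.SV} {t : ℤ} (h1 : ∃ x ∈ Q, x.2 = t) (h2 : ∀ x ∈ Q, t ≤ x.2) :
    base Q = t := by
  obtain ⟨x, hx, rfl⟩ := h1
  rw [base, dif_pos ⟨x, hx⟩]
  exact le_antisymm (Finset.inf'_le _ hx) ((Finset.le_inf'_iff _ _).2 h2)

theorem base_spec {Q : Finset G.SV} (h : Q.Nonempty) :
    (∃ x ∈ Q, x.2 = base Q) ∧ ∀ x ∈ Q, base Q ≤ x.2 := by
  rw [base, dif_pos h]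
  refine ⟨?_, fun x hx => Finset.inf'_le _ hx⟩
  obtain ⟨x, hx, he⟩ := Finset.exists_mem_eq_inf' h (Prod.snd : G.SV → ℤ)
  exact ⟨x, hx, he.symm⟩

/-- The clique, with normalized shifts, that `Q` is a state of. -/
def cliqueOf (Q : Finset G.SV) : Finset (Fin G.m) × Finset (Fin G.n × ℤ) :=
  (edgesOf Q, shift (-base Q) Q)

theorem mem_vertexSet {K : Finset (Fin G.m)} {x : Fin G.n} :
    x ∈ G.vertexSet K ↔ ∃ j ∈ K, (G.edge j).u = x ∨ (G.edge j).v = x := by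
  simp only [vertexSet, Finset.mem_union, Finset.mem_image]
  constructor
  · rintro (⟨j, hj, h⟩ | ⟨j, hj, h⟩)
    · exact ⟨j, hj, .inl h⟩
    · exact ⟨j, hj, .inr h⟩
  · rintro ⟨j, hj, h | h⟩
    · exact .inl ⟨j, hj, h⟩
    · exact .inr ⟨j, hj, h⟩

/-- The shifted clique `(K, S)` is active at the time stamp `t`, when it is at `Q`. -/
structure State (K : Finset (Fin G.m)) (S : Finset (Fin G.n × ℤ)) (t : ℤ) (Q : Finset G.SV) :
    Prop where
  clique : G.IsShiftedClique K S
  active : t ∈ G.activeTimes K S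
  eq : Q = shift t S

section State

variable {K : Finset (Fin G.m)} {S : Finset (Fin G.n × ℤ)} {t : ℤ} {Q : Finset G.SV}

theorem State.mem (h : State K S t Q) {x : Fin G.n} {s : ℤ} : (x, s) ∈ S ↔ (x, s + t) ∈ Q := by
  rw [h.eq, mem_shift]; simp

theorem State.fst_inj (h : State K S t Q) {x y : G.SV} (hx : x ∈ Q) (hy : y ∈ Q)
    (hxy : x.1 = y.1) : x = y := by
  rw [h.eq, mem_shift] at hx hy
  have h1 := (h.clique.shift_unique _ (h.clique.shift_mem _ hx)).unique hx (hxy ▸ hy)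
  exact Prod.ext hxy (by omega)

theorem State.exists_mem (h : State K S t Q) {x : Fin G.n} (hx : x ∈ G.vertexSet K) :
    ∃ s, (x, s) ∈ Q := by
  obtain ⟨s, hs, -⟩ := h.clique.shift_unique x hx
  exact ⟨s + t, h.mem.1 hs⟩

theorem State.mem_vertexSet (h : State K S t Q) {x : G.SV} (hx : x ∈ Q) : x.1 ∈ G.vertexSet K := by
  rw [h.eq, mem_shift] at hx
  exact h.clique.shift_mem (x.1, x.2 - t) hx

theorem State.exists_fits (h : State K S t Q) {j : Fin G.m} (hj : j ∈ K) :
    ∃ x ∈ Q, ∃ y ∈ Q, Fits (j, false) x y := by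
  obtain ⟨a, ha⟩ := h.exists_mem (ThickEdgeGraph.mem_vertexSet.2 ⟨j, hj, .inl rfl⟩)
  obtain ⟨b, hb⟩ := h.exists_mem (ThickEdgeGraph.mem_vertexSet.2 ⟨j, hj, .inr rfl⟩)
  refine ⟨_, ha, _, hb, ?_⟩
  have := h.active j hj (a - t) (b - t) (h.mem.2 (by simpa)) (h.mem.2 (by simpa))
  simp only [sub_add_cancel] at this
  obtain ⟨_ | _, hβ⟩ := joins_iff.1 this
  · exact hβ
  · exact absurd hβ.1.symm (by simpa [src] using G.loopless j)

theorem State.exists_edge (h : State K S t Q) {x y : G.SV} (hx : x ∈ Q) (hy : y ∈ Q) (hxy : x ≠ y) :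
    ∃ a : G.Half, a.1 ∈ K ∧ Fits a x y := by
  obtain ⟨j, hj, hj'⟩ := h.clique.complete x.1 (h.mem_vertexSet hx) y.1 (h.mem_vertexSet hy)
    (fun he => hxy (h.fst_inj hx hy he))
  obtain ⟨x', hx', y', hy', hf⟩ := h.exists_fits hj
  have h1 : (G.edge j).u = x'.1 := hf.1
  have h2 : (G.edge j).v = y'.1 := hf.2.1
  rcases hj' with ⟨hu, hv⟩ | ⟨hu, hv⟩
  · obtain rfl := h.fst_inj hx hx' (hu.symm.trans h1)
    obtain rfl := h.fst_inj hy hy' (hv.symm.trans h2)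
    exact ⟨_, hj, hf⟩
  · obtain rfl := h.fst_inj hy hx' (hu.symm.trans h1)
    obtain rfl := h.fst_inj hx hy' (hv.symm.trans h2)
    exact ⟨_, hj, hf.flip⟩

theorem State.mem_of_fits (h : State K S t Q) {x y : G.SV} (hx : x ∈ Q) (hy : y ∈ Q) {a : G.Half}
    (hf : Fits a x y) : a.1 ∈ K := by
  obtain ⟨a', ha', hf'⟩ := h.exists_edge hx hy (fun he => hf.ne (congrArg _ he))
  rw [hf.unique hf']; exact ha'

theorem State.edgesOf_eq (h : State K S t Q) : edgesOf Q = K := by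
  ext j
  rw [mem_edgesOf]
  constructor
  · rintro ⟨x, hx, y, hy, β, hf⟩
    exact h.mem_of_fits hx hy hf
  · intro hj
    obtain ⟨x, hx, y, hy, hf⟩ := h.exists_fits hj
    exact ⟨x, hx, y, hy, false, hf⟩

/-- Activity at the time stamp `t + δ`. -/
theorem State.add_mem_activeTimes (h : State K S t Q) {δ : ℤ} : t + δ ∈ G.activeTimes K S ↔
    ∀ x ∈ Q, ∀ y ∈ Q, ∀ a, Fits a x y → ts a ≤ x.2 + δ ∧ δ ≤ rem a x.2 := by
  constructor
  · intro hδ x hx y hy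
    have key : ∀ x ∈ Q, ∀ y ∈ Q, ∀ j, Fits (j, false) x y →
        ts (j, false) ≤ x.2 + δ ∧ δ ≤ rem (j, false) x.2 := by
      intro x hx y hy j hf
      have h1 := h.active j (h.mem_of_fits hx hy hf)
      have h2 := hδ j (h.mem_of_fits hx hy hf) (x.2 - t) (y.2 - t)
        (h.mem.2 (by simpa [show (G.edge j).u = x.1 from hf.1]))
        (h.mem.2 (by simpa [show (G.edge j).v = y.1 from hf.2.1]))
      obtain ⟨_ | _, hβ⟩ := joins_iff.1 h2
      · obtain ⟨-, -, -, h4, h5⟩ := hβ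
        simp only [rem] at *
        constructor <;> omega
      · exact absurd hβ.1.symm (by simpa [src] using G.loopless j)
    rintro ⟨j, _ | _⟩ hf
    · exact key x hx y hy j hf
    · have hr := hf.rem_flip
      have := key y hy x hx j hf.flip
      have h3 := hf.2.2.1
      simp only [flip, Bool.not_true] at hr
      have h4 : ts (j, false) = td (j, true) := rfl
      rw [← hr]
      exact ⟨by omega, this.2⟩
  · intro hall j hj a b ha hb
    obtain ⟨x, hx, y, hy, hf⟩ := h.exists_fits hj
    obtain rfl := h.fst_inj hx (h.mem.1 ha) hf.1.symm
    obtain rfl := h.fst_inj hy (h.mem.1 hb) hf.2.1.symm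
    have h1 := hall _ hx _ hy _ hf
    obtain ⟨h2, h3, h4, h5, h6⟩ := hf
    refine joins_iff.2 ⟨false, h2, h3, ?_, ?_, ?_⟩ <;> simp only [rem] at * <;> omega

/-- An edge that starts at `Q` forbids earlier time stamps, an edge of least remaining length
forbids those after `t + b`, and nothing else interferes. -/
theorem State.activeTimes_eq (h : State K S t Q) {b : ℤ} (hb : (bm : ℤ) ≤ b)
    (hcl : ∀ x ∈ Q, ∀ y ∈ Q, x ≠ y → b ≤ R bm x y)
    (hat : ∃ x ∈ Q, ∃ y ∈ Q, x ≠ y ∧ R bm x y = b) (hst : ∃ x ∈ Q, ∃ y ∈ Q, Start x y) :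
    G.activeTimes K S = Set.Icc t (t + b) := by
  ext t'
  obtain ⟨δ, rfl⟩ : ∃ δ, t' = t + δ := ⟨t' - t, by ring⟩
  rw [h.add_mem_activeTimes]
  constructor
  · intro hall
    obtain ⟨x, hx, y, hy, a, ha, hs⟩ := hst
    obtain ⟨x', hx', y', hy', -, hR⟩ := hat
    obtain ⟨a', ha', -, hr⟩ := exists_fits_of_R_nonneg (bm := bm) (x := x') (y := y') (by omega)
    have h1 := hall x hx y hy a ha
    have h2 := hall x' hx' y' hy' a' ha'
    constructor <;> omega
  · rintro ⟨h1, h2⟩ x hx y hy a ha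
    obtain ⟨a', ha', hr⟩ := (le_R_iff hb).1 (hcl x hx y hy (fun he => ha.ne (congrArg _ he)))
    obtain rfl := ha.unique ha'
    have := ha.2.2.2.1
    constructor <;> omega

/-- A new edge cannot join two members of `Q`, as these are already joined by an edge of `K`. So a
larger clique has a new super-vertex `z`, and the member of `Q` with remaining length below `b` to
`z` excludes the time stamp `t + b`. -/
theorem State.closed_of (h : State K S t Q) {b : ℤ} (hb : (bm : ℤ) ≤ b)
    (hτ : G.activeTimes K S = Set.Icc t (t + b)) (hcl : ∀ y, y ∉ Q → ∃ x ∈ Q, R bm x y < b)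
    (K' : Finset (Fin G.m)) (S' : Finset (Fin G.n × ℤ)) (hK' : G.IsShiftedClique K' S')
    (hKK : K ⊂ K') (hSS : S ⊆ S') : G.activeTimes K' S' ≠ G.activeTimes K S := by
  intro he
  rw [hτ] at he
  have hb0 : 0 ≤ b := by omega
  have h' : State K' S' t (shift t S') := ⟨hK', by rw [he]; simp [hb0], rfl⟩
  have hsub : ∀ x ∈ Q, x ∈ shift t S' := fun x hx => by
    rw [h.eq, mem_shift] at hx
    exact mem_shift.2 (hSS hx)
  obtain ⟨j, hj, hjK⟩ := Finset.exists_of_ssubset hKK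
  obtain ⟨x, hx, y, hy, hf⟩ := h'.exists_fits hj
  obtain ⟨z, hz, hzQ⟩ : ∃ z ∈ shift t S', z ∉ Q := by
    by_contra! hcon
    exact hjK (h.mem_of_fits (hcon x hx) (hcon y hy) hf)
  obtain ⟨q, hq, hqz⟩ := hcl z hzQ
  obtain ⟨a, -, hfa⟩ := h'.exists_edge (hsub q hq) hz (fun hh => hzQ (hh ▸ hq))
  have hmem : t + b ∈ G.activeTimes K' S' := by rw [he]; simp [hb0]
  exact absurd ((le_R_iff hb).2 ⟨a, hfa, (h'.add_mem_activeTimes.1 hmem _ (hsub q hq) _ hz a hfa).2⟩)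
    (not_le.2 hqz)

/-- Otherwise `y`, together with its edges to `Q`, could be added to the clique. These edges are
active on all of `[t, t + b]`, so the active set would not change. -/
theorem State.exists_lt_of_closed (h : State K S t Q) {b : ℤ} (hb : (bm : ℤ) ≤ b)
    (hτ : G.activeTimes K S = Set.Icc t (t + b))
    (hcl : ∀ (K' : Finset (Fin G.m)) (S' : Finset (Fin G.n × ℤ)), G.IsShiftedClique K' S' →
      K ⊂ K' → S ⊆ S' → G.activeTimes K' S' ≠ G.activeTimes K S)
    (y : G.SV) (_ : y ∉ Q) : ∃ x ∈ Q, R bm x y < b := by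
  classical
  by_contra! hall
  have hfit : ∀ x ∈ Q, ∃ a, Fits a x y ∧ b ≤ rem a x.2 := fun x hx => (le_R_iff hb).1 (hall x hx)
  have hne : ∀ x ∈ Q, x.1 ≠ y.1 := fun x hx => by
    obtain ⟨a, ha, -⟩ := hfit x hx; exact ha.ne
  -- The vertex of `y` is really new: any of its occurrences in `Q` would be joined to `y` by a
  -- loop.
  have hyK : y.1 ∉ G.vertexSet K := fun hyK => by
    obtain ⟨s, hs⟩ := h.exists_mem hyK; exact hne _ hs rfl
  set K' := K ∪ Finset.univ.filter (fun j => ∃ x ∈ Q, ∃ β, Fits (j, β) x y) with hK'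
  set S' := insert (y.1, y.2 - t) S with hS'
  have hmK' : ∀ j, j ∈ K' ↔ j ∈ K ∨ ∃ x ∈ Q, ∃ β, Fits (j, β) x y := by simp [hK']
  obtain ⟨j0, hj0⟩ := h.clique.nonempty
  obtain ⟨x0, hx0, -⟩ := h.exists_fits hj0
  have hverts : ∀ x, x ∈ G.vertexSet K' ↔ x ∈ G.vertexSet K ∨ x = y.1 := by
    intro x
    constructor
    · intro hx
      obtain ⟨j, hj, hjx⟩ := ThickEdgeGraph.mem_vertexSet.1 hx
      rcases (hmK' j).1 hj with hj | ⟨z, hz, β, hf⟩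
      · exact .inl (ThickEdgeGraph.mem_vertexSet.2 ⟨j, hj, hjx⟩)
      · have h1 := hf.1
        have h2 := hf.2.1
        cases β <;> simp only [src, dst, Bool.false_eq_true, if_false, if_true] at h1 h2 <;>
          rcases hjx with rfl | rfl
        · exact .inl (h1 ▸ h.mem_vertexSet hz)
        · exact .inr h2
        · exact .inr h2
        · exact .inl (h1 ▸ h.mem_vertexSet hz)
    · rintro (hx | rfl)
      · obtain ⟨j, hj, hjx⟩ := ThickEdgeGraph.mem_vertexSet.1 hx
        exact ThickEdgeGraph.mem_vertexSet.2 ⟨j, (hmK' j).2 (.inl hj), hjx⟩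
      · obtain ⟨⟨j, β⟩, ha, -⟩ := hfit x0 hx0
        refine ThickEdgeGraph.mem_vertexSet.2 ⟨j, (hmK' j).2 (.inr ⟨x0, hx0, β, ha⟩), ?_⟩
        have h2 := ha.2.1
        cases β
        · exact .inr h2
        · exact .inl h2
  have hedge : ∀ x ∈ G.vertexSet K, ∃ j ∈ K', ((G.edge j).u = x ∧ (G.edge j).v = y.1) ∨
      ((G.edge j).u = y.1 ∧ (G.edge j).v = x) := by
    intro x hx
    obtain ⟨s, hs⟩ := h.exists_mem hx
    obtain ⟨⟨j, β⟩, ha, -⟩ := hfit _ hs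
    refine ⟨j, (hmK' j).2 (.inr ⟨_, hs, β, ha⟩), ?_⟩
    cases β
    · exact .inl ⟨ha.1, ha.2.1⟩
    · exact .inr ⟨ha.2.1, ha.1⟩
  have hcl' : G.IsShiftedClique K' S' := by
    refine ⟨⟨j0, (hmK' j0).2 (.inl hj0)⟩, ?_, ?_, ?_⟩
    · intro x hx z hz hxz
      rcases (hverts x).1 hx with hx | rfl <;> rcases (hverts z).1 hz with hz | rfl
      · obtain ⟨j, hj, h1⟩ := h.clique.complete x hx z hz hxz
        exact ⟨j, (hmK' j).2 (.inl hj), h1⟩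
      · exact hedge x hx
      · obtain ⟨j, hj, h1⟩ := hedge z hz
        exact ⟨j, hj, h1.symm⟩
      · exact absurd rfl hxz
    · intro p hp
      rcases Finset.mem_insert.1 hp with rfl | hp
      · exact (hverts _).2 (.inr rfl)
      · exact (hverts _).2 (.inl (h.clique.shift_mem p hp))
    · intro x hx
      rcases (hverts x).1 hx with hx | rfl
      · obtain ⟨s, hs, hu⟩ := h.clique.shift_unique x hx
        refine ⟨s, Finset.mem_insert_of_mem hs, fun s' hs' => ?_⟩
        rcases Finset.mem_insert.1 hs' with he | hs'
        · exact absurd (congrArg Prod.fst he) (fun he => hyK (he ▸ hx))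
        · exact hu s' hs'
      · refine ⟨y.2 - t, Finset.mem_insert_self _ _, fun s' hs' => ?_⟩
        rcases Finset.mem_insert.1 hs' with he | hs'
        · exact congrArg Prod.snd he
        · exact absurd (h.clique.shift_mem _ hs') hyK
  have hQ' : shift t S' = insert y Q := by
    ext x
    rw [mem_shift, hS', Finset.mem_insert, Finset.mem_insert, h.eq, mem_shift]
    refine or_congr_left ?_
    rw [Prod.ext_iff, Prod.ext_iff]
    simp
  have hactive : ∀ j ∈ K', ∀ c d : ℤ, ((G.edge j).u, c) ∈ S' → ((G.edge j).v, d) ∈ S' →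
      ∀ δ, 0 ≤ δ → δ ≤ b →
      (G.edge j).Joins ((G.edge j).u, c + (t + δ)) ((G.edge j).v, d + (t + δ)) := by
    intro j hj c d hc hd δ h0 hδ
    have hτδ : t + δ ∈ G.activeTimes K S := by rw [hτ]; constructor <;> omega
    have hKe : ∀ x s, x ∈ G.vertexSet K → (x, s) ∈ S' → (x, s) ∈ S := by
      intro x s hx hs
      rcases Finset.mem_insert.1 hs with he | hs
      · exact absurd (congrArg Prod.fst he) (fun he => hyK (he ▸ hx))
      · exact hs
    rcases (hmK' j).1 hj with hj | ⟨x, hx, β, hf⟩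
    · exact hτδ j hj c d (hKe _ _ (ThickEdgeGraph.mem_vertexSet.2 ⟨j, hj, .inl rfl⟩) hc)
        (hKe _ _ (ThickEdgeGraph.mem_vertexSet.2 ⟨j, hj, .inr rfl⟩) hd)
    · obtain ⟨a', ha', hr⟩ := hfit x hx
      obtain rfl := hf.unique ha'
      have hyS : ∀ s, (y.1, s) ∈ S' → s = y.2 - t := by
        intro s hs
        rcases Finset.mem_insert.1 hs with he | hs
        · exact congrArg Prod.snd he
        · exact absurd (h.clique.shift_mem _ hs) hyK
      have hxS : ∀ s, (x.1, s) ∈ S' → s = x.2 - t := by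
        intro s hs
        have := h.mem.1 (hKe _ _ (h.mem_vertexSet hx) hs)
        have := h.fst_inj this hx rfl
        have := congrArg Prod.snd this
        dsimp only at this
        omega
      have hshift : Fits (j, β) (x.1, x.2 + δ) (y.1, y.2 + δ) := by
        obtain ⟨h1, h2, h3, h4, h5⟩ := hf
        refine ⟨h1, h2, ?_, ?_, ?_⟩ <;> simp only [rem] at * <;> omega
      have h1 := hf.1
      have h2 := hf.2.1
      cases β <;> simp only [src, dst, Bool.false_eq_true, if_false, if_true] at h1 h2
      · rw [h1] at hc ⊢
        rw [h2] at hd ⊢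
        rw [hxS c hc, hyS d hd, show x.2 - t + (t + δ) = x.2 + δ by ring,
          show y.2 - t + (t + δ) = y.2 + δ by ring]
        exact hshift.joins
      · rw [h1] at hd ⊢
        rw [h2] at hc ⊢
        rw [hxS d hd, hyS c hc, show x.2 - t + (t + δ) = x.2 + δ by ring,
          show y.2 - t + (t + δ) = y.2 + δ by ring]
        exact hshift.flip.joins
  refine hcl K' S' hcl' ?_ (Finset.subset_insert _ _) ?_
  · rw [Finset.ssubset_iff_of_subset Finset.subset_union_left]
    obtain ⟨⟨j, β⟩, ha, -⟩ := hfit x0 hx0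
    refine ⟨j, (hmK' j).2 (.inr ⟨x0, hx0, β, ha⟩), fun hjK => hyK ?_⟩
    have h2 := ha.2.1
    refine ThickEdgeGraph.mem_vertexSet.2 ⟨j, hjK, ?_⟩
    cases β
    · exact .inr h2
    · exact .inl h2
  · apply Set.Subset.antisymm
    · intro t' ht' j hj c d hc hd
      exact ht' j ((hmK' j).2 (.inl hj)) c d (Finset.mem_insert_of_mem hc)
        (Finset.mem_insert_of_mem hd)
    · intro t' ht' j hj c d hc hd
      rw [hτ] at ht'
      have := hactive j hj c d hc hd (t' - t) (by linarith [ht'.1]) (by linarith [ht'.2])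
      simpa using this

end State

theorem Sol.state {Q : Finset G.SV} {b : ℤ} (h : Sol bm Q b) :
    State (edgesOf Q) (shift (-base Q) Q) (base Q) Q := by
  have hb0 : 0 ≤ b := (Int.natCast_nonneg bm).trans h.bm_le
  have hinj := fst_injOn_of_clique fun x hx y hy hxy => hb0.trans (h.clique x hx y hy hxy)
  have hfit : ∀ x ∈ Q, ∀ y ∈ Q, x ≠ y → ∃ a, Fits a x y := fun x hx y hy hxy => by
    obtain ⟨a, ha, -⟩ := (le_R_iff h.bm_le).1 (h.clique x hx y hy hxy)
    exact ⟨a, ha⟩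
  have hverts : ∀ v, v ∈ G.vertexSet (edgesOf Q) ↔ ∃ s, (v, s) ∈ Q := by
    intro v
    rw [mem_vertexSet]
    constructor
    · rintro ⟨j, hj, hv⟩
      obtain ⟨x, hx, y, hy, β, hf⟩ := mem_edgesOf.1 hj
      have h1 := hf.1
      have h2 := hf.2.1
      cases β <;> simp only [src, dst, Bool.false_eq_true, if_false, if_true] at h1 h2 <;>
        rcases hv with rfl | rfl
      · exact ⟨x.2, h1 ▸ hx⟩
      · exact ⟨y.2, h2 ▸ hy⟩
      · exact ⟨y.2, h2 ▸ hy⟩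
      · exact ⟨x.2, h1 ▸ hx⟩
    · rintro ⟨s, hs⟩
      obtain ⟨p, hp, q, hq, hpq, -⟩ := h.attained
      obtain ⟨y, hy, hne⟩ : ∃ y ∈ Q, (v, s) ≠ y := by
        by_cases hvp : (v, s) = p
        · exact ⟨q, hq, hvp ▸ hpq⟩
        · exact ⟨p, hp, hvp⟩
      obtain ⟨⟨j, β⟩, hf⟩ := hfit _ hs y hy hne
      refine ⟨j, mem_edgesOf.2 ⟨_, hs, y, hy, β, hf⟩, ?_⟩
      have h1 := hf.1
      cases β
      · exact .inl h1
      · exact .inr h1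
  have hmem : ∀ v s, (v, s) ∈ shift (-base Q) Q ↔ (v, s + base Q) ∈ Q := by
    intro v s; rw [mem_shift]; simp
  refine ⟨⟨?_, ?_, ?_, ?_⟩, ?_, ?_⟩
  · obtain ⟨p, hp, q, hq, hpq, -⟩ := h.attained
    obtain ⟨⟨j, β⟩, hf⟩ := hfit p hp q hq hpq
    exact ⟨j, mem_edgesOf.2 ⟨p, hp, q, hq, β, hf⟩⟩
  · intro x hx y hy hxy
    obtain ⟨s, hs⟩ := (hverts x).1 hx
    obtain ⟨s', hs'⟩ := (hverts y).1 hy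
    obtain ⟨⟨j, β⟩, hf⟩ := hfit _ hs _ hs' (fun he => hxy (congrArg Prod.fst he))
    refine ⟨j, mem_edgesOf.2 ⟨_, hs, _, hs', β, hf⟩, ?_⟩
    have h1 := hf.1
    have h2 := hf.2.1
    cases β
    · exact .inl ⟨h1, h2⟩
    · exact .inr ⟨h2, h1⟩
  · rintro ⟨v, s⟩ hp
    exact (hverts v).2 ⟨_, (hmem v s).1 hp⟩
  · intro v hv
    obtain ⟨s, hs⟩ := (hverts v).1 hv
    refine ⟨s - base Q, (hmem _ _).2 (by simpa), fun s' hs' => ?_⟩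
    have := congrArg Prod.snd (hinj ((hmem _ _).1 hs') hs rfl)
    dsimp only at this
    omega
  · intro j hj c d hc hd
    obtain ⟨x, hx, y, hy, β, hf⟩ := mem_edgesOf.1 hj
    have hc := (hmem _ _).1 hc
    have hd := (hmem _ _).1 hd
    have h1 := hf.1
    have h2 := hf.2.1
    cases β <;> simp only [src, dst, Bool.false_eq_true, if_false, if_true] at h1 h2
    · obtain rfl := hinj hc hx h1
      obtain rfl := hinj hd hy h2
      exact hf.joins
    · obtain rfl := hinj hd hx h1
      obtain rfl := hinj hc hy h2
      exact hf.flip.joins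
  · rw [shift_shift, add_neg_cancel, shift_zero]

theorem Sol.activeTimes_eq {Q : Finset G.SV} {b : ℤ} (h : Sol bm Q b) :
    G.activeTimes (cliqueOf Q).1 (cliqueOf Q).2 = Set.Icc (base Q) (base Q + b) :=
  h.state.activeTimes_eq h.bm_le h.clique h.attained h.start

theorem Sol.nonempty {Q : Finset G.SV} {b : ℤ} (h : Sol bm Q b) : Q.Nonempty := by
  obtain ⟨x, hx, -⟩ := h.start; exact ⟨x, hx⟩

theorem ncard_Icc_int (a b : ℤ) : (Set.Icc a b).ncard = (b + 1 - a).toNat := by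
  rw [← Finset.coe_Icc, Set.ncard_coe_finset, Int.card_Icc]

/-- A remaining length `b` means `b + 1` active time stamps, hence the threshold `σ - 1`. For `σ =
0` the truncated subtraction does no harm, since active sets are non-empty anyway. -/
theorem Sol.cliqueOf_mem {σ : ℕ} {Q : Finset G.SV} {b : ℤ} (h : Sol (σ - 1) Q b) :
    cliqueOf Q ∈ G.longClosedActiveCliques σ := by
  have hb := h.bm_le
  refine ⟨⟨h.state.clique, ⟨_, h.state.active⟩, ?_⟩, ⟨?_, ?_⟩, ?_⟩
  · exact h.state.closed_of h.bm_le h.activeTimes_eq h.closed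
  · intro p hp
    have := (base_spec h.nonempty).2 _ (mem_shift.1 hp)
    dsimp only at this
    omega
  · obtain ⟨x, hx, he⟩ := (base_spec h.nonempty).1
    exact ⟨(x.1, x.2 - base Q), mem_shift.2 (by simpa), by simp [he]⟩
  · rw [h.activeTimes_eq, ncard_Icc_int]
    omega

/-- The normalization is undone by the active set: its least element is the `base` by which `Q` was
translated. -/
theorem Sol.cliqueOf_inj {Q Q' : Finset G.SV} {b b' : ℤ} (h : Sol bm Q b) (h' : Sol bm Q' b')
    (he : cliqueOf Q = cliqueOf Q') : Q = Q' := by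
  have h1 := h.activeTimes_eq
  rw [he, h'.activeTimes_eq] at h1
  have hb0 : 0 ≤ b := (Int.natCast_nonneg bm).trans h.bm_le
  have hb0' : 0 ≤ b' := (Int.natCast_nonneg bm).trans h'.bm_le
  have h2 : base Q ∈ Set.Icc (base Q') (base Q' + b') := by rw [h1]; simp [hb0]
  have h3 : base Q' ∈ Set.Icc (base Q) (base Q + b) := by rw [← h1]; simp [hb0']
  have h4 : base Q = base Q' := le_antisymm h3.1 h2.1
  rw [h.state.eq, h'.state.eq, ← h4]
  have := congrArg Prod.snd he
  simp only [cliqueOf] at this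
  rw [this, h4]

/-- Starting from any active time stamp, one goes back to the first one, which is as early as the
most recently started edge permits. The clique is a `Sol` there. -/
theorem exists_sol {σ : ℕ} {d : Finset (Fin G.m) × Finset (Fin G.n × ℤ)}
    (hd : d ∈ G.longClosedActiveCliques σ) : ∃ Q b, Sol (σ - 1) Q b ∧ cliqueOf Q = d := by
  obtain ⟨K, S⟩ := d
  obtain ⟨⟨hcl, ⟨t1, ht1⟩, hclosed⟩, ⟨hn1, hn2⟩, hσ⟩ := hd
  dsimp only at *
  have h1 : State K S t1 (shift t1 S) := ⟨hcl, ht1, rfl⟩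
  -- the elapsed and the remaining lengths of the edges at the time stamp `t1`
  have hex : ∀ j ∈ K, ∃ x ∈ shift t1 S, ∃ y ∈ shift t1 S, Fits (j, false) x y :=
    fun j hj => h1.exists_fits hj
  obtain ⟨j0, hj0⟩ := hcl.nonempty
  have : Nonempty G.SV := ⟨(hex j0 hj0).choose⟩
  choose! X hX Y hY hf using hex
  obtain ⟨i, hi, hmin⟩ := Finset.exists_min_image K (fun j => (X j).2 - ts (j, false)) hcl.nonempty
  obtain ⟨l, hl, hmin'⟩ := Finset.exists_min_image K (fun j => rem (j, false) (X j).2) hcl.nonempty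
  set e := (X i).2 - ts (i, false) with he
  set f := rem (l, false) (X l).2 with hfdef
  -- Of all edges only two count: the one with least elapsed length `e` limits how far one can go
  -- back, the one with least remaining length `f` how far one can go on.
  have hrange : ∀ δ, t1 + δ ∈ G.activeTimes K S ↔ -e ≤ δ ∧ δ ≤ f := by
    intro δ
    rw [h1.add_mem_activeTimes]
    constructor
    · intro h
      have h2 := h _ (hX i hi) _ (hY i hi) _ (hf i hi)
      have h3 := h _ (hX l hl) _ (hY l hl) _ (hf l hl)
      exact ⟨by omega, h3.2⟩
    · rintro ⟨h2, h3⟩ x hx y hy ⟨j, β⟩ hfit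
      have hj := h1.mem_of_fits hx hy hfit
      have h4 := hmin j hj
      have h5 := hmin' j hj
      have h6 := hf j hj
      cases β
      · obtain rfl := h1.fst_inj hx (hX j hj) (hfit.1.symm.trans h6.1)
        constructor <;> omega
      · obtain rfl := h1.fst_inj hx (hY j hj) (hfit.1.symm.trans h6.2.1)
        obtain rfl := h1.fst_inj hy (hX j hj) (hfit.2.1.symm.trans h6.1)
        have h7 := hfit.rem_flip
        have h8 := h6.2.2.1
        have h9 : ts (j, true) = td (j, false) := rfl
        simp only [flip, Bool.not_true] at h7
        constructor <;> omega
  set t0 := t1 - e with ht0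
  have h0 : State K S t0 (shift t0 S) := by
    refine ⟨hcl, ?_, rfl⟩
    have := (hrange (-e)).2 ⟨le_rfl, ?_⟩
    · rwa [← sub_eq_add_neg] at this
    · have h2 := (hf i hi).2.2.2.1
      have h3 := (hf l hl).rem_nonneg
      omega
  have hτ : G.activeTimes K S = Set.Icc t0 (t0 + (e + f)) := by
    ext t'
    obtain ⟨δ, rfl⟩ : ∃ δ, t' = t1 + δ := ⟨t' - t1, by ring⟩
    rw [hrange, Set.mem_Icc]
    constructor <;> rintro ⟨h2, h3⟩ <;> constructor <;> omega
  have hσ' : ((σ - 1 : ℕ) : ℤ) ≤ e + f := by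
    rw [hτ, ncard_Icc_int] at hσ
    have h2 := (hf i hi).2.2.2.1
    have h3 := (hf l hl).rem_nonneg
    omega
  -- edges at the first time stamp
  have hmv : ∀ x, x ∈ shift t1 S → (x.1, x.2 - e) ∈ shift t0 S := by
    intro x hx
    rw [mem_shift] at hx ⊢
    convert hx using 2
    ring
  have hf0 : ∀ j (hj : j ∈ K), Fits (j, false) ((X j).1, (X j).2 - e) ((Y j).1, (Y j).2 - e) := by
    intro j hj
    obtain ⟨h2, h3, h4, h5, h6⟩ := hf j hj
    have h7 := hmin j hj
    have h8 := (hf i hi).2.2.2.1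
    refine ⟨h2, h3, ?_, ?_, ?_⟩ <;> dsimp only <;> omega
  have hrem : ∀ x ∈ shift t0 S, ∀ y ∈ shift t0 S, x ≠ y → e + f ≤ R (σ - 1) x y := by
    intro x hx y hy hxy
    rw [le_R_iff hσ']
    obtain ⟨a, -, ha⟩ := h0.exists_edge hx hy hxy
    refine ⟨a, ha, (h0.add_mem_activeTimes.1 ?_ x hx y hy a ha).2⟩
    rw [hτ, Set.mem_Icc]
    omega
  refine ⟨shift t0 S, e + f, ⟨hrem, hσ', ?_, ?_, ?_⟩, ?_⟩
  · refine ⟨_, hmv _ (hX l hl), _, hmv _ (hY l hl), fun he => (hf0 l hl).ne (congrArg _ he), ?_⟩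
    have h2 : rem (l, false) ((X l).2 - e) = e + f := by simp only [rem] at *; omega
    have h3 := (hf0 l hl).rem_le
    rw [R_of_fits (hf0 l hl) (by dsimp only at h3; omega)]
    exact h2
  · refine ⟨_, hmv _ (hX i hi), _, hmv _ (hY i hi), _, hf0 i hi, ?_⟩
    dsimp only; omega
  · exact h0.exists_lt_of_closed hσ' hτ hclosed
  -- Since the shifts are normalized, the least time stamp of the state at `t0` is `t0` itself.
  · have hbase : base (shift t0 S) = t0 := by
      apply base_eq
      · obtain ⟨p, hp, hp0⟩ := hn2
        exact ⟨(p.1, p.2 + t0), mem_shift.2 (by simpa), by simp [hp0]⟩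
      · intro x hx
        have := hn1 _ (mem_shift.1 hx)
        dsimp only at this
        omega
    rw [cliqueOf, h0.edgesOf_eq, hbase, shift_shift, neg_add_cancel, shift_zero]

end ThickEdgeGraph

/-! ### Anchors -/

namespace ThickEdgeGraph

variable {G : ThickEdgeGraph} {bm : ℕ}

/-- The super-vertex at which `a` arrives when it leaves at the time stamp `T`. -/
def far (T : ℤ) (a : G.Half) : G.SV := (dst a, td a + T - ts a)

/-- The half-edges of `u` that start at `T`. -/
def starting (bm : ℕ) (u : Fin G.n) (T : ℤ) : List G.Half :=
  (G.adj bm u).filter fun a => ts a = T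

/-- The half-edges of `u` that are active at `T` and started before. -/
def ongoing (bm : ℕ) (u : Fin G.n) (T : ℤ) : List G.Half :=
  (G.adj bm u).filter fun a => ts a < T ∧ T ≤ ts a + len a

/-- The super-vertex `(u, T)` and its neighbours, first those by edges that start at `T`. -/
def localList (bm : ℕ) (u : Fin G.n) (T : ℤ) : List G.SV :=
  (u, T) :: ((starting bm u T).map (far T) ++ (ongoing bm u T).map (far T))

/-- The default `(u, T)` beyond the list makes the map total with values in the local list, so
bounds on time stamps and degrees hold for all indices. -/
def sv (bm : ℕ) (u : Fin G.n) (T : ℤ) (x : ℕ) : G.SV := (localList bm u T).getD x (u, T)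

variable {u : Fin G.n} {T : ℤ}

@[simp] theorem sv_zero : sv bm u T 0 = (u, T) := rfl

theorem mem_starting {a : G.Half} : a ∈ starting bm u T ↔ a ∈ G.adj bm u ∧ ts a = T := by
  simp [starting]

theorem fits_far_of_starting {a : G.Half} (h : a ∈ starting bm u T) : Fits a (u, T) (far T a) := by
  obtain ⟨h1, h2⟩ := mem_starting.1 h
  have := len_nonneg a
  exact ⟨(mem_adj.1 h1).1, rfl, rfl, h2.le, by dsimp only; omega⟩

theorem fits_far_of_ongoing {a : G.Half} (h : a ∈ ongoing bm u T) : Fits a (u, T) (far T a) := by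
  simp only [ongoing, List.mem_filter, decide_eq_true_eq] at h
  exact ⟨(mem_adj.1 h.1).1, rfl, rfl, h.2.1.le, h.2.2⟩

theorem mem_localList {y : G.SV} :
    y ∈ localList bm u T ↔ y = (u, T) ∨ ∃ a ∈ G.adj bm u, Fits a (u, T) y := by
  simp only [localList, List.mem_cons, List.mem_append, List.mem_map]
  refine or_congr_right ⟨?_, ?_⟩
  · rintro (⟨a, ha, rfl⟩ | ⟨a, ha, rfl⟩)
    · exact ⟨a, (mem_starting.1 ha).1, fits_far_of_starting ha⟩
    · exact ⟨a, (List.mem_filter.1 ha).1, fits_far_of_ongoing ha⟩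
  · rintro ⟨a, ha, hf⟩
    obtain ⟨h1, h2, h3, h4, h5⟩ := hf
    have hfar : far T a = y := Prod.ext h2 h3
    rcases eq_or_lt_of_le h4 with h4 | h4
    · exact .inl ⟨a, mem_starting.2 ⟨ha, h4⟩, hfar⟩
    · exact .inr ⟨a, by simpa [ongoing, ha] using ⟨h4, h5⟩, hfar⟩

theorem nodup_localList : (localList (G := G) bm u T).Nodup := by
  have hinj : ∀ a a' : G.Half, Fits a (u, T) (far T a) → Fits a' (u, T) (far T a') →
      far T a = far T a' → a = a' := fun a a' h h' he => h.unique (he ▸ h')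
  refine List.nodup_cons.2 ⟨?_, ?_⟩
  · rw [List.mem_append, List.mem_map, List.mem_map]
    rintro (⟨a, ha, he⟩ | ⟨a, ha, he⟩)
    · exact (fits_far_of_starting ha).ne (by rw [he])
    · exact (fits_far_of_ongoing ha).ne (by rw [he])
  · refine List.Nodup.append ?_ ?_ ?_
    · exact List.Nodup.map_on (fun a ha a' ha' he => hinj a a' (fits_far_of_starting ha)
        (fits_far_of_starting ha') he) ((nodup_adj u).filter _)
    · exact List.Nodup.map_on (fun a ha a' ha' he => hinj a a' (fits_far_of_ongoing ha)
        (fits_far_of_ongoing ha') he) ((nodup_adj u).filter _)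
    · intro y hy hy'
      obtain ⟨a, ha, rfl⟩ := List.mem_map.1 hy
      obtain ⟨a', ha', he⟩ := List.mem_map.1 hy'
      obtain rfl := hinj a' a (fits_far_of_ongoing ha') (fits_far_of_starting ha) he
      have h1 := (mem_starting.1 ha).2
      simp only [ongoing, List.mem_filter, decide_eq_true_eq] at ha'
      omega

theorem sv_eq_getElem {x : ℕ} (hx : x < (localList bm u T).length) :
    sv bm u T x = (localList bm u T)[x] := List.getD_eq_getElem _ _ hx

theorem sv_mem (x : ℕ) : sv bm u T x ∈ localList bm u T := by
  by_cases hx : x < (localList bm u T).length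
  · rw [sv_eq_getElem hx]; exact List.getElem_mem hx
  · rw [sv, List.getD_eq_default _ _ (not_lt.1 hx)]
    exact mem_localList.2 (.inl rfl)

theorem exists_sv {y : G.SV} (hy : y ∈ localList bm u T) :
    ∃ x < (localList bm u T).length, sv bm u T x = y := by
  obtain ⟨x, hx, rfl⟩ := List.getElem_of_mem hy
  exact ⟨x, hx, sv_eq_getElem hx⟩

theorem sv_inj {x y : ℕ} (hx : x < (localList bm u T).length) (hy : y < (localList bm u T).length)
    (h : sv bm u T x = sv bm u T y) : x = y := by
  rw [sv_eq_getElem hx, sv_eq_getElem hy] at h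
  exact (nodup_localList.getElem_inj_iff).1 h

theorem sv_starting {x : ℕ} (h1 : 1 ≤ x) (h2 : x ≤ (starting bm u T).length) :
    ∃ a ∈ starting bm u T, sv bm u T x = far T a := by
  obtain ⟨x, rfl⟩ := Nat.exists_eq_add_of_le' h1
  have hx : x < (starting bm u T).length := h2
  refine ⟨(starting bm u T)[x], List.getElem_mem _, ?_⟩
  rw [sv, localList, List.getD_cons_succ, List.getD_append _ _ _ _ (by simpa), List.getD_eq_getElem _ _ (by simpa),
    List.getElem_map]

theorem exists_sv_of_starting {a : G.Half} (ha : a ∈ starting bm u T) :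
    ∃ x, 1 ≤ x ∧ x ≤ (starting bm u T).length ∧ sv bm u T x = far T a := by
  obtain ⟨x, hx, rfl⟩ := List.getElem_of_mem ha
  refine ⟨x + 1, by omega, hx, ?_⟩
  rw [sv, localList, List.getD_cons_succ, List.getD_append _ _ _ _ (by simpa), List.getD_eq_getElem _ _ (by simpa),
    List.getElem_map]

theorem length_localList_le :
    (localList bm u T).length ≤ (G.adj bm u).length + 1 := by
  simp only [localList, List.length_cons, List.length_append, List.length_map, starting, ongoing]
  have : ∀ l : List G.Half, (l.filter fun a => ts a = T).length +
      (l.filter fun a => ts a < T ∧ T ≤ ts a + len a).length ≤ l.length := by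
    intro l
    induction l with
    | nil => simp
    | cons a l ih =>
      by_cases h1 : ts a = T
      · have h2 : ¬ (ts a < T ∧ T ≤ ts a + len a) := by omega
        rw [List.filter_cons_of_pos (by simpa), List.filter_cons_of_neg (by simpa using h2)]
        simp only [List.length_cons]; omega
      · rw [List.filter_cons_of_neg (by simpa), List.filter_cons]
        split <;> simp only [List.length_cons] <;> omega
  have := this (G.adj bm u)
  omega

/-- The weighted graph of the super-vertices around `(u, T)`. -/
def localGraph (bm : ℕ) (u : Fin G.n) (T : ℤ) (h : starting bm u T ≠ []) : LocalGraph where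
  wt x y := R bm (sv bm u T x) (sv bm u T y)
  w := (localList bm u T).length
  r := (starting bm u T).length
  bm := bm
  top := G.tmax
  symm _ _ := R_symm _ _
  lt_top _ _ := R_lt_top _ _
  bm_nonneg := Int.natCast_nonneg _
  r_pos := List.length_pos_iff.2 h
  r_lt := by simp [localList]
  -- An edge that starts at `T` has its full length left, and only edges of length at least `bm` are
  -- in the adjacency lists.
  bm_le_wt x h1 h2 := by
    obtain ⟨a, ha, hx⟩ := sv_starting h1 h2
    obtain ⟨h3, h4⟩ := mem_starting.1 ha
    rw [sv_zero, hx, R_of_fits (fits_far_of_starting ha) (mem_adj.1 h3).2, rem]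
    have := (mem_adj.1 h3).2
    dsimp only
    omega

/-- `Q` contains `(u, T)` and a neighbour of it by an edge that starts at `T`. -/
def Anchored (Q : Finset G.SV) (u : Fin G.n) (T : ℤ) : Prop :=
  (u, T) ∈ Q ∧ ∃ y ∈ Q, Start (u, T) y

/-- At the last level the alternative `i ≤ r` in `Node.meets` is impossible, so a neighbour by a
starting edge is present. Closedness within the local list is closedness among all super-vertices,
because whatever lies outside is not joined to `(u, T)`. -/
theorem sol_of_node {h : starting bm u T ≠ []} {F : Finset ℕ} {b : ℤ}
    (hF : (localGraph bm u T h).Node (localGraph bm u T h).w F b) :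
    Sol bm (F.image (sv bm u T)) b ∧ Anchored (F.image (sv bm u T)) u T := by
  have hw : (localGraph bm u T h).w = (localList bm u T).length := rfl
  have hlt : ∀ x ∈ F, x < (localList bm u T).length := hF.lt
  obtain ⟨x, hx, hx1, hx2⟩ : (localGraph bm u T h).Meets F :=
    hF.meets.resolve_right (not_le.2 (localGraph bm u T h).r_lt)
  obtain ⟨a, ha, hxa⟩ := sv_starting hx1 hx2
  have hst : Start (u, T) (sv bm u T x) :=
    ⟨a, hxa ▸ fits_far_of_starting ha, (mem_starting.1 ha).2⟩
  have h0 : (u, T) ∈ F.image (sv bm u T) := Finset.mem_image.2 ⟨0, hF.zero, rfl⟩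
  have hxm : sv bm u T x ∈ F.image (sv bm u T) := Finset.mem_image_of_mem _ hx
  refine ⟨⟨?_, hF.bm_le, ?_, ⟨_, h0, _, hxm, hst⟩, ?_⟩, h0, _, hxm, hst⟩
  · intro p hp q hq hpq
    obtain ⟨y, hy, rfl⟩ := Finset.mem_image.1 hp
    obtain ⟨z, hz, rfl⟩ := Finset.mem_image.1 hq
    exact hF.min.1 y hy z hz (fun he => hpq (he ▸ rfl))
  · rcases hF.min.2 with ⟨h1, -⟩ | ⟨y, hy, z, hz, hyz, hR⟩
    · rw [h1, Finset.mem_singleton] at hx; omega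
    · exact ⟨_, Finset.mem_image_of_mem _ hy, _, Finset.mem_image_of_mem _ hz,
        fun he => hyz (sv_inj (hlt y hy) (hlt z hz) he), hR⟩
  · intro y hy
    by_cases hyl : y ∈ localList bm u T
    · obtain ⟨z, hz, rfl⟩ := exists_sv hyl
      obtain ⟨p, hp, hpz⟩ := hF.closed z hz (fun hzF => hy (Finset.mem_image_of_mem _ hzF))
      exact ⟨_, Finset.mem_image_of_mem _ hp, hpz⟩
    -- A super-vertex outside the local list is excluded by the anchor, to which its remaining
    -- length is `-1`.
    · refine ⟨_, h0, ?_⟩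
      rcases R_cases bm (u, T) y with ⟨a, ha1, ha2, -⟩ | ⟨hR, -⟩
      · exact absurd (mem_localList.2 (.inr ⟨a, mem_adj.2 ⟨ha1.1, ha2⟩, ha1⟩)) hyl
      · have := hF.bm_le
        have : (0 : ℤ) ≤ (localGraph bm u T h).bm := (localGraph bm u T h).bm_nonneg
        omega

/-- All members of `Q` are joined to `(u, T)` and hence have indices in the local list; the starting
edge provides an index among `1, …, r`. -/
theorem node_of_sol {h : starting bm u T ≠ []} {Q : Finset G.SV} {b : ℤ} (hQ : Sol bm Q b)
    (hA : Anchored Q u T) : ∃ F, (localGraph bm u T h).Node (localGraph bm u T h).w F b ∧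
      F.image (sv bm u T) = Q := by
  classical
  obtain ⟨h0, y, hy, hst⟩ := hA
  have hb0 : 0 ≤ b := (Int.natCast_nonneg bm).trans hQ.bm_le
  have hQl : ∀ x ∈ Q, x ∈ localList bm u T := by
    intro x hx
    by_cases hxu : (u, T) = x
    · exact mem_localList.2 (.inl hxu.symm)
    · obtain ⟨a, ha, hb, -⟩ := exists_fits_of_R_nonneg (hb0.trans (hQ.clique _ h0 x hx hxu))
      exact mem_localList.2 (.inr ⟨a, mem_adj.2 ⟨ha.1, hb⟩, ha⟩)
  set F := (Finset.range (localList bm u T).length).filter fun x => sv bm u T x ∈ Q with hFdef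
  have hF : ∀ x, x ∈ F ↔ x < (localList bm u T).length ∧ sv bm u T x ∈ Q := by simp [hFdef]
  have himg : F.image (sv bm u T) = Q := by
    ext x
    rw [Finset.mem_image]
    constructor
    · rintro ⟨z, hz, rfl⟩; exact ((hF z).1 hz).2
    · intro hx
      obtain ⟨z, hz, rfl⟩ := exists_sv (hQl x hx)
      exact ⟨z, (hF z).2 ⟨hz, hx⟩, rfl⟩
  have hexF : ∀ x ∈ Q, ∃ z ∈ F, sv bm u T z = x := fun x hx => Finset.mem_image.1 (himg ▸ hx)
  refine ⟨F, ⟨fun x hx => ((hF x).1 hx).1, (hF 0).2 ⟨by simp [localList], h0⟩, ⟨?_, .inr ?_⟩,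
    hQ.bm_le, ?_, .inl ?_⟩, himg⟩
  · intro p hp q hq hpq
    obtain ⟨hp1, hp2⟩ := (hF p).1 hp
    obtain ⟨hq1, hq2⟩ := (hF q).1 hq
    exact hQ.clique _ hp2 _ hq2 (fun he => hpq (sv_inj hp1 hq1 he))
  · obtain ⟨p, hp, q, hq, hpq, hR⟩ := hQ.attained
    obtain ⟨p, hp', rfl⟩ := hexF p hp
    obtain ⟨q, hq', rfl⟩ := hexF q hq
    exact ⟨p, hp', q, hq', fun he => hpq (he ▸ rfl), hR⟩
  · intro z hz hzF
    obtain ⟨x, hx, hR⟩ := hQ.closed (sv bm u T z) (fun hzQ => hzF ((hF z).2 ⟨hz, hzQ⟩))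
    obtain ⟨x, hx', rfl⟩ := hexF x hx
    exact ⟨x, hx', hR⟩
  · obtain ⟨a, ha, hts⟩ := hst
    have hne : (u, T) ≠ y := fun he => ha.ne (congrArg _ he)
    obtain ⟨a', ha', hb, -⟩ := exists_fits_of_R_nonneg (hb0.trans (hQ.clique _ h0 y hy hne))
    obtain rfl := ha.unique ha'
    have has : a ∈ starting bm u T := mem_starting.2 ⟨mem_adj.2 ⟨ha.1, hb⟩, hts⟩
    obtain ⟨x, h1, h2, h3⟩ := exists_sv_of_starting has
    have hxy : sv bm u T x = y := h3.trans ((fits_far_of_starting has).eq_right ha)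
    have hr := (localGraph bm u T h).r_lt
    exact ⟨x, (hF x).2 ⟨h2.trans_lt hr, hxy ▸ hy⟩, h1, h2⟩

theorem image_sv_inj {h : starting bm u T ≠ []} {F F' : Finset ℕ} {b b' : ℤ}
    (hF : (localGraph bm u T h).Node (localGraph bm u T h).w F b)
    (hF' : (localGraph bm u T h).Node (localGraph bm u T h).w F' b')
    (he : F.image (sv bm u T) = F'.image (sv bm u T)) : F = F' := by
  have aux : ∀ {F F' : Finset ℕ}, (∀ x ∈ F, x < (localList bm u T).length) →
      (∀ x ∈ F', x < (localList bm u T).length) →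
      F.image (sv bm u T) = F'.image (sv bm u T) → F ⊆ F' := by
    intro F F' h1 h2 he x hx
    have := Finset.mem_image_of_mem (sv bm u T) hx
    rw [he, Finset.mem_image] at this
    obtain ⟨y, hy, hxy⟩ := this
    rwa [sv_inj (h2 y hy) (h1 x hx) hxy] at hy
  exact (aux hF.lt hF'.lt he).antisymm (aux hF'.lt hF.lt he.symm)

/-- Among the half-edges of the same source and the same starting time, `h` has the largest
number. -/
def Canonical (bm : ℕ) (u : Fin G.n) (h : G.Half) : Prop :=
  ∀ g ∈ G.adj bm u, ts g = ts h → id g ≤ id h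

theorem starting_ne_nil {h : G.Half} (hh : h ∈ G.adj bm u) : starting bm u (ts h) ≠ [] :=
  List.ne_nil_of_mem (mem_starting.2 ⟨hh, rfl⟩)

/-- No vertex below `u` has an edge within `Q` that starts at the time of `Q`. -/
def Accept (u : Fin G.n) (Q : Finset G.SV) : Prop := ∀ x ∈ Q, ∀ y ∈ Q, Start x y → u ≤ x.1

/-- `Q` is to be listed when the half-edge `h` of `u` is dealt with. -/
def Assigned (bm : ℕ) (Q : Finset G.SV) (u : Fin G.n) (h : G.Half) : Prop :=
  h ∈ G.adj bm u ∧ Canonical bm u h ∧ Anchored Q u (ts h) ∧ Accept u Q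

theorem exists_canonical {h : G.Half} (hh : h ∈ G.adj bm u) :
    ∃ g ∈ G.adj bm u, Canonical bm u g ∧ ts g = ts h := by
  obtain ⟨g, hg, hmax⟩ := Finset.exists_max_image ((starting bm u (ts h)).toFinset) id
    ⟨h, List.mem_toFinset.2 (mem_starting.2 ⟨hh, rfl⟩)⟩
  obtain ⟨hg1, hg2⟩ := mem_starting.1 (List.mem_toFinset.1 hg)
  exact ⟨g, hg1, fun g' hg' he => hmax g' (List.mem_toFinset.2 (mem_starting.2 ⟨hg', he.trans hg2⟩)),
    hg2⟩

theorem Canonical.eq {h h' : G.Half} (hc : Canonical bm u h) (hc' : Canonical bm u h')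
    (hh : h ∈ G.adj bm u) (hh' : h' ∈ G.adj bm u) (he : ts h = ts h') : h = h' :=
  id_inj (le_antisymm (hc' h hh he) (hc h' hh' he.symm))

/-- Take the smallest vertex with a starting edge in `Q`, and replace that half-edge by the
canonical one of the same source and starting time. -/
theorem Sol.exists_assigned {Q : Finset G.SV} {b : ℤ} (hQ : Sol bm Q b) :
    ∃ u h, Assigned bm Q u h := by
  classical
  have hb0 : 0 ≤ b := (Int.natCast_nonneg bm).trans hQ.bm_le
  obtain ⟨x, hx, hmin⟩ := Finset.exists_min_image (Q.filter fun x => ∃ y ∈ Q, Start x y) Prod.fst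
    (by obtain ⟨x, hx, h⟩ := hQ.start; exact ⟨x, Finset.mem_filter.2 ⟨hx, h⟩⟩)
  obtain ⟨hxQ, y, hy, hst⟩ := Finset.mem_filter.1 hx
  obtain ⟨a, ha, hts⟩ := hst
  obtain ⟨a', ha', hb, -⟩ := exists_fits_of_R_nonneg
    (hb0.trans (hQ.clique x hxQ y hy (fun he => ha.ne (congrArg _ he))))
  obtain rfl := ha.unique ha'
  have haA : a ∈ G.adj bm x.1 := mem_adj.2 ⟨ha.1, hb⟩
  obtain ⟨g, hg, hc, he⟩ := exists_canonical haA
  have hgx : (x.1, ts g) = x := Prod.ext rfl (he.trans hts)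
  refine ⟨x.1, g, hg, hc, ⟨hgx.symm ▸ hxQ, y, hy, hgx.symm ▸ ⟨a, ha, hts⟩⟩, ?_⟩
  exact fun p hp q hq hpq => hmin p (Finset.mem_filter.2 ⟨hp, q, hq, hpq⟩)

theorem Sol.fst_inj {Q : Finset G.SV} {b : ℤ} (hQ : Sol bm Q b) {x y : G.SV} (hx : x ∈ Q)
    (hy : y ∈ Q) (he : x.1 = y.1) : x = y :=
  fst_injOn_of_clique (fun x hx y hy hxy =>
    ((Int.natCast_nonneg bm).trans hQ.bm_le).trans (hQ.clique x hx y hy hxy)) hx hy he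

/-- Each of the two vertices has a starting edge in `Q`, so acceptance makes them equal. A vertex
occurs in `Q` at one time stamp only, and this fixes the canonical half-edge. -/
theorem Sol.assigned_unique {Q : Finset G.SV} {b : ℤ} (hQ : Sol bm Q b) {u u' : Fin G.n}
    {h h' : G.Half} (hA : Assigned bm Q u h) (hA' : Assigned bm Q u' h') : u = u' ∧ h = h' := by
  obtain ⟨hh, hc, ⟨h1, y, hy, hst⟩, hacc⟩ := hA
  obtain ⟨hh', hc', ⟨h1', y', hy', hst'⟩, hacc'⟩ := hA'
  obtain rfl : u = u' := le_antisymm (hacc _ h1' _ hy' hst') (hacc' _ h1 _ hy hst)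
  exact ⟨rfl, hc.eq hc' hh hh' (congrArg Prod.snd (hQ.fst_inj h1 h1' rfl))⟩

/-! ### The number of leaves of all anchors -/

theorem Sol.one_le_length_adj {Q : Finset G.SV} {b : ℤ} (hQ : Sol bm Q b) :
    ∀ x ∈ Q, 1 ≤ (G.adj bm x.1).length := by
  intro x hx
  have hb0 : 0 ≤ b := (Int.natCast_nonneg bm).trans hQ.bm_le
  obtain ⟨p, hp, q, hq, hpq, -⟩ := hQ.attained
  obtain ⟨y, hy, hne⟩ : ∃ y ∈ Q, x ≠ y := by
    by_cases h : x = p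
    · exact ⟨q, hq, h ▸ hpq⟩
    · exact ⟨p, hp, h⟩
  obtain ⟨a, ha, hb, -⟩ := exists_fits_of_R_nonneg (hb0.trans (hQ.clique x hx y hy hne))
  exact List.length_pos_of_mem (mem_adj.2 ⟨ha.1, hb⟩)

theorem Sol.sum_le {Q : Finset G.SV} {b : ℤ} (hQ : Sol bm Q b) :
    ∑ x ∈ Q, (G.adj bm x.1).length ≤ G.cliqueBound := by
  refine le_trans ?_ (sum_adj_clique_le (bm := bm) (P := Q) (fun x hx y hy hxy =>
    ((Int.natCast_nonneg bm).trans hQ.bm_le).trans (hQ.clique x hx y hy hxy))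
    hQ.one_le_length_adj).1
  exact Finset.sum_le_sum fun _ _ => Nat.le_succ _

open Classical in
-- Exchange the sums. For a fixed `Q`, a vertex `u` contributes at most once, as it occurs in `Q` at
-- one time stamp and has one canonical half-edge for it. What remains is the degree sum of `Q`.
theorem sum_anchored_le (sols : Finset (Finset G.SV)) (hs : ∀ Q ∈ sols, ∃ b, Sol bm Q b) :
    ∑ u, ∑ h ∈ (G.adj bm u).toFinset with Canonical bm u h,
      (G.adj bm u).length * (sols.filter fun Q => Anchored Q u (ts h)).card
      ≤ sols.card * G.cliqueBound := by
  simp only [Finset.card_filter, Finset.mul_sum, mul_ite, mul_one, mul_zero]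
  have hcomm : ∀ u : Fin G.n,
      ∑ h ∈ (G.adj bm u).toFinset with Canonical bm u h, ∑ Q ∈ sols,
        (if Anchored Q u (ts h) then (G.adj bm u).length else 0) =
      ∑ Q ∈ sols, ∑ h ∈ (G.adj bm u).toFinset with Canonical bm u h,
        (if Anchored Q u (ts h) then (G.adj bm u).length else 0) := fun u => Finset.sum_comm
  simp only [hcomm]
  rw [Finset.sum_comm, ← smul_eq_mul]
  refine Finset.sum_le_card_nsmul _ _ _ fun Q hQ => ?_
  obtain ⟨b, hb⟩ := hs Q hQ
  refine le_trans ?_ hb.sum_le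
  have hu : ∀ u : Fin G.n, ∑ h ∈ (G.adj bm u).toFinset with Canonical bm u h,
      (if Anchored Q u (ts h) then (G.adj bm u).length else 0) ≤
      ∑ x ∈ Q with x.1 = u, (G.adj bm x.1).length := by
    intro u
    rw [← Finset.sum_filter]
    have : ∑ x ∈ Q with x.1 = u, (G.adj bm x.1).length
        = ∑ x ∈ Q with x.1 = u, (G.adj bm u).length :=
      Finset.sum_congr rfl fun x hx => by rw [(Finset.mem_filter.1 hx).2]
    rw [this, Finset.sum_const, Finset.sum_const]
    refine Nat.mul_le_mul_right _ (Finset.card_le_card_of_injOn (fun h => (u, ts h)) ?_ ?_)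
    · intro h hh
      simp only [Finset.coe_filter, Finset.mem_filter, List.mem_toFinset] at hh
      simp only [Finset.coe_filter]
      exact ⟨hh.2.1, rfl⟩
    · intro h hh h' hh' he
      simp only [Finset.coe_filter, Finset.mem_filter, List.mem_toFinset] at hh hh'
      exact hh.1.2.eq hh'.1.2 hh.1.1 hh'.1.1 (congrArg Prod.snd he)
  refine (Finset.sum_le_sum fun u _ => hu u).trans ?_
  rw [Finset.sum_fiberwise]

end ThickEdgeGraph

/-! ### The enumeration program -/

namespace Prog

open Var Arr Cond Expr Cmd

/-- Set `res` to the remaining length of the edge between the super-vertices `(zv, zt)` and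
`(yv, yt)`, and `rh` to the number of its half-edge. -/
def lookup : Cmd :=
  res ::= lit (-1) ;; rh ::= 0 ;; c ::= ld head zv ;;
  .loop (lt 0 c) (.ite
    (and (eq (ld dst c) yv) (and (eq (ld td c + zt - ld ts c) yt)
      (and (not (lt zt (ld ts c))) (not (lt (ld ts c + ld len c) zt)))))
    -- Setting `c` to `0` leaves the loop after the first hit, which is the only one.
    (rh ::= c ;; res ::= ld len c - (zt - ld ts c) ;; c ::= 0)
    (c ::= ld nxt c))

/-- The remaining lengths and the half-edges between the listed local vertices and `y`. -/
def row : Cmd :=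
  yv ::= ld wv y ;; yt ::= ld wt y ;; jj ::= 0 ;;
  .loop (lt jj k) (
    zv ::= ld wv (ld ll jj) ;; zt ::= ld wt (ld ll jj) ;; lookup ;;
    .store d jj res ;; .store hh jj rh ;; jj ::= jj + 1)

/-- List the members of the current node. -/
def list : Cmd :=
  k ::= 0 ;; q ::= 0 ;;
  .loop (lt q i) (
    .ite (lt i (ld st q)) (.store ll k q ;; k ::= k + 1) .skip ;; q ::= q + 1)

/-- A child that contains `i` has as its threshold either the weight of a member to `i` or the old
`b`; these candidates go to `a 0, …, a k`. The flags `fl` and `xl` are the two clauses of `Keep`.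
The number `xa` is the largest threshold at which the new node meets `1, …, r`: `-2` if there is
none, `top` if `i` itself counts. -/
def weights : Cmd :=
  xa ::= lit (-2) ;; fl ::= 0 ;; cc ::= 0 ;;
  .loop (lt cc k) (
    .store a cc (ld d cc) ;;
    .ite (lt (ld d cc) (ld bs i)) (fl ::= 1) .skip ;;
    .ite (and (not (lt r (ld ll cc))) (and (lt 0 (ld ll cc)) (lt xa (ld d cc))))
      (xa ::= ld d cc) .skip ;;
    cc ::= cc + 1) ;;
  .store a k (ld bs i) ;;
  .ite (and (not (lt (lit (-2)) xa)) (not (lt i r))) (xl ::= 0) (xl ::= 1) ;;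
  .ite (not (lt r i)) (xa ::= top) .skip

/-- The purely numerical clauses of `Add`, together with the restriction to keys below `b0`. -/
def initOk : Cmd :=
  cc ::= 0 ;;
  .loop (lt cc (k + 1)) (
    .ite (and (not (lt (ld a cc) bm)) (and (not (lt (ld bs i) (ld a cc))) (and (lt (ld a cc) b0)
        (and (not (lt (ld a 0) (ld a cc))) (not (lt xa (ld a cc)))))))
      (.store ok cc 1) (.store ok cc 0) ;;
    cc ::= cc + 1)

/-- Sets `e` if `y` and another member realize `b` and both have weight at least `b` to `i`; only
this justifies the last candidate `a k = b`. -/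
def pairs : Cmd :=
  jj ::= 0 ;;
  .loop (lt jj k) (
    .ite (and (eq (ld d jj) (ld bs i)) (and (not (lt (ld a jj) (ld bs i)))
      (not (lt ay (ld bs i))))) (e ::= 1) .skip ;;
    jj ::= jj + 1)

/-- The flag `s1` stands for the first clause of `Bad`, and `s2` for its greedy alternative. -/
def testBad : Cmd :=
  s1 ::= 1 ;; s2 ::= 1 ;; jj ::= 0 ;;
  .loop (lt jj k) (
    .ite (and (not (lt (ld a jj) (ld a cc))) (lt (ld d jj) (ld a cc))) (s1 ::= 0) .skip ;;
    .ite (and (lt (ld ll jj) y) (lt (ld d jj) (ld a cc))) (s2 ::= 0) .skip ;;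
    jj ::= jj + 1)

/-- Strikes out the candidate thresholds for which the non-member `y` is bad. -/
def bads : Cmd :=
  cc ::= 0 ;;
  .loop (lt cc (k + 1)) (
    testBad ;;
    .ite (and (eq s1 1) (not (and (lt ay (ld a cc)) (eq s2 0)))) (.store ok cc 0) .skip ;;
    cc ::= cc + 1)

/-- One row of weights from the members to `y` is computed for each `y` below `i` and used for all
candidates at once; this keeps the cost at `O(q)` for each `y`. -/
def scan : Cmd :=
  e ::= 0 ;; y ::= 0 ;;
  .loop (lt y i) (
    row ;;
    zv ::= ld wv y ;; zt ::= ld wt y ;; yv ::= ld wv i ;; yt ::= ld wt i ;; lookup ;; ay ::= res ;;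
    .ite (lt i (ld st y)) pairs bads ;;
    y ::= y + 1)

/-- Equal candidates describe the same child, so taking the maximum loses nothing. The child with
key `-1` comes last among the siblings. -/
def select : Cmd :=
  .ite (eq e 0) (.store ok k 0) .skip ;;
  best ::= lit (-2) ;; cc ::= 0 ;;
  .loop (lt cc (k + 1)) (
    .ite (and (eq (ld ok cc) 1) (lt best (ld a cc))) (best ::= ld a cc) .skip ;;
    cc ::= cc + 1) ;;
  .ite (and (lt best 0) (and (lt (lit (-1)) b0) (and (eq fl 1) (eq xl 1))))
    (best ::= lit (-1)) .skip

/-- Set `best` to the largest key below `b0` of a child of the current node, or to `-2`. -/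
def next : Cmd := list ;; y ::= i ;; row ;; weights ;; initOk ;; scan ;; select

/-- Go to the child with key `best`. -/
def push : Cmd :=
  cc ::= 0 ;;
  .loop (lt cc k) (
    -- The entry `st x` is the first level at which `x` no longer belongs to the current path: `x`
    -- is in the node of level `i` if and only if `i < st x`. A vertex that drops out now gets `i +
    -- 1` and is still seen at level `i` after backtracking; one that stays gets a value beyond all
    -- levels. A key of `-1` removes nobody.
    .ite (lt (ld a cc) best) (.store st (ld ll cc) (i + 1)) (.store st (ld ll cc) (wn + 1)) ;;
    cc ::= cc + 1) ;;
  .ite (lt best 0) (.store st i 0 ;; .store bs (i + 1) (ld bs i))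
    (.store st i (wn + 1) ;; .store bs (i + 1) best) ;;
  i ::= i + 1 ;; b0 ::= top + 1

/-- Go back to the parent and set `b0` to the key of the node that is left. -/
def pop : Cmd :=
  -- The key of the abandoned child is its threshold if it contains the new vertex, and `-1`
  -- otherwise.
  i ::= i - 1 ;; .ite (lt (i + 1) (ld st i)) (b0 ::= ld bs (i + 1)) (b0 ::= lit (-1))

/-- Rejects the leaf if an edge to the current member starts at its time from a vertex below `u`. -/
def inspectRow : Cmd :=
  jj ::= 0 ;;
  .loop (lt jj k) (
    .ite (and (not (lt (ld d jj) 0)) (and (lt (ld wv (ld ll jj)) u)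
        (eq (ld ts (ld hh jj)) (ld wt (ld ll jj))))) (f ::= 0) .skip ;;
    jj ::= jj + 1)

/-- A single pass over the rows decides acceptance, finds the least time stamp for the
normalization, and counts the edges as `0 + 1 + ⋯ + (k - 1)`, which has to be written before them.
-/
def inspect : Cmd :=
  f ::= 1 ;; Var.mt ::= top ;; ec ::= 0 ;; cc ::= 0 ;;
  .loop (lt cc k) (
    y ::= ld ll cc ;; row ;; inspectRow ;;
    .ite (lt (ld wt y) Var.mt) (Var.mt ::= ld wt y) .skip ;;
    ec ::= ec + cc ;; cc ::= cc + 1)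

/-- The rows are computed once more instead of being stored, since the edges of a clique would not
fit into an array of linear size. Only `jj < cc` is written, so each edge appears once. -/
def emitEdges : Cmd :=
  cc ::= 0 ;;
  .loop (lt cc k) (
    y ::= ld ll cc ;; row ;; jj ::= 0 ;;
    .loop (lt jj cc) (.emit (ld eid (ld hh jj)) ;; jj ::= jj + 1) ;;
    cc ::= cc + 1)

def emitVertices : Cmd :=
  cc ::= 0 ;;
  .loop (lt cc k) (
    .emit (ld wv (ld ll cc)) ;; .emit (ld wt (ld ll cc) - Var.mt) ;; cc ::= cc + 1)

/-- Write the clique of the current leaf, unless it is found from a smaller vertex. -/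
def leaf : Cmd :=
  list ;; inspect ;;
  .ite (eq f 1) (.emit ec ;; emitEdges ;; .emit k ;; emitVertices) .skip

def step : Cmd := .ite (eq i wn) (leaf ;; pop) (next ;; .ite (lt (lit (-2)) best) push pop)

/-- The stack of the root `{0}` at level `1`, with threshold `top`; since `b0 = top + 1` exceeds all
keys, the search begins with the first child. -/
def search : Cmd :=
  .store st 0 (wn + 1) ;; .store bs 1 top ;; i ::= 1 ;; b0 ::= top + 1 ;; .loop (lt 0 i) step

/-- Append the neighbours of `(u, T)` by the half-edges that satisfy a condition. -/
def append (t : Cond) : Cmd :=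
  g ::= ld head u ;;
  .loop (lt 0 g) (
    .ite t (.store wv wn (ld dst g) ;; .store wt wn (ld td g + T - ld ts g) ;; wn ::= wn + 1)
      .skip ;;
    g ::= ld nxt g)

/-- Two passes over the adjacency list put the half-edges that start at `T` first, so that they
receive the indices `1, …, r`. -/
def build : Cmd :=
  .store wv 0 u ;; .store wt 0 T ;; wn ::= 1 ;;
  append (eq (ld ts g) T) ;; r ::= wn - 1 ;;
  append (and (lt (ld ts g) T) (not (lt (ld ts g + ld len g) T)))

def testCanonical : Cmd :=
  T ::= ld ts h ;; f ::= 1 ;; g ::= ld head u ;;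
  .loop (lt 0 g) (
    .ite (and (eq (ld ts g) T) (lt h g)) (f ::= 0) .skip ;; g ::= ld nxt g)

def anchor : Cmd := testCanonical ;; .ite (eq f 1) (build ;; search) .skip

def searches : Cmd :=
  u ::= 0 ;;
  .loop (lt u n) (
    h ::= ld head u ;; .loop (lt 0 h) (anchor ;; h ::= ld nxt h) ;; u ::= u + 1)

def addHalf (x x' t t' : Expr) : Cmd :=
  .store dst q x' ;; .store ts q t ;; .store td q t' ;; .store len q (ld inp (p + 4)) ;;
  .store eid q j ;; .store nxt q (ld head x) ;; .store head x q ;; q ::= q + 1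

/-- An edge that is too short still uses up two numbers, so the edge `j` always has the half-edges
`2j + 1` and `2j + 2`, and `0` is free to end a list. -/
def readEdges : Cmd :=
  j ::= 0 ;; p ::= 4 ;; q ::= 1 ;;
  .loop (lt j m) (
    .ite (lt (ld inp (p + 4)) bm) (q ::= q + 2)
      (addHalf (ld inp p) (ld inp (p + 1)) (ld inp (p + 2)) (ld inp (p + 3)) ;;
       addHalf (ld inp (p + 1)) (ld inp p) (ld inp (p + 3)) (ld inp (p + 2))) ;;
    j ::= j + 1 ;; p ::= p + 5)

def readInput : Cmd :=
  n ::= ld inp 0 ;; m ::= ld inp 1 ;; top ::= ld inp 2 ;; bm ::= ld inp 3 - 1 ;;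
  .ite (lt bm 0) (bm ::= 0) .skip ;; readEdges

def main : Cmd := readInput ;; searches

end Prog


/-! ### Correctness of the subroutines -/

/-- `s'` differs from `s` at most in the variables `V`, the arrays `A`, and the clock. -/
structure Frame (V : List Var) (A : List Arr) (s s' : St) : Prop where
  v : ∀ x, x ∉ V → s'.v x = s.v x
  a : ∀ b, b ∉ A → s'.a b = s.a b
  out : s'.out = s.out

namespace Frame

variable {V V' : List Var} {A A' : List Arr} {s s' s'' : St}

theorem refl (V : List Var) (A : List Arr) (s : St) : Frame V A s s :=
  ⟨fun _ _ => rfl, fun _ _ => rfl, rfl⟩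

theorem mono (h : Frame V A s s') (hV : V ⊆ V') (hA : A ⊆ A') : Frame V' A' s s' :=
  ⟨fun x hx => h.v x fun hh => hx (hV hh), fun b hb => h.a b fun hh => hb (hA hh), h.out⟩

theorem trans (h : Frame V A s s') (h' : Frame V A s' s'') : Frame V A s s'' :=
  ⟨fun x hx => (h'.v x hx).trans (h.v x hx), fun b hb => (h'.a b hb).trans (h.a b hb),
    h'.out.trans h.out⟩

@[simp] theorem tick_iff : Frame V A s s'.tick ↔ Frame V A s s' :=
  ⟨fun h => ⟨h.v, h.a, h.out⟩, fun h => ⟨h.v, h.a, h.out⟩⟩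

theorem set_iff {x : Var} (hx : x ∈ V) {z : ℤ} : Frame V A s (s'.set x z) ↔ Frame V A s s' := by
  have hv : ∀ x', x' ∉ V → (s'.set x z).v x' = s'.v x' := fun x' hx' => by
    rw [St.set_v, if_neg (by rintro rfl; exact hx' hx)]
  exact ⟨fun h => ⟨fun x' hx' => by rw [← h.v x' hx', hv x' hx'], h.a, h.out⟩,
    fun h => ⟨fun x' hx' => by rw [← h.v x' hx', hv x' hx'], h.a, h.out⟩⟩

theorem put_iff {b : Arr} (hb : b ∈ A) {k : ℕ} {z : ℤ} :
    Frame V A s (s'.put b k z) ↔ Frame V A s s' := by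
  have hv : ∀ b', b' ∉ A → (s'.put b k z).a b' = s'.a b' := fun b' hb' => by
    rw [St.put_a, if_neg (by rintro rfl; exact hb' hb)]
  exact ⟨fun h => ⟨h.v, fun b' hb' => by rw [← h.a b' hb', hv b' hb'], h.out⟩,
    fun h => ⟨h.v, fun b' hb' => by rw [← h.a b' hb', hv b' hb'], h.out⟩⟩

theorem trans_of (h : Frame V A s s') (h' : Frame V' A' s' s'') (hV : V' ⊆ V) (hA : A' ⊆ A) :
    Frame V A s s'' := h.trans (h'.mono hV hA)

end Frame

namespace ThickEdgeGraph

open Cmd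

variable {G : ThickEdgeGraph} {bm Z : ℕ} {B : ℤ} {s : St} {Q : St → Prop}

/-- The arrays are long enough and the words wide enough for `G`. -/
structure Room (G : ThickEdgeGraph) (Z : ℕ) (B : ℤ) : Prop where
  le_Z : 5 * G.m + G.n + 5 ≤ Z
  le_B : (Z : ℤ) + G.tmax + 10 ≤ B
  sq_le : (Z : ℤ) * Z ≤ B

/-- The linked list that starts at the half-edge number `c` is `l`. -/
def Chain (nxt : ℕ → ℤ) : ℤ → List G.Half → Prop
  | c, [] => c = 0
  | c, a :: l => c = id a ∧ Chain nxt (nxt (id a)) l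

/-- The state holds the adjacency lists of the edges of length at least `bm`. -/
structure Mem (G : ThickEdgeGraph) (bm : ℕ) (s : St) : Prop where
  n_eq : s.v .n = G.n
  top_eq : s.v .top = G.tmax
  bm_eq : s.v .bm = bm
  head : ∀ x : Fin G.n, Chain (s.a .nxt) (s.a .head x) (G.adj bm x)
  dst_eq : ∀ a : G.Half, (bm : ℤ) ≤ len a → s.a .dst (id a) = (dst a : ℕ)
  ts_eq : ∀ a : G.Half, (bm : ℤ) ≤ len a → s.a .ts (id a) = ts a
  td_eq : ∀ a : G.Half, (bm : ℤ) ≤ len a → s.a .td (id a) = td a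
  len_eq : ∀ a : G.Half, (bm : ℤ) ≤ len a → s.a .len (id a) = len a
  eid_eq : ∀ a : G.Half, (bm : ℤ) ≤ len a → s.a .eid (id a) = (a.1 : ℕ)

theorem Mem.frame {V : List Var} {A : List Arr} {s' : St} (h : Mem G bm s) (hF : Frame V A s s')
    (hV : ∀ x ∈ [Var.n, .top, .bm], x ∉ V)
    (hA : ∀ b ∈ [Arr.head, .nxt, .dst, .ts, .td, .len, .eid], b ∉ A) : Mem G bm s' := by
  simp only [List.forall_mem_cons] at hV hA
  obtain ⟨v1, v2, v3, -⟩ := hV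
  obtain ⟨a1, a2, a3, a4, a5, a6, a7, -⟩ := hA
  constructor <;> simp only [hF.v _ v1, hF.v _ v2, hF.v _ v3, hF.a _ a1, hF.a _ a2, hF.a _ a3,
    hF.a _ a4, hF.a _ a5, hF.a _ a6, hF.a _ a7]
  exacts [h.n_eq, h.top_eq, h.bm_eq, h.head, h.dst_eq, h.ts_eq, h.td_eq, h.len_eq, h.eid_eq]

theorem id_lt_Z (hr : Room G Z B) (a : G.Half) : id a < Z := by
  have := id_le a; have := hr.le_Z; omega

theorem fits_iff {a : G.Half} {x y : G.SV} (h : src a = x.1) : Fits a x y ↔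
    ((dst a : ℕ) : ℤ) = ((y.1 : ℕ) : ℤ) ∧ td a + x.2 - ts a = y.2 ∧ ¬ x.2 < ts a ∧
      ¬ ts a + len a < x.2 := by
  simp only [Fits, h, true_and, Nat.cast_inj, Fin.val_inj, not_lt]

/-- The linked list is followed as `List.find?` follows the adjacency list, which is how `R` is
defined; the cost is linear in the degree of the source. -/
theorem wp_lookup (hr : Room G Z B) (hm : Mem G bm s) {x y : G.SV} (hzv : s.v .zv = (x.1 : ℕ))
    (hzt : s.v .zt = x.2) (hyv : s.v .yv = (y.1 : ℕ)) (hyt : s.v .yt = y.2)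
    (hQ : ∀ s', Frame [.c, .res, .rh] [] s s' → s'.v .res = R bm x y →
      (∀ a, Fits a x y → (bm : ℤ) ≤ len a → s'.v .rh = id a) → (0 ≤ s'.v .rh ∧ s'.v .rh < Z) →
      s'.clk ≤ s.clk + 8 * ((G.adj bm x.1).length + 1) → Q s') : wp Z B Prog.lookup Q s := by
  have hZ := hr.le_Z
  have hB := hr.le_B
  -- The induction runs over the rest of the list, with the outcome of the search in that rest in
  -- the postcondition; if nothing is found, `res` and `rh` keep their initial values.
  have loop : ∀ (l : List G.Half) (s1 : St), (∀ a ∈ l, a ∈ G.adj bm x.1) →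
      Frame [.c, .res, .rh] [] s s1 → Chain (s.a .nxt) (s1.v .c) l →
      (∀ s', Frame [.c, .res, .rh] [] s s' →
        (match l.find? (fun a => Fits a x y) with
          | some a => s'.v .res = rem a x.2 ∧ s'.v .rh = id a
          | none => s'.v .res = s1.v .res ∧ s'.v .rh = s1.v .rh) →
        s'.clk ≤ s1.clk + 8 * l.length + 1 → Q s') →
      wp Z B (.loop (.lt 0 Var.c) (.ite
        (.and (.eq (.ld .dst Var.c) Var.yv) (.and (.eq (.ld .td Var.c + Var.zt - .ld .ts Var.c) Var.yt)
          (.and (.not (.lt Var.zt (.ld .ts Var.c)))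
            (.not (.lt (.ld .ts Var.c + .ld .len Var.c) Var.zt)))))
        (.rh ::= Var.c ;; .res ::= .ld .len Var.c - (Var.zt - .ld .ts Var.c) ;; .c ::= 0)
        (.c ::= .ld .nxt Var.c))) Q s1 := by
    intro l
    induction l with
    | nil =>
      intro s1 _ hF hc hQ
      have hc : s1.v .c = 0 := hc
      refine wp_loop_done (by simp) (by simp [hc]) (hQ _ (by simpa using hF) (by simp) (by simp))
    | cons a l ih =>
      intro s1 hl hF hc hQ
      obtain ⟨hc, hc'⟩ := hc
      have ha := hl a (by simp)
      obtain ⟨hsrc, hlen⟩ := mem_adj.1 ha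
      have hid := id_pos a
      have hidZ := id_lt_Z hr a
      have hm1 := hm.frame hF (by decide) (by decide)
      have e1 : s1.v .zt = x.2 := (hF.v _ (by decide)).trans hzt
      have e2 : s1.v .yv = (y.1 : ℕ) := (hF.v _ (by decide)).trans hyv
      have e3 : s1.v .yt = y.2 := (hF.v _ (by decide)).trans hyt
      have e4 : s1.a .nxt = s.a .nxt := hF.a _ (by decide)
      have d1 := hm1.dst_eq a hlen
      have d2 := hm1.ts_eq a hlen
      have d3 := hm1.td_eq a hlen
      have d4 := hm1.len_eq a hlen
      have b1 := len_nonneg a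
      have b2 := ts_pos a
      have b3 := ts_add_len_le a
      have hfit := fits_iff (y := y) hsrc
      refine wp_loop_step (by simp) (by simp [hc, hid]) ?_
      simp only [wp_ite, wp_seq, wp_assign, Cond.ok_and, Cond.ok_eq, Cond.ok_lt, Cond.ok_not,
        Cond.holds_and, Cond.holds_eq, Cond.holds_lt, Cond.holds_not, Expr.eval_ld, Expr.eval_var,
        Expr.eval_add, Expr.eval_sub, Expr.eval_zero, Expr.ok_ld, Expr.ok_var, Expr.ok_add,
        Expr.ok_sub, Expr.ok_zero, St.tick_v, St.tick_a, St.set_v, St.set_a, reduceCtorEq,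
        if_false, hc, Int.toNat_natCast, d1, d2, d3, d4, e1, e2, e3, e4, ← hfit]
      refine ⟨?_, ?_, ?_⟩
      · simp [hidZ]
      · intro hf
        have h4 := hf.2.2.2.1
        have h5 := hf.2.2.2.2
        refine ⟨trivial, ⟨by omega, by omega⟩, by simp [hidZ], ⟨by omega, by omega⟩, trivial,
          ⟨by omega, by omega⟩, ?_⟩
        refine wp_loop_done (by simp) (by simp) (hQ _ ?_ ?_ ?_)
        · simpa [Frame.set_iff] using hF
        · simp [hf, rem]
        · simp; omega
      · intro hf
        have hnb : -B ≤ s.a .nxt (id a) ∧ s.a .nxt (id a) ≤ B := by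
          cases l with
          | nil => have h0 : s.a .nxt (id a) = 0 := hc'; rw [h0]; constructor <;> omega
          | cons a' l => have h0 := id_lt_Z hr a'; rw [hc'.1]; constructor <;> omega
        refine ⟨by simp [hidZ], hnb, ih _ (fun a ha => hl a (by simp [ha])) ?_ ?_ ?_⟩
        · simpa [Frame.set_iff] using hF
        · simpa using hc'
        · intro s' h1 h2 h3
          refine hQ s' h1 ?_ ?_
          · rw [List.find?_cons_of_neg (by simpa using hf)]
            simpa using h2
          · simp at h3 ⊢; omega
  have hx := x.1.2
  have hhead := hm.head x.1
  have hhb : -B ≤ s.a .head x.1 ∧ s.a .head x.1 ≤ B := by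
    cases hl : G.adj bm x.1 with
    | nil => rw [hl] at hhead; have h0 : s.a .head x.1 = 0 := hhead; rw [h0]; constructor <;> omega
    | cons a l =>
      rw [hl] at hhead
      have h0 := id_lt_Z hr a; rw [hhead.1]; constructor <;> omega
  simp only [Prog.lookup, wp_seq, wp_assign, Expr.ok_ld, Expr.ok_var, Expr.ok_lit, Expr.eval_lit, Expr.ok_zero, Expr.eval_zero,
    Expr.eval_ld, Expr.eval_var, St.set_v, St.set_a, reduceCtorEq, if_false, hzv, Int.toNat_natCast]
  refine ⟨trivial, ⟨by omega, by omega⟩, trivial, by omega, ⟨trivial, by omega, by omega⟩, hhb,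
    loop _ _ (fun a ha => ha) ?_ ?_ ?_⟩
  · simpa [Frame.set_iff] using Frame.refl _ _ _
  · simpa using hhead
  · intro s' h1 h2 h3
    refine hQ s' h1 ?_ ?_ ?_ ?_
    · rw [R]
      cases hf : (G.adj bm x.1).find? (fun a => Fits a x y) with
      | none => rw [hf] at h2; simpa using h2.1
      | some a => rw [hf] at h2; simpa using h2.1
    · intro a ha hb
      rw [find_eq_some ha hb] at h2
      exact h2.2
    · cases hf : (G.adj bm x.1).find? (fun a => Fits a x y) with
      | none =>
        rw [hf] at h2
        have h4 : s'.v .rh = 0 := by simpa using h2.2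
        omega
      | some a =>
        rw [hf] at h2
        have := id_lt_Z hr a
        omega
    · simp at h3; omega

end ThickEdgeGraph


/-! ### Local lists in memory and rows of weights -/

namespace ThickEdgeGraph

open Cmd

variable {G : ThickEdgeGraph} {bm Z : ℕ} {B : ℤ} {s : St} {Q : St → Prop} {u : Fin G.n} {T : ℤ}

/-- The state holds the local list of `(u, T)`. -/
structure Ctx (G : ThickEdgeGraph) (bm : ℕ) (u : Fin G.n) (T : ℤ) (s : St) : Prop where
  mem : Mem G bm s
  u_eq : s.v .u = (u : ℕ)
  wn_eq : s.v .wn = (localList bm u T).length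
  r_eq : s.v .r = (starting bm u T).length
  wv : ∀ x < (localList bm u T).length, s.a .wv x = ((sv bm u T x).1 : ℕ)
  wt : ∀ x < (localList bm u T).length, s.a .wt x = (sv bm u T x).2
  time : ∀ x, 1 ≤ (sv bm u T x).2 ∧ (sv bm u T x).2 ≤ G.tmax

theorem Ctx.frame {V : List Var} {A : List Arr} {s' : St} (h : Ctx G bm u T s)
    (hF : Frame V A s s') (hV : ∀ x ∈ [Var.n, .top, .bm, .u, .wn, .r], x ∉ V)
    (hA : ∀ b ∈ [Arr.head, .nxt, .dst, .ts, .td, .len, .eid, .wv, .wt], b ∉ A) :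
    Ctx G bm u T s' where
  mem := h.mem.frame hF (fun x hx => hV x (by revert x; decide))
    (fun x hx => hA x (by revert x; decide))
  u_eq := (hF.v _ (hV _ (by decide))).trans h.u_eq
  wn_eq := (hF.v _ (hV _ (by decide))).trans h.wn_eq
  r_eq := (hF.v _ (hV _ (by decide))).trans h.r_eq
  wv := by rw [hF.a _ (hA _ (by decide))]; exact h.wv
  wt := by rw [hF.a _ (hA _ (by decide))]; exact h.wt
  time := h.time

theorem localList_lt_Z (hr : Room G Z B) : (localList bm u T).length + 2 < Z := by
  have h1 := length_localList_le (G := G) (bm := bm) (u := u) (T := T)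
  have h2 := length_adj_le (bm := bm) u
  have h3 := G.maxDegree_le
  have h4 := hr.le_Z
  omega

/-- The first `k` entries of the member list are `ℓ 0, …, ℓ (k - 1)`. -/
structure Members (w k : ℕ) (ℓ : ℕ → ℕ) (s : St) : Prop where
  k_eq : s.v .k = k
  ll : ∀ j < k, s.a .ll j = ℓ j
  lt : ∀ j < k, ℓ j < w
  le : k ≤ w

theorem Members.frame {w k : ℕ} {ℓ : ℕ → ℕ} {V : List Var} {A : List Arr} {s' : St}
    (h : Members w k ℓ s) (hF : Frame V A s s') (hV : Var.k ∉ V) (hA : Arr.ll ∉ A) :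
    Members w k ℓ s' :=
  ⟨(hF.v _ hV).trans h.k_eq, by rw [hF.a _ hA]; exact h.ll, h.lt, h.le⟩

/-- The work for looking up the edges at `ℓ 0, …, ℓ (k - 1)`. -/
def work (bm : ℕ) (u : Fin G.n) (T : ℤ) (k : ℕ) (ℓ : ℕ → ℕ) : ℕ :=
  ∑ j ∈ Finset.range k, ((G.adj bm (sv bm u T (ℓ j)).1).length + 1)

/-- The lookups start from the members and not from `y`, so the cost is the degree sum over a clique
and not the degree of `y` times the size. -/
theorem wp_row (hr : Room G Z B) (hc : Ctx G bm u T s) {k y : ℕ} {ℓ : ℕ → ℕ}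
    (hl : Members (localList bm u T).length k ℓ s) (hy : y < (localList bm u T).length)
    (hyv : s.v .y = y)
    (hQ : ∀ s', Frame [.jj, .zv, .zt, .yv, .yt, .c, .res, .rh] [.d, .hh] s s' →
      (∀ j < k, s'.a .d j = R bm (sv bm u T (ℓ j)) (sv bm u T y)) →
      (∀ j < k, ∀ a, Fits a (sv bm u T (ℓ j)) (sv bm u T y) → (bm : ℤ) ≤ len a →
        s'.a .hh j = id a) →
      s'.clk ≤ s.clk + 16 * work bm u T k ℓ + 4 → Q s') : wp Z B Prog.row Q s := by
  have hZ := localList_lt_Z (bm := bm) (u := u) (T := T) hr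
  have hB := hr.le_B
  have hty := hc.time y
  have hyn := (sv bm u T y).1.2
  have hZ' := hr.le_Z
  have hk := hl.le
  have w1 := hc.wv y hy
  have w2 := hc.wt y hy
  simp only [Prog.row, wp_seq, wp_assign, Expr.ok_ld, Expr.ok_var, Expr.ok_zero, Expr.eval_zero,
    Expr.eval_ld, Expr.eval_var, St.set_v, St.set_a, reduceCtorEq, if_false, hyv,
    Int.toNat_natCast, w1, w2]
  refine ⟨by simp; omega, by omega, by simp; omega, by omega, trivial, by omega, ?_⟩
  refine wp_loop_count k (fun n s' =>
    Frame [.jj, .zv, .zt, .yv, .yt, .c, .res, .rh] [.d, .hh] s s' ∧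
    s'.v .yv = ((sv bm u T y).1 : ℕ) ∧ s'.v .yt = (sv bm u T y).2 ∧ s'.v .jj = n ∧
    (∀ j < n, s'.a .d j = R bm (sv bm u T (ℓ j)) (sv bm u T y)) ∧
    (∀ j < n, ∀ a, Fits a (sv bm u T (ℓ j)) (sv bm u T y) → (bm : ℤ) ≤ len a →
      s'.a .hh j = id a) ∧
    s'.clk ≤ s.clk + 16 * work bm u T n ℓ + 3) ?_ ?_ ?_
  · rintro n hn s1 ⟨hF, h1, h2, h3, h4, h5, h6⟩
    have hc1 := hc.frame hF (by decide) (by decide)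
    have hl1 := hl.frame hF (by decide) (by decide)
    have hlt := hl.lt n hn
    have hkv := hl1.k_eq
    have hlv := hl1.ll n hn
    have hz1 := hc1.wv _ hlt
    have hz2 := hc1.wt _ hlt
    have ht := hc.time (ℓ n)
    have hzn := (sv bm u T (ℓ n)).1.2
    refine ⟨by simp, by simp [h3, hkv, hn], ?_⟩
    simp only [wp_seq, wp_assign, Expr.ok_ld, Expr.ok_var, Expr.eval_ld, Expr.eval_var, St.set_v,
      St.set_a, St.tick_v, St.tick_a, reduceCtorEq, if_false, h3, hlv, hz1, hz2,
      Int.toNat_natCast]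
    refine ⟨by simp; omega, by omega, by simp; omega, by omega, ?_⟩
    refine wp_lookup hr (x := sv bm u T (ℓ n)) (y := sv bm u T y)
      (hc1.mem.frame (V := [.zv, .zt]) (A := []) ?_ (by decide) (by decide)) (by simp) (by simp)
      (by simpa using h1) (by simpa using h2) ?_
    · simpa [Frame.set_iff] using Frame.refl _ _ _
    · intro s2 hF2 e1 e2 hrh e3
      have hF3 : Frame [.jj, .zv, .zt, .yv, .yt, .c, .res, .rh] [.d, .hh] s s2 :=
        Frame.trans_of (by simpa [Frame.set_iff] using hF) hF2 (by decide) (by decide)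
      have hjj : s2.v .jj = n := by rw [hF2.v _ (by decide)]; simpa using h3
      have ad : s2.a .d = s1.a .d := hF2.a _ (by decide)
      have ah : s2.a .hh = s1.a .hh := hF2.a _ (by decide)
      have hyv2 : s2.v .yv = _ := (hF2.v _ (by decide)).trans h1
      have hyt2 : s2.v .yt = _ := (hF2.v _ (by decide)).trans h2
      have hR1 := R_lt_top (bm := bm) (sv bm u T (ℓ n)) (sv bm u T y)
      have hR2 := neg_one_le_R (bm := bm) (sv bm u T (ℓ n)) (sv bm u T y)
      simp only [wp_store, wp_assign, wp_seq, Expr.ok_add, Expr.ok_var, Expr.ok_one, Expr.eval_add,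
        Expr.eval_var, Expr.eval_one, St.put_v, hjj, e1, Int.toNat_natCast]
      refine ⟨trivial, trivial, by omega, by omega, trivial, trivial, by omega, by omega,
        by simp, by omega, ?_, ?_, ?_, ?_, ?_, ?_, ?_⟩
      · simpa [Frame.set_iff, Frame.put_iff] using hF3
      · simpa using hyv2
      · simpa using hyt2
      · simp
      · intro j hj
        simp only [St.set_a, St.put_a, reduceCtorEq, if_false, if_true, ad, Function.update_apply]
        split
        · next h => rw [h]
        · exact h4 j (by omega)
      · intro j hj a ha hb
        simp only [St.set_a, St.put_a, reduceCtorEq, if_false, if_true, ah, Function.update_apply]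
        split
        · next h => subst h; exact e2 a ha hb
        · exact h5 j (by omega) a ha hb
      · rw [work, Finset.sum_range_succ, ← work]
        simp at e3 ⊢
        omega
  · rintro s1 ⟨hF, h1, h2, h3, h4, h5, h6⟩
    have hkv := (hl.frame hF (by decide) (by decide)).k_eq
    exact ⟨by simp, by simp [h3, hkv], hQ _ (by simpa using hF) h4 h5 (by simp; omega)⟩
  · refine ⟨by simpa [Frame.set_iff] using Frame.refl _ _ _, by simp, by simp, by simp, by simp, by simp, by simp [work]⟩

end ThickEdgeGraph


/-! ### The members of a node and the candidate thresholds -/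

namespace ThickEdgeGraph

open Cmd

variable {G : ThickEdgeGraph} {bm Z : ℕ} {B : ℤ} {s : St} {Q : St → Prop} {u : Fin G.n} {T : ℤ}
  {i k w : ℕ} {b : ℤ} {ℓ : ℕ → ℕ} {δ α : ℕ → ℤ} {L : Finset ℕ}

/-- The members of `L` in increasing order are `ℓ 0, …, ℓ (k - 1)`. -/
structure Lists (L : Finset ℕ) (k : ℕ) (ℓ : ℕ → ℕ) : Prop where
  strict : ∀ j j', j < j' → j' < k → ℓ j < ℓ j'
  mem : ∀ x, x ∈ L ↔ ∃ j < k, ℓ j = x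

theorem Lists.exists_iff (h : Lists L k ℓ) {P : ℕ → Prop} :
    (∃ x ∈ L, P x) ↔ ∃ j < k, P (ℓ j) := by
  simp only [h.mem]
  exact ⟨fun ⟨_, ⟨j, hj, he⟩, hP⟩ => ⟨j, hj, he ▸ hP⟩, fun ⟨j, hj, hP⟩ => ⟨_, ⟨j, hj, rfl⟩, hP⟩⟩

theorem Lists.forall_iff (h : Lists L k ℓ) {P : ℕ → Prop} :
    (∀ x ∈ L, P x) ↔ ∀ j < k, P (ℓ j) := by
  simp only [h.mem]
  exact ⟨fun hP j hj => hP _ ⟨j, hj, rfl⟩, fun hP _ ⟨j, hj, he⟩ => he ▸ hP j hj⟩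

theorem Lists.inj (h : Lists L k ℓ) {j j' : ℕ} (hj : j < k) (hj' : j' < k) (he : ℓ j = ℓ j') :
    j = j' := by
  rcases lt_trichotomy j j' with h1 | h1 | h1
  · have := h.strict _ _ h1 hj'; omega
  · exact h1
  · have := h.strict _ _ h1 hj; omega

theorem Lists.eq_image (h : Lists L k ℓ) : L = (Finset.range k).image ℓ := by
  ext x; simp [h.mem]

theorem Lists.sum_eq (h : Lists L k ℓ) {M : Type*} [AddCommMonoid M] (F : ℕ → M) :
    ∑ j ∈ Finset.range k, F (ℓ j) = ∑ x ∈ L, F x := by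
  rw [h.eq_image, Finset.sum_image]
  intro j hj j' hj' he
  exact h.inj (by simpa using hj) (by simpa using hj') he

theorem Lists.card (h : Lists L k ℓ) : L.card = k := by
  have := h.sum_eq fun _ => 1
  simpa using this.symm

theorem wp_list (hZ : i < Z) (hB : (Z : ℤ) ≤ B) (hi : s.v .i = i) (hiw : i ≤ w)
    (hst : ∀ x < i, x ∈ L ↔ (i : ℤ) < s.a .st x) (hL : ∀ x ∈ L, x < i)
    (hQ : ∀ s' k ℓ, Frame [.k, .q] [.ll] s s' → Members w k ℓ s' → Lists L k ℓ →
      s'.clk ≤ s.clk + 5 * i + 3 → Q s') : wp Z B Prog.list Q s := by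
  simp only [Prog.list, wp_seq, wp_assign, Expr.ok_zero, Expr.eval_zero]
  refine ⟨trivial, by omega, trivial, by omega, ?_⟩
  refine wp_loop_count i (fun n s' => Frame [.k, .q] [.ll] s s' ∧ s'.v .q = n ∧ ∃ k ℓ, k ≤ n ∧
    Members w k ℓ s' ∧ Lists (L.filter (· < n)) k ℓ ∧ s'.clk ≤ s.clk + 5 * n + 2) ?_ ?_ ?_
  · rintro n hn s1 ⟨hF, hq, k, ℓ, hk, hm, hl, hclk⟩
    have hi1 : s1.v .i = i := (hF.v _ (by decide)).trans hi
    have hst1 : s1.a .st = s.a .st := hF.a _ (by decide)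
    have hk1 := hm.k_eq
    refine ⟨by simp, by simp [hq, hi1, hn], ?_⟩
    simp only [wp_ite, wp_seq, wp_assign, wp_store, wp_skip, Cond.ok_lt, Cond.holds_lt, Expr.ok_ld,
      Expr.ok_var, Expr.ok_add, Expr.ok_one, Expr.eval_ld, Expr.eval_var, Expr.eval_add,
      Expr.eval_one, St.tick_v, St.tick_a, St.put_v, St.set_v, reduceCtorEq, if_false, hq, hi1,
      hst1, hk1, Int.toNat_natCast, ← hst n hn]
    refine ⟨by simp; omega, ?_, ?_⟩
    · intro hmem
      refine ⟨trivial, trivial, by omega, by omega, by simp, by omega, by simp, by omega,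
        ?_, ?_, k + 1, Function.update ℓ k n, by omega, ⟨?_, ?_, ?_, by omega⟩, ⟨?_, ?_⟩, ?_⟩
      · simpa [Frame.set_iff, Frame.put_iff] using hF
      · simp
      · simp
      · intro j hj
        have h1 := hm.ll j
        simp only [St.set_a, St.put_a, St.tick_a, if_true, Function.update_apply]
        split <;> [rfl; exact h1 (by omega)]
      · intro j hj
        have h1 := hm.lt j
        rw [Function.update_apply]
        split <;> [omega; exact h1 (by omega)]
      · intro j j' hjj hj'
        rw [Function.update_of_ne (by omega), Function.update_apply]
        split
        · have := (hl.mem (ℓ j)).2 ⟨j, by omega, rfl⟩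
          simpa using (Finset.mem_filter.1 this).2
        · exact hl.strict _ _ hjj (by omega)
      · intro x
        rw [Nat.exists_lt_succ_right]
        have : (∃ j < k, Function.update ℓ k n j = x) ↔ ∃ j < k, ℓ j = x := by
          refine exists_congr fun j => and_congr_right fun hj => ?_
          rw [Function.update_of_ne (by omega)]
        rw [this, ← hl.mem, Function.update_self, Finset.mem_filter, Finset.mem_filter]
        constructor
        · rintro ⟨h1, h2⟩
          rcases Nat.lt_succ_iff_lt_or_eq.1 h2 with h3 | h3
          · exact .inl ⟨h1, h3⟩
          · exact .inr h3.symm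
        · rintro (⟨h1, h2⟩ | rfl)
          · exact ⟨h1, by omega⟩
          · exact ⟨hmem, by omega⟩
      · simp; omega
    · intro hmem
      refine ⟨by simp, by omega, ?_, by simp, k, ℓ, by omega, ⟨by simpa using hm.k_eq,
        by simpa using hm.ll, hm.lt, hm.le⟩, ?_, by simp; omega⟩
      · simpa [Frame.set_iff] using hF
      · convert hl using 1
        ext x
        simp only [Finset.mem_filter]
        refine and_congr_right fun hx => ⟨fun h => ?_, fun h => by omega⟩
        have : x ≠ n := by rintro rfl; exact hmem hx
        omega
  · rintro s1 ⟨hF, hq, k, ℓ, hk, hm, hl, hclk⟩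
    have hi1 : s1.v .i = i := (hF.v _ (by decide)).trans hi
    refine ⟨by simp, by simp [hq, hi1], hQ _ k ℓ (by simpa using hF)
      ⟨hm.k_eq, hm.ll, hm.lt, hm.le⟩ ?_ (by simp; omega)⟩
    rwa [Finset.filter_true_of_mem hL] at hl
  · refine ⟨by simpa [Frame.set_iff] using Frame.refl _ _ _, by simp, 0, fun _ => 0, by simp,
      ⟨by simp, by simp, by simp, by simp⟩, ⟨by simp, by simp⟩, by simp⟩

/-- The weights of `i` are listed in the array `d`. -/
structure Weighted (G : ThickEdgeGraph) (i k w : ℕ) (b : ℤ) (ℓ : ℕ → ℕ) (δ : ℕ → ℤ) (s : St) :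
    Prop where
  i_eq : s.v .i = i
  bs : s.a .bs i = b
  mem : Members w k ℓ s
  d : ∀ j < k, s.a .d j = δ j
  lt : i < w
  le : k ≤ i
  b_nonneg : 0 ≤ b
  b_le : b ≤ G.tmax
  δ_ge : ∀ j, -1 ≤ δ j
  δ_lt : ∀ j, δ j < G.tmax

theorem wp_weights (hZ : w + 2 < Z) (hB : (Z : ℤ) + G.tmax + 10 ≤ B) {r : ℕ} (hr : s.v .r = r)
    (ht : s.v .top = G.tmax) (h : Weighted G i k w b ℓ δ s)
    (hQ : ∀ s', Frame [.xa, .fl, .cc, .xl] [.a] s s' → (∀ j < k, s'.a .a j = δ j) →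
      s'.a .a k = b → (s'.v .fl = 1 ↔ ∃ j < k, δ j < b) →
      (s'.v .xl = 1 ↔ (∃ j < k, 1 ≤ ℓ j ∧ ℓ j ≤ r) ∨ i < r) →
      (∀ c : ℤ, 0 ≤ c → c ≤ G.tmax →
        (c ≤ s'.v .xa ↔ i ≤ r ∨ ∃ j < k, 1 ≤ ℓ j ∧ ℓ j ≤ r ∧ c ≤ δ j)) →
      s'.clk ≤ s.clk + 7 * k + 9 → Q s') : wp Z B Prog.weights Q s := by
  obtain ⟨hi, hbs, hm, hd, hiw, hki, hb0, hbt, hδ1, hδ2⟩ := h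
  simp only [Prog.weights, wp_seq, wp_assign, Expr.ok_zero, Expr.eval_zero, Expr.ok_lit,
    Expr.eval_lit]
  refine ⟨trivial, by omega, trivial, by omega, trivial, by omega, ?_⟩
  refine wp_loop_count k (fun n s' => Frame [.xa, .fl, .cc, .xl] [.a] s s' ∧ s'.v .cc = n ∧
    (∀ j < n, s'.a .a j = δ j) ∧ (s'.v .fl = 1 ↔ ∃ j < n, δ j < b) ∧
    (-2 ≤ s'.v .xa ∧ s'.v .xa ≤ G.tmax) ∧
    (∀ c : ℤ, -2 < c → (c ≤ s'.v .xa ↔ ∃ j < n, 1 ≤ ℓ j ∧ ℓ j ≤ r ∧ c ≤ δ j)) ∧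
    s'.clk ≤ s.clk + 7 * n + 3) ?_ ?_ ?_
  · rintro n hn s1 ⟨hF, hcc, h1, h2, h3, h4, h5⟩
    have hi1 : s1.v .i = i := (hF.v _ (by decide)).trans hi
    have hr1 : s1.v .r = r := (hF.v _ (by decide)).trans hr
    have hm1 := hm.frame hF (by decide) (by decide)
    have hk1 := hm1.k_eq
    have hl1 := hm1.ll n hn
    have hb1 : s1.a .bs i = b := by rw [hF.a _ (by decide), hbs]
    have hd1 : s1.a .d n = δ n := by rw [hF.a _ (by decide), hd n hn]
    have hlt := hm.lt n hn
    have e1 := hδ1 n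
    have e2 := hδ2 n
    refine ⟨by simp, by simp [hcc, hk1, hn], ?_⟩
    have key : ∀ s2 : St, (Frame [.xa, .fl, .cc, .xl] [.a] s s2 ∧ s2.v .cc = n ∧
        (∀ j < n + 1, s2.a .a j = δ j) ∧ s2.v .xa = s1.v .xa ∧ s2.clk ≤ s1.clk + 4 ∧
        (s2.v .fl = 1 ↔ ∃ j < n + 1, δ j < b)) →
        wp Z B (.ite (.and (.not (.lt Var.r (.ld .ll Var.cc))) (.and (.lt 0 (.ld .ll Var.cc))
          (.lt Var.xa (.ld .d Var.cc)))) (.xa ::= .ld .d Var.cc) .skip ;; .cc ::= Var.cc + 1)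
          (fun s' => Frame [.xa, .fl, .cc, .xl] [.a] s s' ∧ s'.v .cc = (n + 1 : ℕ) ∧
            (∀ j < n + 1, s'.a .a j = δ j) ∧ (s'.v .fl = 1 ↔ ∃ j < n + 1, δ j < b) ∧
            (-2 ≤ s'.v .xa ∧ s'.v .xa ≤ G.tmax) ∧
            (∀ c : ℤ, -2 < c → (c ≤ s'.v .xa ↔ ∃ j < n + 1, 1 ≤ ℓ j ∧ ℓ j ≤ r ∧ c ≤ δ j)) ∧
            s'.clk ≤ s.clk + 7 * (n + 1) + 3) s2 := by
      rintro s2 ⟨hF2, hcc2, ha2, hxa2, hclk2, hfl2⟩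
      have hr2 : s2.v .r = r := (hF2.v _ (by decide)).trans hr
      have hl2 := (hm.frame hF2 (by decide) (by decide)).ll n hn
      have hd2 : s2.a .d n = δ n := by rw [hF2.a _ (by decide), hd n hn]
      simp only [wp_ite, wp_seq, wp_assign, wp_skip, Cond.ok_lt, Cond.holds_lt, Cond.ok_and,
        Cond.holds_and, Cond.ok_not, Cond.holds_not, Expr.ok_ld,
        Expr.ok_var, Expr.ok_add, Expr.ok_one, Expr.ok_zero, Expr.eval_zero, Expr.eval_ld,
        Expr.eval_var, Expr.eval_add,
        Expr.eval_one, St.tick_v, St.tick_a, St.set_v, reduceCtorEq, if_false, if_true,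
        hcc2, hr2, hl2, hd2, hxa2, Int.toNat_natCast]
      refine ⟨by simp; omega, ?_, ?_⟩
      · rintro ⟨c1, c2, c3⟩
        refine ⟨by simp; omega, by omega, by simp, by omega, by simpa [Frame.set_iff] using hF2,
          by simp, by simpa using ha2, by simpa using hfl2, by omega, ?_, by simp; omega⟩
        intro c hc
        rw [Nat.exists_lt_succ_right, ← h4 c hc]
        omega
      · intro hcon
        refine ⟨by simp, by omega, by simpa [Frame.set_iff] using hF2,
          by simp, by simpa using ha2, by simpa using hfl2, by omega, ?_, by simp; omega⟩
        intro c hc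
        rw [Nat.exists_lt_succ_right, ← h4 c hc]
        omega
    simp only [wp_seq, wp_store, Expr.ok_var, Expr.ok_ld, Expr.eval_ld, Expr.eval_var,
      St.tick_v, St.tick_a, hcc, hd1, Int.toNat_natCast]
    have hF' : Frame [.xa, .fl, .cc, .xl] [.a] s (s1.tick.put .a n (δ n)) := by
      simpa [Frame.put_iff] using hF
    have ha' : ∀ j < n + 1, (s1.tick.put .a n (δ n)).a .a j = δ j := by
      intro j hj
      simp only [St.put_a, if_true, St.tick_a, Function.update_apply]
      split
      · next hh => rw [hh]
      · exact h1 j (by omega)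
    refine ⟨trivial, by simp; omega, by omega, by omega, wp_mono key ?_⟩
    simp only [wp_ite, Expr.ok_var, Expr.ok_ld, Expr.eval_ld, Expr.eval_var,
      St.tick_v, St.tick_a, hcc, hd1, Int.toNat_natCast, Cond.ok_lt, Cond.holds_lt, St.put_v,
      St.put_a, reduceCtorEq, if_false, hi1, hb1, wp_assign, wp_skip, Expr.ok_one, Expr.eval_one]
    refine ⟨by simp; omega, ?_, ?_⟩
    · intro hlt
      refine ⟨trivial, by omega, by simpa [Frame.set_iff] using hF', by simpa using hcc, ha',
        by simp, by simp, ?_⟩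
      simp only [St.set_v, if_true, true_iff]
      exact ⟨n, by omega, hlt⟩
    · intro hlt
      refine ⟨by simpa using hF', by simpa using hcc, ha', by simp, by simp, ?_⟩
      rw [h2, Nat.exists_lt_succ_right]
      simp [hlt]
  · rintro s1 ⟨hF, hcc, h1, h2, h3, h4, h5⟩
    have hi1 : s1.v .i = i := (hF.v _ (by decide)).trans hi
    have hr1 : s1.v .r = r := (hF.v _ (by decide)).trans hr
    have ht1 : s1.v .top = G.tmax := (hF.v _ (by decide)).trans ht
    have hk1 := (hm.frame hF (by decide) (by decide)).k_eq
    have hb1 : s1.a .bs i = b := by rw [hF.a _ (by decide), hbs]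
    refine ⟨by simp, by simp [hcc, hk1], ?_⟩
    -- Weights are at least `-1`, so the initial value `-2` persists exactly if no member lies in
    -- `1, …, r`.
    have hxa : -2 < s1.v .xa ↔ ∃ j < k, 1 ≤ ℓ j ∧ ℓ j ≤ r := by
      have := h4 (-1) (by omega)
      rw [show -2 < s1.v .xa ↔ -1 ≤ s1.v .xa by omega, this]
      simp only [hδ1, and_true]
    have ha : ∀ j < k, Function.update (s1.a .a) k b j = δ j := fun j hj => by
      rw [Function.update_of_ne (by omega), h1 j hj]
    simp only [wp_seq, wp_store, wp_ite, Expr.ok_var, Expr.ok_ld, Expr.eval_ld, Expr.eval_var,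
      St.tick_v, St.tick_a, hk1, hb1, hr1, hi1, ht1, Int.toNat_natCast, Cond.ok_lt, Cond.holds_lt,
      St.put_v, Cond.ok_and, Cond.holds_and, Cond.ok_not, Cond.holds_not, Expr.ok_lit,
      Expr.eval_lit, St.set_v, Expr.ok_zero, Expr.eval_zero, hxa, Nat.cast_lt,
      reduceCtorEq, if_false, wp_assign, wp_skip, Expr.ok_one, Expr.eval_one]
    have fin : ∀ s2 : St, Frame [.xa, .fl, .cc, .xl] [.a] s s2 →
        s2.a .a = Function.update (s1.a .a) k b → s2.v .fl = s1.v .fl → s2.v .xa = s1.v .xa →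
        s2.clk ≤ s1.clk + 4 → (s2.v .xl = 1 ↔ (∃ j < k, 1 ≤ ℓ j ∧ ℓ j ≤ r) ∨ i < r) →
        (¬ r < i → Q (s2.tick.set .xa G.tmax)) ∧ (¬ ¬ r < i → Q s2.tick.tick) := by
      intro s2 hF2 ha2 hfl2 hxa2 hclk2 hxl2
      constructor
      · intro hri
        refine hQ _ (by simpa [Frame.set_iff] using hF2) ?_ ?_ ?_ ?_ ?_ ?_
        · simpa [ha2] using ha
        · simp [ha2]
        · simpa [hfl2] using h2
        · simpa using hxl2
        · intro c hc1 hc2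
          simp only [St.set_v, if_true, hc2, true_iff]
          exact .inl (by omega)
        · simp; omega
      · intro hri
        refine hQ _ (by simpa using hF2) ?_ ?_ ?_ ?_ ?_ ?_
        · simpa [ha2] using ha
        · simp [ha2]
        · simpa [hfl2] using h2
        · simpa using hxl2
        · intro c hc1 hc2
          simp only [St.tick_v, hxa2]
          rw [h4 c (by omega)]
          exact ⟨.inr, fun hh => hh.resolve_left (by omega)⟩
        · simp; omega
    refine ⟨trivial, by simp; omega, by omega, by omega, by simp, ?_, ?_⟩
    · rintro ⟨hc1, hc2⟩
      refine ⟨trivial, by omega, by simp, ?_⟩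
      have := fin ((((s1.tick.put .a k b).tick.set .xl 0))) (by simpa [Frame.set_iff, Frame.put_iff] using hF) (by simp)
        (by simp) (by simp) (by simp) (by simp [hc2]; simpa using hc1)
      exact ⟨fun hri => ⟨trivial, by omega, this.1 hri⟩, this.2⟩
    · intro hc1
      refine ⟨trivial, by omega, by simp, ?_⟩
      have := fin ((((s1.tick.put .a k b).tick.set .xl 1))) (by simpa [Frame.set_iff, Frame.put_iff] using hF) (by simp)
        (by simp) (by simp) (by simp) (by
          simp only [St.set_v, if_true, true_iff]
          by_contra hcon
          exact hc1 ⟨fun hh => hcon (.inl hh), fun hh => hcon (.inr hh)⟩)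
      exact ⟨fun hri => ⟨trivial, by omega, this.1 hri⟩, this.2⟩
  · refine ⟨by simpa [Frame.set_iff] using Frame.refl _ _ _, by simp, by simp, by simp, by simp,
      ?_, by simp⟩
    intro c hc
    simp only [St.set_v, reduceCtorEq, if_false, if_true]
    simp
    omega

end ThickEdgeGraph


/-! ### Testing and selecting the candidates -/

namespace ThickEdgeGraph

open Cmd

variable {G : ThickEdgeGraph} {bm Z : ℕ} {B : ℤ} {s : St} {Q : St → Prop} {u : Fin G.n} {T : ℤ}
  {i k w : ℕ} {b : ℤ} {ℓ : ℕ → ℕ} {δ α : ℕ → ℤ} {L : Finset ℕ}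

/-- The candidate keys are listed in the array `a`. -/
structure Keys (G : ThickEdgeGraph) (i k w : ℕ) (b : ℤ) (ℓ : ℕ → ℕ) (α : ℕ → ℤ) (s : St) :
    Prop where
  i_eq : s.v .i = i
  bs : s.a .bs i = b
  mem : Members w k ℓ s
  a : ∀ j ≤ k, s.a .a j = α j
  lt : i < w
  le : k ≤ i
  b_nonneg : 0 ≤ b
  b_le : b ≤ G.tmax
  α_ge : ∀ j, -1 ≤ α j
  α_le : ∀ j, α j ≤ G.tmax

theorem Keys.frame {V : List Var} {A : List Arr} {s' : St} (h : Keys G i k w b ℓ α s)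
    (hF : Frame V A s s') (hV : ∀ x ∈ [Var.i, .k], x ∉ V) (hA : ∀ x ∈ [Arr.bs, .ll, .a], x ∉ A) :
    Keys G i k w b ℓ α s' where
  i_eq := (hF.v _ (hV _ (by decide))).trans h.i_eq
  bs := by rw [hF.a _ (hA _ (by decide)), h.bs]
  mem := h.mem.frame hF (hV _ (by decide)) (hA _ (by decide))
  a := by rw [hF.a _ (hA _ (by decide))]; exact h.a
  lt := h.lt
  le := h.le
  b_nonneg := h.b_nonneg
  b_le := h.b_le
  α_ge := h.α_ge
  α_le := h.α_le

theorem wp_initOk (hZ : w + 2 < Z) (hB : (Z : ℤ) + G.tmax + 10 ≤ B) (hbm : s.v .bm = bm)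
    (h : Keys G i k w b ℓ α s)
    (hQ : ∀ s', Frame [.cc] [.ok] s s' → (∀ c ≤ k, s'.a .ok c = 1 ↔
      bm ≤ α c ∧ α c ≤ b ∧ α c < s.v .b0 ∧ α c ≤ α 0 ∧ α c ≤ s.v .xa) →
      s'.clk ≤ s.clk + 4 * k + 6 → Q s') : wp Z B Prog.initOk Q s := by
  have hlt := h.lt
  have hle := h.le
  simp only [Prog.initOk, wp_seq, wp_assign, Expr.ok_zero, Expr.eval_zero]
  refine ⟨trivial, by omega, ?_⟩
  refine wp_loop_count (k + 1) (fun n s' => Frame [.cc] [.ok] s s' ∧ s'.v .cc = n ∧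
    (∀ c < n, s'.a .ok c = 1 ↔
      bm ≤ α c ∧ α c ≤ b ∧ α c < s.v .b0 ∧ α c ≤ α 0 ∧ α c ≤ s.v .xa) ∧
    s'.clk ≤ s.clk + 4 * n + 1) ?_ ?_ ?_
  · rintro n hn s1 ⟨hF, hcc, h1, h2⟩
    have hK := h.frame hF (by decide) (by decide)
    have hk1 := hK.mem.k_eq
    have hi1 := hK.i_eq
    have hb1 := hK.bs
    have ha1 := hK.a n (by omega)
    have ha0 := hK.a 0 (by omega)
    have hbm1 : s1.v .bm = bm := (hF.v _ (by decide)).trans hbm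
    have hb0 : s1.v .b0 = s.v .b0 := hF.v _ (by decide)
    have hxa : s1.v .xa = s.v .xa := hF.v _ (by decide)
    refine ⟨by simp, by simp [hcc, hk1]; omega, ?_⟩
    have put : ∀ z : ℤ, (z = 1 ↔
        bm ≤ α n ∧ α n ≤ b ∧ α n < s.v .b0 ∧ α n ≤ α 0 ∧ α n ≤ s.v .xa) → ∀ c < n + 1,
        Function.update (s1.a .ok) n z c = 1 ↔
          bm ≤ α c ∧ α c ≤ b ∧ α c < s.v .b0 ∧ α c ≤ α 0 ∧ α c ≤ s.v .xa := by
      intro z hz c hc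
      rw [Function.update_apply]
      split
      · next hh => rw [hh]; exact hz
      · exact h1 c (by omega)
    simp only [wp_ite, wp_seq, wp_assign, wp_store, Cond.ok_lt, Cond.holds_lt, Cond.ok_and,
      Cond.holds_and, Cond.ok_not, Cond.holds_not, Expr.ok_ld, Expr.ok_var, Expr.ok_add,
      Expr.ok_one, Expr.ok_zero, Expr.eval_zero, Expr.eval_ld, Expr.eval_var, Expr.eval_add,
      Expr.eval_one, St.tick_v, St.tick_a, St.put_v, hcc, hi1, hb1, ha1, ha0,
      hbm1, hb0, hxa, Int.toNat_natCast, Int.toNat_zero]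
    refine ⟨by simp; omega, ?_, ?_⟩
    · rintro ⟨c1, c2, c3, c4, c5⟩
      refine ⟨trivial, trivial, by omega, by omega, by simp, by omega, ?_, by simp, ?_, ?_⟩
      · simpa [Frame.set_iff, Frame.put_iff] using hF
      · simp only [St.set_a, St.put_a, if_true]
        refine put 1 ⟨fun _ => ?_, fun _ => rfl⟩
        exact ⟨not_lt.1 c1, not_lt.1 c2, c3, not_lt.1 c4, not_lt.1 c5⟩
      · simp; omega
    · intro hcon
      refine ⟨trivial, trivial, by omega, by omega, by simp, by omega, ?_, by simp, ?_, ?_⟩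
      · simpa [Frame.set_iff, Frame.put_iff] using hF
      · simp only [St.set_a, St.put_a, if_true]
        refine put 0 ⟨by simp, fun hh => absurd ?_ hcon⟩
        obtain ⟨c1, c2, c3, c4, c5⟩ := hh
        exact ⟨not_lt.2 c1, not_lt.2 c2, c3, not_lt.2 c4, not_lt.2 c5⟩
      · simp; omega
  · rintro s1 ⟨hF, hcc, h1, h2⟩
    have hk1 := (h.frame hF (by decide) (by decide)).mem.k_eq
    refine ⟨by simp, by simp [hcc, hk1], hQ _ (by simpa using hF) (fun c hc => h1 c (by omega)) ?_⟩
    simp; omega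
  · refine ⟨by simpa [Frame.set_iff] using Frame.refl _ _ _, by simp, by simp, by simp⟩

theorem wp_pairs (hZ : w + 2 < Z) (hB : (Z : ℤ) + G.tmax + 10 ≤ B)
    (h : Keys G i k w b ℓ α s) (hd : ∀ j < k, s.a .d j = δ j)
    (hQ : ∀ s', Frame [.jj, .e] [] s s' → (s'.v .e = 0 ↔
      s.v .e = 0 ∧ ¬ ∃ j < k, δ j = b ∧ b ≤ α j ∧ b ≤ s.v .ay) →
      s'.clk ≤ s.clk + 4 * k + 2 → Q s') : wp Z B Prog.pairs Q s := by
  have hlt := h.lt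
  have hle := h.le
  simp only [Prog.pairs, wp_seq, wp_assign, Expr.ok_zero, Expr.eval_zero]
  refine ⟨trivial, by omega, ?_⟩
  refine wp_loop_count k (fun n s' => Frame [.jj, .e] [] s s' ∧ s'.v .jj = n ∧
    (s'.v .e = 0 ↔ s.v .e = 0 ∧ ¬ ∃ j < n, δ j = b ∧ b ≤ α j ∧ b ≤ s.v .ay) ∧
    s'.clk ≤ s.clk + 4 * n + 1) ?_ ?_ ?_
  · rintro n hn s1 ⟨hF, hjj, h1, h2⟩
    have hK := h.frame hF (by decide) (by decide)
    have hk1 := hK.mem.k_eq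
    have hi1 := hK.i_eq
    have hb1 := hK.bs
    have ha1 := hK.a n (by omega)
    have hd1 : s1.a .d n = δ n := by rw [hF.a _ (by decide), hd n hn]
    have hay : s1.v .ay = s.v .ay := hF.v _ (by decide)
    refine ⟨by simp, by simp [hjj, hk1]; omega, ?_⟩
    simp only [wp_ite, wp_seq, wp_assign, wp_skip, Cond.ok_lt, Cond.holds_lt, Cond.ok_and,
      Cond.holds_and, Cond.ok_not, Cond.holds_not, Cond.ok_eq, Cond.holds_eq, Expr.ok_ld,
      Expr.ok_var, Expr.ok_add, Expr.ok_one, Expr.eval_ld, Expr.eval_var, Expr.eval_add,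
      Expr.eval_one, St.tick_v, St.tick_a, St.set_v, reduceCtorEq, if_false, hjj, hi1, hb1,
      ha1, hd1, hay, Int.toNat_natCast, Nat.exists_lt_succ_right]
    refine ⟨by simp; omega, ?_, ?_⟩
    · rintro ⟨c1, c2, c3⟩
      refine ⟨trivial, by omega, by simp, by omega, by simpa [Frame.set_iff] using hF, by simp,
        ?_, by simp; omega⟩
      simp [c1, not_lt.1 c2, not_lt.1 c3]
    · intro hcon
      refine ⟨by simp, by omega, by simpa [Frame.set_iff] using hF, by simp, ?_, by simp; omega⟩
      have : ¬ (δ n = b ∧ b ≤ α n ∧ b ≤ s.v .ay) := fun ⟨c1, c2, c3⟩ =>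
        hcon ⟨c1, not_lt.2 c2, not_lt.2 c3⟩
      simpa only [this, or_false, if_neg, St.tick_v] using h1
  · rintro s1 ⟨hF, hcc, h1, h2⟩
    have hk1 := (h.frame hF (by decide) (by decide)).mem.k_eq
    exact ⟨by simp, by simp [hcc, hk1], hQ _ (by simpa using hF) h1 (by simp; omega)⟩
  · refine ⟨by simpa [Frame.set_iff] using Frame.refl _ _ _, by simp, by simp, by simp⟩

theorem wp_testBad (hZ : w + 2 < Z) (hB : (Z : ℤ) + G.tmax + 10 ≤ B)
    (h : Keys G i k w b ℓ α s) (hd : ∀ j < k, s.a .d j = δ j) {y c : ℕ} (hy : s.v .y = y)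
    (hcc : s.v .cc = c) (hck : c ≤ k)
    (hQ : ∀ s', Frame [.s1, .s2, .jj] [] s s' → (s'.v .s1 = 1 ↔ ∀ j < k, α c ≤ α j → α c ≤ δ j) →
      (s'.v .s2 = 0 ↔ ∃ j < k, ℓ j < y ∧ δ j < α c) →
      s'.clk ≤ s.clk + 6 * k + 4 → Q s') : wp Z B Prog.testBad Q s := by
  have hlt := h.lt
  have hle := h.le
  simp only [Prog.testBad, wp_seq, wp_assign, Expr.ok_zero, Expr.eval_zero, Expr.ok_one,
    Expr.eval_one]
  refine ⟨trivial, by omega, trivial, by omega, trivial, by omega, ?_⟩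
  refine wp_loop_count k (fun n s' => Frame [.s1, .s2, .jj] [] s s' ∧ s'.v .jj = n ∧
    (s'.v .s1 = 1 ↔ ∀ j < n, α c ≤ α j → α c ≤ δ j) ∧
    (s'.v .s2 = 0 ↔ ∃ j < n, ℓ j < y ∧ δ j < α c) ∧
    s'.clk ≤ s.clk + 6 * n + 3) ?_ ?_ ?_
  · rintro n hn s1 ⟨hF, hjj, h1, h2, h3⟩
    have hK := h.frame hF (by decide) (by decide)
    have hk1 := hK.mem.k_eq
    have ha1 := hK.a n (by omega)
    have hac := hK.a c (by omega)
    have hl1 := hK.mem.ll n hn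
    have hd1 : s1.a .d n = δ n := by rw [hF.a _ (by decide), hd n hn]
    have hy1 : s1.v .y = y := (hF.v _ (by decide)).trans hy
    have hc1 : s1.v .cc = c := (hF.v _ (by decide)).trans hcc
    refine ⟨by simp, by simp [hjj, hk1]; omega, ?_⟩
    simp only [wp_ite, wp_seq, wp_assign, wp_skip, Cond.ok_lt, Cond.holds_lt, Cond.ok_and,
      Cond.holds_and, Cond.ok_not, Cond.holds_not, Expr.ok_ld,
      Expr.ok_var, Expr.ok_add, Expr.ok_one, Expr.eval_ld, Expr.eval_var, Expr.eval_add,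
      Expr.ok_zero, Expr.eval_zero,
      Expr.eval_one, St.tick_v, St.tick_a, St.set_v, St.set_a, reduceCtorEq, if_false, hjj, hc1, ha1, hac, hl1, hd1, hy1, Int.toNat_natCast, Nat.exists_lt_succ_right,
      Nat.forall_lt_succ_right, if_true, Nat.cast_lt]
    refine ⟨by simp; omega, ?_, ?_⟩ <;> intro hc1 <;>
      [refine ⟨trivial, by omega, ?_⟩; skip] <;> refine ⟨by simp; omega, ?_, ?_⟩ <;> intro hc2 <;>
      [refine ⟨trivial, by omega, ?_⟩; skip; refine ⟨trivial, by omega, ?_⟩; skip] <;>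
      refine ⟨by simp, by omega, by simpa [Frame.set_iff] using hF, by simp, ?_, ?_,
        by simp; omega⟩ <;> simp [h1, h2] <;> grind
  · rintro s1 ⟨hF, hcc, h1, h2, h3⟩
    have hk1 := (h.frame hF (by decide) (by decide)).mem.k_eq
    exact ⟨by simp, by simp [hcc, hk1], hQ _ (by simpa using hF) h1 h2 (by simp; omega)⟩
  · refine ⟨by simpa [Frame.set_iff] using Frame.refl _ _ _, by simp, by simp, by simp, by simp⟩

/-- The condition `LocalGraph.Bad` in terms of the arrays. -/
def BadKey (k : ℕ) (ℓ : ℕ → ℕ) (α δ : ℕ → ℤ) (y : ℕ) (ay c : ℤ) : Prop :=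
  (∀ j < k, c ≤ α j → c ≤ δ j) ∧ (c ≤ ay ∨ ∀ j < k, ℓ j < y → c ≤ δ j)

theorem wp_bads (hZ : w + 2 < Z) (hB : (Z : ℤ) + G.tmax + 10 ≤ B)
    (h : Keys G i k w b ℓ α s) (hd : ∀ j < k, s.a .d j = δ j) {y : ℕ} (hy : s.v .y = y)
    (hQ : ∀ s', Frame [.cc, .s1, .s2, .jj] [.ok] s s' →
      (∀ c ≤ k, s'.a .ok c = 1 ↔ s.a .ok c = 1 ∧ ¬ BadKey k ℓ α δ y (s.v .ay) (α c)) →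
      s'.clk ≤ s.clk + (k + 1) * (6 * k + 8) + 2 → Q s') : wp Z B Prog.bads Q s := by
  have hlt := h.lt
  have hle := h.le
  simp only [Prog.bads, wp_seq, wp_assign, Expr.ok_zero, Expr.eval_zero]
  refine ⟨trivial, by omega, ?_⟩
  refine wp_loop_count (k + 1) (fun n s' => Frame [.cc, .s1, .s2, .jj] [.ok] s s' ∧
    s'.v .cc = n ∧ (∀ c ≤ k, s'.a .ok c = 1 ↔
      s.a .ok c = 1 ∧ (c < n → ¬ BadKey k ℓ α δ y (s.v .ay) (α c))) ∧
    s'.clk ≤ s.clk + n * (6 * k + 8) + 1) ?_ ?_ ?_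
  · rintro n hn s1 ⟨hF, hcc, h1, h2⟩
    have hK := h.frame hF (by decide) (by decide)
    have hk1 := hK.mem.k_eq
    have hd1 : ∀ j < k, s1.a .d j = δ j := by rw [hF.a _ (by decide)]; exact hd
    have hy1 : s1.v .y = y := (hF.v _ (by decide)).trans hy
    have hay : s1.v .ay = s.v .ay := hF.v _ (by decide)
    refine ⟨by simp, by simp [hcc, hk1]; omega, ?_⟩
    rw [wp_seq]
    refine wp_testBad hZ hB (hK.frame (s' := s1.tick) (V := []) (A := []) (by
      simpa using Frame.refl _ _ _) (by decide) (by decide)) hd1 hy1 hcc (by omega) ?_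
    intro s2 hF2 e1 e2 e3
    have hF3 : Frame [.cc, .s1, .s2, .jj] [.ok] s s2 :=
      Frame.trans_of (s' := s1.tick) (by simpa using hF) hF2 (by decide) (by decide)
    have hK2 := h.frame hF3 (by decide) (by decide)
    have hcc2 : s2.v .cc = n := (hF2.v _ (by decide)).trans hcc
    have hay2 : s2.v .ay = s.v .ay := hF3.v _ (by decide)
    have ha2 := hK2.a n (by omega)
    have hok2 : s2.a .ok = s1.a .ok := hF2.a _ (by decide)
    have hbad : (∀ j < k, α n ≤ α j → α n ≤ δ j) ∧
        ¬ (s.v .ay < α n ∧ ∃ j < k, ℓ j < y ∧ δ j < α n) ↔ BadKey k ℓ α δ y (s.v .ay) (α n) := by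
      rw [BadKey, not_and_or, not_lt]
      push Not
      rfl
    simp only [wp_ite, wp_seq, wp_assign, wp_skip, wp_store, Cond.ok_lt, Cond.holds_lt,
      Cond.ok_and, Cond.holds_and, Cond.ok_not, Cond.holds_not, Cond.ok_eq, Cond.holds_eq,
      Expr.ok_ld, Expr.ok_var, Expr.ok_add, Expr.ok_one, Expr.eval_ld, Expr.eval_var,
      Expr.eval_add, Expr.ok_zero, Expr.eval_zero, Expr.eval_one, St.tick_v, St.put_v,
      hcc2, hay2, ha2, Int.toNat_natCast, e1, e2, hbad]
    refine ⟨by simp; omega, ?_, ?_⟩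
    · intro hb
      refine ⟨trivial, trivial, by omega, by omega, by simp, by omega, ?_, by simp, ?_, ?_⟩
      · simpa [Frame.set_iff, Frame.put_iff] using hF3
      · intro c hc
        simp only [St.set_a, St.put_a, if_true, Function.update_apply]
        split
        · next hh => subst hh; simp [hb]
        · next hh =>
          rw [St.tick_a, hok2, h1 c hc]
          have : c < n + 1 ↔ c < n := by omega
          rw [this]
      · simp at e3 ⊢; nlinarith
    · intro hb
      refine ⟨by simp, by omega, ?_, by simp, ?_, ?_⟩
      · simpa [Frame.set_iff, Frame.put_iff] using hF3
      · intro c hc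
        simp only [St.set_a, St.tick_a]
        rw [hok2, h1 c hc]
        refine and_congr_right fun _ => ⟨fun hh hlt => ?_, fun hh hlt => hh (by omega)⟩
        rcases Nat.lt_succ_iff_lt_or_eq.1 hlt with h5 | h5
        · exact hh h5
        · rw [h5]; exact hb
      · simp at e3 ⊢; nlinarith
  · rintro s1 ⟨hF, hcc, h1, h2⟩
    have hk1 := (h.frame hF (by decide) (by decide)).mem.k_eq
    refine ⟨by simp, by simp [hcc, hk1], hQ _ (by simpa using hF) (fun c hc => ?_) ?_⟩
    · have : c < k + 1 := by omega
      rw [St.tick_a, h1 c hc]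
      simp [this]
    · simp; omega
  · refine ⟨by simpa [Frame.set_iff] using Frame.refl _ _ _, by simp, by simp, by simp⟩

/-- The last candidate counts only if `e` is set. Valid candidates are non-negative, so a negative
`best` after the loop means that none was valid, and only then the key `-1` is considered. -/
theorem wp_select (hZ : w + 2 < Z) (hB : (Z : ℤ) + G.tmax + 10 ≤ B) (h : Keys G i k w b ℓ α s)
    (hok : ∀ c ≤ k, s.a .ok c = 1 → 0 ≤ α c)
    (hQ : ∀ s', Frame [.best, .cc] [.ok] s s' →
      ((∃ c ≤ k, (s.a .ok c = 1 ∧ (c = k → s.v .e ≠ 0)) ∧ s'.v .best = α c ∧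
        ∀ c' ≤ k, s.a .ok c' = 1 → (c' = k → s.v .e ≠ 0) → α c' ≤ α c) ∨
       ((∀ c ≤ k, s.a .ok c = 1 → ¬ (c = k → s.v .e ≠ 0)) ∧
        ((-1 < s.v .b0 ∧ s.v .fl = 1 ∧ s.v .xl = 1 ∧ s'.v .best = -1) ∨
         (¬ (-1 < s.v .b0 ∧ s.v .fl = 1 ∧ s.v .xl = 1) ∧ s'.v .best = -2)))) →
      s'.clk ≤ s.clk + 4 * k + 11 → Q s') : wp Z B Prog.select Q s := by
  have hlt := h.lt
  have hle := h.le
  have h1B : (10 : ℤ) ≤ B := by omega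
  have key : ∀ s0 : St, (Frame [.best, .cc] [.ok] s s0 ∧
      (∀ c ≤ k, s0.a .ok c = 1 ↔ s.a .ok c = 1 ∧ (c = k → s.v .e ≠ 0)) ∧
      s0.clk ≤ s.clk + 2) → wp Z B (.best ::= .lit (-2) ;; .cc ::= 0 ;;
        .loop (.lt Var.cc (Var.k + 1)) (
          .ite (.and (.eq (.ld .ok Var.cc) 1) (.lt Var.best (.ld .a Var.cc)))
            (.best ::= .ld .a Var.cc) .skip ;;
          .cc ::= Var.cc + 1) ;;
        .ite (.and (.lt Var.best 0) (.and (.lt (.lit (-1)) Var.b0) (.and (.eq Var.fl 1)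
          (.eq Var.xl 1)))) (.best ::= .lit (-1)) .skip) Q s0 := by
    rintro s0 ⟨hF0, hok0, hc0⟩
    simp only [wp_seq, wp_assign, Expr.ok_zero, Expr.eval_zero, Expr.ok_lit, Expr.eval_lit]
    refine ⟨trivial, by omega, trivial, by omega, ?_⟩
    refine wp_loop_count (k + 1) (fun n s' => Frame [.best, .cc] [.ok] s s' ∧
      s'.a .ok = s0.a .ok ∧ s'.v .cc = n ∧
      ((∃ c < n, s0.a .ok c = 1 ∧ s'.v .best = α c ∧
        ∀ c' < n, s0.a .ok c' = 1 → α c' ≤ α c) ∨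
       ((∀ c < n, s0.a .ok c ≠ 1) ∧ s'.v .best = -2)) ∧
      s'.clk ≤ s.clk + 4 * n + 4) ?_ ?_ ?_
    · rintro n hn s1 ⟨hF, ho, hcc, h1, h2⟩
      have hK := h.frame hF (by decide) (by decide)
      have hk1 := hK.mem.k_eq
      have ha1 := hK.a n (by omega)
      have hα := h.α_ge n
      have hα' := h.α_le n
      refine ⟨by simp, by simp [hcc, hk1]; omega, ?_⟩
      simp only [wp_ite, wp_seq, wp_assign, wp_skip, Cond.ok_lt, Cond.holds_lt, Cond.ok_and,
        Cond.holds_and, Cond.ok_eq, Cond.holds_eq, Expr.ok_ld,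
        Expr.ok_var, Expr.ok_add, Expr.ok_one, Expr.eval_ld, Expr.eval_var, Expr.eval_add,
        Expr.eval_one, St.tick_v, St.tick_a, St.set_v, St.set_a, reduceCtorEq, if_false, if_true,
        hcc, ha1, ho, Int.toNat_natCast]
      refine ⟨by simp; omega, ?_, ?_⟩
      · rintro ⟨c1, c2⟩
        refine ⟨by simp; omega, by omega, by simp, by omega, by simpa [Frame.set_iff] using hF,
          trivial, by simp, .inl ⟨n, by omega, c1, rfl, ?_⟩, by simp; omega⟩
        intro c' hc' hc1
        rcases Nat.lt_succ_iff_lt_or_eq.1 hc' with h5 | h5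
        · rcases h1 with ⟨c, -, -, h6, h7⟩ | ⟨h6, -⟩
          · have := h7 c' h5 hc1; omega
          · exact absurd hc1 (h6 c' h5)
        · rw [h5]
      · intro hcon
        refine ⟨by simp, by omega, by simpa [Frame.set_iff] using hF, trivial, by simp, ?_,
          by simp; omega⟩
        rcases h1 with ⟨c, h5, h6, h7, h8⟩ | ⟨h5, h6⟩
        · refine .inl ⟨c, by omega, h6, h7, fun c' hc' hc1 => ?_⟩
          rcases Nat.lt_succ_iff_lt_or_eq.1 hc' with h9 | h9
          · exact h8 c' h9 hc1
          · subst h9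
            rw [← h7]; exact not_lt.1 fun h => hcon ⟨hc1, h⟩
        · refine .inr ⟨fun c hc hc1 => ?_, h6⟩
          rcases Nat.lt_succ_iff_lt_or_eq.1 hc with h9 | h9
          · exact h5 c h9 hc1
          · subst h9; exact hcon ⟨hc1, by omega⟩
    · rintro s1 ⟨hF, ho, hcc, h1, h2⟩
      have hk1 := (h.frame hF (by decide) (by decide)).mem.k_eq
      have e1 : s1.v .b0 = s.v .b0 := hF.v _ (by decide)
      have e2 : s1.v .fl = s.v .fl := hF.v _ (by decide)
      have e3 : s1.v .xl = s.v .xl := hF.v _ (by decide)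
      refine ⟨by simp, by simp [hcc, hk1], ?_⟩
      simp only [wp_ite, wp_assign, wp_skip, Cond.ok_lt, Cond.holds_lt, Cond.ok_and,
        Cond.holds_and, Cond.ok_eq, Cond.holds_eq, Expr.ok_lit, Expr.eval_lit, Expr.ok_zero,
        Expr.ok_var, Expr.ok_one, Expr.eval_var, Expr.eval_one, Expr.eval_zero, St.tick_v, e1, e2,
        e3]
      rcases h1 with ⟨c, h3, h4, h5, h6⟩ | ⟨h3, h4⟩
      · have hc := (hok0 c (by omega)).1 h4
        have := hok c (by omega) hc.1
        refine ⟨by simp, fun hh => by omega, fun _ => hQ _ (by simpa using hF) (.inl ⟨c, by omega,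
          hc, h5, fun c' hc' h7 h8 => h6 c' (by omega) ((hok0 c' hc').2 ⟨h7, h8⟩)⟩)
          (by simp; omega)⟩
      · have h5 : ∀ c ≤ k, s.a .ok c = 1 → ¬ (c = k → s.v .e ≠ 0) := fun c hc h6 h7 =>
          h3 c (by omega) ((hok0 c hc).2 ⟨h6, h7⟩)
        refine ⟨by simp, fun hh => ⟨trivial, by omega, hQ _ (by simpa [Frame.set_iff] using hF)
          (.inr ⟨h5, .inl ?_⟩) (by simp; omega)⟩, fun hh => hQ _ (by simpa using hF)
          (.inr ⟨h5, .inr ?_⟩) (by simp; omega)⟩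
        · simpa using hh.2
        · simp only [St.tick_v, h4, and_true]
          exact fun h7 => hh ⟨by omega, h7⟩
    · refine ⟨by simpa [Frame.set_iff] using hF0, rfl, by simp, .inr ⟨by simp, by simp⟩,
        by simp; omega⟩
  have hk := h.mem.k_eq
  rw [Prog.select, wp_seq]
  refine wp_mono key ?_
  simp only [wp_ite, wp_store, wp_skip, Cond.ok_eq, Cond.holds_eq, Expr.ok_var, Expr.ok_zero,
    Expr.eval_var, Expr.eval_zero, St.tick_v, hk, Int.toNat_natCast]
  refine ⟨by simp, fun he => ⟨trivial, trivial, by omega, by omega, ?_, ?_, by simp⟩,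
    fun he => ⟨?_, ?_, by simp⟩⟩
  · simpa [Frame.put_iff] using Frame.refl _ _ _
  · intro c hc
    simp only [St.put_a, if_true, Function.update_apply, St.tick_a]
    split
    · next hh => simp [hh, he]
    · next hh => simp [hh]
  · simpa using Frame.refl _ _ _
  · intro c hc
    simp [he]

end ThickEdgeGraph


/-! ### Finding the next child -/

namespace ThickEdgeGraph

open Cmd

variable {G : ThickEdgeGraph} {bm Z : ℕ} {B : ℤ} {s : St} {Q : St → Prop} {u : Fin G.n} {T : ℤ}
  {i k w : ℕ} {b : ℤ} {ℓ : ℕ → ℕ} {δ α : ℕ → ℤ} {L : Finset ℕ}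

theorem R_self (x : G.SV) : R bm x x = -1 := by
  rcases R_cases bm x x with ⟨a, h, -⟩ | ⟨h, -⟩
  · exact absurd rfl h.ne
  · exact h

/-- The single number `q` dominates the three costs of a round: a row, one lookup, and the `O(k²)`
test of all candidates against `y`. -/
theorem wp_scan (hr : Room G Z B) (hc : Ctx G bm u T s)
    (h : Keys G i k (localList bm u T).length b ℓ α s)
    (hst : ∀ x < i, x ∈ L ↔ (i : ℤ) < s.a .st x) {q : ℕ} (hq1 : work bm u T k ℓ ≤ q)
    (hq2 : k * k ≤ q) (hq3 : ∀ y, (G.adj bm (sv bm u T y).1).length + 1 ≤ q)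
    (hQ : ∀ s', Frame [.e, .y, .jj, .zv, .zt, .yv, .yt, .c, .res, .rh, .ay, .cc, .s1, .s2]
        [.d, .hh, .ok] s s' →
      (s'.v .e = 0 ↔ ¬ ∃ y < i, y ∈ L ∧ ∃ j < k, R bm (sv bm u T (ℓ j)) (sv bm u T y) = b ∧
        b ≤ α j ∧ b ≤ R bm (sv bm u T y) (sv bm u T i)) →
      (∀ c ≤ k, s'.a .ok c = 1 ↔ s.a .ok c = 1 ∧ ∀ y < i, y ∉ L → ¬ BadKey k ℓ α
        (fun j => R bm (sv bm u T (ℓ j)) (sv bm u T y)) y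
        (R bm (sv bm u T y) (sv bm u T i)) (α c)) →
      s'.clk ≤ s.clk + 70 * q * i + 3 → Q s') : wp Z B Prog.scan Q s := by
  have hlt := h.lt
  have hle := h.le
  have hZ := localList_lt_Z (bm := bm) (u := u) (T := T) hr
  have hB := hr.le_B
  have hZ' := hr.le_Z
  simp only [Prog.scan, wp_seq, wp_assign, Expr.ok_zero, Expr.eval_zero]
  refine ⟨trivial, by omega, trivial, by omega, ?_⟩
  refine wp_loop_count i (fun n s' => Frame [.e, .y, .jj, .zv, .zt, .yv, .yt, .c, .res, .rh, .ay,
      .cc, .s1, .s2] [.d, .hh, .ok] s s' ∧ s'.v .y = n ∧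
    (s'.v .e = 0 ↔ ¬ ∃ y < n, y ∈ L ∧ ∃ j < k, R bm (sv bm u T (ℓ j)) (sv bm u T y) = b ∧
      b ≤ α j ∧ b ≤ R bm (sv bm u T y) (sv bm u T i)) ∧
    (∀ c ≤ k, s'.a .ok c = 1 ↔ s.a .ok c = 1 ∧ ∀ y < n, y ∉ L → ¬ BadKey k ℓ α
      (fun j => R bm (sv bm u T (ℓ j)) (sv bm u T y)) y
      (R bm (sv bm u T y) (sv bm u T i)) (α c)) ∧
    s'.clk ≤ s.clk + 70 * q * n + 2) ?_ ?_ ?_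
  · rintro n hn s1 ⟨hF, hy, h1, h2, h3⟩
    have hK := h.frame hF (by decide) (by decide)
    have hc1 := hc.frame hF (by decide) (by decide)
    refine ⟨by simp, by simp [hy, hK.i_eq, hn], ?_⟩
    have hF0 : Frame [] [] s1 s1.tick := by simpa using Frame.refl _ _ _
    rw [wp_seq]
    refine wp_row hr (hc1.frame hF0 (by decide) (by decide))
      (hK.mem.frame hF0 (by decide) (by decide)) (y := n) (by omega) hy ?_
    intro s2 hF2 hd2 _ hclk2
    have hF2' : Frame [.e, .y, .jj, .zv, .zt, .yv, .yt, .c, .res, .rh, .ay, .cc, .s1, .s2]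
        [.d, .hh, .ok] s s2 := Frame.trans_of (s' := s1.tick) (by simpa using hF) hF2 (by decide) (by decide)
    have hK2 := h.frame hF2' (by decide) (by decide)
    have hc2 := hc.frame hF2' (by decide) (by decide)
    have hy2 : s2.v .y = n := (hF2.v _ (by decide)).trans hy
    have w1 := hc2.wv n (by omega)
    have w2 := hc2.wt n (by omega)
    have w3 := hc2.wv i hlt
    have w4 := hc2.wt i hlt
    have t1 := hc.time n
    have t2 := hc.time i
    have n1 := (sv bm u T n).1.2
    have n2 := (sv bm u T i).1.2
    simp only [wp_seq, wp_assign, Expr.ok_ld, Expr.ok_var, Expr.eval_ld, Expr.eval_var, St.set_v,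
      St.set_a, reduceCtorEq, if_false, hy2, hK2.i_eq, w1, w2, w3, w4, Int.toNat_natCast]
    refine ⟨by simp; omega, by omega, by simp; omega, by omega, by simp; omega, by omega,
      by simp; omega, by omega, ?_⟩
    refine wp_lookup hr (x := sv bm u T n) (y := sv bm u T i)
      (hc2.mem.frame (V := [.zv, .zt, .yv, .yt]) (A := []) ?_ (by decide) (by decide)) (by simp)
      (by simp) (by simp) (by simp) ?_
    · simpa [Frame.set_iff] using Frame.refl _ _ _
    intro s3 hF3 hres _ _ hclk3
    have hR1 := R_lt_top (bm := bm) (sv bm u T n) (sv bm u T i)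
    have hR2 := neg_one_le_R (bm := bm) (sv bm u T n) (sv bm u T i)
    have hF3' : Frame [.e, .y, .jj, .zv, .zt, .yv, .yt, .c, .res, .rh, .ay, .cc, .s1, .s2]
        [.d, .hh, .ok] s s3 :=
      Frame.trans_of (by simpa [Frame.set_iff] using hF2') hF3 (by decide) (by decide)
    have hK3 := h.frame hF3' (by decide) (by decide)
    have hst3 : s3.a .st = s.a .st := hF3'.a _ (by decide)
    have hy3 : s3.v .y = n := (hF3.v _ (by decide)).trans (by simpa using hy2)
    have hd3 : s3.a .d = s2.a .d := hF3.a _ (by decide)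
    have hok3 : s3.a .ok = s1.a .ok :=
      (hF3.a _ (by decide)).trans ((hF2.a _ (by decide)))
    have he3 : s3.v .e = s1.v .e :=
      (hF3.v _ (by decide)).trans (by simpa using (hF2.v _ (by decide)))
    have key : ∀ s4 : St, (Frame [.e, .y, .jj, .zv, .zt, .yv, .yt, .c, .res, .rh, .ay, .cc, .s1,
          .s2] [.d, .hh, .ok] s s4 ∧ s4.v .y = n ∧
        (s4.v .e = 0 ↔ ¬ ∃ y < n + 1, y ∈ L ∧ ∃ j < k,
          R bm (sv bm u T (ℓ j)) (sv bm u T y) = b ∧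
          b ≤ α j ∧ b ≤ R bm (sv bm u T y) (sv bm u T i)) ∧
        (∀ c ≤ k, s4.a .ok c = 1 ↔ s.a .ok c = 1 ∧ ∀ y < n + 1, y ∉ L → ¬ BadKey k ℓ α
          (fun j => R bm (sv bm u T (ℓ j)) (sv bm u T y)) y
          (R bm (sv bm u T y) (sv bm u T i)) (α c)) ∧
        s4.clk ≤ s3.clk + 36 * q) → wp Z B (.y ::= Var.y + 1)
        (fun s' => Frame [.e, .y, .jj, .zv, .zt, .yv, .yt, .c, .res, .rh, .ay,
            .cc, .s1, .s2] [.d, .hh, .ok] s s' ∧ s'.v .y = (n + 1 : ℕ) ∧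
          (s'.v .e = 0 ↔ ¬ ∃ y < n + 1, y ∈ L ∧ ∃ j < k,
            R bm (sv bm u T (ℓ j)) (sv bm u T y) = b ∧
            b ≤ α j ∧ b ≤ R bm (sv bm u T y) (sv bm u T i)) ∧
          (∀ c ≤ k, s'.a .ok c = 1 ↔ s.a .ok c = 1 ∧ ∀ y < n + 1, y ∉ L → ¬ BadKey k ℓ α
            (fun j => R bm (sv bm u T (ℓ j)) (sv bm u T y)) y
            (R bm (sv bm u T y) (sv bm u T i)) (α c)) ∧
          s'.clk ≤ s.clk + 70 * q * (n + 1) + 2) s4 := by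
      rintro s4 ⟨hF4, hy4, he4, ho4, hclk4⟩
      have := hq3 n
      simp only [wp_assign, Expr.ok_add, Expr.ok_var, Expr.ok_one, Expr.eval_add, Expr.eval_var,
        Expr.eval_one, hy4]
      refine ⟨by simp, by omega, by simpa [Frame.set_iff] using hF4, by simp, by simpa using he4,
        by simpa using ho4, ?_⟩
      have e : 70 * q * (n + 1) = 70 * q * n + 70 * q := by ring
      rw [e]
      simp only [St.tick_clk, St.set_clk] at hclk2 hclk3 ⊢
      omega
    -- Expanded, the left side is `6k² + 14k + 14`, and `k²`, `k` and `1` are all at most `q`.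
    have hk4 : (k + 1) * (6 * k + 8) + 6 ≤ 34 * q := by
      have := hq3 n
      nlinarith [Nat.le_mul_self k]
    simp only [wp_seq, wp_assign, Expr.ok_var, Expr.eval_var, hres]
    refine ⟨trivial, by omega, wp_mono key ?_⟩
    simp only [wp_ite, Cond.ok_lt, Cond.holds_lt, Expr.ok_var, Expr.ok_ld, Expr.eval_var,
      Expr.eval_ld, St.set_v, reduceCtorEq, if_false, hy3, hK3.i_eq, St.set_a, hst3,
      Int.toNat_natCast, ← hst n hn]
    have hF5 : Frame [.e, .y, .jj, .zv, .zt, .yv, .yt, .c, .res, .rh, .ay, .cc, .s1, .s2]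
        [.d, .hh, .ok] s (s3.set .ay (R bm (sv bm u T n) (sv bm u T i))).tick := by
      simpa [Frame.set_iff] using hF3'
    have hK5 := h.frame hF5 (by decide) (by decide)
    refine ⟨by simp; omega, ?_, ?_⟩
    · intro hmem
      refine wp_pairs hZ hB hK5 (by simpa [hd3] using hd2) ?_
      intro s6 hF6 he6 hclk6
      refine ⟨Frame.trans_of hF5 hF6 (by decide) (by decide), ?_, ?_, ?_, ?_⟩
      · rw [hF6.v _ (by decide)]; simpa using hy3
      · rw [he6]
        simp only [St.tick_v, St.set_v, reduceCtorEq, if_false, if_true, he3, h1,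
          Nat.exists_lt_succ_right, hmem, true_and, not_or]
      · intro c hck
        rw [hF6.a _ (by decide)]
        simp only [St.tick_a, St.set_a, hok3, h2 c hck, Nat.forall_lt_succ_right, hmem,
          not_true_eq_false, false_imp_iff, and_true]
      · simp only [St.tick_clk, St.set_clk] at hclk6
        have := hq3 n
        have := Nat.le_mul_self k
        omega
    · intro hmem
      refine wp_bads hZ hB hK5 (δ := fun j => R bm (sv bm u T (ℓ j)) (sv bm u T n))
        (by simpa [hd3] using hd2) (y := n) (by simpa using hy3) ?_
      intro s6 hF6 ho6 hclk6
      refine ⟨Frame.trans_of hF5 hF6 (by decide) (by decide), ?_, ?_, ?_, ?_⟩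
      · rw [hF6.v _ (by decide)]; simpa using hy3
      · rw [hF6.v _ (by decide)]
        simp only [St.tick_v, St.set_v, reduceCtorEq, if_false, he3, h1,
          Nat.exists_lt_succ_right, hmem, false_and, or_false]
      · intro c hck
        rw [ho6 c hck]
        simp only [St.tick_a, St.set_a, hok3, h2 c hck, Nat.forall_lt_succ_right, hmem,
          not_false_eq_true, true_imp_iff, St.tick_v, St.set_v, if_true, and_assoc]
      · simp only [St.tick_clk, St.set_clk] at hclk6
        have := hq3 n
        have := Nat.le_mul_self k
        omega
  · rintro s1 ⟨hF, hy, h1, h2, h3⟩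
    have hK := h.frame hF (by decide) (by decide)
    exact ⟨by simp, by simp [hy, hK.i_eq], hQ _ (by simpa using hF) h1 h2 (by simp; omega)⟩
  · refine ⟨by simpa [Frame.set_iff] using Frame.refl _ _ _, by simp, by simp, by simp, by simp⟩

/-- The search stands at the node `L` of level `i`. -/
structure At (i : ℕ) (L : Finset ℕ) (b : ℤ) (s : St) : Prop where
  i_eq : s.v .i = i
  bs : s.a .bs i = b
  st : ∀ x < i, x ∈ L ↔ (i : ℤ) < s.a .st x

theorem At.frame {V : List Var} {A : List Arr} {s' : St} (h : At i L b s)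
    (hF : Frame V A s s') (hV : Var.i ∉ V) (hA : ∀ x ∈ [Arr.bs, .st], x ∉ A) :
    At i L b s' where
  i_eq := (hF.v _ hV).trans h.i_eq
  bs := by rw [hF.a _ (hA _ (by decide)), h.bs]
  st := by rw [hF.a _ (hA _ (by decide))]; exact h.st

/-- The clauses of `Add` in terms of the arrays. A threshold occurs among the candidates because it
is attained at `i`, or is the last candidate `b`, which requires a surviving pair (`e ≠ 0`). The
hypothesis `hneg` ensures that the pair found consists of two different vertices. -/
theorem LocalGraph.add_iff {Γ : LocalGraph} (hN : Γ.Node i L b) (hl : Lists L k ℓ)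
    (hneg : ∀ x, Γ.wt x x < 0) {α : ℕ → ℤ} (hα : ∀ j < k, α j = Γ.wt (ℓ j) i) (hαk : α k = b)
    {xa : ℤ} (hxa : ∀ c : ℤ, 0 ≤ c → c ≤ Γ.top →
      (c ≤ xa ↔ i ≤ Γ.r ∨ ∃ j < k, 1 ≤ ℓ j ∧ ℓ j ≤ Γ.r ∧ c ≤ α j)) {e : ℤ}
    (he : e = 0 ↔ ¬ ∃ y < i, y ∈ L ∧ ∃ j < k, Γ.wt (ℓ j) y = b ∧ b ≤ α j ∧ b ≤ Γ.wt y i) (v : ℤ) :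
    Γ.Add i L b v ↔ ∃ c ≤ k, α c = v ∧ (Γ.bm ≤ v ∧ v ≤ b ∧ v ≤ α 0 ∧ v ≤ xa) ∧
      (∀ y < i, y ∉ L → ¬ BadKey k ℓ α (fun j => Γ.wt (ℓ j) y) y (Γ.wt y i) v) ∧
      (c = k → e ≠ 0) := by
  have hb0 : 0 ≤ b := Γ.bm_nonneg.trans hN.bm_le
  have htop : b ≤ Γ.top := by
    rcases hN.min.2 with ⟨-, h⟩ | ⟨x, -, y, -, -, h⟩
    · exact h.le
    · exact h ▸ (Γ.lt_top x y).le
  have hα0 : α 0 = Γ.wt 0 i := by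
    obtain ⟨j, hj, h0⟩ := (hl.mem 0).1 hN.zero
    rcases Nat.eq_zero_or_pos j with h | h
    · subst h; rw [hα 0 hj, h0]
    · have := hl.strict 0 j h hj; omega
  have hbad : ∀ y < i, Γ.Bad i L v y ↔
      BadKey k ℓ α (fun j => Γ.wt (ℓ j) y) y (Γ.wt y i) v := by
    intro y hy
    rw [LocalGraph.Bad, BadKey, hl.forall_iff, hl.forall_iff]
    refine and_congr (forall₂_congr fun j hj => by rw [hα j hj]) Iff.rfl
  have hmeet : v ≤ b → 0 ≤ v → (v ≤ xa ↔ i ≤ Γ.r ∨ ∃ x ∈ L, 1 ≤ x ∧ x ≤ Γ.r ∧ v ≤ Γ.wt x i) := by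
    intro h1 h2
    rw [hxa v h2 (h1.trans htop), hl.exists_iff]
    refine or_congr_right (exists_congr fun j => and_congr_right fun hj => by rw [hα j hj])
  have hpair : e ≠ 0 ↔ ∃ x ∈ L, ∃ y ∈ L, x ≠ y ∧ Γ.wt x y = b ∧ b ≤ Γ.wt x i ∧ b ≤ Γ.wt y i := by
    rw [Ne, he, not_not, hl.exists_iff]
    constructor
    · rintro ⟨y, hy, hyL, j, hj, h1, h2, h3⟩
      refine ⟨j, hj, y, hyL, ?_, h1, hα j hj ▸ h2, h3⟩
      rintro rfl
      have := hneg (ℓ j); omega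
    · rintro ⟨j, hj, y, hyL, -, h1, h2, h3⟩
      exact ⟨y, hN.lt y hyL, hyL, j, hj, h1, (hα j hj).symm ▸ h2, h3⟩
  constructor
  · rintro ⟨h1, h2, h3, h4, h5, h6⟩
    have hc := (hmeet h2 (Γ.bm_nonneg.trans h1)).2 h4
    have hg : ∀ y < i, y ∉ L → ¬ BadKey k ℓ α (fun j => Γ.wt (ℓ j) y) y (Γ.wt y i) v :=
      fun y hy hyL hh => h6 y hy hyL ((hbad y hy).2 hh)
    rcases h5 with h5 | ⟨h5, h7⟩
    · obtain ⟨j, hj, hj'⟩ := hl.exists_iff.1 h5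
      exact ⟨j, hj.le, (hα j hj).trans hj', ⟨h1, h2, hα0 ▸ h3, hc⟩, hg, by omega⟩
    · exact ⟨k, le_rfl, hαk.trans h5.symm, ⟨h1, h2, hα0 ▸ h3, hc⟩, hg, fun _ => hpair.2 h7⟩
  · rintro ⟨c, hck, hcv, ⟨h1, h2, h3, h4⟩, hg, h5⟩
    refine ⟨h1, h2, hα0 ▸ h3, (hmeet h2 (Γ.bm_nonneg.trans h1)).1 h4, ?_,
      fun y hy hyL hh => hg y hy hyL ((hbad y hy).1 hh)⟩
    rcases Nat.lt_or_eq_of_le hck with h6 | h6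
    · exact .inl (hl.exists_iff.2 ⟨c, h6, hα c h6 ▸ hcv⟩)
    · exact .inr ⟨by rw [← hcv, h6, hαk], hpair.1 (h5 h6)⟩

/-- The children are enumerated by decreasing key. The result is the largest key below `b0`, so
repeated calls, each with `b0` set to the previous key, run through all children. -/
theorem wp_next (hr : Room G Z B) (hc : Ctx G bm u T s) {hne : starting bm u T ≠ []}
    (hA : At i L b s) (hN : (localGraph bm u T hne).Node i L b)
    (hiw : i < (localList bm u T).length) {q : ℕ}
    (hq1 : ∑ x ∈ L, ((G.adj bm (sv bm u T x).1).length + 1) ≤ q)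
    (hq2 : L.card * L.card ≤ q) (hq3 : ∀ y, (G.adj bm (sv bm u T y).1).length + 1 ≤ q)
    (hQ : ∀ s' k ℓ α, Frame [.e, .y, .jj, .zv, .zt, .yv, .yt, .c, .res, .rh, .ay, .cc, .s1, .s2,
        .k, .q, .xa, .fl, .xl, .best] [.d, .hh, .ok, .a, .ll] s s' →
      Keys G i k (localList bm u T).length b ℓ α s' → Lists L k ℓ →
      (∀ j < k, α j = R bm (sv bm u T (ℓ j)) (sv bm u T i)) →
      ((s'.v .best < s.v .b0 ∧
          (∃ K c, (localGraph bm u T hne).Child i L b (s'.v .best) K c) ∧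
          ∀ key K c, (localGraph bm u T hne).Child i L b key K c → key < s.v .b0 →
            key ≤ s'.v .best) ∨
        (s'.v .best = -2 ∧
          ∀ key K c, (localGraph bm u T hne).Child i L b key K c → s.v .b0 ≤ key)) →
      s'.clk ≤ s.clk + 75 * q * (localList bm u T).length → Q s') :
    wp Z B Prog.next Q s := by
  have hZ := localList_lt_Z (bm := bm) (u := u) (T := T) hr
  have hB := hr.le_B
  have hb0 : (0 : ℤ) ≤ b := (Int.natCast_nonneg bm).trans hN.bm_le
  have htop : b ≤ G.tmax := by
    rcases hN.min.2 with ⟨-, h⟩ | ⟨x, -, y, -, -, h⟩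
    · exact h.le
    · exact h ▸ ((localGraph bm u T hne).lt_top x y).le
  rw [Prog.next, wp_seq]
  refine wp_list (w := (localList bm u T).length) (by omega) (by omega) hA.i_eq (by omega) hA.st
    hN.lt ?_
  intro s1 k ℓ hF1 hM1 hl hclk1
  have hk : k * k ≤ q := by rw [← hl.card]; exact hq2
  have hW : work bm u T k ℓ ≤ q := by
    rw [work, hl.sum_eq fun x => (G.adj bm (sv bm u T x).1).length + 1]; exact hq1
  have hki : k ≤ i := by
    rw [← hl.card]
    exact (Finset.card_le_card (t := Finset.range i) fun x hx => by simpa using hN.lt x hx).trans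
      (by simp)
  have hA1 := hA.frame hF1 (by decide) (by decide)
  have hc1 := hc.frame hF1 (by decide) (by decide)
  simp only [wp_seq, wp_assign, Expr.ok_var, Expr.eval_var, hA1.i_eq]
  refine ⟨trivial, by omega, ?_⟩
  have hF1' : Frame [.y] [] s1 (s1.set .y i) := by simpa [Frame.set_iff] using Frame.refl _ _ _
  refine wp_row hr (hc1.frame hF1' (by decide) (by decide))
    (hM1.frame hF1' (by decide) (by decide)) hiw (by simp) ?_
  intro s2 hF2 hd2 _ hclk2
  have hF2' : Frame [.y, .jj, .zv, .zt, .yv, .yt, .c, .res, .rh] [.d, .hh] s1 s2 :=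
    Frame.trans_of (hF1'.mono (by decide) (by decide)) hF2 (by decide) (by decide)
  have hA2 := hA1.frame hF2' (by decide) (by decide)
  have hc2 := hc1.frame hF2' (by decide) (by decide)
  have hM2 := hM1.frame hF2' (by decide) (by decide)
  refine wp_weights (r := (starting bm u T).length) (δ := fun j => R bm (sv bm u T (ℓ j)) (sv bm u T i)) hZ hB hc2.r_eq
    hc2.mem.top_eq ⟨hA2.i_eq, hA2.bs, hM2, hd2, hiw, hki, hb0, htop, fun j => neg_one_le_R _ _,
      fun j => R_lt_top _ _⟩ ?_
  intro s3 hF3 ha3 hak3 hfl3 hxl3 hxa3 hclk3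
  have hA3 := hA2.frame hF3 (by decide) (by decide)
  have hc3 := hc2.frame hF3 (by decide) (by decide)
  have hM3 := hM2.frame hF3 (by decide) (by decide)
  -- The list of candidates: the weights to `i`, followed by `b`. It is kept opaque so that later
  -- simplifications do not unfold it.
  obtain ⟨α, hα⟩ : ∃ α : ℕ → ℤ, α = fun j =>
    if j < k then R bm (sv bm u T (ℓ j)) (sv bm u T i) else b := ⟨_, rfl⟩
  have hα1 : ∀ j < k, α j = R bm (sv bm u T (ℓ j)) (sv bm u T i) := fun j hj => by simp [hα, hj]
  have hαk : α k = b := by simp [hα]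
  have hK3 : Keys G i k (localList bm u T).length b ℓ α s3 := by
    refine ⟨hA3.i_eq, hA3.bs, hM3, fun j hj => ?_, hiw, hki, hb0, htop, fun j => ?_, fun j => ?_⟩
    · rcases Nat.lt_or_eq_of_le hj with h | h
      · rw [ha3 j h, hα1 j h]
      · rw [h, hak3, hαk]
    · rw [hα]; dsimp only; split <;> [exact neg_one_le_R _ _; omega]
    · rw [hα]; dsimp only; split <;> [exact (R_lt_top _ _).le; exact htop]
  refine wp_initOk hZ hB hc3.mem.bm_eq hK3 ?_
  intro s4 hF4 hok4 hclk4
  have hA4 := hA3.frame hF4 (by decide) (by decide)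
  have hc4 := hc3.frame hF4 (by decide) (by decide)
  have hK4 := hK3.frame hF4 (by decide) (by decide)
  refine wp_scan hr hc4 hK4 hA4.st hW hk hq3 ?_
  intro s5 hF5 he5 hok5 hclk5
  have hK5 := hK4.frame hF5 (by decide) (by decide)
  refine wp_select hZ hB hK5 ?_ ?_
  · intro c hck hc
    exact (Int.natCast_nonneg bm).trans ((hok4 c hck).1 ((hok5 c hck).1 hc).1).1
  intro s6 hF6 hbest hclk6
  have hF : Frame [.e, .y, .jj, .zv, .zt, .yv, .yt, .c, .res, .rh, .ay, .cc, .s1, .s2,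
      .k, .q, .xa, .fl, .xl, .best] [.d, .hh, .ok, .a, .ll] s s6 :=
    ((((((hF1.mono (by decide) (by decide)).trans_of hF2' (by decide) (by decide)).trans_of
      hF3 (by decide) (by decide)).trans_of hF4 (by decide) (by decide)).trans_of hF5 (by decide)
      (by decide)).trans_of hF6 (by decide) (by decide))
  have hK6 := hK5.frame hF6 (by decide) (by decide)
  have b3 : s3.v .b0 = s.v .b0 := by
    rw [hF3.v _ (by decide), hF2'.v _ (by decide), hF1.v _ (by decide)]
  have b5 : s5.v .b0 = s.v .b0 := by
    rw [hF5.v _ (by decide), hF4.v _ (by decide), b3]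
  have fl5 : s5.v .fl = s3.v .fl := by rw [hF5.v _ (by decide), hF4.v _ (by decide)]
  have xl5 : s5.v .xl = s3.v .xl := by rw [hF5.v _ (by decide), hF4.v _ (by decide)]
  have hadd := LocalGraph.add_iff (Γ := localGraph bm u T hne) hN hl
    (fun x => by show R bm _ _ < 0; rw [R_self]; omega) hα1 hαk (xa := s3.v .xa)
    (fun c h1 h2 => (hxa3 c h1 h2).trans (or_congr_right (exists_congr fun j =>
      and_congr_right fun hj => by rw [hα1 j hj]; rfl))) he5
  have hkeep : s5.v .fl = 1 ∧ s5.v .xl = 1 ↔ (localGraph bm u T hne).Keep i L b := by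
    rw [fl5, xl5, hfl3, hxl3, LocalGraph.Keep, LocalGraph.Meets, hl.exists_iff, hl.exists_iff]
    rfl
  have hval : ∀ c ≤ k, s5.a .ok c = 1 → (c = k → s5.v .e ≠ 0) →
      (localGraph bm u T hne).Add i L b (α c) ∧ α c < s.v .b0 := by
    intro c hck h1 h2
    obtain ⟨h3, h4⟩ := (hok5 c hck).1 h1
    obtain ⟨e1, e2, e3, e4, e5⟩ := (hok4 c hck).1 h3
    exact ⟨(hadd _).2 ⟨c, hck, rfl, ⟨e1, e2, e4, e5⟩, h4, h2⟩, b3 ▸ e3⟩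
  have hval' : ∀ v, (localGraph bm u T hne).Add i L b v → v < s.v .b0 →
      ∃ c ≤ k, α c = v ∧ s5.a .ok c = 1 ∧ (c = k → s5.v .e ≠ 0) := by
    intro v hv hvb
    obtain ⟨c, hck, rfl, ⟨e1, e2, e3, e4⟩, h2, h3⟩ := (hadd v).1 hv
    exact ⟨c, hck, rfl, (hok5 c hck).2 ⟨(hok4 c hck).2 ⟨e1, e2, b3.symm ▸ hvb, e3, e4⟩, h2⟩, h3⟩
  refine hQ s6 k ℓ α hF hK6 hl hα1 ?_ ?_
  · rcases hbest with ⟨c, hck, ⟨h1, h2⟩, h3, h4⟩ | ⟨h1, h2⟩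
    · obtain ⟨h5, h6⟩ := hval c hck h1 h2
      refine .inl ⟨h3 ▸ h6, by rw [h3]; exact ⟨_, _, .add h5⟩, ?_⟩
      intro key K d hch hkey
      rw [h3]
      cases hch with
      | keep h => exact hK5.α_ge c
      | add h =>
        obtain ⟨c', hc', rfl, h7, h8⟩ := hval' _ h hkey
        exact h4 c' hc' h7 h8
    · have hno : ∀ v, (localGraph bm u T hne).Add i L b v → s.v .b0 ≤ v := by
        intro v hv
        by_contra hcon
        obtain ⟨c, hc, -, h7, h8⟩ := hval' _ hv (not_le.1 hcon)
        exact h1 c hc h7 h8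
      rw [b5] at h2
      rcases h2 with ⟨h3, h4, h5, h6⟩ | ⟨h3, h5⟩
      · refine .inl ⟨h6 ▸ h3, by rw [h6]; exact ⟨_, _, .keep (hkeep.1 ⟨h4, h5⟩)⟩, ?_⟩
        intro key K d hch hkey
        cases hch with
        | keep h => exact h6.ge
        | add h => have := hno _ h; omega
      · refine .inr ⟨h5, fun key K d hch => ?_⟩
        cases hch with
        | keep h =>
          by_contra hcon
          exact h3 ⟨not_le.1 hcon, hkeep.2 h⟩
        | add h => exact hno _ h
  · simp at hclk2
    have : 1 ≤ q := (Nat.le_add_left 1 _).trans (hq3 0)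
    have : k ≤ q := (Nat.le_mul_self k).trans hk
    nlinarith

end ThickEdgeGraph


/-! ### Moving down and up in the tree -/

namespace ThickEdgeGraph

open Cmd

variable {G : ThickEdgeGraph} {bm Z : ℕ} {B : ℤ} {s : St} {Q : St → Prop} {u : Fin G.n} {T : ℤ}
  {i k w : ℕ} {b : ℤ} {ℓ : ℕ → ℕ} {δ α : ℕ → ℤ} {L : Finset ℕ}

/-- All members of `L` have their entry of `st` rewritten, because an earlier sibling may have left
smaller values there. The old and the new entries exceed `i`, so the nodes of level at most `i` on
the path read the same. -/
theorem wp_push (hr : Room G Z B) (hc : Ctx G bm u T s) {hne : starting bm u T ≠ []}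
    (hA : At i L b s) (hN : (localGraph bm u T hne).Node i L b)
    (h : Keys G i k (localList bm u T).length b ℓ α s) (hl : Lists L k ℓ)
    (hα : ∀ j < k, α j = R bm (sv bm u T (ℓ j)) (sv bm u T i)) {K : Finset ℕ} {c : ℤ}
    (hch : (localGraph bm u T hne).Child i L b (s.v .best) K c)
    (hQ : ∀ s', Frame [.cc, .i, .b0] [.st, .bs] s s' → At (i + 1) K c s' →
      s'.v .b0 = G.tmax + 1 →
      (∀ x < i, ∀ t ≤ i, (t : ℤ) < s'.a .st x ↔ (t : ℤ) < s.a .st x) →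
      (∀ t ≤ i, s'.a .bs t = s.a .bs t) → s'.clk ≤ s.clk + 4 * k + 7 → Q s') :
    wp Z B Prog.push Q s := by
  have hZ := localList_lt_Z (bm := bm) (u := u) (T := T) hr
  have hB := hr.le_B
  have hlt := h.lt
  have hle := h.le
  have hb0 := h.b_nonneg
  have hbt := h.b_le
  simp only [Prog.push, wp_seq, wp_assign, Expr.ok_zero, Expr.eval_zero]
  refine ⟨trivial, by omega, ?_⟩
  refine wp_loop_count k (fun n s' => Frame [.cc] [.st] s s' ∧ s'.v .cc = n ∧
    (∀ j < n, s'.a .st (ℓ j) = if α j < s.v .best then (i + 1 : ℤ) else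
      (localList bm u T).length + 1) ∧
    (∀ x, (∀ j < n, ℓ j ≠ x) → s'.a .st x = s.a .st x) ∧
    s'.clk ≤ s.clk + 4 * n + 1) ?_ ?_ ?_
  · rintro n hn s1 ⟨hF, hcc, h1, h2, h3⟩
    have hK := h.frame hF (by decide) (by decide)
    have hk1 := hK.mem.k_eq
    have hi1 := hK.i_eq
    have ha1 := hK.a n (by omega)
    have hl1 := hK.mem.ll n hn
    have hln := hK.mem.lt n hn
    have hb1 : s1.v .best = s.v .best := hF.v _ (by decide)
    have hwn : s1.v .wn = (localList bm u T).length := (hF.v _ (by decide)).trans hc.wn_eq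
    refine ⟨by simp, by simp [hcc, hk1, hn], ?_⟩
    have put : ∀ z : ℤ, (z = if α n < s.v .best then (i + 1 : ℤ) else
        (localList bm u T).length + 1) → (∀ j < n + 1, Function.update (s1.a .st) (ℓ n) z (ℓ j) =
          if α j < s.v .best then (i + 1 : ℤ) else (localList bm u T).length + 1) ∧
        ∀ x, (∀ j < n + 1, ℓ j ≠ x) → Function.update (s1.a .st) (ℓ n) z x = s.a .st x := by
      intro z hz
      refine ⟨fun j hj => ?_, fun x hx => ?_⟩
      · rcases Nat.lt_succ_iff_lt_or_eq.1 hj with hj | rfl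
        · rw [Function.update_of_ne (hl.strict j n hj hn).ne, h1 j hj]
        · rw [Function.update_self, hz]
      · rw [Function.update_of_ne (hx n (by omega)).symm, h2 x fun j hj => hx j (by omega)]
    simp only [wp_ite, wp_seq, wp_assign, wp_store, Cond.ok_lt, Cond.holds_lt, Expr.ok_ld,
      Expr.ok_var, Expr.ok_add, Expr.ok_one, Expr.eval_ld, Expr.eval_var, Expr.eval_add,
      Expr.eval_one, St.tick_v, St.tick_a, St.put_v, hcc, hi1, ha1, hl1, hb1, hwn,
      Int.toNat_natCast]
    refine ⟨by simp; omega, fun hlt => ?_, fun hlt => ?_⟩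
    · refine ⟨by simp; omega, by simp, by omega, by omega, by simp, by omega,
        by simpa [Frame.set_iff, Frame.put_iff] using hF, by simp, ?_, ?_, by simp; omega⟩
      · simpa using (put _ (by rw [if_pos hlt])).1
      · simpa using (put _ (by rw [if_pos hlt])).2
    · refine ⟨by simp; omega, by simp, by omega, by omega, by simp, by omega,
        by simpa [Frame.set_iff, Frame.put_iff] using hF, by simp, ?_, ?_, by simp; omega⟩
      · simpa using (put _ (by rw [if_neg hlt])).1
      · simpa using (put _ (by rw [if_neg hlt])).2
  · rintro s1 ⟨hF, hcc, h1, h2, h3⟩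
    have hK := h.frame hF (by decide) (by decide)
    have hk1 := hK.mem.k_eq
    have hi1 := hK.i_eq
    have hbs := hK.bs
    have hb1 : s1.v .best = s.v .best := hF.v _ (by decide)
    have hwn : s1.v .wn = (localList bm u T).length := (hF.v _ (by decide)).trans hc.wn_eq
    have htop : s1.v .top = G.tmax := (hF.v _ (by decide)).trans hc.mem.top_eq
    have hbs1 : s1.a .bs = s.a .bs := hF.a _ (by decide)
    refine ⟨by simp, by simp [hcc, hk1], ?_⟩
    simp only [wp_ite, wp_seq, wp_assign, wp_store, Cond.ok_lt, Cond.holds_lt, Expr.ok_ld,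
      Expr.ok_var, Expr.ok_add, Expr.ok_one, Expr.eval_ld, Expr.eval_var, Expr.eval_add,
      Expr.eval_one, Expr.ok_zero, Expr.eval_zero, St.tick_v, St.tick_a, St.put_v, St.put_a,
      St.set_v, reduceCtorEq, if_false, hi1, hb1, hwn, htop, hbs, Int.toNat_natCast]
    have hlL : ∀ j < k, ℓ j ∈ L := fun j hj => (hl.mem _).2 ⟨j, hj, rfl⟩
    have hmemL : ∀ x < i, x ∈ L → s1.a .st x = if R bm (sv bm u T x) (sv bm u T i) < s.v .best then
        (i + 1 : ℤ) else (localList bm u T).length + 1 := by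
      intro x _ hx
      obtain ⟨j, hj, rfl⟩ := (hl.mem x).1 hx
      rw [h1 j hj, hα j hj]
    have hnmemL : ∀ x, x ∉ L → s1.a .st x = s.a .st x := fun x hx =>
      h2 x fun j hj he => hx (he ▸ hlL j hj)
    have hold : ∀ x < i, ∀ t ≤ i, ((t : ℤ) < s1.a .st x ↔ (t : ℤ) < s.a .st x) := by
      intro x hx t ht
      by_cases hxL : x ∈ L
      · have e1 := (hA.st x hx).1 hxL
        rw [hmemL x hx hxL]
        split <;> constructor <;> intro <;> omega
      · rw [hnmemL x hxL]
    have hcast : (i : ℤ) + 1 = ((i + 1 : ℕ) : ℤ) := by push_cast; rfl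
    have hnode := hch.node hN (by have := hN.lt 0 hN.zero; omega)
    have hkey := hch.key_eq hN.lt
    have hRi : ∀ x, -1 ≤ R bm (sv bm u T x) (sv bm u T i) := fun x => neg_one_le_R _ _
    generalize hkb : s.v .best = key at *
    rw [hcast]
    simp only [Int.toNat_natCast]
    refine ⟨by simp, fun hneg => ?_, fun hneg => ?_⟩
    · have hKL : K = L ∧ c = b ∧ i ∉ K := by
        cases hch with
        | keep hh => exact ⟨rfl, rfl, fun hi => absurd (hN.lt i hi) (lt_irrefl i)⟩
        | add hh => have := (Int.natCast_nonneg bm).trans hh.bm_le; omega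
      obtain ⟨rfl, rfl, hiK⟩ := hKL
      refine ⟨trivial, by simp, by omega, by omega, by simp, by simp; omega, by omega, by omega, by simp,
        by omega, by simp, by omega, hQ _ ?_ ⟨?_, ?_, ?_⟩ ?_ ?_ ?_ ?_⟩
      · simpa [Frame.set_iff, Frame.put_iff] using hF.mono (by decide) (by decide)
      · simp
      · simp
      · intro x hx
        simp only [St.set_a, St.put_a, St.tick_a, reduceCtorEq, if_false, if_true,
          Function.update_apply]
        split
        · next hh => subst hh; simp only [hiK, false_iff]; omega
        · have hxi : x < i := by omega
          by_cases hxL : x ∈ K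
          · have := hRi x
            rw [hmemL x hxi hxL, if_neg (by omega)]
            simp only [hxL, true_iff]; push_cast; omega
          · have := (hA.st x hxi).not.1 hxL
            rw [hnmemL x hxL]
            simp only [hxL, false_iff]; push_cast; omega
      · simp
      · intro x hx t ht
        simp only [St.set_a, St.put_a, St.tick_a, reduceCtorEq, if_false, if_true]
        rw [Function.update_of_ne (by omega)]
        exact hold x hx t ht
      · intro t ht
        simp only [St.set_a, St.put_a, St.tick_a, reduceCtorEq, if_false, if_true]
        rw [Function.update_of_ne (by omega), hbs1]
      · simp; omega
    · have hKL : K = (localGraph bm u T hne).up i L c ∧ key = c ∧ c ≤ b := by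
        cases hch with
        | keep hh => omega
        | add hh => exact ⟨rfl, rfl, hh.le⟩
      obtain ⟨hKe, rfl, hcb⟩ := hKL
      have hiK : i ∈ K := hKe ▸ LocalGraph.mem_up.2 (.inl rfl)
      refine ⟨trivial, by simp, by omega, by omega, by simp, by simp, by omega, by omega, by simp,
        by omega, by simp, by omega, hQ _ ?_ ⟨?_, ?_, ?_⟩ ?_ ?_ ?_ ?_⟩
      · simpa [Frame.set_iff, Frame.put_iff] using hF.mono (by decide) (by decide)
      · simp
      · simp
      · intro x hx
        simp only [St.set_a, St.put_a, St.tick_a, reduceCtorEq, if_false, if_true,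
          Function.update_apply]
        split
        · next hh => subst hh; simp only [hiK, true_iff]; push_cast; omega
        · next hxi' =>
          have hxi : x < i := by omega
          have hxK : x ∈ K ↔ x ∈ L ∧ key ≤ R bm (sv bm u T x) (sv bm u T i) := by
            rw [hKe, LocalGraph.mem_up]
            simp only [hxi', false_or]; rfl
          by_cases hxL : x ∈ L
          · rw [hmemL x hxi hxL, hxK]
            simp only [hxL, true_and]
            split <;> constructor <;> intro <;> push_cast at * <;> omega
          · have := (hA.st x hxi).not.1 hxL
            rw [hnmemL x hxL, hxK]
            simp only [hxL, false_and, false_iff]; push_cast; omega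
      · simp
      · intro x hx t ht
        simp only [St.set_a, St.put_a, St.tick_a, reduceCtorEq, if_false, if_true]
        rw [Function.update_of_ne (by omega)]
        exact hold x hx t ht
      · intro t ht
        simp only [St.set_a, St.put_a, St.tick_a, reduceCtorEq, if_false, if_true]
        rw [Function.update_of_ne (by omega), hbs1]
      · simp; omega
  · refine ⟨by simpa [Frame.set_iff] using Frame.refl _ _ _, by simp, by simp, by simp, by simp⟩

theorem wp_pop (hZ : i + 1 < Z) (hB : (Z : ℤ) + G.tmax + 10 ≤ B) {K : Finset ℕ} {c : ℤ}
    (hi : s.v .i = (i + 1 : ℕ)) (hst : i ∈ K ↔ ((i + 1 : ℕ) : ℤ) < s.a .st i)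
    (hbs : s.a .bs (i + 1) = c) (hc0 : 0 ≤ c) (hct : c ≤ G.tmax)
    (hQ : ∀ s', Frame [.i, .b0] [] s s' → s'.v .i = i → s'.v .b0 = (if i ∈ K then c else -1) →
      s'.clk ≤ s.clk + 3 → Q s') : wp Z B Prog.pop Q s := by
  have hcast : (i : ℤ) + 1 = ((i + 1 : ℕ) : ℤ) := by push_cast; rfl
  have hi' : ((i + 1 : ℕ) : ℤ) - 1 = i := by push_cast; ring
  simp only [Prog.pop, wp_seq, wp_assign, wp_ite, Cond.ok_lt, Cond.holds_lt, Expr.ok_ld,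
    Expr.ok_var, Expr.ok_add, Expr.ok_sub, Expr.ok_one, Expr.eval_ld, Expr.eval_var, Expr.eval_add,
    Expr.eval_sub, Expr.ok_lit, Expr.eval_lit,
    Expr.eval_one, St.tick_v, St.tick_a, St.set_v, St.set_a, if_true, hi, hi', hcast,
    Int.toNat_natCast, ← hst, hbs]
  refine ⟨by simp, by omega, by simp; omega, fun h => ?_, fun h => ?_⟩
  · refine ⟨by simp; omega, by omega, hQ _ ?_ (by simp) (by simp [h]) (by simp)⟩
    simpa [Frame.set_iff] using Frame.refl _ _ _
  · refine ⟨by simp, by omega, hQ _ ?_ (by simp) (by simp [h]) (by simp)⟩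
    simpa [Frame.set_iff] using Frame.refl _ _ _

end ThickEdgeGraph


/-! ### Inspecting a leaf -/

namespace ThickEdgeGraph

open Cmd

variable {G : ThickEdgeGraph} {bm Z : ℕ} {B : ℤ} {s : St} {Q : St → Prop} {u : Fin G.n} {T : ℤ}
  {i k w : ℕ} {b : ℤ} {ℓ : ℕ → ℕ} {δ α : ℕ → ℤ} {L : Finset ℕ}

theorem start_iff {x y : G.SV} {a : G.Half} (h : Fits a x y) : Start x y ↔ ts a = x.2 :=
  ⟨fun ⟨_, h1, h2⟩ => h.unique h1 ▸ h2, fun h1 => ⟨a, h, h1⟩⟩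

theorem wp_inspectRow (hr : Room G Z B) (hc : Ctx G bm u T s)
    (hm : Members (localList bm u T).length k ℓ s) {y : G.SV}
    (hcl : ∀ j < k, sv bm u T (ℓ j) ≠ y → 0 ≤ R bm (sv bm u T (ℓ j)) y)
    (hd : ∀ j < k, s.a .d j = R bm (sv bm u T (ℓ j)) y)
    (hh : ∀ j < k, ∀ a, Fits a (sv bm u T (ℓ j)) y → (bm : ℤ) ≤ len a → s.a .hh j = id a)
    (hQ : ∀ s', Frame [.jj, .f] [] s s' → (s'.v .f = 1 ↔ s.v .f = 1 ∧
        ∀ j < k, Start (sv bm u T (ℓ j)) y → u ≤ (sv bm u T (ℓ j)).1) →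
      s'.clk ≤ s.clk + 4 * k + 2 → Q s') : wp Z B Prog.inspectRow Q s := by
  have hZ := localList_lt_Z (bm := bm) (u := u) (T := T) hr
  have hB := hr.le_B
  have hle := hm.le
  simp only [Prog.inspectRow, wp_seq, wp_assign, Expr.ok_zero, Expr.eval_zero]
  refine ⟨trivial, by omega, ?_⟩
  refine wp_loop_count k (fun n s' => Frame [.jj, .f] [] s s' ∧ s'.v .jj = n ∧
    (s'.v .f = 1 ↔ s.v .f = 1 ∧
        ∀ j < n, Start (sv bm u T (ℓ j)) y → u ≤ (sv bm u T (ℓ j)).1) ∧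
    s'.clk ≤ s.clk + 4 * n + 1) ?_ ?_ ?_
  · rintro n hn s1 ⟨hF, hjj, h1, h2⟩
    have hm1 := hm.frame hF (by decide) (by decide)
    have hc1 := hc.frame hF (by decide) (by decide)
    have hln := hm.lt n hn
    have w1 := hc1.wv _ hln
    have w2 := hc1.wt _ hln
    have hd1 : s1.a .d n = R bm (sv bm u T (ℓ n)) y := by rw [hF.a _ (by decide), hd n hn]
    have hhh : 0 ≤ R bm (sv bm u T (ℓ n)) y → ∃ a, Fits a (sv bm u T (ℓ n)) y ∧
        s1.a .hh n = id a ∧ s1.a .ts (id a) = ts a := by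
      intro h
      obtain ⟨a, h1, h2, -⟩ := exists_fits_of_R_nonneg h
      exact ⟨a, h1, by rw [hF.a _ (by decide), hh n hn a h1 h2], hc1.mem.ts_eq a h2⟩
    refine ⟨by simp, by simp [hjj, hm1.k_eq, hn], ?_⟩
    simp only [wp_ite, wp_seq, wp_assign, wp_skip, Cond.ok_lt, Cond.holds_lt, Cond.ok_and,
      Cond.holds_and, Cond.ok_not, Cond.holds_not, Cond.ok_eq, Cond.holds_eq, Expr.ok_ld,
      Expr.ok_var, Expr.ok_add, Expr.ok_one, Expr.ok_zero, Expr.eval_ld, Expr.eval_var,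
      Expr.eval_add, Expr.eval_one, Expr.eval_zero, St.tick_v, St.tick_a, St.set_v, reduceCtorEq,
      if_false, if_true, hjj, hm1.ll n hn, w1, w2, hd1, hc1.u_eq, Int.toNat_natCast,
      Nat.cast_lt, not_lt, Nat.forall_lt_succ_right]
    refine ⟨⟨by simp; omega, fun h => ⟨by simp; omega, fun _ => ?_⟩⟩, ?_, ?_⟩
    · obtain ⟨a, -, h3, -⟩ := hhh h
      have := id_lt_Z hr a
      rw [h3]
      simp; omega
    · rintro ⟨c1, c2, c3⟩
      obtain ⟨a, h3, h4, h5⟩ := hhh c1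
      rw [h4, Int.toNat_natCast, h5] at c3
      refine ⟨trivial, by omega, by simp, by omega, by simpa [Frame.set_iff] using hF, by simp, ?_,
        by simp; omega⟩
      have : ¬ (Start (sv bm u T (ℓ n)) y → u ≤ (sv bm u T (ℓ n)).1) := fun h =>
        absurd (h ((start_iff h3).2 c3)) (not_le.2 c2)
      simp [this]
    · intro hcon
      refine ⟨by simp, by omega, by simpa [Frame.set_iff] using hF, by simp, ?_, by simp; omega⟩
      have : Start (sv bm u T (ℓ n)) y → u ≤ (sv bm u T (ℓ n)).1 := by
        intro h
        by_contra hlt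
        have h' := h
        obtain ⟨a0, ha0, -⟩ := h'
        obtain ⟨a, h3, h4, h5⟩ := hhh (hcl n hn fun he => ha0.ne (congrArg Prod.fst he))
        refine hcon ⟨hcl n hn fun he => ha0.ne (congrArg Prod.fst he), not_le.1 hlt, ?_⟩
        rw [h4, Int.toNat_natCast, h5]
        exact (start_iff h3).1 h
      rw [h1]
      exact ⟨fun h => ⟨h.1, h.2, this⟩, fun h => ⟨h.1, h.2.1⟩⟩
  · rintro s1 ⟨hF, hjj, h1, h2⟩
    have hk1 := (hm.frame hF (by decide) (by decide)).k_eq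
    exact ⟨by simp, by simp [hjj, hk1], hQ _ (by simpa using hF) h1 (by simp; omega)⟩
  · exact ⟨by simpa [Frame.set_iff] using Frame.refl _ _ _, by simp, by simp, by simp⟩

theorem sum_range_le (n : ℕ) : ∑ x ∈ Finset.range n, x ≤ n * n := by
  calc ∑ x ∈ Finset.range n, x ≤ ∑ _x ∈ Finset.range n, n :=
        Finset.sum_le_sum fun x hx => (Finset.mem_range.1 hx).le
    _ = n * n := by simp

theorem wp_inspect (hr : Room G Z B) (hc : Ctx G bm u T s)
    (hm : Members (localList bm u T).length k ℓ s)
    (hcl : ∀ j < k, ∀ j' < k, sv bm u T (ℓ j) ≠ sv bm u T (ℓ j') →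
      0 ≤ R bm (sv bm u T (ℓ j)) (sv bm u T (ℓ j')))
    (hQ : ∀ s', Frame [.y, .jj, .zv, .zt, .yv, .yt, .c, .res, .rh, .cc, .f, .mt, .ec] [.d, .hh]
        s s' →
      (s'.v .f = 1 ↔ ∀ c < k, ∀ j < k, Start (sv bm u T (ℓ j)) (sv bm u T (ℓ c)) →
        u ≤ (sv bm u T (ℓ j)).1) →
      (∀ c < k, s'.v .mt ≤ (sv bm u T (ℓ c)).2) →
      (k = 0 ∨ ∃ c < k, s'.v .mt = (sv bm u T (ℓ c)).2) →
      s'.v .ec = (∑ x ∈ Finset.range k, x : ℕ) →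
      s'.clk ≤ s.clk + k * (16 * work bm u T k ℓ + 4 * k + 12) + 5 → Q s') :
    wp Z B Prog.inspect Q s := by
  have hZ := localList_lt_Z (bm := bm) (u := u) (T := T) hr
  have hB := hr.le_B
  have hle := hm.le
  have htop := hc.mem.top_eq
  simp only [Prog.inspect, wp_seq, wp_assign, Expr.ok_zero, Expr.eval_zero, Expr.ok_one,
    Expr.eval_one, Expr.ok_var, Expr.eval_var, St.set_v, reduceCtorEq, if_false, htop]
  refine ⟨trivial, by omega, trivial, by omega, trivial, by omega, trivial, by omega, ?_⟩
  refine wp_loop_count k (fun n s' => Frame [.y, .jj, .zv, .zt, .yv, .yt, .c, .res, .rh, .cc, .f,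
      .mt, .ec] [.d, .hh] s s' ∧ s'.v .cc = n ∧
      (s'.v .f = 1 ↔ ∀ c < n, ∀ j < k, Start (sv bm u T (ℓ j)) (sv bm u T (ℓ c)) →
        u ≤ (sv bm u T (ℓ j)).1) ∧ (0 ≤ s'.v .mt ∧ s'.v .mt ≤ G.tmax) ∧
      (∀ c < n, s'.v .mt ≤ (sv bm u T (ℓ c)).2) ∧
      ((n = 0 ∧ s'.v .mt = G.tmax) ∨ ∃ c < n, s'.v .mt = (sv bm u T (ℓ c)).2) ∧
      s'.v .ec = (∑ x ∈ Finset.range n, x : ℕ) ∧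
      s'.clk ≤ s.clk + n * (16 * work bm u T k ℓ + 4 * k + 12) + 4) ?_ ?_ ?_
  · rintro n hn s1 ⟨hF, hcc, h1, h2, h3, h4, h5, h6⟩
    have hm1 := hm.frame hF (by decide) (by decide)
    have hc1 := hc.frame hF (by decide) (by decide)
    have hln := hm.lt n hn
    refine ⟨by simp, by simp [hcc, hm1.k_eq, hn], ?_⟩
    simp only [wp_seq, wp_assign, Expr.ok_ld, Expr.ok_var, Expr.eval_ld, Expr.eval_var,
      St.tick_v, St.tick_a, hcc, Int.toNat_natCast, hm1.ll n hn]
    refine ⟨by simp; omega, by omega, ?_⟩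
    have hF1 : Frame [.y] [] s1 (s1.tick.set .y (ℓ n)) := by
      simpa [Frame.set_iff] using Frame.refl _ _ _
    refine wp_row hr (hc1.frame hF1 (by decide) (by decide)) (hm1.frame hF1 (by decide) (by decide))
      hln (by simp) ?_
    intro s2 hF2 hd2 hh2 hclk2
    have hF2' : Frame [.y, .jj, .zv, .zt, .yv, .yt, .c, .res, .rh, .cc, .f, .mt, .ec] [.d, .hh]
        s s2 := (hF.trans_of hF1 (by decide) (by decide)).trans_of hF2 (by decide) (by decide)
    refine wp_inspectRow hr (hc.frame hF2' (by decide) (by decide))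
      (hm.frame hF2' (by decide) (by decide)) (fun j hj => hcl j hj n hn) hd2 hh2 ?_
    intro s3 hF3 hf3 hclk3
    have hF3' : Frame [.y, .jj, .zv, .zt, .yv, .yt, .c, .res, .rh, .cc, .f, .mt, .ec] [.d, .hh]
        s s3 := hF2'.trans_of hF3 (by decide) (by decide)
    have hf2 : s2.v .f = s1.v .f := by rw [hF2.v _ (by decide), hF1.v _ (by decide)]
    have hy : s3.v .y = ℓ n := by rw [hF3.v _ (by decide), hF2.v _ (by decide)]; simp
    have hmt : s3.v .mt = s1.v .mt := by
      rw [hF3.v _ (by decide), hF2.v _ (by decide), hF1.v _ (by decide)]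
    have hec : s3.v .ec = (∑ x ∈ Finset.range n, x : ℕ) := by
      rw [hF3.v _ (by decide), hF2.v _ (by decide), hF1.v _ (by decide), h5]
    have hcc3 : s3.v .cc = n := by
      rw [hF3.v _ (by decide), hF2.v _ (by decide), hF1.v _ (by decide), hcc]
    have hw3 := (hc.frame hF3' (by decide) (by decide)).wt _ hln
    have ht := hc.time (ℓ n)
    rw [hf2, h1] at hf3
    have hsum := sum_range_le (n + 1)
    -- The number of edges of a clique can be quadratic in its size; this is what the square in the
    -- word bound is for.
    have hsumB : ((∑ x ∈ Finset.range n, x : ℕ) : ℤ) + n ≤ B := by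
      have h7 : (n + 1) * (n + 1) ≤ Z * Z := Nat.mul_le_mul (by omega) (by omega)
      have h8 := hr.sq_le
      rw [Finset.sum_range_succ] at hsum
      have h9 : (((∑ x ∈ Finset.range n, x) + n : ℕ) : ℤ) ≤ ((Z * Z : ℕ) : ℤ) :=
        Int.ofNat_le.2 (hsum.trans h7)
      rw [Nat.cast_add, Nat.cast_mul] at h9
      linarith
    have hsum0 : (0 : ℤ) ≤ ((∑ x ∈ Finset.range n, x : ℕ) : ℤ) := Int.natCast_nonneg _
    simp only [wp_seq, wp_assign, wp_ite, wp_skip, Cond.ok_lt, Cond.holds_lt, Expr.ok_ld,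
      Expr.ok_var, Expr.ok_add, Expr.ok_one, Expr.eval_ld, Expr.eval_var, Expr.eval_add,
      Expr.eval_one, St.tick_v, St.tick_a, St.set_v, reduceCtorEq, if_false, if_true,
      hy, hw3, hmt, hec, hcc3, Int.toNat_natCast]
    have hclk : (n + 1) * (16 * work bm u T k ℓ + 4 * k + 12) =
        n * (16 * work bm u T k ℓ + 4 * k + 12) + (16 * work bm u T k ℓ + 4 * k + 12) := by ring
    simp only [St.tick_clk, St.set_clk] at hclk2 hclk3
    have hfn : s3.v .f = 1 ↔ ∀ c < n + 1, ∀ j < k,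
        Start (sv bm u T (ℓ j)) (sv bm u T (ℓ c)) → u ≤ (sv bm u T (ℓ j)).1 := by
      rw [hf3, Nat.forall_lt_succ_right]
    refine ⟨by simp; omega, fun hlt => ?_, fun hlt => ?_⟩
    · refine ⟨by simp; omega, by omega, by simp, by omega, by simp, by omega,
        by simpa [Frame.set_iff] using hF3', by simp, hfn, by omega, ?_, .inr ⟨n, by omega, by simp⟩,
        by simp [Finset.sum_range_succ], ?_⟩
      · intro c hc
        rcases Nat.lt_succ_iff_lt_or_eq.1 hc with h | rfl
        · exact hlt.le.trans (h3 c h)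
        · exact le_rfl
      · simp only [St.tick_clk, St.set_clk]; omega
    · refine ⟨by simp, by omega, by simp, by omega,
        by simpa [Frame.set_iff] using hF3', by simp, hfn, by omega, ?_, ?_,
        by simp [Finset.sum_range_succ], ?_⟩
      · intro c hc
        rcases Nat.lt_succ_iff_lt_or_eq.1 hc with h | rfl
        · exact h3 c h
        · exact not_lt.1 hlt
      · right
        rcases h4 with ⟨-, h4⟩ | ⟨c, hc, h4⟩
        · exact ⟨n, by omega, by omega⟩
        · exact ⟨c, by omega, h4⟩
      · simp only [St.tick_clk, St.set_clk]; omega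
  · rintro s1 ⟨hF, hcc, h1, h2, h3, h4, h5, h6⟩
    have hk1 := (hm.frame hF (by decide) (by decide)).k_eq
    exact ⟨by simp, by simp [hcc, hk1], hQ _ (by simpa using hF) h1 h3 (h4.imp_left And.left) h5
      (by simp; omega)⟩
  · exact ⟨by simpa [Frame.set_iff] using Frame.refl _ _ _, by simp, by simp, by simp, by simp,
      by simp, by simp, by simp⟩

end ThickEdgeGraph


/-- `s'` differs from `s` at most in the variables `V`, the arrays `A`, the output and the clock. -/
structure Keeps (V : List Var) (A : List Arr) (s s' : St) : Prop where
  v : ∀ x, x ∉ V → s'.v x = s.v x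
  a : ∀ b, b ∉ A → s'.a b = s.a b

theorem Frame.keeps {V : List Var} {A : List Arr} {s s' : St} (h : Frame V A s s') :
    Keeps V A s s' := ⟨h.v, h.a⟩

namespace Keeps

variable {V V' : List Var} {A A' : List Arr} {s s' s'' : St}

theorem refl (V : List Var) (A : List Arr) (s : St) : Keeps V A s s :=
  ⟨fun _ _ => rfl, fun _ _ => rfl⟩

theorem mono (h : Keeps V A s s') (hV : V ⊆ V') (hA : A ⊆ A') : Keeps V' A' s s' :=
  ⟨fun x hx => h.v x fun hh => hx (hV hh), fun b hb => h.a b fun hh => hb (hA hh)⟩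

theorem trans (h : Keeps V A s s') (h' : Keeps V A s' s'') : Keeps V A s s'' :=
  ⟨fun x hx => (h'.v x hx).trans (h.v x hx), fun b hb => (h'.a b hb).trans (h.a b hb)⟩

theorem trans_of (h : Keeps V A s s') (h' : Keeps V' A' s' s'') (hV : V' ⊆ V) (hA : A' ⊆ A) :
    Keeps V A s s'' := h.trans (h'.mono hV hA)

@[simp] theorem tick_iff : Keeps V A s s'.tick ↔ Keeps V A s s' :=
  ⟨fun h => ⟨h.v, h.a⟩, fun h => ⟨h.v, h.a⟩⟩

@[simp] theorem write_iff {z : ℤ} : Keeps V A s (s'.write z) ↔ Keeps V A s s' :=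
  ⟨fun h => ⟨h.v, h.a⟩, fun h => ⟨h.v, h.a⟩⟩

theorem set_iff {x : Var} (hx : x ∈ V) {z : ℤ} : Keeps V A s (s'.set x z) ↔ Keeps V A s s' := by
  have hv : ∀ x', x' ∉ V → (s'.set x z).v x' = s'.v x' := fun x' hx' => by
    rw [St.set_v, if_neg (by rintro rfl; exact hx' hx)]
  exact ⟨fun h => ⟨fun x' hx' => by rw [← h.v x' hx', hv x' hx'], h.a⟩,
    fun h => ⟨fun x' hx' => by rw [← h.v x' hx', hv x' hx'], h.a⟩⟩

/-- Memory invariants do not mention the output. Resetting it gives a state to which the lemmas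
about `Frame` apply. -/
theorem frame (h : Keeps V A s s') : Frame V A s { s' with out := s.out } := ⟨h.v, h.a, rfl⟩

end Keeps

/-! ### Writing a clique -/

namespace ThickEdgeGraph

open Cmd

variable {G : ThickEdgeGraph} {bm Z : ℕ} {B : ℤ} {s : St} {Q : St → Prop} {u : Fin G.n} {T : ℤ}
  {i k w : ℕ} {b : ℤ} {ℓ : ℕ → ℕ} {δ α : ℕ → ℤ} {L : Finset ℕ}

theorem Mem.keeps {V : List Var} {A : List Arr} {s' : St} (h : Mem G bm s) (hF : Keeps V A s s')
    (hV : ∀ x ∈ [Var.n, .top, .bm], x ∉ V)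
    (hA : ∀ b ∈ [Arr.head, .nxt, .dst, .ts, .td, .len, .eid], b ∉ A) : Mem G bm s' := by
  have h1 := h.frame hF.frame hV hA
  exact ⟨h1.n_eq, h1.top_eq, h1.bm_eq, h1.head, h1.dst_eq, h1.ts_eq, h1.td_eq, h1.len_eq,
    h1.eid_eq⟩

theorem Ctx.keeps {V : List Var} {A : List Arr} {s' : St} (h : Ctx G bm u T s)
    (hF : Keeps V A s s') (hV : ∀ x ∈ [Var.n, .top, .bm, .u, .wn, .r], x ∉ V)
    (hA : ∀ b ∈ [Arr.head, .nxt, .dst, .ts, .td, .len, .eid, .wv, .wt], b ∉ A) :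
    Ctx G bm u T s' := by
  have h1 := h.frame hF.frame hV hA
  exact ⟨h.mem.keeps hF (fun x hx => hV x (by revert x; decide))
    (fun x hx => hA x (by revert x; decide)), h1.u_eq, h1.wn_eq, h1.r_eq, h1.wv, h1.wt, h1.time⟩

theorem Members.keeps {V : List Var} {A : List Arr} {s' : St}
    (h : Members w k ℓ s) (hF : Keeps V A s s') (hV : Var.k ∉ V) (hA : Arr.ll ∉ A) :
    Members w k ℓ s' :=
  ⟨(hF.v _ hV).trans h.k_eq, by rw [hF.a _ hA]; exact h.ll, h.lt, h.le⟩

theorem At.keeps {V : List Var} {A : List Arr} {s' : St} (h : At i L b s)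
    (hF : Keeps V A s s') (hV : Var.i ∉ V) (hA : ∀ x ∈ [Arr.bs, .st], x ∉ A) :
    At i L b s' :=
  ⟨(hF.v _ hV).trans h.i_eq, by rw [hF.a _ (hA _ (by decide)), h.bs],
    by rw [hF.a _ (hA _ (by decide))]; exact h.st⟩

/-- Two edges within a set of super-vertices of distinct vertices are distinct. -/
theorem fits_index_unique {X : ℕ → G.SV}
    (hX : ∀ j < k, ∀ j' < k, (X j).1 = (X j').1 → j = j') {e : Fin G.m} {β β' : Bool}
    {j c j' c' : ℕ} (hj : j < c) (hc : c < k) (hj' : j' < c') (hc' : c' < k)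
    (h : Fits (e, β) (X j) (X c)) (h' : Fits (e, β') (X j') (X c')) : j = j' ∧ c = c' := by
  obtain ⟨h1, h2, -⟩ := h
  obtain ⟨h1', h2', -⟩ := h'
  by_cases hβ : β = β'
  · subst hβ
    exact ⟨hX j (by omega) j' (by omega) (h1.symm.trans h1'),
      hX c hc c' hc' (h2.symm.trans h2')⟩
  · have hflip : ((e, β') : G.Half) = flip (e, β) := by
      cases β <;> cases β' <;> simp_all [flip]
    rw [hflip, src_flip] at h1'
    rw [hflip, dst_flip] at h2'
    have e1 := hX j (by omega) c' hc' (h1.symm.trans h2')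
    have e2 := hX c hc j' (by omega) (h2.symm.trans h1')
    omega

/-- Every earlier member has its edge to `X c`, and different `j` give different edges by
`fits_index_unique`. -/
theorem wp_emitRow (hr : Room G Z B) (hm : Mem G bm s) {X : ℕ → G.SV} {c : ℕ} (hcZ : c < Z)
    (hX : ∀ j ≤ c, ∀ j' ≤ c, (X j).1 = (X j').1 → j = j') (hcc : s.v .cc = c) (hjj : s.v .jj = 0)
    (hcl : ∀ j < c, 0 ≤ R bm (X j) (X c))
    (hh : ∀ j < c, ∀ a, Fits a (X j) (X c) → (bm : ℤ) ≤ len a → s.a .hh j = id a)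
    (hQ : ∀ s', Keeps [.jj] [] s s' → (∃ l : List (Fin G.m),
        s'.out = s.out ++ l.map (fun e : Fin G.m => ((e : ℕ) : ℤ)) ∧ l.Nodup ∧ l.length = c ∧
        ∀ e, e ∈ l ↔ ∃ j < c, ∃ β, Fits (e, β) (X j) (X c)) →
      s'.clk ≤ s.clk + 3 * c + 1 → Q s') :
    wp Z B (.loop (.lt Var.jj Var.cc) (.emit (.ld .eid (.ld .hh Var.jj)) ;; .jj ::= Var.jj + 1))
      Q s := by
  have hB := hr.le_B
  refine wp_loop_count c (fun n s' => Keeps [.jj] [] s s' ∧ s'.v .jj = n ∧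
    (∃ l : List (Fin G.m), s'.out = s.out ++ l.map (fun e : Fin G.m => ((e : ℕ) : ℤ)) ∧ l.Nodup ∧
      l.length = n ∧ ∀ e, e ∈ l ↔ ∃ j < n, ∃ β, Fits (e, β) (X j) (X c)) ∧
    s'.clk ≤ s.clk + 3 * n) ?_ ?_ ?_
  · rintro n hn s1 ⟨hF, hj, ⟨l, h1, h2, h3, h4⟩, h5⟩
    have hcc1 : s1.v .cc = c := (hF.v _ (by decide)).trans hcc
    obtain ⟨a, ha, hb, -⟩ := exists_fits_of_R_nonneg (hcl n hn)
    have hha : s1.a .hh n = id a := by rw [hF.a _ (by decide), hh n hn a ha hb]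
    have heid : s1.a .eid (id a) = (a.1 : ℕ) := by rw [hF.a _ (by decide), hm.eid_eq a hb]
    have hidZ := id_lt_Z hr a
    refine ⟨by simp, by simp [hj, hcc1, hn], ?_⟩
    simp only [wp_seq, wp_emit, wp_assign, Expr.ok_ld, Expr.ok_var, Expr.ok_add, Expr.ok_one,
      Expr.eval_ld, Expr.eval_var, Expr.eval_add, Expr.eval_one, St.tick_v, St.tick_a, St.write_v,
      hj, hha, heid, Int.toNat_natCast]
    refine ⟨by simp; omega, by simp, by omega, by simpa [Keeps.set_iff] using hF, by simp,
      ⟨l ++ [a.1], by simp [h1], ?_, by simp [h3], ?_⟩, by simp; omega⟩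
    · refine List.nodup_append.2 ⟨h2, by simp, ?_⟩
      rintro e he e' he' rfl
      obtain rfl : e = a.1 := by simpa using he'
      obtain ⟨j, hjn, β, hβ⟩ := (h4 _).1 he
      have := (fits_index_unique (k := c + 1) (fun j hj j' hj' => hX j (by omega) j' (by omega))
        (by omega) (by omega) (by omega) (by omega) hβ (β' := a.2) ha).1
      omega
    · intro e
      rw [List.mem_append, List.mem_singleton, h4, Nat.exists_lt_succ_right]
      refine or_congr_right ⟨?_, ?_⟩
      · rintro rfl; exact ⟨a.2, ha⟩
      · rintro ⟨β, hβ⟩; exact congrArg Prod.fst (hβ.unique ha)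
  · rintro s1 ⟨hF, hj, h1, h2⟩
    have hcc1 : s1.v .cc = c := (hF.v _ (by decide)).trans hcc
    exact ⟨by simp, by simp [hj, hcc1], hQ _ (by simpa using hF) h1 (by simp; omega)⟩
  · exact ⟨Keeps.refl _ _ _, by simpa using hjj, ⟨[], by simp, by simp, by simp, by simp⟩, by simp⟩

theorem wp_emitEdges (hr : Room G Z B) (hc : Ctx G bm u T s)
    (hm : Members (localList bm u T).length k ℓ s)
    (hcl : ∀ j < k, ∀ j' < k, j ≠ j' → 0 ≤ R bm (sv bm u T (ℓ j)) (sv bm u T (ℓ j')))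
    (hX : ∀ j < k, ∀ j' < k, (sv bm u T (ℓ j)).1 = (sv bm u T (ℓ j')).1 → j = j')
    (hQ : ∀ s', Keeps [.y, .jj, .zv, .zt, .yv, .yt, .c, .res, .rh, .cc] [.d, .hh] s s' →
      (∃ l : List (Fin G.m), s'.out = s.out ++ l.map (fun e : Fin G.m => ((e : ℕ) : ℤ)) ∧ l.Nodup ∧
        l.length = ∑ x ∈ Finset.range k, x ∧
        ∀ e, e ∈ l ↔ ∃ c < k, ∃ j < c, ∃ β, Fits (e, β) (sv bm u T (ℓ j)) (sv bm u T (ℓ c))) →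
      s'.clk ≤ s.clk + k * (16 * work bm u T k ℓ + 3 * k + 9) + 2 → Q s') :
    wp Z B Prog.emitEdges Q s := by
  have hZ := localList_lt_Z (bm := bm) (u := u) (T := T) hr
  have hB := hr.le_B
  have hle := hm.le
  simp only [Prog.emitEdges, wp_seq, wp_assign, Expr.ok_zero, Expr.eval_zero]
  refine ⟨trivial, by omega, ?_⟩
  refine wp_loop_count k (fun n s' => Keeps [.y, .jj, .zv, .zt, .yv, .yt, .c, .res, .rh, .cc]
      [.d, .hh] s s' ∧ s'.v .cc = n ∧
      (∃ l : List (Fin G.m), s'.out = s.out ++ l.map (fun e : Fin G.m => ((e : ℕ) : ℤ)) ∧ l.Nodup ∧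
        l.length = ∑ x ∈ Finset.range n, x ∧
        ∀ e, e ∈ l ↔ ∃ c < n, ∃ j < c, ∃ β, Fits (e, β) (sv bm u T (ℓ j)) (sv bm u T (ℓ c))) ∧
      s'.clk ≤ s.clk + n * (16 * work bm u T k ℓ + 3 * k + 9) + 1) ?_ ?_ ?_
  · rintro n hn s1 ⟨hF, hcc, ⟨l, h1, h2, h3, h4⟩, h5⟩
    have hm1 := hm.keeps hF (by decide) (by decide)
    have hc1 := hc.keeps hF (by decide) (by decide)
    have hln := hm.lt n hn
    refine ⟨by simp, by simp [hcc, hm1.k_eq, hn], ?_⟩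
    simp only [wp_seq, wp_assign, Expr.ok_ld, Expr.ok_var, Expr.eval_ld, Expr.eval_var,
      St.tick_v, St.tick_a, hcc, Int.toNat_natCast, hm1.ll n hn]
    refine ⟨by simp; omega, by omega, ?_⟩
    have hF1 : Frame [.y] [] s1 (s1.tick.set .y (ℓ n)) := by
      simpa [Frame.set_iff] using Frame.refl _ _ _
    refine wp_row hr (hc1.frame hF1 (by decide) (by decide)) (hm1.frame hF1 (by decide) (by decide))
      hln (by simp) ?_
    intro s2 hF2 hd2 hh2 hclk2
    have hF2' : Keeps [.y, .jj, .zv, .zt, .yv, .yt, .c, .res, .rh, .cc] [.d, .hh]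
        s s2 := (hF.trans_of hF1.keeps (by decide) (by decide)).trans_of hF2.keeps (by decide)
          (by decide)
    have hcc2 : s2.v .cc = n := by
      rw [hF2.v _ (by decide), hF1.v _ (by decide), hcc]
    have hout2 : s2.out = s1.out := by rw [hF2.out]; simp
    simp only [wp_seq, wp_assign, Expr.ok_zero, Expr.eval_zero]
    refine ⟨trivial, by omega, ?_⟩
    have hF3 : Keeps [.jj] [] s2 (s2.set .jj 0) := by simpa [Keeps.set_iff] using Keeps.refl _ _ _
    refine wp_emitRow hr ((hc.keeps hF2' (by decide) (by decide)).mem.keeps hF3 (by decide)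
      (by decide)) (X := fun j => sv bm u T (ℓ j)) (c := n) (by omega)
      (fun j hj j' hj' => hX j (by omega) j' (by omega)) (by simpa using hcc2) (by simp)
      (fun j hj => hcl j (by omega) n hn (by omega)) (fun j hj => by simpa using hh2 j (by omega)) ?_
    rintro s3 hF4 ⟨l', e1, e2, e3, e4⟩ hclk3
    have hF5 := (hF2'.trans_of hF3 (by decide) (by decide)).trans_of hF4 (by decide) (by decide)
    have hcc3 : s3.v .cc = n := by rw [hF4.v _ (by decide)]; simpa using hcc2
    simp only [wp_assign, Expr.ok_add, Expr.ok_var, Expr.ok_one, Expr.eval_add, Expr.eval_var,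
      Expr.eval_one, hcc3]
    refine ⟨by simp, by omega, by simpa [Keeps.set_iff] using hF5, by simp,
      ⟨l ++ l', ?_, ?_, ?_, ?_⟩, ?_⟩
    · simp [e1, hout2, h1]
    · refine List.nodup_append.2 ⟨h2, e2, ?_⟩
      rintro e he e' he' rfl
      obtain ⟨c, hc, j, hj, β, hβ⟩ := (h4 e).1 he
      obtain ⟨j', hj', β', hβ'⟩ := (e4 e).1 he'
      have := (fits_index_unique (X := fun j => sv bm u T (ℓ j)) hX hj (by omega) hj' hn hβ hβ').2
      omega
    · rw [List.length_append, h3, e3, Finset.sum_range_succ]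
    · intro e
      rw [List.mem_append, h4, e4, Nat.exists_lt_succ_right]
    · have hclk : (n + 1) * (16 * work bm u T k ℓ + 3 * k + 9) =
        n * (16 * work bm u T k ℓ + 3 * k + 9) + (16 * work bm u T k ℓ + 3 * k + 9) := by ring
      simp only [St.tick_clk, St.set_clk] at hclk2 hclk3 ⊢
      omega
  · rintro s1 ⟨hF, hcc, h1, h2⟩
    have hk1 := (hm.keeps hF (by decide) (by decide)).k_eq
    exact ⟨by simp, by simp [hcc, hk1], hQ _ (by simpa using hF) h1 (by simp; omega)⟩
  · exact ⟨by simpa [Keeps.set_iff] using Keeps.refl _ _ _, by simp, ⟨[], by simp, by simp, by simp,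
      by simp⟩, by simp⟩

theorem wp_emitVertices (hr : Room G Z B) (hc : Ctx G bm u T s)
    (hm : Members (localList bm u T).length k ℓ s)
    (hQ : ∀ s', Keeps [.cc] [] s s' → s'.out = s.out ++ (List.range k).flatMap (fun c =>
        [(((sv bm u T (ℓ c)).1 : ℕ) : ℤ), (sv bm u T (ℓ c)).2 - s.v .mt]) →
      s'.clk ≤ s.clk + 4 * k + 2 → Q s') :
    wp Z B Prog.emitVertices Q s := by
  have hZ := localList_lt_Z (bm := bm) (u := u) (T := T) hr
  have hB := hr.le_B
  have hle := hm.le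
  simp only [Prog.emitVertices, wp_seq, wp_assign, Expr.ok_zero, Expr.eval_zero]
  refine ⟨trivial, by omega, ?_⟩
  refine wp_loop_count k (fun n s' => Keeps [.cc] [] s s' ∧ s'.v .cc = n ∧
      s'.out = s.out ++ (List.range n).flatMap (fun c =>
        [(((sv bm u T (ℓ c)).1 : ℕ) : ℤ), (sv bm u T (ℓ c)).2 - s.v .mt]) ∧
      s'.clk ≤ s.clk + 4 * n + 1) ?_ ?_ ?_
  · rintro n hn s1 ⟨hF, hcc, h1, h2⟩
    have hm1 := hm.keeps hF (by decide) (by decide)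
    have hc1 := hc.keeps hF (by decide) (by decide)
    have hln := hm.lt n hn
    have hmt : s1.v .mt = s.v .mt := hF.v _ (by decide)
    refine ⟨by simp, by simp [hcc, hm1.k_eq, hn], ?_⟩
    simp only [wp_seq, wp_emit, wp_assign, Expr.ok_ld, Expr.ok_var, Expr.ok_add, Expr.ok_one,
      Expr.ok_sub, Expr.eval_sub,
      Expr.eval_ld, Expr.eval_var, Expr.eval_add, Expr.eval_one, St.tick_v, St.tick_a, St.write_v,
      St.write_a, hcc, hm1.ll n hn, hc1.wv _ hln, hc1.wt _ hln, hmt, Int.toNat_natCast]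
    refine ⟨by simp; omega, by simp; omega, by simp, by omega, by simpa [Keeps.set_iff] using hF,
      by simp, ?_, by simp; omega⟩
    simp [h1, List.range_succ]
  · rintro s1 ⟨hF, hcc, h1, h2⟩
    have hk1 := (hm.keeps hF (by decide) (by decide)).k_eq
    exact ⟨by simp, by simp [hcc, hk1], hQ _ (by simpa using hF) h1 (by simp; omega)⟩
  · exact ⟨by simpa [Keeps.set_iff] using Keeps.refl _ _ _, by simp, by simp, by simp⟩

/-- At a leaf the listed members are a `Sol`, so their vertices are distinct and all pairs are
joined. Hence the counted, the written and the abstract set of edges agree, and the least time stamp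
is the `base`. -/
theorem wp_leaf (hr : Room G Z B) (hc : Ctx G bm u T s) {hne : starting bm u T ≠ []}
    (hA : At (localList bm u T).length L b s)
    (hN : (localGraph bm u T hne).Node (localList bm u T).length L b) {q : ℕ}
    (hq1 : ∑ x ∈ L, ((G.adj bm (sv bm u T x).1).length + 1) ≤ q) (hq2 : L.card * L.card ≤ q)
    (hq3 : 1 ≤ q)
    (hQ : ∀ s', Keeps [.y, .jj, .zv, .zt, .yv, .yt, .c, .res, .rh, .cc, .f, .mt, .ec, .k, .q]
        [.d, .hh, .ll] s s' →
      ((Accept u (L.image (sv bm u T)) ∧ ∃ c : List (Fin G.m) × List (Fin G.n × ℤ),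
          c.1.Nodup ∧ c.2.Nodup ∧ (c.1.toFinset, c.2.toFinset) = cliqueOf (L.image (sv bm u T)) ∧
          s'.out = s.out ++ G.record c) ∨
        (¬ Accept u (L.image (sv bm u T)) ∧ s'.out = s.out)) →
      s'.clk ≤ s.clk + 100 * q * (localList bm u T).length → Q s') :
    wp Z B Prog.leaf Q s := by
  have hZ := localList_lt_Z (bm := bm) (u := u) (T := T) hr
  have hB := hr.le_B
  obtain ⟨hsol, hanch⟩ := sol_of_node hN
  have hb0 : (0 : ℤ) ≤ b := (Int.natCast_nonneg bm).trans hN.bm_le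
  rw [Prog.leaf, wp_seq]
  refine wp_list (w := (localList bm u T).length) (by omega) (by omega) hA.i_eq le_rfl hA.st
    hN.lt ?_
  intro s1 k ℓ hF1 hM1 hl hclk1
  have hk : k * k ≤ q := by rw [← hl.card]; exact hq2
  have hkw : k ≤ (localList bm u T).length := hM1.le
  have hW : work bm u T k ℓ ≤ q := by
    rw [work, hl.sum_eq fun x => (G.adj bm (sv bm u T x).1).length + 1]; exact hq1
  have hc1 := hc.frame hF1 (by decide) (by decide)
  have hℓ : ∀ j < k, ℓ j ∈ L := fun j hj => (hl.mem _).2 ⟨j, hj, rfl⟩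
  have hX : ∀ j < k, sv bm u T (ℓ j) ∈ L.image (sv bm u T) := fun j hj =>
    Finset.mem_image_of_mem _ (hℓ j hj)
  have hXex : ∀ x ∈ L.image (sv bm u T), ∃ j < k, sv bm u T (ℓ j) = x := by
    intro x hx
    obtain ⟨y, hy, rfl⟩ := Finset.mem_image.1 hx
    obtain ⟨j, hj, rfl⟩ := (hl.mem y).1 hy
    exact ⟨j, hj, rfl⟩
  have hXinj : ∀ j < k, ∀ j' < k, (sv bm u T (ℓ j)).1 = (sv bm u T (ℓ j')).1 → j = j' := by
    intro j hj j' hj' he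
    exact hl.inj hj hj' (sv_inj (hM1.lt j hj) (hM1.lt j' hj')
      (hsol.fst_inj (hX j hj) (hX j' hj') he))
  have hcl : ∀ j < k, ∀ j' < k, sv bm u T (ℓ j) ≠ sv bm u T (ℓ j') →
      0 ≤ R bm (sv bm u T (ℓ j)) (sv bm u T (ℓ j')) := fun j hj j' hj' hne =>
    hb0.trans (hsol.clique _ (hX j hj) _ (hX j' hj') hne)
  have hkpos : k ≠ 0 := by
    rintro rfl
    have := (hl.mem 0).1 hN.zero
    simp at this
  rw [wp_seq]
  refine wp_inspect hr hc1 hM1 hcl ?_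
  intro s2 hF2 hf hmt1 hmt2 hec hclk2
  have hF2' : Frame [.y, .jj, .zv, .zt, .yv, .yt, .c, .res, .rh, .cc, .f, .mt, .ec, .k, .q]
        [.d, .hh, .ll] s s2 := (hF1.mono (by decide) (by decide)).trans_of hF2 (by decide)
          (by decide)
  have hacc : s2.v .f = 1 ↔ Accept u (L.image (sv bm u T)) := by
    rw [hf]
    constructor
    · intro h x hx y hy hst
      obtain ⟨j, hj, rfl⟩ := hXex x hx
      obtain ⟨c, hc, rfl⟩ := hXex y hy
      exact h c hc j hj hst
    · exact fun h c hc j hj hst => h _ (hX j hj) _ (hX c hc) hst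
  have hbase : s2.v .mt = base (L.image (sv bm u T)) := by
    refine (base_eq ?_ ?_).symm
    · obtain ⟨c, hc, he⟩ := hmt2.resolve_left hkpos
      exact ⟨_, hX c hc, he.symm⟩
    · intro x hx
      obtain ⟨j, hj, rfl⟩ := hXex x hx
      exact hmt1 j hj
  have hkk : k ≤ q := (Nat.le_mul_self k).trans hk
  have hw1 : k * (16 * work bm u T k ℓ + 4 * k + 12) ≤ 32 * q * (localList bm u T).length := by
    rw [mul_comm]; exact Nat.mul_le_mul (by omega) hkw
  have hw2 : k * (16 * work bm u T k ℓ + 3 * k + 9) ≤ 28 * q * (localList bm u T).length := by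
    rw [mul_comm]; exact Nat.mul_le_mul (by omega) hkw
  have hwq : (localList bm u T).length ≤ q * (localList bm u T).length :=
    Nat.le_mul_of_pos_left _ hq3
  have hwpos : 1 ≤ (localList bm u T).length := (Nat.pos_of_ne_zero hkpos).trans_le hkw
  rw [mul_assoc] at hw1 hw2
  simp only [wp_ite, wp_skip, Cond.ok_eq, Cond.holds_eq, Expr.ok_var, Expr.ok_one, Expr.eval_var,
    Expr.eval_one, hacc]
  refine ⟨by simp, fun ha => ?_, fun ha => hQ _ (by simpa using hF2'.keeps)
    (.inr ⟨ha, by simp [hF2'.out]⟩) (by rw [mul_assoc]; simp only [St.tick_clk]; omega)⟩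
  simp only [wp_seq, wp_emit, Expr.ok_var, Expr.eval_var]
  refine ⟨trivial, ?_⟩
  have hF3 : Keeps [] [] s2 (s2.tick.write (s2.tick.v .ec)) := by simpa using Keeps.refl _ _ _
  have hc2 := hc1.frame hF2 (by decide) (by decide)
  have hM2 := hM1.frame hF2 (by decide) (by decide)
  refine wp_emitEdges hr (hc2.keeps hF3 (by decide) (by decide))
    (hM2.keeps hF3 (by decide) (by decide))
    (fun j hj j' hj' hne => hcl j hj j' hj' fun he => hne (hXinj j hj j' hj' (by rw [he]))) hXinj ?_
  rintro s4 hF4 ⟨l, e1, e2, e3, e4⟩ hclk4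
  have hM4 := (hM2.keeps hF3 (by decide) (by decide)).keeps hF4 (by decide) (by decide)
  have hc4 := (hc2.keeps hF3 (by decide) (by decide)).keeps hF4 (by decide) (by decide)
  refine ⟨trivial, ?_⟩
  have hF5 : Keeps [] [] s4 (s4.write (s4.v .k)) := by simpa using Keeps.refl _ _ _
  refine wp_emitVertices hr (hc4.keeps hF5 (by decide) (by decide))
    (hM4.keeps hF5 (by decide) (by decide)) ?_
  intro s6 hF6 ho6 hclk6
  refine hQ s6 ((((hF2'.keeps.trans_of hF3 (by decide) (by decide)).trans_of hF4 (by decide)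
    (by decide)).trans_of hF5 (by decide) (by decide)).trans_of hF6 (by decide) (by decide))
    (.inl ⟨ha, (l, (List.range k).map fun c => ((sv bm u T (ℓ c)).1,
      (sv bm u T (ℓ c)).2 - base (L.image (sv bm u T)))), e2, ?_, ?_, ?_⟩) ?_
  · refine List.Nodup.map_on ?_ List.nodup_range
    intro c hc c' hc' he
    exact hXinj c (by simpa using hc) c' (by simpa using hc') (Prod.ext_iff.1 he).1
  · rw [cliqueOf]
    refine Prod.ext ?_ ?_
    · ext e
      rw [List.mem_toFinset, e4, mem_edgesOf]
      constructor
      · rintro ⟨c, hc, j, hj, β, h⟩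
        exact ⟨_, hX j (by omega), _, hX c hc, β, h⟩
      · rintro ⟨x, hx, y, hy, β, h⟩
        obtain ⟨j, hj, rfl⟩ := hXex x hx
        obtain ⟨c, hc, rfl⟩ := hXex y hy
        rcases lt_trichotomy j c with h1 | h1 | h1
        · exact ⟨c, hc, j, h1, β, h⟩
        · exact absurd (by rw [h1]) h.ne
        · exact ⟨j, hj, c, h1, !β, h.flip⟩
    · ext x
      simp only [List.mem_toFinset, List.mem_map, List.mem_range, mem_shift]
      constructor
      · rintro ⟨c, hc, rfl⟩
        have := hX c hc
        simpa using this
      · intro hx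
        obtain ⟨j, hj, he⟩ := hXex _ hx
        refine ⟨j, hj, ?_⟩
        rw [he]
        simp
  · have hmt4 : (s4.write (s4.v .k)).v .mt = base (L.image (sv bm u T)) := by
      rw [hF5.v _ (by decide), hF4.v _ (by decide), hF3.v _ (by decide), hbase]
    have hk4 : (s4.write (s4.v .k)).v .mt = s4.v .mt := rfl
    rw [ho6]
    rw [hk4] at hmt4
    simp [hmt4, record, e1, e3, hec, hM4.k_eq, hF2'.out, List.flatMap_map]
    exact List.map_eq_flatMap
  · rw [mul_assoc]
    simp only [St.tick_clk, St.write_clk] at hclk4 hclk6 ⊢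
    omega

end ThickEdgeGraph


/-! ### Traversal of the search tree -/

namespace ThickEdgeGraph

open Cmd

variable {G : ThickEdgeGraph} {bm Z : ℕ} {B : ℤ} {s : St} {Q : St → Prop} {u : Fin G.n} {T : ℤ}
  {i k w : ℕ} {b : ℤ} {ℓ : ℕ → ℕ} {δ α : ℕ → ℤ} {L : Finset ℕ}

/-- The word list `o` consists of records of the cliques of the members of `P`. -/
def Writes (P : List (Finset G.SV)) (o : List ℤ) : Prop :=
  ∃ C : List (List (Fin G.m) × List (Fin G.n × ℤ)), o = C.flatMap G.record ∧
    (∀ c ∈ C, c.1.Nodup ∧ c.2.Nodup) ∧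
    C.map (fun c => (c.1.toFinset, c.2.toFinset)) = P.map cliqueOf

theorem Writes.nil : Writes (G := G) [] [] := ⟨[], by simp⟩

theorem Writes.append {P P' : List (Finset G.SV)} {o o' : List ℤ} (h : Writes P o)
    (h' : Writes P' o') : Writes (P ++ P') (o ++ o') := by
  obtain ⟨C, rfl, h2, h3⟩ := h
  obtain ⟨C', rfl, h2', h3'⟩ := h'
  refine ⟨C ++ C', by simp, fun c hc => ?_, by simp [h3, h3']⟩
  rcases List.mem_append.1 hc with hc | hc
  · exact h2 c hc
  · exact h2' c hc

/-- Those leaves in a list whose cliques are to be written at `u`. -/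
noncomputable def accepted (bm : ℕ) (u : Fin G.n) (T : ℤ) (ls : List (Finset ℕ)) :
    List (Finset G.SV) :=
  open scoped Classical in (ls.map fun F => F.image (sv bm u T)).filter fun P => Accept u P

theorem accepted_append (ls ls' : List (Finset ℕ)) :
    accepted bm u T (ls ++ ls') = accepted bm u T ls ++ accepted bm u T ls' := by
  simp [accepted]

/-- The variables and the arrays that the search changes. -/
def scratchV : List Var := [.y, .jj, .zv, .zt, .yv, .yt, .c, .res, .rh, .cc, .f, .mt, .ec, .k, .q,
  .e, .ay, .s1, .s2, .xa, .fl, .xl, .best, .i, .b0]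
def scratchA : List Arr := [.d, .hh, .ok, .a, .ll, .st, .bs]

/-- From `s` to `s'` the search has written the cliques of the leaves `ls` within time `t` and has
left the levels up to `i` of the stack unchanged. -/
structure Visited (bm : ℕ) (u : Fin G.n) (T : ℤ) (i : ℕ) (ls : List (Finset ℕ)) (t : ℕ)
    (s s' : St) : Prop where
  keeps : Keeps scratchV scratchA s s'
  st : ∀ x < i, ∀ t ≤ i, (t : ℤ) < s'.a .st x ↔ (t : ℤ) < s.a .st x
  bs : ∀ t ≤ i, s'.a .bs t = s.a .bs t
  out : ∃ o, s'.out = s.out ++ o ∧ Writes (accepted bm u T ls) o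
  clk : s'.clk ≤ s.clk + t

theorem Visited.trans {i' : ℕ} {ls ls' : List (Finset ℕ)} {t t' t'' : ℕ} {s s' s'' : St}
    (h : Visited bm u T i ls t s s') (h' : Visited bm u T i' ls' t' s' s'') (hi : i ≤ i')
    (ht : t + t' ≤ t'') : Visited bm u T i (ls ++ ls') t'' s s'' := by
  obtain ⟨o, ho, hw⟩ := h.out
  obtain ⟨o', ho', hw'⟩ := h'.out
  refine ⟨h.keeps.trans h'.keeps, fun x hx t ht => ?_, fun t ht => ?_, ⟨o ++ o', ?_, ?_⟩, ?_⟩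
  · rw [h'.st x (by omega) t (by omega), h.st x hx t ht]
  · rw [h'.bs t (by omega), h.bs t ht]
  · rw [ho', ho, List.append_assoc]
  · rw [accepted_append]; exact hw.append hw'
  · have := h.clk; have := h'.clk; omega

/-- The search leaves the node `L` of level `p + 1`. -/
structure Leaves (bm : ℕ) (u : Fin G.n) (T : ℤ) (p : ℕ) (L : Finset ℕ) (b : ℤ)
    (ls : List (Finset ℕ)) (t : ℕ) (s s' : St) : Prop
    extends Visited bm u T (p + 1) ls t s s' where
  i_eq : s'.v .i = p
  b0_eq : s'.v .b0 = if p ∈ L then b else -1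

open scoped Classical in
-- Stated in continuation style, since the whole traversal is one loop: if the loop is correct from
-- every state in which the search has left the node, it is correct from the state that enters it. A
-- round of the loop costs at most `C`. With `d` levels left, the subtree is charged `C * (2d + 1)`
-- for each leaf. A node that meets `1, …, r` has a leaf to charge. Among the children of a node
-- that does not, only the one with the unchanged set can again fail to meet them, so such nodes
-- form a single path, and one additional unit pays for it even if no leaf is found.
theorem wp_visit (hr : Room G Z B) {hne : starting bm u T ≠ []} {q C : ℕ} (hq0 : 1 ≤ q)
    (hq : ∀ i L b, (localGraph bm u T hne).Node i L b → i ≤ (localList bm u T).length →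
      ∑ x ∈ L, ((G.adj bm (sv bm u T x).1).length + 1) ≤ q ∧ L.card * L.card ≤ q)
    (hq3 : ∀ y, (G.adj bm (sv bm u T y).1).length + 1 ≤ q)
    (hC : 120 * q * (localList bm u T).length ≤ C) (d : ℕ) :
    ∀ p, p + 1 + d = (localList bm u T).length → ∀ L b, (localGraph bm u T hne).Node (p + 1) L b →
    ∀ s Q, Ctx G bm u T s → At (p + 1) L b s → s.v .b0 = G.tmax + 1 →
    (∀ s' ls, ls.Nodup → (∀ F, F ∈ ls ↔ (localGraph bm u T hne).Below (p + 1) L b F) →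
      Leaves bm u T p L b ls (C * (2 * d + 1) *
        (ls.length + if (localGraph bm u T hne).Meets L then 0 else 1)) s s' →
      wp Z B (.loop (.lt 0 Var.i) Prog.step) Q s') →
    wp Z B (.loop (.lt 0 Var.i) Prog.step) Q s := by
  have hZ := localList_lt_Z (bm := bm) (u := u) (T := T) hr
  have hB := hr.le_B
  have hw : (localGraph bm u T hne).w = (localList bm u T).length := rfl
  have hqw : (localList bm u T).length ≤ q * (localList bm u T).length :=
    Nat.le_mul_of_pos_left _ hq0
  rw [mul_assoc] at hC
  have hbt : ∀ {i L b}, (localGraph bm u T hne).Node i L b → 0 ≤ b ∧ b ≤ G.tmax := by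
    intro i L b hN
    refine ⟨(Int.natCast_nonneg bm).trans hN.bm_le, ?_⟩
    rcases hN.min.2 with ⟨-, h⟩ | ⟨x, -, y, -, -, h⟩
    · exact h.le
    · exact h ▸ ((localGraph bm u T hne).lt_top x y).le
  induction d with
  | zero =>
    intro p hp L b hN s Q hc hA hb0 hQ
    have hp1 : p + 1 = (localList bm u T).length := hp
    have hi := hA.i_eq
    refine wp_loop_step (by simp) (by simp [hi]) ?_
    have hF0 : Frame [] [] s s.tick.tick := by simpa using Frame.refl _ _ _
    simp only [Prog.step, wp_ite, Cond.ok_eq, Cond.holds_eq, Expr.ok_var, Expr.eval_var, St.tick_v,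
      hi, hc.wn_eq, hp1]
    refine ⟨by simp, fun _ => ?_, fun h => absurd trivial h⟩
    rw [wp_seq]
    refine wp_leaf hr (hc.frame hF0 (by decide) (by decide)) (L := L) (b := b) (hne := hne)
      (hp1 ▸ hA.frame hF0 (by decide) (by decide)) (hp1 ▸ hN) (hq _ _ _ hN hp1.le).1
      (hq _ _ _ hN hp1.le).2 hq0 ?_
    intro s1 hK1 hout1 hclk1
    have hA1 := hA.keeps ((hF0.keeps.mono (by simp) (by simp)).trans hK1) (by decide) (by decide)
    refine wp_pop (K := L) (c := b) (i := p) (by omega) hB hA1.i_eq (hA1.st p (by omega)) hA1.bs (hbt hN).1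
      (hbt hN).2 ?_
    intro s2 hF2 hi2 hb2 hclk2
    have hK2 : Keeps scratchV scratchA s s2 :=
      ((hF0.keeps.mono (List.nil_subset _) (List.nil_subset _)).trans_of hK1 (by decide)
        (by decide)).trans_of hF2.keeps (by decide) (by decide)
    refine hQ s2 [L] (by simp) ?_ ⟨⟨hK2, ?_, ?_, ?_, ?_⟩, hi2, hb2⟩
    · intro F
      rw [List.mem_singleton, show p + 1 = (localGraph bm u T hne).w from hp,
        LocalGraph.below_leaf_iff]
    · intro x _ t _
      rw [hF2.a _ (by decide), hK1.a _ (by decide)]; rfl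
    · intro t _
      rw [hF2.a _ (by decide), hK1.a _ (by decide)]; rfl
    · rw [hF2.out]
      rcases hout1 with ⟨ha, c, h1, h2, h3, h4⟩ | ⟨ha, h4⟩
      · refine ⟨G.record c, h4, [c], by simp, by simp [h1, h2], by simp [accepted, ha, h3]⟩
      · refine ⟨[], by simpa using h4, ?_⟩
        have : accepted bm u T [L] = [] := by simp [accepted, ha]
        rw [this]; exact Writes.nil
    · have : C ≤ C * (2 * 0 + 1) * ([L].length + if (localGraph bm u T hne).Meets L then 0 else 1)
          := by
        rw [mul_assoc]; exact Nat.le_mul_of_pos_right _ (by simp)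
      simp only [St.tick_clk] at hclk1
      rw [mul_assoc] at hclk1
      omega
  | succ d ih =>
    intro p hp L b hN s Q hc hA hb0 hQ
    have hp1 : p + 1 < (localList bm u T).length := by omega
    have hq' := hq _ _ _ hN hp1.le
    have hkq := (Nat.le_mul_self L.card).trans hq'.2
    have hkL : L.card ≤ p + 1 := by
      exact (Finset.card_le_card (t := Finset.range (p + 1)) fun x hx => by
        simpa using hN.lt x hx).trans (by simp)
    -- The children with keys below the current `b0`, by strong induction on `b0 + 1`. Each child
    -- costs one round and its subtree, and a final round finds that no child is left. The
    -- additional unit is needed only while the child with key `-1` is still to come.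
    have drain : ∀ N : ℕ, ∀ s, Ctx G bm u T s → At (p + 1) L b s → (s.v .b0 + 1).toNat = N →
        (∀ s' ls, ls.Nodup → (∀ F, F ∈ ls ↔ ∃ key K c, (localGraph bm u T hne).Child (p + 1) L b
            key K c ∧ key < s.v .b0 ∧ (localGraph bm u T hne).Below (p + 2) K c F) →
          Leaves bm u T p L b ls (C + (C + C * (2 * d + 1)) * (ls.length +
            if (localGraph bm u T hne).Meets L ∨ s.v .b0 ≤ -1 then 0 else 1)) s s' →
          wp Z B (.loop (.lt 0 Var.i) Prog.step) Q s') →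
        wp Z B (.loop (.lt 0 Var.i) Prog.step) Q s := by
      intro N
      induction N using Nat.strong_induction_on with
      | _ N ihN =>
      intro s hc hA hNs hQ
      have hi := hA.i_eq
      refine wp_loop_step (by simp) (by simp [hi]) ?_
      have hF0 : Frame [] [] s s.tick.tick := by simpa using Frame.refl _ _ _
      simp only [Prog.step, wp_ite, Cond.ok_eq, Cond.holds_eq, Expr.ok_var, Expr.eval_var,
        St.tick_v, hi, hc.wn_eq]
      refine ⟨by simp, fun h => absurd (Int.natCast_inj.1 h) hp1.ne, fun _ => ?_⟩
      rw [wp_seq]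
      refine wp_next hr (hc.frame hF0 (by decide) (by decide)) (hne := hne)
        (hA.frame hF0 (by decide) (by decide)) hN hp1 hq'.1 hq'.2 hq3 ?_
      intro s1 k ℓ α hF1 hK1 hl1 hα1 hbest hclk1
      have hKe1 : Keeps scratchV scratchA s s1 :=
        (hF0.keeps.mono (List.nil_subset _) (List.nil_subset _)).trans_of hF1.keeps (by decide)
          (by decide)
      have hc1 := hc.keeps hKe1 (by decide) (by decide)
      have hA1 : At (p + 1) L b s1 := (hA.frame hF0 (by decide) (by decide)).frame hF1 (by decide)
        (by decide)
      have hst1 : s1.a .st = s.a .st := hF1.a _ (by decide)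
      have hbs1 : s1.a .bs = s.a .bs := hF1.a _ (by decide)
      have hb01 : s1.v .b0 = s.v .b0 := hF1.v _ (by decide)
      have hk : L.card = k := hl1.card
      rw [mul_assoc] at hclk1
      simp only [St.tick_clk, St.tick_v] at hclk1 hbest
      simp only [wp_ite, Cond.ok_lt, Cond.holds_lt, Expr.ok_lit, Expr.eval_lit, Expr.ok_var,
        Expr.eval_var]
      rcases hbest with ⟨hlt, ⟨K, c, hch⟩, hmax⟩ | ⟨hb2, hall⟩
      · have hge := hch.key_ge
        refine ⟨by simp, fun _ => ?_, fun h => by omega⟩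
        have hF1' : Frame [] [] s1 s1.tick := by simpa using Frame.refl _ _ _
        refine wp_push hr (hc1.frame hF1' (by decide) (by decide)) (hne := hne)
          (hA1.frame hF1' (by decide) (by decide)) hN (hK1.frame hF1' (by decide) (by decide)) hl1 hα1
          (by simpa using hch) ?_
        intro s2 hF2 hA2 hb02 hst2 hbs2 hclk2
        have hN2 := hch.node hN (by omega)
        have hKe2 : Keeps scratchV scratchA s s2 :=
          (hKe1.trans_of hF1'.keeps (by decide) (by decide)).trans_of hF2.keeps (by decide)
            (by decide)
        refine ih (p + 1) (by omega) K c hN2 s2 Q (hc.keeps hKe2 (by decide) (by decide)) hA2 hb02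
          ?_
        intro s3 l3 hnd3 hm3 hL3
        have hkey : s3.v .b0 = s1.v .best := by rw [hL3.b0_eq, hch.key_eq hN.lt]
        have hst3 : ∀ x < p + 1, ∀ t ≤ p + 1, (t : ℤ) < s3.a .st x ↔ (t : ℤ) < s.a .st x := by
          intro x hx t ht
          rw [hL3.st x (by omega) t (by omega), hst2 x hx t ht, St.tick_a, hst1]
        have hbs3 : ∀ t ≤ p + 1, s3.a .bs t = s.a .bs t := by
          intro t ht
          rw [hL3.bs t (by omega), hbs2 t ht, St.tick_a, hbs1]
        have hV3 : Visited bm u T (p + 1) l3 (C + C * (2 * d + 1) * (l3.length +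
            if (localGraph bm u T hne).Meets K then 0 else 1)) s s3 := by
          refine ⟨hKe2.trans hL3.keeps, hst3, hbs3, ?_, ?_⟩
          · obtain ⟨o, ho, hw⟩ := hL3.out
            exact ⟨o, by rw [ho, hF2.out, St.tick_out, hF1.out, St.tick_out, St.tick_out], hw⟩
          · have := hL3.clk
            simp only [St.tick_clk] at hclk2
            omega
        refine ihN _ ?_ s3 (hc.keeps hV3.keeps (by decide) (by decide)) ⟨?_, ?_, ?_⟩ rfl ?_
        -- On return `b0` is the key of the child just left, which is smaller than before and at
        -- least `-1`.
        · rw [hkey]; omega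
        · exact_mod_cast hL3.i_eq
        · rw [hbs3 _ le_rfl, hA.bs]
        · intro x hx
          rw [hA.st x hx]
          exact_mod_cast (hst3 x hx (p + 1) le_rfl).symm
        intro s4 l4 hnd4 hm4 hL4
        refine hQ s4 (l3 ++ l4) ?_ ?_ ⟨hV3.trans hL4.toVisited le_rfl ?_, hL4.i_eq, hL4.b0_eq⟩
        · refine List.nodup_append'.2 ⟨hnd3, hnd4, fun F h3 h4 => ?_⟩
          -- A leaf below two children would make them equal, whereas the later one has a smaller
          -- key.
          obtain ⟨key, K', c', hch', hlt', hbel⟩ := (hm4 F).1 h4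
          obtain ⟨rfl, rfl⟩ := hbel.unique ((hm3 F).1 h3) (by omega) (hch'.node hN (by omega)) hN2
          have := hch'.key_eq hN.lt
          have := hch.key_eq hN.lt
          omega
        · intro F
          rw [List.mem_append, hm3, hm4]
          constructor
          · rintro (h | ⟨key, K', c', h1, h2, h3⟩)
            · exact ⟨_, K, c, hch, by omega, h⟩
            · exact ⟨key, K', c', h1, by omega, h3⟩
          · rintro ⟨key, K', c', h1, h2, h3⟩
            rcases (hmax key K' c' h1 h2).lt_or_eq with h | rfl
            · exact .inr ⟨key, K', c', h1, by omega, h3⟩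
            · obtain ⟨rfl, rfl⟩ := hch.ext h1
              exact .inl h3
        · rw [List.length_append, hkey]
          generalize C * (2 * d + 1) = X
          have e1 : ∀ a : ℕ, (C + X) * a = C * a + X * a := fun a => add_mul _ _ _
          rcases hch.meets (by omega) with ⟨h1, h2, -⟩ | h
          · subst h2
            by_cases hM : (localGraph bm u T hne).Meets K
            · obtain ⟨F, hF⟩ := LocalGraph.exists_below (by omega) (by omega) hN2 hM
              have h1 : 1 ≤ l3.length := List.length_pos_of_mem ((hm3 F).2 hF)
              have := Nat.le_mul_of_pos_right C h1
              simp only [hM, if_true, true_or, Nat.add_zero, e1, mul_add]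
              omega
            · simp only [hM, if_false, false_or, e1, mul_add, if_pos h1.le,
                if_neg (show ¬ s.v .b0 ≤ -1 by omega)]
              omega
          · obtain ⟨F, hF⟩ := LocalGraph.exists_below (by omega) (by omega) hN2 h
            have h1 : 1 ≤ l3.length := List.length_pos_of_mem ((hm3 F).2 hF)
            have := Nat.le_mul_of_pos_right C h1
            have h2 : (if (localGraph bm u T hne).Meets L ∨ s1.v .best ≤ -1 then 0 else 1) ≤
                if (localGraph bm u T hne).Meets L ∨ s.v .b0 ≤ -1 then 0 else 1 := by
              split_ifs with h3 h4 h4 <;> first | omega | exact absurd (h4.imp_right (by omega)) h3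
            have h3 := Nat.mul_le_mul_left C h2
            have h4 := Nat.mul_le_mul_left X h2
            simp only [h, if_true, Nat.add_zero, e1, mul_add]
            omega
      · refine ⟨by simp, fun h => by omega, fun _ => ?_⟩
        have hF1' : Frame [] [] s1 s1.tick := by simpa using Frame.refl _ _ _
        have hA1' := hA1.frame hF1' (by decide) (by decide)
        refine wp_pop (K := L) (c := b) (i := p) (by omega) hB hA1'.i_eq (hA1'.st p (by omega))
          hA1'.bs (hbt hN).1 (hbt hN).2 ?_
        intro s2 hF2 hi2 hb2 hclk2
        have hKe2 : Keeps scratchV scratchA s s2 :=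
          (hKe1.trans_of hF1'.keeps (by decide) (by decide)).trans_of hF2.keeps (by decide)
            (by decide)
        refine hQ s2 [] (by simp) ?_ ⟨⟨hKe2, ?_, ?_, ⟨[], ?_, ?_⟩, ?_⟩, hi2, hb2⟩
        · intro F
          simp only [List.not_mem_nil, false_iff]
          rintro ⟨key, K', c', h1, h2, -⟩
          have := hall key K' c' h1
          omega
        · intro x _ t _
          rw [hF2.a _ (by decide), St.tick_a, hst1]
        · intro t _
          rw [hF2.a _ (by decide), St.tick_a, hbs1]
        · rw [hF2.out, St.tick_out, hF1.out]; simp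
        · exact Writes.nil
        · simp only [St.tick_clk] at hclk2
          omega
    have hbelow : ∀ F, (∃ key K c, (localGraph bm u T hne).Child (p + 1) L b key K c ∧
        key < s.v .b0 ∧ (localGraph bm u T hne).Below (p + 2) K c F) ↔
        (localGraph bm u T hne).Below (p + 1) L b F := by
      intro F
      rw [LocalGraph.below_step_iff (by omega)]
      refine ⟨fun ⟨key, K, c, h1, _, h3⟩ => ⟨key, K, c, h1, h3⟩,
        fun ⟨key, K, c, h1, h3⟩ => ⟨key, K, c, h1, ?_, h3⟩⟩
      have hk := h1.key_eq hN.lt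
      have := (hbt (h1.node hN (by omega))).2
      split_ifs at hk <;> omega
    refine drain _ s hc hA rfl fun s' ls hnd hls hl => ?_
    have hls' : ∀ F, F ∈ ls ↔ (localGraph bm u T hne).Below (p + 1) L b F :=
      fun F => (hls F).trans (hbelow F)
    refine hQ s' ls hnd hls' ⟨⟨hl.keeps, hl.st, hl.bs, hl.out, hl.clk.trans ?_⟩, hl.i_eq, hl.b0_eq⟩
    have hε : (if (localGraph bm u T hne).Meets L ∨ s.v .b0 ≤ -1 then 0 else 1) =
        if (localGraph bm u T hne).Meets L then 0 else 1 := by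
      simp only [hb0, show ¬ ((G.tmax : ℤ) + 1 ≤ -1) by omega, or_false]
    rw [hε]
    have h1 : 1 ≤ ls.length + if (localGraph bm u T hne).Meets L then 0 else 1 := by
      split_ifs with hM
      · obtain ⟨F, hF⟩ := LocalGraph.exists_below (by omega) (by omega) hN hM
        exact List.length_pos_of_mem ((hls' F).2 hF)
      · omega
    generalize (ls.length + if (localGraph bm u T hne).Meets L then 0 else 1) = Y at h1 ⊢
    have h2 := Nat.le_mul_of_pos_right C h1
    -- A new level adds `2C` for each unit: one `C` for the round that enters a child, and one that
    -- pays for the final round, as there is at least one unit.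
    have h3 : C * (2 * (d + 1) + 1) * Y = (C + C * (2 * d + 1)) * Y + C * Y := by ring
    omega

end ThickEdgeGraph


/-! ### The search from one anchor -/

namespace ThickEdgeGraph

open Cmd

variable {G : ThickEdgeGraph} {bm Z : ℕ} {B : ℤ} {s : St} {Q : St → Prop} {u : Fin G.n} {T : ℤ}
  {i k w : ℕ} {b : ℤ} {ℓ : ℕ → ℕ} {δ α : ℕ → ℤ} {L : Finset ℕ}

theorem one_le_length_adj_sv (hne : starting bm u T ≠ []) (y : ℕ) :
    1 ≤ (G.adj bm (sv bm u T y).1).length := by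
  obtain ⟨a, ha⟩ := List.exists_mem_of_ne_nil _ hne
  rcases mem_localList.1 (sv_mem (bm := bm) (u := u) (T := T) y) with h | ⟨g, hg, hf⟩
  · rw [h]; exact List.length_pos_of_mem (mem_starting.1 ha).1
  · exact List.length_pos_of_mem (mem_adj.2 ⟨hf.flip.1, (mem_adj.1 hg).2⟩ : flip g ∈ _)

theorem length_adj_sv_le (hne : starting bm u T ≠ []) (y : ℕ) :
    (G.adj bm (sv bm u T y).1).length + 1 ≤ G.cliqueBound := by
  have h := (sum_adj_clique_le (bm := bm) (P := {sv bm u T y})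
    (fun x hx z hz hxz => absurd ((Finset.mem_singleton.1 hx).trans (Finset.mem_singleton.1 hz).symm)
      hxz) (fun x hx => by rw [Finset.mem_singleton.1 hx]; exact one_le_length_adj_sv hne y)).1
  simpa using h

theorem node_le_cliqueBound {hne : starting bm u T ≠ []} (hN : (localGraph bm u T hne).Node i L b)
    (hi : i ≤ (localList bm u T).length) :
    ∑ x ∈ L, ((G.adj bm (sv bm u T x).1).length + 1) ≤ G.cliqueBound ∧
      L.card * L.card ≤ G.cliqueBound := by
  classical
  have hinj : Set.InjOn (sv bm u T) L := fun x hx y hy h =>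
    sv_inj ((hN.lt x hx).trans_le hi) ((hN.lt y hy).trans_le hi) h
  have h := sum_adj_clique_le (bm := bm) (P := L.image (sv bm u T)) ?_ ?_
  · rwa [Finset.sum_image hinj, Finset.card_image_of_injOn hinj, pow_two] at h
  · intro x hx y hy hxy
    obtain ⟨x, hx', rfl⟩ := Finset.mem_image.1 hx
    obtain ⟨y, hy', rfl⟩ := Finset.mem_image.1 hy
    exact ((Int.natCast_nonneg bm).trans hN.bm_le).trans
      (hN.min.1 x hx' y hy' fun h => hxy (h ▸ rfl))
  · intro x hx
    obtain ⟨x, -, rfl⟩ := Finset.mem_image.1 hx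
    exact one_le_length_adj_sv hne x

/-- The root does not meet `1, …, r`, but a leaf exists, so its additional unit at most doubles the
number of leaves. With `2w` for the depth this gives `120 * 2 * 2 = 480`; the rest of `490` covers
the initialization. -/
theorem wp_search (hr : Room G Z B) (hc : Ctx G bm u T s) (hne : starting bm u T ≠ [])
    (hQ : ∀ s' ls, ls.Nodup →
      (∀ F, F ∈ ls ↔ ∃ c, (localGraph bm u T hne).Node (localList bm u T).length F c) →
      1 ≤ ls.length →
      Visited bm u T 0 ls (490 * G.cliqueBound * ((localList bm u T).length *
        (localList bm u T).length) * ls.length) s s' → Q s') :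
    wp Z B Prog.search Q s := by
  classical
  have hZ := localList_lt_Z (bm := bm) (u := u) (T := T) hr
  have hB := hr.le_B
  have hq0 : 1 ≤ G.cliqueBound := le_trans (by omega) (length_adj_sv_le hne 0)
  have hw : (localGraph bm u T hne).w = (localList bm u T).length := rfl
  have hw1 : 1 < (localList bm u T).length :=
    lt_of_le_of_lt (localGraph bm u T hne).r_pos (localGraph bm u T hne).r_lt
  simp only [Prog.search, wp_seq, wp_assign, wp_store, Expr.ok_zero, Expr.ok_one, Expr.ok_var,
    Expr.ok_add, Expr.eval_zero, Expr.eval_one, Expr.eval_add, Expr.eval_var, St.put_v, St.set_v,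
    hc.wn_eq, hc.mem.top_eq, reduceCtorEq, if_false]
  refine ⟨trivial, ⟨trivial, trivial⟩, by omega, by omega, trivial, trivial, by omega, by omega,
    trivial, by omega, ⟨trivial, trivial⟩, by omega, ?_⟩
  set s1 := (((s.put .st (0 : ℤ).toNat _).put .bs (1 : ℤ).toNat _).set .i 1).set .b0 _ with hs1
  have hF1 : Frame scratchV scratchA s s1 := by
    rw [hs1, Frame.set_iff (by decide), Frame.set_iff (by decide), Frame.put_iff (by decide),
      Frame.put_iff (by decide)]
    exact Frame.refl _ _ _
  have hA : At 1 {0} (localGraph bm u T hne).top s1 := by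
    refine ⟨by simp [hs1], by simp [hs1]; rfl, ?_⟩
    intro x hx
    obtain rfl : x = 0 := by omega
    simp [hs1]
    omega
  refine wp_visit hr hq0 (C := 120 * G.cliqueBound * (localList bm u T).length)
    (fun i L b hN hi => node_le_cliqueBound hN hi) (length_adj_sv_le hne) le_rfl
    ((localList bm u T).length - 1) 0 (by omega) {0} _ LocalGraph.root_node s1 Q
    (hc.frame hF1 (by decide) (by decide)) hA (by simp [hs1]) ?_
  intro s2 ls hnd hls hl
  obtain ⟨F, hF⟩ := LocalGraph.exists_below_root (Γ := localGraph bm u T hne)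
  have h1 : 1 ≤ ls.length := List.length_pos_of_mem ((hls F).2 hF)
  refine wp_loop_done (by simp) (by simp [hl.i_eq]) ?_
  refine hQ _ ls hnd (fun F => (hls F).trans LocalGraph.below_root_iff) h1
    ⟨by simpa using hF1.keeps.trans hl.keeps, by simp, ?_, ?_, ?_⟩
  · intro t ht
    obtain rfl : t = 0 := by omega
    rw [St.tick_a, hl.bs 0 (by omega)]
    simp [hs1]
  · obtain ⟨o, ho, hw⟩ := hl.out
    exact ⟨o, by rw [St.tick_out, ho, hF1.out], hw⟩
  · have h2 := hl.clk
    have h3 : s1.clk = s.clk + 4 := by simp [hs1]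
    have h4 : ls.length + (if (localGraph bm u T hne).Meets {0} then 0 else 1) ≤ 2 * ls.length := by
      split_ifs <;> omega
    have h5 := Nat.mul_le_mul (Nat.mul_le_mul_left (120 * G.cliqueBound * (localList bm u T).length)
      (show 2 * ((localList bm u T).length - 1) + 1 ≤ 2 * (localList bm u T).length by omega)) h4
    have h6 : 1 ≤ G.cliqueBound * ((localList bm u T).length * (localList bm u T).length) *
      ls.length := Nat.mul_pos (Nat.mul_pos hq0 (by positivity)) h1
    rw [St.tick_clk]
    have h7 : 120 * G.cliqueBound * (localList bm u T).length * (2 * (localList bm u T).length) *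
      (2 * ls.length) = 480 * (G.cliqueBound * ((localList bm u T).length *
        (localList bm u T).length) * ls.length) := by ring
    have h8 : 490 * G.cliqueBound * ((localList bm u T).length * (localList bm u T).length) *
      ls.length = 490 * (G.cliqueBound * ((localList bm u T).length * (localList bm u T).length) *
      ls.length) := by ring
    omega

end ThickEdgeGraph


/-! ### Building local lists and recognizing canonical half-edges -/

namespace ThickEdgeGraph

open Cmd

variable {G : ThickEdgeGraph} {bm Z : ℕ} {B : ℤ} {s : St} {Q : St → Prop} {u : Fin G.n} {T : ℤ}

theorem Chain.bounds (hr : Room G Z B) {nxt : ℕ → ℤ} {c : ℤ} {l : List G.Half}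
    (h : Chain nxt c l) : 0 ≤ c ∧ c < Z := by
  have := hr.le_Z
  cases l with
  | nil => have h : c = 0 := h; omega
  | cons a l => have := id_lt_Z hr a; rw [h.1]; omega

theorem length_adj_lt_Z (hr : Room G Z B) (u : Fin G.n) :
    2 * (G.adj bm u).length + 1 < Z := by
  have := sum_length_adj_le (bm := bm) {u}
  have := hr.le_Z
  simp at *; omega

/-- The arrays `wv` and `wt` hold the list `l`, of length `wn`. -/
structure Listed (l : List G.SV) (s : St) : Prop where
  wn_eq : s.v .wn = l.length
  wv : ∀ x (hx : x < l.length), s.a .wv x = ((l[x].1 : ℕ) : ℤ)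
  wt : ∀ x (hx : x < l.length), s.a .wt x = l[x].2

theorem Listed.append_singleton {l : List G.SV} {s' : St} {y : G.SV} (h : Listed l s)
    (hn : s'.v .wn = l.length + 1)
    (hv : s'.a .wv = Function.update (s.a .wv) l.length ((y.1 : ℕ) : ℤ))
    (ht : s'.a .wt = Function.update (s.a .wt) l.length y.2) : Listed (l ++ [y]) s' := by
  refine ⟨by simpa using hn, fun x hx => ?_, fun x hx => ?_⟩ <;>
    rw [List.length_append, List.length_singleton] at hx <;>
    rcases Nat.lt_succ_iff_lt_or_eq.1 hx with hx | rfl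
  · rw [hv, Function.update_of_ne hx.ne, List.getElem_append_left hx, h.wv x hx]
  · rw [hv, Function.update_self]; simp
  · rw [ht, Function.update_of_ne hx.ne, List.getElem_append_left hx, h.wt x hx]
  · rw [ht, Function.update_self]; simp

/-- Used for both passes, with `p` as the meaning of the test `t`. The hypothesis `hp` keeps `T`
within the active interval, so that the stored time stamps are in range. -/
theorem wp_append (hr : Room G Z B) (hm : Mem G bm s) (hu : s.v .u = (u : ℕ)) (hT : s.v .T = T)
    {t : Cond} {p : G.Half → Bool} {l : List G.SV} (hl : Listed l s)
    (ht : ∀ a ∈ G.adj bm u, ∀ s', Frame [.g, .wn] [.wv, .wt] s s' → s'.v .g = id a →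
      t.Ok Z s' ∧ (t.Holds s' ↔ p a))
    (hp : ∀ a ∈ G.adj bm u, p a → ts a ≤ T ∧ T ≤ ts a + len a)
    (hlen : l.length + (G.adj bm u).length < Z)
    (hQ : ∀ s', Frame [.g, .wn] [.wv, .wt] s s' →
      Listed (l ++ ((G.adj bm u).filter p).map (far T)) s' →
      s'.clk ≤ s.clk + 6 * (G.adj bm u).length + 2 → Q s') : wp Z B (Prog.append t) Q s := by
  have hB := hr.le_B
  have hZ := hr.le_Z
  have loop : ∀ (r : List G.Half) (l : List G.SV) (s1 : St), (∀ a ∈ r, a ∈ G.adj bm u) →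
      Frame [.g, .wn] [.wv, .wt] s s1 → Chain (s.a .nxt) (s1.v .g) r → Listed l s1 →
      l.length + r.length < Z →
      (∀ s', Frame [.g, .wn] [.wv, .wt] s s' → Listed (l ++ (r.filter p).map (far T)) s' →
        s'.clk ≤ s1.clk + 6 * r.length + 1 → Q s') →
      wp Z B (.loop (.lt 0 Var.g) (
        .ite t (.store .wv Var.wn (.ld .dst Var.g) ;;
          .store .wt Var.wn (.ld .td Var.g + Var.T - .ld .ts Var.g) ;; .wn ::= Var.wn + 1) .skip ;;
        .g ::= .ld .nxt Var.g)) Q s1 := by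
    intro r
    induction r with
    | nil =>
      intro l s1 _ hF hc hl _ hQ
      have hc : s1.v .g = 0 := hc
      exact wp_loop_done (by simp) (by simp [hc]) (hQ _ (by simpa using hF)
        (by simpa using ⟨hl.wn_eq, hl.wv, hl.wt⟩) (by simp))
    | cons a r ih =>
      intro l s1 hr1 hF hc hl hlen hQ
      obtain ⟨hc, hc'⟩ := hc
      have ha := hr1 a (by simp)
      have hid := id_pos a
      have hidZ := id_lt_Z hr a
      have hm1 := hm.frame hF (by decide) (by decide)
      have hb := (mem_adj.1 ha).2
      have e1 : s1.v .T = T := (hF.v _ (by decide)).trans hT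
      have e4 : s1.a .nxt = s.a .nxt := hF.a _ (by decide)
      have d1 := hm1.dst_eq a hb
      have d2 := hm1.ts_eq a hb
      have d3 := hm1.td_eq a hb
      have hnb := hc'.bounds hr
      have hwn := hl.wn_eq
      have hdst := (dst a).2
      have htd := td_pos a
      have htd' := td_add_len_le a
      have ht1 := ht a ha s1.tick.tick (by simpa using hF) (by simpa using hc)
      have ht0 := ht a ha s1.tick (by simpa using hF) (by simpa using hc)
      simp only [List.length_cons] at hlen
      refine wp_loop_step (by simp) (by simp [hc, hid]) ?_
      simp only [wp_seq, wp_ite, wp_skip]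
      refine ⟨ht0.1, fun h => ?_, fun h => ?_⟩
      · have hpa := ht0.2.1 h
        obtain ⟨h1, h2⟩ := hp a ha hpa
        simp only [wp_seq, wp_assign, wp_store, Expr.ok_ld, Expr.ok_var, Expr.ok_add, Expr.ok_sub,
          Expr.ok_one, Expr.eval_ld, Expr.eval_var, Expr.eval_add, Expr.eval_sub, Expr.eval_one,
          St.tick_v, St.tick_a, St.put_v, St.put_a, St.set_v, St.set_a, reduceCtorEq, if_false, hc,
          hwn, Int.toNat_natCast, d1, d2, d3, e1, e4]
        refine ⟨trivial, ⟨trivial, by omega, by omega⟩, by omega, by omega, trivial,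
          ⟨⟨⟨trivial, by omega, by omega⟩, trivial⟩, trivial, by omega, by omega⟩, by omega,
          by omega, ⟨trivial, trivial⟩, by omega, ⟨trivial, by omega, by omega⟩, by omega, ?_⟩
        refine ih (l ++ [far T a]) _ (fun a ha => hr1 a (by simp [ha])) ?_ ?_
          (hl.append_singleton (by simp) (by simp [far]) (by simp [far])) (by simp; omega) ?_
        · simpa [Frame.set_iff, Frame.put_iff] using hF
        · simpa using hc'
        · intro s' h1 h2 h3
          refine hQ s' h1 ?_ ?_
          · rw [List.filter_cons_of_pos hpa]; simpa using h2
          · simp at h3 ⊢; omega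
      · have hpa : ¬ p a := fun hp => h (ht0.2.2 hp)
        simp only [wp_assign, Expr.ok_ld, Expr.ok_var, Expr.eval_ld, Expr.eval_var,
          St.tick_v, St.tick_a, hc, Int.toNat_natCast, e4]
        refine ⟨⟨trivial, by omega, by omega⟩, by omega, ?_⟩
        refine ih l _ (fun a ha => hr1 a (by simp [ha])) ?_ ?_ ⟨by simpa using hl.wn_eq,
          by simpa using hl.wv, by simpa using hl.wt⟩ (by omega) ?_
        · simpa [Frame.set_iff] using hF
        · simpa using hc'
        · intro s' h1 h2 h3
          refine hQ s' h1 ?_ ?_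
          · rw [List.filter_cons_of_neg hpa]; exact h2
          · simp at h3 ⊢; omega
  have hx := u.2
  have hhead := hm.head u
  have hhb := hhead.bounds hr
  simp only [Prog.append, wp_seq, wp_assign, Expr.ok_ld, Expr.ok_var, Expr.eval_ld, Expr.eval_var,
    hu, Int.toNat_natCast]
  refine ⟨⟨trivial, by omega, by omega⟩, by omega, loop _ l _ (fun a ha => ha) ?_ ?_
    ⟨by simpa using hl.wn_eq, by simpa using hl.wv, by simpa using hl.wt⟩ hlen ?_⟩
  · simpa [Frame.set_iff] using Frame.refl _ _ _
  · simpa using hhead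
  · intro s' h1 h2 h3
    refine hQ s' h1 h2 ?_
    simp at h3; omega

theorem wp_build (hr : Room G Z B) (hm : Mem G bm s) (hu : s.v .u = (u : ℕ)) (hT : s.v .T = T)
    (hT1 : 1 ≤ T) (hT2 : T ≤ G.tmax)
    (hQ : ∀ s', Frame [.g, .wn, .r] [.wv, .wt] s s' → Ctx G bm u T s' →
      s'.clk ≤ s.clk + 12 * (G.adj bm u).length + 8 → Q s') : wp Z B Prog.build Q s := by
  have hB := hr.le_B
  have hZ := hr.le_Z
  have hlZ := length_adj_lt_Z (bm := bm) hr u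
  have hx := u.2
  simp only [Prog.build, wp_seq, wp_assign, wp_store, Expr.ok_zero, Expr.ok_one, Expr.ok_var,
    Expr.eval_zero, Expr.eval_one, Expr.eval_var, St.put_v, hu, hT]
  refine ⟨trivial, trivial, by omega, by omega, trivial, trivial, by omega, by omega, trivial,
    by omega, ?_⟩
  set s1 := ((s.put .wv (0 : ℤ).toNat _).put .wt (0 : ℤ).toNat _).set .wn 1 with hs1
  have hF1 : Frame [.g, .wn, .r] [.wv, .wt] s s1 := by
    rw [hs1, Frame.set_iff (by decide), Frame.put_iff (by decide), Frame.put_iff (by decide)]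
    exact Frame.refl _ _ _
  have hl1 : Listed [(u, T)] s1 := by
    refine ⟨by simp [hs1], fun x hx => ?_, fun x hx => ?_⟩ <;>
      obtain rfl : x = 0 := by simpa using hx
    · simp [hs1]
    · simp [hs1]
  have hm1 := hm.frame hF1 (by decide) (by decide)
  have hT' : s1.v .T = T := (hF1.v _ (by decide)).trans hT
  have hu' : s1.v .u = (u : ℕ) := (hF1.v _ (by decide)).trans hu
  refine wp_append hr hm1 hu' hT' (p := fun a => ts a = T) hl1 ?_ ?_ (by simp; omega) ?_
  · intro a ha s' hF hg
    have hb := (mem_adj.1 ha).2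
    have := (hm1.frame hF (by decide) (by decide)).ts_eq a hb
    have hid := id_lt_Z hr a
    have e1 : s'.v .T = T := (hF.v _ (by decide)).trans hT'
    simp [hg, this, e1, hid]
  · intro a ha hp
    have := len_nonneg a
    simp at hp; omega
  intro s2 hF2 hl2 hclk2
  have hst : (G.adj bm u).filter (fun a => ts a = T) = starting bm u T := rfl
  rw [hst] at hl2
  have hsl : (starting bm u T).length ≤ (G.adj bm u).length := List.length_filter_le _ _
  have hwn2 := hl2.wn_eq
  simp only [List.length_append, List.length_singleton, List.length_map] at hwn2
  have hF2' := hF1.trans_of hF2 (by decide) (by decide)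
  simp only [wp_seq, wp_assign, Expr.ok_sub, Expr.ok_var, Expr.ok_one, Expr.eval_sub, Expr.eval_var,
    Expr.eval_one, hwn2]
  refine ⟨⟨trivial, trivial⟩, by push_cast; omega, ?_⟩
  have hF3 : Frame [.g, .wn, .r] [.wv, .wt] s (s2.set .r (((1 + (starting bm u T).length : ℕ) : ℤ)
    - 1)) := by rwa [Frame.set_iff (by decide)]
  have hm3 := hm.frame hF3 (by decide) (by decide)
  have hT3 : (s2.set .r (((1 + (starting bm u T).length : ℕ) : ℤ) - 1)).v .T = T :=
    (hF3.v _ (by decide)).trans hT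
  refine wp_append hr hm3 ((hF3.v _ (by decide)).trans hu) hT3
    (p := fun a => ts a < T ∧ T ≤ ts a + len a) (l := (u, T) :: (starting bm u T).map (far T))
    ⟨by simpa using hl2.wn_eq, by simpa using hl2.wv, by simpa using hl2.wt⟩ ?_ ?_
    (by simp; omega) ?_
  · intro a ha s' hF hg
    have hb := (mem_adj.1 ha).2
    have hm' := hm3.frame hF (by decide) (by decide)
    have h1 := hm'.ts_eq a hb
    have h2 := hm'.len_eq a hb
    have hid := id_lt_Z hr a
    have e1 : s'.v .T = T := (hF.v _ (by decide)).trans hT3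
    simp [hg, h1, h2, e1, hid]
  · intro a ha hp
    simp at hp; omega
  intro s4 hF4 hl4 hclk4
  have hon : (G.adj bm u).filter (fun a => ts a < T ∧ T ≤ ts a + len a) = ongoing bm u T := rfl
  rw [hon] at hl4
  have hll : ((u, T) :: (starting bm u T).map (far T)) ++ (ongoing bm u T).map (far T) =
    localList bm u T := rfl
  rw [hll] at hl4
  have hF5 := hF3.trans_of hF4 (by decide) (by decide)
  refine hQ s4 hF5 ⟨hm.frame hF5 (by decide) (by decide), (hF5.v _ (by decide)).trans hu, hl4.wn_eq,
    ?_, ?_, ?_, ?_⟩ ?_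
  · rw [hF4.v _ (by decide), St.set_v, if_pos rfl]; push_cast; ring
  · intro x hx
    rw [sv_eq_getElem hx, hl4.wv x hx]
  · intro x hx
    rw [sv_eq_getElem hx, hl4.wt x hx]
  · intro x
    rcases mem_localList.1 (sv_mem (bm := bm) (u := u) (T := T) x) with h | ⟨g, hg, hf⟩
    · rw [h]; exact ⟨hT1, hT2⟩
    · have := hf.flip.2.2.2
      have h1 := ts_pos (flip g)
      have h2 := ts_add_len_le (flip g)
      omega
  · have h1 : s1.clk = s.clk + 3 := by simp [hs1]
    rw [St.set_clk] at hclk4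
    omega

theorem wp_testCanonical (hr : Room G Z B) (hm : Mem G bm s) (hu : s.v .u = (u : ℕ)) {h : G.Half}
    (hh : h ∈ G.adj bm u) (hv : s.v .h = id h)
    (hQ : ∀ s', Frame [.T, .f, .g] [] s s' → s'.v .T = ts h →
      (s'.v .f = 1 ↔ Canonical bm u h) → s'.clk ≤ s.clk + 4 * (G.adj bm u).length + 4 → Q s') :
    wp Z B Prog.testCanonical Q s := by
  have hB := hr.le_B
  have hZ := hr.le_Z
  have hx := u.2
  have hidh := id_lt_Z hr h
  have hts := hm.ts_eq h (mem_adj.1 hh).2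
  have ht1 := ts_pos h
  have ht2 := ts_add_len_le h
  have ht3 := len_nonneg h
  have hhead := hm.head u
  have hhb := hhead.bounds hr
  have loop : ∀ (r r' : List G.Half) (s1 : St), G.adj bm u = r' ++ r →
      Frame [.T, .f, .g] [] s s1 → Chain (s.a .nxt) (s1.v .g) r → s1.v .T = ts h →
      (s1.v .f = 1 ↔ ∀ g ∈ r', ts g = ts h → id g ≤ id h) →
      (∀ s', Frame [.T, .f, .g] [] s s' → s'.v .T = ts h → (s'.v .f = 1 ↔ Canonical bm u h) →
        s'.clk ≤ s1.clk + 4 * r.length + 1 → Q s') →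
      wp Z B (.loop (.lt 0 Var.g) (
        .ite (.and (.eq (.ld .ts Var.g) Var.T) (.lt Var.h Var.g)) (.f ::= 0) .skip ;;
        .g ::= .ld .nxt Var.g)) Q s1 := by
    intro r
    induction r with
    | nil =>
      intro r' s1 hadj hF hc hT hf hQ
      have hc : s1.v .g = 0 := hc
      refine wp_loop_done (by simp) (by simp [hc]) (hQ _ (by simpa using hF) (by simpa using hT) ?_
        (by simp))
      rw [St.tick_v, hf, Canonical, hadj, List.append_nil]
    | cons a r ih =>
      intro r' s1 hadj hF hc hT hf hQ
      obtain ⟨hc, hc'⟩ := hc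
      have ha : a ∈ G.adj bm u := by rw [hadj]; simp
      have hid := id_pos a
      have hidZ := id_lt_Z hr a
      have hm1 := hm.frame hF (by decide) (by decide)
      have d2 := hm1.ts_eq a (mem_adj.1 ha).2
      have e1 : s1.v .h = id h := (hF.v _ (by decide)).trans hv
      have e4 : s1.a .nxt = s.a .nxt := hF.a _ (by decide)
      have hnb := hc'.bounds hr
      refine wp_loop_step (by simp) (by simp [hc, hid]) ?_
      simp only [wp_seq, wp_ite, wp_skip, wp_assign, Cond.ok_and, Cond.ok_eq, Cond.ok_lt,
        Cond.holds_and, Cond.holds_eq, Cond.holds_lt, Expr.ok_ld, Expr.ok_var, Expr.ok_zero,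
        Expr.eval_ld, Expr.eval_var, Expr.eval_zero, St.tick_v, St.tick_a, St.set_v, St.set_a,
        reduceCtorEq, if_false, hc, hT, d2, e1, e4, Int.toNat_natCast]
      refine ⟨⟨⟨⟨trivial, by omega, by omega⟩, trivial⟩, fun _ => ⟨trivial, trivial⟩⟩,
        fun hlt => ⟨trivial, by omega, ⟨trivial, by omega, by omega⟩, by omega, ?_⟩,
        fun hlt => ⟨⟨trivial, by omega, by omega⟩, by omega, ?_⟩⟩
      · refine ih (r' ++ [a]) _ (by simpa using hadj) (by simpa [Frame.set_iff] using hF)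
          (by simpa using hc') (by simpa using hT) ?_ fun s' h1 h2 h3 h4 => hQ s' h1 h2 h3 ?_
        · simp only [St.set_v, reduceCtorEq, if_false, if_true]
          refine iff_of_false (by omega) fun hall => ?_
          have := hall a (by simp) hlt.1
          omega
        · simp at h4 ⊢; omega
      · refine ih (r' ++ [a]) _ (by simpa using hadj) (by simpa [Frame.set_iff] using hF)
          (by simpa using hc') (by simpa using hT) ?_ fun s' h1 h2 h3 h4 => hQ s' h1 h2 h3 ?_
        · simp only [St.set_v, St.tick_v, reduceCtorEq, if_false, hf, List.mem_append,
            List.mem_singleton]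
          constructor
          · rintro hall g (hg | rfl) he
            · exact hall g hg he
            · by_contra hcon
              exact hlt ⟨he, by omega⟩
          · exact fun hall g hg => hall g (.inl hg)
        · simp at h4 ⊢; omega
  simp only [Prog.testCanonical, wp_seq, wp_assign, Expr.ok_ld, Expr.ok_var, Expr.ok_one,
    Expr.eval_ld, Expr.eval_var, Expr.eval_one, St.set_v, St.set_a, reduceCtorEq, if_false,
    hu, hv, hts, Int.toNat_natCast]
  refine ⟨⟨trivial, by omega, by omega⟩, by omega, trivial, by omega,
    ⟨trivial, by omega, by omega⟩, by omega, loop (G.adj bm u) [] _ (List.nil_append _).symm ?_ ?_ (by simp) (by simp) ?_⟩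
  · simpa [Frame.set_iff] using Frame.refl _ _ _
  · simpa using hhead
  · intro s' h1 h2 h3 h4
    refine hQ s' h1 h2 h3 ?_
    simp at h4; omega

end ThickEdgeGraph


/-! ### The searches from all anchors -/

namespace ThickEdgeGraph

open Cmd

variable {G : ThickEdgeGraph} {bm Z : ℕ} {B : ℤ} {s : St} {Q : St → Prop} {u : Fin G.n} {T : ℤ}

open scoped Classical in
variable (G) in
/-- The cliques of super-vertices that are to be listed. -/
noncomputable def sols (bm : ℕ) : Finset (Finset G.SV) :=
  ((Finset.univ ×ˢ Finset.Icc (1 : ℤ) G.tmax).powerset).filter fun P => ∃ b, Sol bm P b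

/-- The finite ambient set is no restriction: every member of a solution has an edge at its time
stamp, which therefore lies between `1` and `tmax`. -/
theorem mem_sols {P : Finset G.SV} : P ∈ G.sols bm ↔ ∃ b, Sol bm P b := by
  simp only [sols, Finset.mem_filter, Finset.mem_powerset, and_iff_right_iff_imp]
  rintro ⟨b, hb⟩ x hx
  obtain ⟨y, hy, hxy⟩ : ∃ y ∈ P, x ≠ y := by
    obtain ⟨p, hp, q, hq, hpq, -⟩ := hb.attained
    by_cases h : x = p
    · exact ⟨q, hq, h ▸ hpq⟩
    · exact ⟨p, hp, h⟩
  obtain ⟨a, ha, -⟩ := exists_fits_of_R_nonneg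
    (((Int.natCast_nonneg bm).trans hb.bm_le).trans (hb.clique x hx y hy hxy))
  have := ha.2.2.2
  have := ts_pos a
  have := ts_add_len_le a
  simp only [Finset.mem_product, Finset.mem_univ, Finset.mem_Icc, true_and]
  omega

open scoped Classical in
/-- The number of cliques found from an anchor. -/
noncomputable def leaves (bm : ℕ) (u : Fin G.n) (T : ℤ) : ℕ :=
  ((G.sols bm).filter fun P => Anchored P u T).card

open scoped Classical in
theorem image_leaves {hne : starting bm u T ≠ []} {ls : List (Finset ℕ)}
    (hls : ∀ F, F ∈ ls ↔ ∃ c, (localGraph bm u T hne).Node (localList bm u T).length F c)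
    (P : Finset G.SV) :
    P ∈ ls.map (fun F => F.image (sv bm u T)) ↔ P ∈ G.sols bm ∧ Anchored P u T := by
  simp only [List.mem_map, mem_sols]
  constructor
  · rintro ⟨F, hF, rfl⟩
    obtain ⟨c, hc⟩ := (hls F).1 hF
    have h := sol_of_node (h := hne) hc
    exact ⟨⟨c, by convert h.1⟩, by convert h.2⟩
  · rintro ⟨⟨b, hb⟩, hA⟩
    obtain ⟨F, hF, h⟩ := node_of_sol (h := hne) hb hA
    exact ⟨F, (hls F).2 ⟨b, hF⟩, by convert h⟩

open scoped Classical in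
theorem nodup_image_leaves {hne : starting bm u T ≠ []} {ls : List (Finset ℕ)} (hnd : ls.Nodup)
    (hls : ∀ F, F ∈ ls ↔ ∃ c, (localGraph bm u T hne).Node (localList bm u T).length F c) :
    (ls.map fun F => F.image (sv bm u T)).Nodup := by
  refine hnd.map_on fun F hF F' hF' he => ?_
  obtain ⟨c, hc⟩ := (hls F).1 hF
  obtain ⟨c', hc'⟩ := (hls F').1 hF'
  exact image_sv_inj (h := hne) hc hc' (by convert he)

theorem length_leaves {hne : starting bm u T ≠ []} {ls : List (Finset ℕ)} (hnd : ls.Nodup)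
    (hls : ∀ F, F ∈ ls ↔ ∃ c, (localGraph bm u T hne).Node (localList bm u T).length F c) :
    ls.length = leaves bm u T := by
  classical
  rw [leaves, ← List.length_map (fun F => F.image (sv bm u T)),
    ← List.toFinset_card_of_nodup (nodup_image_leaves hnd hls)]
  congr 1
  ext P
  rw [List.mem_toFinset, image_leaves hls, Finset.mem_filter]

/-- No search is in vain, so even the time for scanning the half-edges of `u` can be charged to
cliques. -/
theorem one_le_leaves (hne : starting bm u T ≠ []) : 1 ≤ leaves bm u T := by
  classical
  obtain ⟨F, hF⟩ := LocalGraph.exists_below_root (Γ := localGraph bm u T hne)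
  obtain ⟨c, hc⟩ := LocalGraph.below_root_iff.1 hF
  obtain ⟨h1, h2⟩ := sol_of_node hc
  exact Finset.card_pos.2 ⟨_, Finset.mem_filter.2 ⟨mem_sols.2 ⟨c, h1⟩, by convert h2⟩⟩

/-- From `s` to `s'` those members of `sols` that satisfy `A` have been written. -/
structure Found (bm : ℕ) (V : List Var) (A : Finset G.SV → Prop) (t : ℕ) (s s' : St) : Prop where
  keeps : Keeps V (scratchA ++ [.wv, .wt]) s s'
  out : ∃ Ps o, s'.out = s.out ++ o ∧ Writes Ps o ∧ Ps.Nodup ∧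
    ∀ P : Finset G.SV, P ∈ Ps ↔ P ∈ G.sols bm ∧ A P
  clk : s'.clk ≤ s.clk + t

namespace Found

variable {V V' : List Var} {A A' : Finset G.SV → Prop} {t t' : ℕ} {s' s'' : St}

theorem of_keeps (h : Keeps V (scratchA ++ [.wv, .wt]) s s') (ho : s'.out = s.out)
    (hA : ∀ P, ¬ A P) (ht : s'.clk ≤ s.clk + t) : Found bm V A t s s' :=
  ⟨h, ⟨[], [], by simp [ho], Writes.nil, by simp, by simp [hA]⟩, ht⟩

theorem mono (h : Found bm V A t s s') (hV : V ⊆ V') (hA : ∀ P, A P ↔ A' P) (ht : t ≤ t') :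
    Found bm V' A' t' s s' := by
  obtain ⟨Ps, o, h1, h2, h3, h4⟩ := h.out
  exact ⟨h.keeps.mono hV (List.Subset.refl _), ⟨Ps, o, h1, h2, h3, fun P => by rw [h4, hA]⟩,
    h.clk.trans (by omega)⟩

theorem trans (h : Found bm V A t s s') (h' : Found bm V A' t' s' s'')
    (hd : ∀ P ∈ G.sols bm, A P → ¬ A' P) :
    Found bm V (fun P => A P ∨ A' P) (t + t') s s'' := by
  obtain ⟨Ps, o, h1, h2, h3, h4⟩ := h.out
  obtain ⟨Ps', o', h1', h2', h3', h4'⟩ := h'.out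
  refine ⟨h.keeps.trans h'.keeps, ⟨Ps ++ Ps', o ++ o', ?_, h2.append h2', ?_, fun P => ?_⟩, ?_⟩
  · rw [h1', h1, List.append_assoc]
  · refine List.nodup_append'.2 ⟨h3, h3', fun P hP hP' => ?_⟩
    exact hd P ((h4 P).1 hP).1 ((h4 P).1 hP).2 ((h4' P).1 hP').2
  · rw [List.mem_append, h4, h4', and_or_left]
  · have := h.clk; have := h'.clk; omega

end Found

open scoped Classical in
/-- The time spent on a half-edge of `u`. -/
noncomputable def anchorCost (bm : ℕ) (u : Fin G.n) (h : G.Half) : ℕ :=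
  16 * (G.adj bm u).length + 15 + if Canonical bm u h then
    490 * G.cliqueBound * (((G.adj bm u).length + 1) * ((G.adj bm u).length + 1)) *
      leaves bm u (ts h) else 0

def anchorV : List Var := scratchV ++ [.T, .f, .g, .wn, .r]

theorem wp_anchor (hr : Room G Z B) (hm : Mem G bm s) (hu : s.v .u = (u : ℕ)) {h : G.Half}
    (hh : h ∈ G.adj bm u) (hv : s.v .h = id h)
    (hQ : ∀ s', Found bm anchorV (fun P => Assigned bm P u h) (anchorCost bm u h) s s' → Q s') :
    wp Z B Prog.anchor Q s := by
  classical
  have hne := starting_ne_nil hh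
  rw [Prog.anchor, wp_seq]
  refine wp_testCanonical hr hm hu hh hv ?_
  intro s1 hF1 hT1 hf1 hclk1
  simp only [wp_ite, wp_seq, wp_skip, Cond.ok_eq, Cond.holds_eq, Expr.ok_var, Expr.ok_one,
    Expr.eval_var, Expr.eval_one, hf1]
  have hF1' : Frame anchorV (scratchA ++ [.wv, .wt]) s s1.tick := by
    simpa using hF1.mono (by decide) (by decide)
  refine ⟨⟨trivial, trivial⟩, fun hc => ?_, fun hc => ?_⟩
  · have ht1 := ts_pos h
    have ht2 := ts_add_len_le h
    have ht3 := len_nonneg h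
    refine wp_build (T := ts h) hr (hm.frame hF1' (by decide) (by decide))
      ((hF1'.v _ (by decide)).trans hu) (by simpa using hT1) ht1 (by omega) ?_
    intro s2 hF2 hc2 hclk2
    refine wp_search hr hc2 hne ?_
    intro s3 ls hnd hls _ hV3
    have hw := length_localList_le (bm := bm) (u := u) (T := ts h)
    obtain ⟨o, ho, hwr⟩ := hV3.out
    refine hQ s3 ⟨?_, ⟨accepted bm u (ts h) ls, o, ?_, hwr, ?_, fun P => ?_⟩, ?_⟩
    · exact (hF1'.keeps.trans_of hF2.keeps (by decide) (by decide)).trans_of hV3.keeps (by decide)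
        (by decide)
    · rw [ho, hF2.out, hF1'.out]
    · exact (nodup_image_leaves hnd hls).filter _
    · rw [accepted, List.mem_filter, image_leaves hls]
      simp only [decide_eq_true_eq, Assigned]
      tauto
    · have h1 := hV3.clk
      rw [length_leaves hnd hls] at h1
      have h2 := Nat.mul_le_mul_right (leaves bm u (ts h)) (Nat.mul_le_mul_left
        (490 * G.cliqueBound) (Nat.mul_le_mul hw hw))
      rw [anchorCost, if_pos hc]
      simp only [St.tick_clk] at hclk2
      omega
  · refine hQ _ (.of_keeps (by simpa using hF1'.keeps) (by simpa using hF1'.out) (fun P hP => hc hP.2.1)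
      ?_)
    simp only [St.tick_clk, anchorCost]
    omega

/-- Every solution is assigned to exactly one pair of a vertex and a half-edge: existence makes the
output complete, uniqueness makes the contributions disjoint. -/
theorem wp_searches (hr : Room G Z B) (hm : Mem G bm s)
    (hQ : ∀ s', Found bm (anchorV ++ [.h, .u]) (fun _ : Finset G.SV => True)
      (∑ u : Fin G.n, (4 + ((G.adj bm u).map fun h => anchorCost bm u h + 2).sum) + 2) s s' →
      Q s') :
    wp Z B Prog.searches Q s := by
  classical
  have hB := hr.le_B
  have hZ := hr.le_Z
  have hdis : ∀ {P : Finset G.SV}, P ∈ G.sols bm → ∀ {u u' h h'}, Assigned bm P u h →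
      Assigned bm P u' h' → u = u' ∧ h = h' := by
    intro P hP u u' h h' h1 h2
    obtain ⟨b, hb⟩ := mem_sols.1 hP
    exact hb.assigned_unique h1 h2
  -- the loop over the half-edges of a vertex
  have inner : ∀ (u : Fin G.n) (r r' : List G.Half) (s1 : St) (Q : St → Prop),
      G.adj bm u = r' ++ r → Mem G bm s1 → s1.v .u = (u : ℕ) →
      Chain (s1.a .nxt) (s1.v .h) r →
      (∀ s', Found bm (anchorV ++ [.h]) (fun P => ∃ h ∈ r, Assigned bm P u h)
        ((r.map fun h => anchorCost bm u h + 2).sum + 1) s1 s' → Q s') →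
      wp Z B (.loop (.lt 0 Var.h) (Prog.anchor ;; .h ::= .ld .nxt Var.h)) Q s1 := by
    intro u r
    induction r with
    | nil =>
      intro r' s1 Q hadj hm hu hc hQ
      have hc : s1.v .h = 0 := hc
      exact wp_loop_done (by simp) (by simp [hc]) (hQ _ (.of_keeps (by simpa using Keeps.refl _ _ _)
        (by simp) (by simp) (by simp)))
    | cons a r ih =>
      intro r' s1 Q hadj hm hu hc hQ
      obtain ⟨hc, hc'⟩ := hc
      have hid := id_pos a
      have hidZ := id_lt_Z hr a
      have hnb := hc'.bounds hr
      have ha : a ∈ G.adj bm u := by rw [hadj]; simp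
      refine wp_loop_step (by simp) (by simp [hc, hid]) ?_
      rw [wp_seq]
      have hF0 : Frame [] [] s1 s1.tick := by simpa using Frame.refl _ _ _
      refine wp_anchor hr (hm.frame hF0 (by decide) (by decide)) (by simpa using hu) ha
        (by simpa using hc) ?_
      intro s2 hf2
      have hk2 : Keeps anchorV (scratchA ++ [.wv, .wt]) s1 s2 :=
        (hF0.keeps.mono (List.nil_subset _) (List.nil_subset _)).trans hf2.keeps
      have hh2 : s2.v .h = id a := (hk2.v _ (by decide)).trans hc
      have hn2 : s2.a .nxt = s1.a .nxt := hk2.a _ (by decide)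
      simp only [wp_assign, Expr.ok_ld, Expr.ok_var, Expr.eval_ld, Expr.eval_var, hh2, hn2,
        Int.toNat_natCast]
      refine ⟨⟨trivial, by omega, by omega⟩, by omega, ?_⟩
      have hk3 : Keeps (anchorV ++ [.h]) (scratchA ++ [.wv, .wt]) s1
          (s2.set .h (s1.a .nxt (id a))) := by
        rw [Keeps.set_iff (by decide)]; exact hk2.mono (by decide) (by decide)
      refine ih (r' ++ [a]) _ _ (by simpa using hadj) (hm.keeps hk3 (by decide) (by decide))
        ((hk3.v _ (by decide)).trans hu) (by simpa [hn2] using hc') ?_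
      intro s4 hf4
      obtain ⟨Ps, o, h1, h2, h3, h4⟩ := hf2.out
      have hf3 : Found bm (anchorV ++ [.h]) (fun P => Assigned bm P u a) (anchorCost bm u a + 2) s1
          (s2.set .h (s1.a .nxt (id a))) := by
        refine ⟨hk3, ⟨Ps, o, by simpa using h1, h2, h3, h4⟩, ?_⟩
        have := hf2.clk
        simp at this ⊢; omega
      refine hQ s4 ((hf3.trans hf4 ?_).mono (List.Subset.refl _) (by simp) ?_)
      · rintro P hP hA ⟨h, hh, hA'⟩
        obtain rfl := (hdis hP hA hA').2
        have := nodup_adj (bm := bm) u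
        rw [hadj] at this
        exact (List.nodup_cons.1 (List.nodup_append'.1 this).2.1).1 hh
      · simp; omega
  simp only [Prog.searches, wp_seq, wp_assign, Expr.ok_zero, Expr.eval_zero]
  refine ⟨trivial, by omega, ?_⟩
  refine wp_loop_count G.n (fun i s' => s'.v .u = i ∧ Found bm (anchorV ++ [.h, .u])
    (fun P => ∃ (u : Fin G.n) (h : G.Half), (u : ℕ) < i ∧ Assigned bm P u h)
    (∑ u ∈ Finset.univ.filter (fun u : Fin G.n => (u : ℕ) < i),
      (4 + ((G.adj bm u).map fun h => anchorCost bm u h + 2).sum) + 1)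
    s s') ?_ ?_ ?_
  · rintro i hi s1 ⟨hu1, hf1⟩
    have hm1 := hm.keeps hf1.keeps (by decide) (by decide)
    have hhead := hm1.head ⟨i, hi⟩
    have hhb := hhead.bounds hr
    dsimp only at hhead hhb
    refine ⟨by simp, by simp [hu1, hm1.n_eq, hi], ?_⟩
    simp only [wp_seq, wp_assign, Expr.ok_ld, Expr.ok_var, Expr.eval_ld, Expr.eval_var, St.tick_v,
      St.tick_a, hu1, Int.toNat_natCast]
    refine ⟨⟨trivial, by omega, by omega⟩, by omega, ?_⟩
    have hF2 : Frame [.h] [] s1 (s1.tick.set .h (s1.a .head i)) := by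
      simpa [Frame.set_iff] using Frame.refl _ _ _
    refine inner ⟨i, hi⟩ (G.adj bm ⟨i, hi⟩) [] _ _ (List.nil_append _).symm
      (hm1.frame hF2 (by decide) (by decide)) (by simpa using hu1) (by simpa using hhead) ?_
    intro s3 hf3
    have hu3 : s3.v .u = i := (hf3.keeps.v _ (by decide)).trans (by simpa using hu1)
    simp only [wp_assign, Expr.ok_add, Expr.ok_var, Expr.ok_one, Expr.eval_add, Expr.eval_var,
      Expr.eval_one, hu3]
    refine ⟨⟨trivial, trivial⟩, by omega, by simp, ?_⟩
    obtain ⟨Ps, o, h1, h2, h3, h4⟩ := hf3.out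
    have hf4 : Found bm (anchorV ++ [.h, .u]) (fun P => ∃ h ∈ G.adj bm ⟨i, hi⟩,
        Assigned bm P ⟨i, hi⟩ h) (4 + ((G.adj bm ⟨i, hi⟩).map fun h =>
          anchorCost bm ⟨i, hi⟩ h + 2).sum) s1 (s3.set .u (i + 1)) := by
      refine ⟨?_, ⟨Ps, o, by simpa using h1, h2, h3, h4⟩, ?_⟩
      · rw [Keeps.set_iff (by decide)]
        exact (hF2.keeps.mono (by decide) (by decide)).trans_of hf3.keeps (by decide) (by decide)
      · have := hf3.clk
        simp at this ⊢; omega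
    refine (hf1.trans hf4 ?_).mono (List.Subset.refl _) ?_ ?_
    · rintro P hP ⟨u, h, hu, hA⟩ ⟨h', -, hA'⟩
      have := (hdis hP hA hA').1
      subst this
      exact lt_irrefl _ hu
    · intro P
      constructor
      · rintro (⟨u, h, hu, hA⟩ | ⟨h, -, hA⟩)
        · exact ⟨u, h, by omega, hA⟩
        · exact ⟨_, h, Nat.lt_succ_self i, hA⟩
      · rintro ⟨u, h, hu, hA⟩
        rcases Nat.lt_succ_iff_lt_or_eq.1 hu with hu | rfl
        · exact .inl ⟨u, h, hu, hA⟩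
        · exact .inr ⟨h, hA.1, hA⟩
    · have : (Finset.univ.filter fun u : Fin G.n => (u : ℕ) < i + 1) =
          insert ⟨i, hi⟩ (Finset.univ.filter fun u : Fin G.n => (u : ℕ) < i) := by
        ext u; simp [Fin.ext_iff]; omega
      rw [this, Finset.sum_insert (by simp)]
      omega
  · rintro s1 ⟨hu1, hf1⟩
    have hm1 := hm.keeps hf1.keeps (by decide) (by decide)
    refine ⟨by simp, by simp [hu1, hm1.n_eq], hQ _ ?_⟩
    obtain ⟨Ps, o, h1, h2, h3, h4⟩ := hf1.out
    refine ⟨by simpa using hf1.keeps, ⟨Ps, o, by simpa using h1, h2, h3, fun P => ?_⟩, ?_⟩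
    · rw [h4]
      refine and_congr_right fun hP => iff_of_true ?_ trivial
      obtain ⟨b, hb⟩ := mem_sols.1 hP
      obtain ⟨u, h, hA⟩ := hb.exists_assigned
      exact ⟨u, h, u.2, hA⟩
    · have := hf1.clk
      simp only [Fin.is_lt, Finset.filter_true] at this
      simp only [St.tick_clk]
      omega
  · refine ⟨by simp, .of_keeps ?_ (by simp) (by simp) (by simp)⟩
    rw [Keeps.set_iff (by decide)]; exact Keeps.refl _ _ _

end ThickEdgeGraph


/-! ### Reading the input -/

namespace ThickEdgeGraph

open Cmd

variable {G : ThickEdgeGraph} {bm Z σ : ℕ} {B : ℤ} {s : St} {Q : St → Prop}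

theorem getD_flatMap {α : Type*} {c k : ℕ} (hk : k < c) (f : α → List ℤ)
    (hf : ∀ x, (f x).length = c) (l : List α) (j : ℕ) (hj : j < l.length) :
    (l.flatMap f).getD (c * j + k) 0 = (f l[j]).getD k 0 := by
  induction l generalizing j with
  | nil => simp at hj
  | cons x l ih =>
    rw [List.flatMap_cons]
    cases j with
    | zero => rw [List.getD_append _ _ _ _ (by rw [hf]; omega)]; simp
    | succ j =>
      rw [List.getD_append_right _ _ _ _ (by rw [hf]; nlinarith), hf,
        show c * (j + 1) + k - c = c * j + k by rw [mul_add, mul_one]; omega,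
        ih j (by simpa using hj)]
      simp

theorem input_getD (j : Fin G.m) {k : ℕ} (hk : k < 5) :
    (G.input σ).getD (4 + 5 * j + k) 0 = [((G.edge j).u : ℤ), ((G.edge j).v : ℤ), (G.edge j).tu,
      (G.edge j).tv, ((G.edge j).len : ℤ)].getD k 0 := by
  rw [input, List.getD_append_right _ _ _ _ (by simp; omega),
    show 4 + 5 * (j : ℕ) + k - [(G.n : ℤ), (G.m : ℤ), (G.tmax : ℤ), (σ : ℤ)].length = 5 * j + k by
      simp; omega, getD_flatMap hk _ (fun _ => rfl) _ _ (by simp)]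
  simp

theorem Chain.update {nxt : ℕ → ℤ} {c z : ℤ} {i : ℕ} {l : List G.Half} (h : Chain nxt c l)
    (hl : ∀ a ∈ l, id a ≠ i) : Chain (Function.update nxt i z) c l := by
  induction l generalizing c with
  | nil => exact h
  | cons a l ih =>
    refine ⟨h.1, ?_⟩
    rw [Function.update_of_ne (hl a (by simp))]
    exact ih h.2 fun a ha => hl a (by simp [ha])

/-- The state holds the adjacency lists `A` and the data of the half-edges in `D`. -/
structure Holding (A : Fin G.n → List G.Half) (D : G.Half → Prop) (s : St) : Prop where
  head : ∀ x : Fin G.n, Chain (s.a .nxt) (s.a .head x) (A x)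
  dst_eq : ∀ a, D a → s.a .dst (id a) = (dst a : ℕ)
  ts_eq : ∀ a, D a → s.a .ts (id a) = ts a
  td_eq : ∀ a, D a → s.a .td (id a) = td a
  len_eq : ∀ a, D a → s.a .len (id a) = len a
  eid_eq : ∀ a, D a → s.a .eid (id a) = (a.1 : ℕ)

theorem Holding.frame {A : Fin G.n → List G.Half} {D : G.Half → Prop} {V : List Var}
    {A' : List Arr} {s' : St} (h : Holding A D s) (hF : Frame V A' s s')
    (hA : ∀ b ∈ [Arr.head, .nxt, .dst, .ts, .td, .len, .eid], b ∉ A') : Holding A D s' := by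
  simp only [List.forall_mem_cons] at hA
  obtain ⟨a1, a2, a3, a4, a5, a6, a7, -⟩ := hA
  constructor <;> simp only [hF.a _ a1, hF.a _ a2, hF.a _ a3, hF.a _ a4, hF.a _ a5, hF.a _ a6,
    hF.a _ a7]
  exacts [h.head, h.dst_eq, h.ts_eq, h.td_eq, h.len_eq, h.eid_eq]

theorem Holding.bounds (hr : Room G Z B) {A : Fin G.n → List G.Half} {D : G.Half → Prop}
    (h : Holding A D s) (x : Fin G.n) : 0 ≤ s.a .head x ∧ s.a .head x < Z := (h.head x).bounds hr

def halfArrays : List Arr := [.dst, .ts, .td, .len, .eid, .nxt, .head]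

/-- The argument expressions are evaluated between the stores, so their values are required in all
states that differ from `s` in the half-edge arrays only. -/
theorem wp_addHalf (hr : Room G Z B) {A : Fin G.n → List G.Half} {D : G.Half → Prop}
    (h : Holding A D s) {a : G.Half} (hA : ∀ x, a ∉ A x) (hq : s.v .q = id a)
    (hj : s.v .j = (a.1 : ℕ)) {x x' t t' : Expr}
    (he : ∀ s', Frame [] halfArrays s s' → (x.Ok Z s' ∧ x'.Ok Z s' ∧ t.Ok Z s' ∧ t'.Ok Z s' ∧
      (0 ≤ s.v .p + 4 ∧ s.v .p + 4 < Z)) ∧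
      x.eval s' = (src a : ℕ) ∧ x'.eval s' = (dst a : ℕ) ∧ t.eval s' = ts a ∧ t'.eval s' = td a)
    (hl : s.a .inp (s.v .p + 4).toNat = len a)
    (hQ : ∀ s', Frame [.q] halfArrays s s' →
      Holding (fun y => if y = src a then a :: A y else A y) (fun a' => D a' ∨ a' = a) s' →
      s'.v .q = id a + 1 → s'.clk = s.clk + 8 → Q s') :
    wp Z B (Prog.addHalf x x' t t') Q s := by
  have hB := hr.le_B
  have hZ := hr.le_Z
  have hid := id_lt_Z hr a
  have h1 := (src a).2
  have h2 := (dst a).2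
  have h3 := ts_pos a
  have h4 := ts_add_len_le a
  have h5 := len_nonneg a
  have h6 := td_pos a
  have h7 := td_add_len_le a
  have h8 := a.1.2
  have hb := h.bounds hr (src a)
  have f0 : Frame [] halfArrays s s := Frame.refl _ _ _
  have f1 : Frame [] halfArrays s (s.put .dst (id a) (dst a : ℕ)) := by
    rwa [Frame.put_iff (by decide)]
  have f2 : Frame [] halfArrays s ((s.put .dst (id a) (dst a : ℕ)).put .ts (id a) (ts a)) := by
    rwa [Frame.put_iff (by decide)]
  have f5 : Frame [] halfArrays s (((((s.put .dst (id a) (dst a : ℕ)).put .ts (id a) (ts a)).put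
      .td (id a) (td a)).put .len (id a) (len a)).put .eid (id a) (a.1 : ℕ)) := by
    rwa [Frame.put_iff (by decide), Frame.put_iff (by decide), Frame.put_iff (by decide)]
  have f6 : Frame [] halfArrays s ((((((s.put .dst (id a) (dst a : ℕ)).put .ts (id a) (ts a)).put
      .td (id a) (td a)).put .len (id a) (len a)).put .eid (id a) (a.1 : ℕ)).put .nxt (id a)
      (s.a .head (src a))) := by
    rwa [Frame.put_iff (by decide)]
  simp only [Prog.addHalf, wp_seq, wp_assign, wp_store, Expr.ok_ld, Expr.ok_var, Expr.ok_add,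
    Expr.ok_one, Expr.ok_four, Expr.eval_ld, Expr.eval_var, Expr.eval_add, Expr.eval_one,
    Expr.eval_four, St.put_v, St.put_a, hq, hj, Int.toNat_natCast, (he _ f0).2, (he _ f1).2,
    (he _ f2).2, (he _ f5).2, (he _ f6).2, hl, reduceCtorEq, if_false]
  refine ⟨trivial, (he _ f0).1.2.1, by omega, by omega, trivial, (he _ f1).1.2.2.1, by omega,
    by omega, trivial, (he _ f2).1.2.2.2.1, by omega, by omega, trivial,
    ⟨⟨trivial, trivial⟩, (he _ f0).1.2.2.2.2⟩, by omega, by omega, trivial, trivial, by omega,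
    by omega, trivial, ⟨(he _ f5).1.1, by omega, by omega⟩, by omega, by omega, (he _ f6).1.1,
    trivial, by omega, by omega, ⟨trivial, trivial⟩, by omega, ?_⟩
  have old : ∀ {f : ℕ → ℤ} {g : G.Half → ℤ}, (∀ a', D a' → f (id a') = g a') →
      ∀ a', (D a' ∨ a' = a) → Function.update f (id a) (g a) (id a') = g a' := by
    intro f g hf a' ha'
    by_cases haa : a' = a
    · rw [haa, Function.update_self]
    · rw [Function.update_of_ne (fun he => haa (id_inj he)), hf a' (ha'.resolve_right haa)]
  refine hQ _ ?_ ⟨fun y => ?_, ?_, ?_, ?_, ?_, ?_⟩ (by simp) (by simp)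
  · rw [Frame.set_iff (by decide), Frame.put_iff (by decide)]
    exact f6.mono (List.nil_subset _) (List.Subset.refl _)
  · simp only [St.set_a, St.put_a, reduceCtorEq, if_false, if_true]
    have hne : ∀ y, ∀ a' ∈ A y, id a' ≠ id a := fun y a' ha' he => hA y (id_inj he ▸ ha')
    by_cases hy : y = src a
    · subst hy
      rw [if_pos rfl, Function.update_self]
      refine ⟨rfl, ?_⟩
      rw [Function.update_self]
      exact (h.head _).update (hne _)
    · rw [if_neg hy, Function.update_of_ne (fun he => hy (Fin.ext he))]
      exact (h.head _).update (hne _)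
  · simpa using old h.dst_eq
  · simpa using old h.ts_eq
  · simpa using old h.td_eq
  · simpa using old h.len_eq
  · simpa using old (g := fun a => ((a.1 : ℕ) : ℤ)) h.eid_eq

theorem adjTo_succ_of_lt {j : ℕ} (hj : j < G.m) (hl : (G.edge ⟨j, hj⟩).len < bm) (x : Fin G.n) :
    adjTo (G := G) bm (j + 1) x = adjTo bm j x := by
  rw [adjTo, dif_pos hj, if_neg (by omega)]

theorem adjTo_succ_of_le {j : ℕ} (hj : j < G.m) (hl : bm ≤ (G.edge ⟨j, hj⟩).len) (x : Fin G.n) :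
    adjTo (G := G) bm (j + 1) x =
      if x = (G.edge ⟨j, hj⟩).v then
        (⟨j, hj⟩, true) :: if x = (G.edge ⟨j, hj⟩).u then (⟨j, hj⟩, false) :: adjTo bm j x
          else adjTo bm j x
      else if x = (G.edge ⟨j, hj⟩).u then (⟨j, hj⟩, false) :: adjTo bm j x else adjTo bm j x := by
  have := G.loopless ⟨j, hj⟩
  rw [adjTo, dif_pos hj, if_pos hl]
  simp only [eq_comm (b := x)]
  split_ifs with h1 h2 <;> first | rfl | exact absurd (h2.symm.trans h1) this

/-- The invariant is that the lists hold `adjTo bm j`, which is defined by the same successive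
insertions at the head. -/
theorem wp_readEdges (hr : Room G Z B) (hinp : ∀ i < Z, s.a .inp i = (G.input σ).getD i 0)
    (hm : s.v .m = G.m) (hbm : s.v .bm = bm) (h0 : ∀ x : Fin G.n, s.a .head x = 0)
    (hQ : ∀ s', Frame [.j, .p, .q] halfArrays s s' →
      Holding (G.adj bm) (fun a => (bm : ℤ) ≤ len a) s' → s'.clk ≤ s.clk + 20 * G.m + 4 → Q s') :
    wp Z B Prog.readEdges Q s := by
  have hB := hr.le_B
  have hZ := hr.le_Z
  simp only [Prog.readEdges, wp_seq, wp_assign, Expr.ok_zero, Expr.ok_one, Expr.ok_four,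
    Expr.eval_zero, Expr.eval_one, Expr.eval_four]
  refine ⟨trivial, by omega, trivial, by omega, trivial, by omega, ?_⟩
  refine wp_loop_count G.m (fun j s' => Frame [.j, .p, .q] halfArrays s s' ∧
    Holding (adjTo (G := G) bm j) (fun a => (a.1 : ℕ) < j ∧ (bm : ℤ) ≤ len a) s' ∧ s'.v .j = j ∧
    s'.v .p = 4 + 5 * j ∧ s'.v .q = 1 + 2 * j ∧ s'.clk ≤ s.clk + 20 * j + 3) ?_ ?_ ?_
  · rintro j hj s1 ⟨hF, hH, hj1, hp1, hq1, hc1⟩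
    set e := G.edge ⟨j, hj⟩ with he
    have hi : ∀ s' : St, s'.a .inp = s.a .inp → ∀ k : ℕ, (hk : k < 5) →
        s'.a .inp (4 + 5 * j + k : ℤ).toNat =
          [(e.u : ℤ), (e.v : ℤ), e.tu, e.tv, (e.len : ℤ)].getD k 0 := by
      intro s' hs k hk
      rw [hs, show (4 + 5 * j + k : ℤ).toNat = 4 + 5 * j + k by omega, hinp _ (by omega)]
      exact input_getD ⟨j, hj⟩ hk
    have hs1 : s1.a .inp = s.a .inp := hF.a _ (by decide)
    have hi4 : ∀ s' : St, s'.a .inp = s.a .inp → s'.a .inp (4 + 5 * j + 4 : ℤ).toNat = e.len :=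
      fun s' hs => by simpa using hi s' hs 4 (by omega)
    have hm1 : s1.v .m = G.m := (hF.v _ (by decide)).trans hm
    have hb1 : s1.v .bm = bm := (hF.v _ (by decide)).trans hbm
    refine ⟨by simp, by simp [hj1, hm1, hj], ?_⟩
    -- the end of the loop body
    have fin : ∀ s2 : St, Frame [.j, .p, .q] halfArrays s s2 →
        Holding (adjTo (G := G) bm (j + 1)) (fun a => (a.1 : ℕ) < j + 1 ∧ (bm : ℤ) ≤ len a) s2 →
        s2.v .j = j → s2.v .p = 4 + 5 * j → s2.v .q = 1 + 2 * (j + 1 : ℕ) →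
        s2.clk ≤ s.clk + 20 * j + 3 + 18 →
        wp Z B (.j ::= Var.j + 1 ;; .p ::= Var.p + 5) (fun s' =>
          Frame [.j, .p, .q] halfArrays s s' ∧
          Holding (adjTo (G := G) bm (j + 1)) (fun a => (a.1 : ℕ) < j + 1 ∧ (bm : ℤ) ≤ len a) s' ∧
          s'.v .j = (j + 1 : ℕ) ∧ s'.v .p = 4 + 5 * (j + 1 : ℕ) ∧ s'.v .q = 1 + 2 * (j + 1 : ℕ) ∧
          s'.clk ≤ s.clk + 20 * (j + 1) + 3) s2 := by
      intro s2 hF2 hH2 hj2 hp2 hq2 hc2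
      simp only [wp_seq, wp_assign, Expr.ok_add, Expr.ok_var, Expr.ok_one, Expr.ok_five,
        Expr.eval_add, Expr.eval_var, Expr.eval_one, Expr.eval_five, St.set_v, reduceCtorEq,
        if_false, hj2, hp2]
      refine ⟨⟨trivial, trivial⟩, by omega, ⟨trivial, trivial⟩, by omega, ?_, ?_, by simp,
        by simp; ring, by simpa using hq2, by simp; omega⟩
      · rwa [Frame.set_iff (by decide), Frame.set_iff (by decide)]
      · exact ⟨by simpa using hH2.head, by simpa using hH2.dst_eq, by simpa using hH2.ts_eq,
          by simpa using hH2.td_eq, by simpa using hH2.len_eq, by simpa using hH2.eid_eq⟩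
    rw [wp_seq]
    simp only [wp_ite, wp_assign, Cond.ok_lt, Cond.holds_lt, Expr.ok_ld, Expr.ok_add, Expr.ok_var,
      Expr.ok_two, Expr.ok_four, Expr.eval_ld, Expr.eval_add, Expr.eval_var, Expr.eval_two,
      Expr.eval_four, St.tick_v, St.tick_a, hp1, hb1, hq1, hi4 s1 hs1]
    refine ⟨⟨⟨⟨trivial, trivial⟩, by omega, by omega⟩, trivial⟩, fun hlt => ?_, fun hlt => ?_⟩
    · have hlt' : e.len < bm := by exact_mod_cast hlt
      refine ⟨⟨trivial, trivial⟩, by omega, fin _ ?_ ?_ (by simpa using hj1) (by simpa using hp1)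
        (by simp; ring) (by simp; omega)⟩
      · rw [Frame.set_iff (by decide)]; simpa using hF
      · have hD : ∀ a : G.Half, ((a.1 : ℕ) < j + 1 ∧ (bm : ℤ) ≤ len a) ↔
            ((a.1 : ℕ) < j ∧ (bm : ℤ) ≤ len a) := by
          intro a
          refine and_congr_left fun hb => ⟨fun h => ?_, fun h => by omega⟩
          rcases Nat.lt_succ_iff_lt_or_eq.1 h with h | rfl
          · exact h
          · exact absurd hb (not_le.2 (by rw [len]; exact_mod_cast hlt'))
        have hadj : adjTo (G := G) bm (j + 1) = adjTo bm j :=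
          funext fun x => adjTo_succ_of_lt hj hlt' x
        simp only [hD, hadj]
        exact ⟨by simpa using hH.head, by simpa using hH.dst_eq, by simpa using hH.ts_eq,
          by simpa using hH.td_eq, by simpa using hH.len_eq, by simpa using hH.eid_eq⟩
    · have hlt' : bm ≤ e.len := by exact_mod_cast not_lt.1 hlt
      have hF1 : Frame [] [] s1 s1.tick.tick := by simpa using Frame.refl _ _ _
      have hi0 : ∀ s' : St, s'.a .inp = s.a .inp → s'.a .inp (4 + 5 * j : ℤ).toNat = e.u :=
        fun s' hs => by simpa using hi s' hs 0 (by omega)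
      have hi1 : ∀ s' : St, s'.a .inp = s.a .inp → s'.a .inp (4 + 5 * j + 1 : ℤ).toNat = e.v :=
        fun s' hs => by simpa using hi s' hs 1 (by omega)
      have hi2 : ∀ s' : St, s'.a .inp = s.a .inp → s'.a .inp (4 + 5 * j + 2 : ℤ).toNat = e.tu :=
        fun s' hs => by simpa using hi s' hs 2 (by omega)
      have hi3 : ∀ s' : St, s'.a .inp = s.a .inp → s'.a .inp (4 + 5 * j + 3 : ℤ).toNat = e.tv :=
        fun s' hs => by simpa using hi s' hs 3 (by omega)
      have hnot : ∀ β x, ((⟨j, hj⟩, β) : G.Half) ∉ adjTo bm j x := fun β x h =>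
        lt_irrefl _ (mem_adjTo.1 h).1
      rw [wp_seq]
      refine wp_addHalf hr (a := (⟨j, hj⟩, false)) (hH.frame hF1 (by decide)) (hnot false)
        (by simp [hq1, id]; ring) (by simpa using hj1) ?_ ?_ ?_
      · intro s' hF'
        have hp' : s'.v .p = 4 + 5 * j := (hF'.v _ (by decide)).trans (by simpa using hp1)
        have hs' : s'.a .inp = s.a .inp := (hF'.a _ (by decide)).trans hs1
        simp only [Expr.ok_ld, Expr.ok_add, Expr.ok_var, Expr.ok_one, Expr.ok_two, Expr.ok_three,
          Expr.eval_ld, Expr.eval_add, Expr.eval_var, Expr.eval_one, Expr.eval_two,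
          Expr.eval_three, hp', hi0 s' hs', hi1 s' hs', hi2 s' hs', hi3 s' hs', St.tick_v, hp1]
        exact ⟨⟨⟨trivial, by omega⟩, ⟨⟨trivial, trivial⟩, by omega⟩, ⟨⟨trivial, trivial⟩, by omega⟩,
          ⟨⟨trivial, trivial⟩, by omega⟩, by omega⟩, rfl, rfl, rfl, rfl⟩
      · rw [St.tick_v, St.tick_v, St.tick_a, St.tick_a, hp1]
        exact hi4 s1 hs1
      intro s2 hF2 hH2 hq2 hc2
      have hj2 : s2.v .j = j := (hF2.v _ (by decide)).trans (by simpa using hj1)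
      have hp2 : s2.v .p = 4 + 5 * j := (hF2.v _ (by decide)).trans (by simpa using hp1)
      have hs2 : s2.a .inp = s.a .inp := (hF2.a _ (by decide)).trans hs1
      refine wp_addHalf hr (a := (⟨j, hj⟩, true)) hH2 ?_ (by simp [hq2, id])
        (by simpa using hj2) ?_ ?_ ?_
      · intro x
        split_ifs with hx
        · simpa using hnot true x
        · exact hnot true x
      · intro s' hF'
        have hp' : s'.v .p = 4 + 5 * j := (hF'.v _ (by decide)).trans (by simpa using hp2)
        have hs' : s'.a .inp = s.a .inp := (hF'.a _ (by decide)).trans hs2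
        simp only [Expr.ok_ld, Expr.ok_add, Expr.ok_var, Expr.ok_one, Expr.ok_two, Expr.ok_three,
          Expr.eval_ld, Expr.eval_add, Expr.eval_var, Expr.eval_one, Expr.eval_two,
          Expr.eval_three, hp', hi0 s' hs', hi1 s' hs', hi2 s' hs', hi3 s' hs', hp2]
        exact ⟨⟨⟨⟨trivial, trivial⟩, by omega⟩, ⟨trivial, by omega⟩, ⟨⟨trivial, trivial⟩, by omega⟩,
          ⟨⟨trivial, trivial⟩, by omega⟩, by omega⟩, rfl, rfl, rfl, rfl⟩
      · rw [hp2]; exact hi4 s2 hs2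
      intro s3 hF3 hH3 hq3 hc3
      refine fin s3 ?_ ?_ ((hF3.v _ (by decide)).trans hj2) ((hF3.v _ (by decide)).trans hp2)
        (by rw [hq3]; simp [id]; ring) (by simp at hc2; omega)
      · exact ((hF.trans_of hF1 (by decide) (by decide)).trans_of hF2 (by decide)
          (by decide)).trans_of hF3 (by decide) (by decide)
      · have hadj : adjTo (G := G) bm (j + 1) = fun y =>
            if y = src ((⟨j, hj⟩, true) : G.Half) then (⟨j, hj⟩, true) ::
              (if y = src ((⟨j, hj⟩, false) : G.Half) then (⟨j, hj⟩, false) :: adjTo bm j y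
                else adjTo bm j y)
            else if y = src ((⟨j, hj⟩, false) : G.Half) then (⟨j, hj⟩, false) :: adjTo bm j y
              else adjTo bm j y := funext fun x => adjTo_succ_of_le hj hlt' x
        have hD : ∀ a : G.Half, ((a.1 : ℕ) < j + 1 ∧ (bm : ℤ) ≤ len a) →
            (((a.1 : ℕ) < j ∧ (bm : ℤ) ≤ len a) ∨ a = (⟨j, hj⟩, false)) ∨ a = (⟨j, hj⟩, true) := by
          rintro ⟨a, β⟩ ⟨h1, h2⟩
          rcases Nat.lt_succ_iff_lt_or_eq.1 h1 with h | h
          · exact .inl (.inl ⟨h, h2⟩)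
          · obtain rfl : a = ⟨j, hj⟩ := Fin.ext h
            cases β
            · exact .inl (.inr rfl)
            · exact .inr rfl
        rw [hadj]
        exact ⟨hH3.head, fun a ha => hH3.dst_eq a (hD a ha), fun a ha => hH3.ts_eq a (hD a ha),
          fun a ha => hH3.td_eq a (hD a ha), fun a ha => hH3.len_eq a (hD a ha),
          fun a ha => hH3.eid_eq a (hD a ha)⟩
  · rintro s1 ⟨hF, hH, hj1, hp1, hq1, hc1⟩
    have hm1 : s1.v .m = G.m := (hF.v _ (by decide)).trans hm
    refine ⟨by simp, by simp [hj1, hm1], hQ _ (by simpa using hF) ?_ (by simp; omega)⟩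
    have hH' : Holding (G.adj bm) (fun a => (bm : ℤ) ≤ len a) s1 := by
      have := hH
      simp only [Fin.is_lt, true_and] at this
      exact this
    exact hH'.frame (by simpa using Frame.refl [] [] s1) (by decide)
  · refine ⟨?_, ⟨fun x => by simpa [adjTo, Chain] using h0 x, by simp, by simp, by simp, by simp,
      by simp⟩, by simp, by simp, by simp, by simp⟩
    rw [Frame.set_iff (by decide), Frame.set_iff (by decide), Frame.set_iff (by decide)]
    exact Frame.refl _ _ _

theorem wp_readInput (hr : Room G Z B) (hσ : (σ : ℤ) ≤ B)
    (hinp : ∀ i < Z, s.a .inp i = (G.input σ).getD i 0) (h0 : ∀ x : Fin G.n, s.a .head x = 0)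
    (hQ : ∀ s', Mem G (σ - 1) s' → s'.out = s.out → s'.clk ≤ s.clk + 20 * G.m + 10 → Q s') :
    wp Z B Prog.readInput Q s := by
  have hB := hr.le_B
  have hZ := hr.le_Z
  have i0 : s.a .inp 0 = G.n := by rw [hinp 0 (by omega)]; simp [input]
  have i1 : s.a .inp 1 = G.m := by rw [hinp 1 (by omega)]; simp [input]
  have i2 : s.a .inp 2 = G.tmax := by rw [hinp 2 (by omega)]; simp [input]
  have i3 : s.a .inp 3 = σ := by rw [hinp 3 (by omega)]; simp [input]
  have key : ∀ s1 : St, s1.v .n = G.n → s1.v .m = G.m → s1.v .top = G.tmax →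
      s1.v .bm = ((σ - 1 : ℕ) : ℤ) → s1.a = s.a → s1.out = s.out → s1.clk ≤ s.clk + 6 →
      wp Z B Prog.readEdges Q s1 := by
    intro s1 e1 e2 e3 e4 ea eo ec
    refine wp_readEdges hr (by rwa [ea]) e2 e4 (by rwa [ea]) ?_
    intro s2 hF hH hc
    refine hQ s2 ⟨(hF.v _ (by decide)).trans e1, (hF.v _ (by decide)).trans e3,
      (hF.v _ (by decide)).trans e4, hH.head, hH.dst_eq, hH.ts_eq, hH.td_eq, hH.len_eq, hH.eid_eq⟩
      (hF.out.trans eo) (by omega)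
  simp only [Prog.readInput, wp_seq, wp_ite, wp_assign, wp_skip, Cond.ok_lt, Cond.holds_lt,
    Expr.ok_ld, Expr.ok_sub, Expr.ok_var, Expr.ok_zero, Expr.ok_one, Expr.ok_two, Expr.ok_three,
    Expr.eval_ld, Expr.eval_sub, Expr.eval_var, Expr.eval_zero, Expr.eval_one, Expr.eval_two,
    Expr.eval_three, St.set_a, St.set_v, Int.toNat_zero, Int.toNat_one, Int.reduceToNat, i0, i1, i2,
    i3, if_true]
  refine ⟨⟨trivial, by omega, by omega⟩, by omega, ⟨trivial, by omega, by omega⟩, by omega,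
    ⟨trivial, by omega, by omega⟩, by omega, ⟨⟨trivial, by omega, by omega⟩, trivial⟩, by omega,
    ⟨trivial, trivial⟩, fun h => ⟨trivial, by omega, ?_⟩, fun h => ?_⟩
  · exact key _ (by simp) (by simp) (by simp) (by simp; omega) (by rfl) (by rfl) (by simp)
  · exact key _ (by simp) (by simp) (by simp) (by simp; omega) (by rfl) (by rfl) (by simp)

end ThickEdgeGraph


/-! ### The memory layout -/

/-- Set the base addresses of the arrays `0, …, k` to multiples of the number in `treg 0`. -/
def basesCode : ℕ → RamProg
  | 0 => .const 2 0
  | k + 1 => .seq (basesCode k) (.add (3 * (k + 1) + 2) (3 * k + 2) (treg 0))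

theorem basesCode_run {M W Z : ℕ} {r : RamState} (hr : r.reg (treg 0) = Z) :
    ∀ k : ℕ, k * Z ≤ W → ∃ r', RamRun M W (basesCode k) r r' (k + 1) ∧ r'.mem = r.mem ∧
      r'.out = r.out ∧ (∀ i ≤ k, r'.reg (3 * i + 2) = ((i * Z : ℕ) : ℤ)) ∧
      ∀ x, x % 3 ≠ 2 → r'.reg x = r.reg x := by
  intro k
  induction k with
  | zero =>
    intro _
    refine ⟨_, .const _ _ _ (by simp), rfl, rfl, fun i hi => ?_, fun x hx => ?_⟩
    · obtain rfl : i = 0 := by omega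
      simp
    · exact setReg_reg_ne _ _ (by omega)
  | succ k ih =>
    intro hk
    have h1 : (k + 1) * Z = k * Z + Z := by ring
    obtain ⟨r1, hrun, hm, ho, hb, hx⟩ := ih (by omega)
    have hs : r1.reg (3 * k + 2) + r1.reg (treg 0) = (((k + 1) * Z : ℕ) : ℤ) := by
      rw [hb k le_rfl, hx _ (by simp [treg]), hr, h1]; push_cast; ring
    refine ⟨_, .seq hrun (.add _ _ _ _ ?_), hm, ho, fun i hi => ?_, fun x hx' => ?_⟩
    · rw [hs, abs_of_nonneg (by positivity)]; exact_mod_cast hk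
    · rcases Nat.le_succ_iff.1 hi with h | rfl
      · rw [setReg_reg_ne _ _ (by omega), hb i h]
      · rw [setReg_reg_self, hs]
    · rw [setReg_reg_ne _ _ (by omega), hx x hx']

/-- Set `treg 0` to `n + 5 * m + 5`, where `n` and `m` are the first two numbers of the input. -/
def sizeCode : RamProg :=
  .seq (.const 1 0) (.seq (.load 4 1) (.seq (.const 1 1) (.seq (.load 7 1) (.seq (.const 1 5)
    (.seq (.add 1 1 4) (.seq (.add 1 1 7) (.seq (.add 1 1 7) (.seq (.add 1 1 7)
      (.seq (.add 1 1 7) (.add 1 1 7))))))))))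

theorem sizeCode_run {M W n m : ℕ} {r : RamState} (h0 : r.mem 0 = n) (h1 : r.mem 1 = m)
    (hM : 1 < M) (hW : n + 5 * m + 5 ≤ W) : ∃ r', RamRun M W sizeCode r r' 11 ∧ r'.mem = r.mem ∧
      r'.out = r.out ∧ r'.reg (treg 0) = ((n + 5 * m + 5 : ℕ) : ℤ) ∧
      ∀ x, x % 3 ≠ 1 → r'.reg x = r.reg x := by
  have key : ∀ z : ℤ, 0 ≤ z → z ≤ n + 5 * m + 5 → |z| ≤ W := fun z h h' => by
    rw [abs_of_nonneg h]; omega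
  refine ⟨_, .seq (.const _ _ _ (key _ (by omega) (by omega)))
    (.seq (.load _ _ _ 0 (by simp) (by omega) ?_)
    (.seq (.const _ _ _ (key _ (by omega) (by omega)))
    (.seq (.load _ _ _ 1 (by simp) (by omega) ?_)
    (.seq (.const _ _ _ (key _ (by omega) (by omega)))
    (.seq (.add _ _ _ _ ?_) (.seq (.add _ _ _ _ ?_) (.seq (.add _ _ _ _ ?_)
      (.seq (.add _ _ _ _ ?_) (.seq (.add _ _ _ _ ?_) (.add _ _ _ _ ?_)))))))))), rfl, rfl, ?_, ?_⟩
  all_goals simp only [RamState.setReg, h0, h1, treg, Function.update_apply, mul_zero, zero_add,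
    OfNat.ofNat_ne_one, OfNat.one_ne_ofNat, Nat.reduceEqDiff, if_true, if_false]
  · exact key _ (by omega) (by omega)
  · exact key _ (by omega) (by omega)
  · exact key _ (by omega) (by omega)
  · exact key _ (by omega) (by omega)
  · exact key _ (by omega) (by omega)
  · exact key _ (by omega) (by omega)
  · exact key _ (by omega) (by omega)
  · exact key _ (by omega) (by omega)
  · push_cast; ring
  · intro x hx
    simp only [show x ≠ 1 by omega, show x ≠ 4 by omega, show x ≠ 7 by omega, if_false]

namespace ThickEdgeGraph

open Cmd

variable (G : ThickEdgeGraph) (σ : ℕ)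

/-- The length of the arrays. -/
def arraySize : ℕ := G.n + 5 * G.m + 5

/-- The square is for the number of edges of a clique, the linear term for indices and half-edge
numbers, and the other terms for time stamps, `σ` and small constants. -/
def wordBound : ℤ := G.arraySize * G.arraySize + G.arraySize + G.tmax + σ + 10

theorem room : Room G G.arraySize (G.wordBound σ) where
  le_Z := by unfold arraySize; omega
  le_B := by
    have : (0 : ℤ) ≤ G.arraySize * G.arraySize := by positivity
    unfold wordBound; omega
  sq_le := by unfold wordBound; omega

/-- The state at the start. -/
def start : St where
  v _ := 0
  a b i := if b = .inp then (G.input σ).getD i 0 else 0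
  out := []
  clk := 0

theorem length_input : (G.input σ).length = 4 + 5 * G.m := by
  simp [input, List.length_flatMap]; omega

theorem input_bounds {z : ℤ} (hz : z ∈ G.input σ) : 0 ≤ z ∧ z ≤ G.wordBound σ := by
  have hB := (G.room σ).le_B
  have h1 : (0 : ℤ) ≤ G.arraySize * G.arraySize := by positivity
  have h2 : G.wordBound σ = G.arraySize * G.arraySize + G.arraySize + G.tmax + σ + 10 := rfl
  have h3 : G.arraySize = G.n + 5 * G.m + 5 := rfl
  simp only [input, List.mem_append, List.mem_cons, List.not_mem_nil, or_false,
    List.mem_flatMap] at hz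
  rcases hz with (rfl | rfl | rfl | rfl) | ⟨j, -, hz⟩
  · omega
  · omega
  · omega
  · omega
  · have := (G.edge j).u.2
    have := (G.edge j).v.2
    have := G.tu_pos j
    have := G.tv_pos j
    have := G.tu_le j
    have := G.tv_le j
    rcases hz with rfl | rfl | rfl | rfl | rfl <;> omega

theorem start_bdd : (G.start σ).Bdd (G.wordBound σ) := by
  have hB := (G.room σ).le_B
  have h0 : -G.wordBound σ ≤ 0 ∧ 0 ≤ G.wordBound σ := by omega
  refine ⟨fun _ => h0, fun b i => ?_⟩
  simp only [start]
  split_ifs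
  · by_cases hi : i < (G.input σ).length
    · rw [List.getD_eq_getElem _ _ hi]
      have := G.input_bounds σ (List.getElem_mem hi)
      omega
    · rw [List.getD_eq_default _ _ (not_lt.1 hi)]; exact h0
  · exact h0

/-- The whole program. -/
def enumerationCode : RamProg := .seq sizeCode (.seq (basesCode 16) Prog.main.code)

variable {G σ}

theorem setup_run {M W : ℕ} (hM : 1 < M) (hW : 17 * G.arraySize ≤ W) :
    ∃ r t, (∀ r' t', RamRun M W Prog.main.code r r' t' →
      RamRun M W enumerationCode (RamState.init (G.input σ)) r' (t + t')) ∧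
      Sim G.arraySize (G.start σ) r ∧ t = 28 := by
  have hZ : G.arraySize = G.n + 5 * G.m + 5 := rfl
  obtain ⟨r1, h1, hm1, ho1, hz1, hx1⟩ := sizeCode_run (M := M) (W := W) (n := G.n) (m := G.m)
    (r := RamState.init (G.input σ)) (by simp [RamState.init, input]) (by simp [RamState.init, input])
    hM (by omega)
  obtain ⟨r2, h2, hm2, ho2, hb2, hx2⟩ := basesCode_run (M := M) (W := W) hz1 16 (by omega)
  refine ⟨r2, 11 + (16 + 1), fun r' t' h => ?_, ⟨fun x => ?_, fun b => ?_, fun b i hi => ?_, ?_⟩, rfl⟩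
  · rw [add_assoc]; exact .seq h1 (.seq h2 h)
  · rw [hx2 _ (by unfold Var.reg; omega), hx1 _ (by unfold Var.reg; omega)]; rfl
  · have := b.ctorIdx_lt
    exact hb2 _ (by unfold Arr.count at this; omega)
  · rw [hm2, hm1]
    simp only [RamState.init, start]
    by_cases hb : b = .inp
    · subst hb
      -- The array `inp` has the base address `0`, so the input is already in place. It is shorter
      -- than an array, so all other arrays start out zero.
      rw [if_pos rfl, show Arr.inp.ctorIdx = 0 from rfl, zero_mul, zero_add]
    · have h1 : 1 ≤ b.ctorIdx := Nat.pos_of_ne_zero fun h => hb (Arr.ctorIdx_injective h)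
      have h2 := Nat.mul_le_mul_right G.arraySize h1
      rw [if_neg hb, List.getD_eq_default _ _ (by rw [length_input]; omega)]
  · rw [ho2, ho1]; rfl

/-! ### The number of cliques and the total time -/

theorem image_sols : cliqueOf '' (G.sols (σ - 1) : Set (Finset G.SV)) =
    G.longClosedActiveCliques σ := by
  ext d
  constructor
  · rintro ⟨P, hP, rfl⟩
    obtain ⟨b, hb⟩ := mem_sols.1 (Finset.mem_coe.1 hP)
    exact hb.cliqueOf_mem
  · intro hd
    obtain ⟨P, b, hP, rfl⟩ := exists_sol hd
    exact ⟨P, Finset.mem_coe.2 (mem_sols.2 ⟨b, hP⟩), rfl⟩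

theorem cliqueOf_injOn {bm : ℕ} : Set.InjOn cliqueOf (G.sols bm : Set (Finset G.SV)) := by
  intro P hP P' hP' h
  obtain ⟨b, hb⟩ := mem_sols.1 (Finset.mem_coe.1 hP)
  obtain ⟨b', hb'⟩ := mem_sols.1 (Finset.mem_coe.1 hP')
  exact hb.cliqueOf_inj hb' h

theorem ncard_longClosedActiveCliques :
    (G.longClosedActiveCliques σ).ncard = (G.sols (σ - 1)).card := by
  rw [← image_sols, cliqueOf_injOn.ncard_image, Set.ncard_coe_finset]

theorem enumerates {Ps : List (Finset G.SV)} {o : List ℤ} (hw : Writes Ps o) (hnd : Ps.Nodup)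
    (hPs : ∀ P, P ∈ Ps ↔ P ∈ G.sols (σ - 1)) :
    G.Enumerates o (G.longClosedActiveCliques σ) := by
  obtain ⟨C, h1, h2, h3⟩ := hw
  refine ⟨C, h1, h2, ?_, fun d => ?_⟩
  · rw [h3]
    exact hnd.map_on fun P hP P' hP' h =>
      cliqueOf_injOn (Finset.mem_coe.2 ((hPs P).1 hP)) (Finset.mem_coe.2 ((hPs P').1 hP')) h
  · rw [h3, ← image_sols, List.mem_map, Set.mem_image]
    simp only [hPs, Finset.mem_coe]

variable (G) in
-- With `q = min (Δ², m)` the cost of a clique is `q² Δ`, and the two bounds for `q` give the two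
-- terms of the minimum.
theorem cliqueBound_sq_mul_le : G.cliqueBound * G.cliqueBound * G.maxDegree ≤
    16 * min (G.maxDegree ^ 5) (G.m ^ 2 * G.maxDegree) := by
  have h1 : G.cliqueBound * G.cliqueBound * G.maxDegree =
      16 * (min (G.maxDegree ^ 2) G.m ^ 2 * G.maxDegree) := by unfold cliqueBound; ring
  rw [h1]
  refine Nat.mul_le_mul_left _ (le_min ?_ ?_)
  · calc _ ≤ (G.maxDegree ^ 2) ^ 2 * G.maxDegree :=
          Nat.mul_le_mul_right _ (Nat.pow_le_pow_left (min_le_left _ _) 2)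
      _ = _ := by ring
  · exact Nat.mul_le_mul_right _ (Nat.pow_le_pow_left (min_le_right _ _) 2)

open scoped Classical in
-- Handling the `D` half-edges of `u` costs `O(D²)` even where no search is made. At least one
-- half-edge is canonical and its search yields a clique, so the weighted number of leaves is at
-- least `D` and pays for this. In the searches one factor `D` is replaced by `Δ`, while the other
-- is kept for the summation over the clique.
theorem sum_anchorCost_le {bm : ℕ} (u : Fin G.n) :
    ((G.adj bm u).map fun h => anchorCost bm u h + 2).sum ≤ 2000 * (G.cliqueBound * G.maxDegree) *
      ∑ h ∈ (G.adj bm u).toFinset with Canonical bm u h,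
        (G.adj bm u).length * leaves bm u (ts h) := by
  rcases Nat.eq_zero_or_pos (G.adj bm u).length with h0 | hd
  · rw [List.length_eq_zero_iff.1 h0]; simp
  set D := (G.adj bm u).length with hD
  obtain ⟨g0, hg0⟩ := List.exists_mem_of_length_pos hd
  obtain ⟨g, hg, hcan, -⟩ := exists_canonical hg0
  have hQ : 1 ≤ G.cliqueBound :=
    le_trans (by omega) (length_adj_sv_le (starting_ne_nil hg) 0)
  have hDΔ : D ≤ G.maxDegree := length_adj_le u
  set Y := ∑ h ∈ (G.adj bm u).toFinset with Canonical bm u h, D * leaves bm u (ts h) with hY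
  have hDY : D ≤ Y := by
    refine le_trans (Nat.le_mul_of_pos_right D (one_le_leaves (starting_ne_nil hg)))
      (Finset.single_le_sum (f := fun h => D * leaves bm u (ts h)) (fun _ _ => Nat.zero_le _) ?_)
    exact Finset.mem_filter.2 ⟨List.mem_toFinset.2 hg, hcan⟩
  have h1 : ∀ h ∈ (G.adj bm u).toFinset, anchorCost bm u h + 2 ≤ 33 * D +
      if Canonical bm u h then 1960 * (G.cliqueBound * D) * (D * leaves bm u (ts h)) else 0 := by
    intro h _
    rw [anchorCost, ← hD]
    split_ifs with hc
    · have h2 := Nat.mul_le_mul (show D + 1 ≤ 2 * D by omega) (show D + 1 ≤ 2 * D by omega)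
      have h3 := Nat.mul_le_mul_right (leaves bm u (ts h))
        (Nat.mul_le_mul_left (490 * G.cliqueBound) h2)
      have h4 : 490 * G.cliqueBound * (2 * D * (2 * D)) * leaves bm u (ts h) =
        1960 * (G.cliqueBound * D) * (D * leaves bm u (ts h)) := by ring
      omega
    · omega
  rw [← List.sum_toFinset _ (nodup_adj u)]
  refine (Finset.sum_le_sum h1).trans ?_
  rw [Finset.sum_add_distrib, Finset.sum_const, List.toFinset_card_of_nodup (nodup_adj u), ← hD,
    smul_eq_mul, ← Finset.sum_filter, ← Finset.mul_sum, ← hY]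
  have h5 : D * D ≤ G.cliqueBound * G.maxDegree * Y :=
    (Nat.mul_le_mul hDΔ hDY).trans (Nat.mul_le_mul_right _ (Nat.le_mul_of_pos_left _ hQ))
  have h6 := Nat.mul_le_mul_right Y (Nat.mul_le_mul_left 1960 (Nat.mul_le_mul_left G.cliqueBound hDΔ))
  have h7 : 2000 * (G.cliqueBound * G.maxDegree) * Y = 2000 * (G.cliqueBound * G.maxDegree * Y) := by
    ring
  have h8 : 1960 * (G.cliqueBound * G.maxDegree) * Y = 1960 * (G.cliqueBound * G.maxDegree * Y) := by
    ring
  have h9 : D * (33 * D) = 33 * (D * D) := by ring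
  omega

/-- The retained degree factor, summed over all anchors of a clique, is one `cliqueBound`; the work
at a node is the other. -/
theorem sum_cost_le : ∑ u : Fin G.n, (4 + ((G.adj (σ - 1) u).map fun h =>
      anchorCost (σ - 1) u h + 2).sum) ≤ 4 * G.n + 32000 * ((G.longClosedActiveCliques σ).ncard *
        min (G.maxDegree ^ 5) (G.m ^ 2 * G.maxDegree)) := by
  classical
  rw [Finset.sum_add_distrib, Finset.sum_const, Finset.card_univ, Fintype.card_fin, smul_eq_mul,
    mul_comm G.n]
  refine Nat.add_le_add_left ((Finset.sum_le_sum fun u _ => sum_anchorCost_le u).trans ?_) _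
  rw [← Finset.mul_sum, ncard_longClosedActiveCliques]
  have h1 := sum_anchored_le (G.sols (σ - 1)) fun Q hQ => mem_sols.1 hQ
  have h2 : ∑ u : Fin G.n, ∑ h ∈ (G.adj (σ - 1) u).toFinset with Canonical (σ - 1) u h,
      (G.adj (σ - 1) u).length * leaves (σ - 1) u (ts h) ≤ (G.sols (σ - 1)).card * G.cliqueBound := by
    refine le_trans (le_of_eq ?_) h1
    simp only [leaves]
  have h3 := Nat.mul_le_mul_left (2000 * (G.cliqueBound * G.maxDegree)) h2
  have h4 := Nat.mul_le_mul_left (2000 * (G.sols (σ - 1)).card) (cliqueBound_sq_mul_le G)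
  calc _ ≤ 2000 * (G.cliqueBound * G.maxDegree) * ((G.sols (σ - 1)).card * G.cliqueBound) := h3
    _ = 2000 * (G.sols (σ - 1)).card * (G.cliqueBound * G.cliqueBound * G.maxDegree) := by ring
    _ ≤ _ := h4
    _ = _ := by ring

theorem wp_main {Q : St → Prop} (hQ : ∀ s', G.Enumerates s'.out (G.longClosedActiveCliques σ) →
      s'.clk ≤ 20 * G.m + 4 * G.n + 12 + 32000 * ((G.longClosedActiveCliques σ).ncard *
        min (G.maxDegree ^ 5) (G.m ^ 2 * G.maxDegree)) → Q s') :
    wp G.arraySize (G.wordBound σ) Prog.main Q (G.start σ) := by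
  have hr := G.room σ
  rw [Prog.main, wp_seq]
  refine wp_readInput (σ := σ) hr ?_ (fun i _ => by simp [start]) (fun x => by simp [start]) ?_
  · have : (0 : ℤ) ≤ G.arraySize * G.arraySize := by positivity
    unfold wordBound; omega
  intro s1 hm1 ho1 hc1
  refine wp_searches hr hm1 ?_
  intro s2 hf
  obtain ⟨Ps, o, h1, h2, h3, h4⟩ := hf.out
  refine hQ s2 ?_ ?_
  · rw [h1, ho1]
    exact enumerates (by simpa [start] using h2) h3 fun P => by simpa using h4 P
  · have h5 := hf.clk
    have h6 := sum_cost_le (G := G) (σ := σ)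
    have h7 : (G.start σ).clk = 0 := rfl
    omega

/-- Words of `O(log (n + m + tmax + σ + 2))` bits are wide enough. -/
theorem word_le (κ : ℕ) {C : ℕ} (hC : 40 * κ + 100 ≤ C) :
    (κ : ℤ) * G.wordBound σ + Arr.count * G.arraySize ≤
      ((G.n + G.m + G.tmax + σ + 2) ^ C : ℕ) := by
  set X := G.n + G.m + G.tmax + σ + 2 with hX
  have hZ : G.arraySize ≤ 5 * X := by unfold arraySize; omega
  have h2 : 2 ≤ X := by omega
  have hXX : 2 * X ≤ X * X := Nat.mul_le_mul_right X h2
  have hZZ := Nat.mul_le_mul hZ hZ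
  have hZZ' : 5 * X * (5 * X) = 25 * (X * X) := by ring
  have hB : G.wordBound σ ≤ ((40 * (X * X) : ℕ) : ℤ) := by
    have : G.wordBound σ = ((G.arraySize * G.arraySize + G.arraySize + G.tmax + σ + 10 : ℕ) : ℤ) := by
      unfold wordBound; push_cast; ring
    rw [this]
    exact_mod_cast (by omega :
      G.arraySize * G.arraySize + G.arraySize + G.tmax + σ + 10 ≤ 40 * (X * X))
  have h3 : κ * (40 * (X * X)) + 17 * G.arraySize ≤ X ^ C := by
    calc κ * (40 * (X * X)) + 17 * G.arraySize ≤ κ * (40 * (X * X)) + 85 * (X * X) := by omega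
      _ = (40 * κ + 85) * X ^ 2 := by ring
      -- A constant factor is moved into the exponent, which is possible since `X` is at least `2`.
      _ ≤ 2 ^ (40 * κ + 85) * X ^ 2 := Nat.mul_le_mul_right _ Nat.lt_two_pow_self.le
      _ ≤ X ^ (40 * κ + 85) * X ^ 2 := Nat.mul_le_mul_right _ (Nat.pow_le_pow_left h2 _)
      _ = X ^ (40 * κ + 87) := by rw [← pow_add]
      _ ≤ X ^ C := Nat.pow_le_pow_right (by omega) (by omega)
  calc (κ : ℤ) * G.wordBound σ + Arr.count * G.arraySize
      ≤ κ * ((40 * (X * X) : ℕ) : ℤ) + Arr.count * G.arraySize := by gcongr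
    _ = ((κ * (40 * (X * X)) + 17 * G.arraySize : ℕ) : ℤ) := by unfold Arr.count; push_cast; ring
    _ ≤ _ := by exact_mod_cast h3

end ThickEdgeGraph

open ThickEdgeGraph in
theorem mainTheorem8 :
    ∃ (P : RamProg) (C : ℕ), ∀ (G : ThickEdgeGraph) (σ : ℕ),
      ∃ (s : RamState) (t : ℕ),
        RamRun (C * (G.n + G.m + 1)) ((G.n + G.m + G.tmax + σ + 2) ^ C) P
          (RamState.init (G.input σ)) s t ∧
        G.Enumerates s.out (G.longClosedActiveCliques σ) ∧
        t ≤ C * (G.n + G.m + 1 +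
          (G.longClosedActiveCliques σ).ncard * min (G.maxDegree ^ 5) (G.m ^ 2 * G.maxDegree)) := by
  -- The cost of the program is hidden behind a variable, so that it is never evaluated.
  obtain ⟨κ, hκ⟩ : ∃ κ, Prog.main.cost ≤ κ := ⟨_, le_rfl⟩
  -- One constant for memory, word width and time: `32000 * κ` is for the compiled ticks, `100` for
  -- the layout of the memory and the `17` arrays.
  refine ⟨enumerationCode, 32000 * κ + 100, fun G σ => ?_⟩
  have hZ : G.arraySize = G.n + 5 * G.m + 5 := rfl
  have hM0 : 100 * (G.n + G.m + 1) ≤ (32000 * κ + 100) * (G.n + G.m + 1) :=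
    Nat.mul_le_mul_right _ (by omega)
  have hM : Arr.count * G.arraySize ≤ (32000 * κ + 100) * (G.n + G.m + 1) := by
    unfold Arr.count; omega
  have hW := word_le (G := G) (σ := σ) κ (C := 32000 * κ + 100) (by omega)
  have hB : 1 ≤ G.wordBound σ := by have := (G.room σ).le_B; omega
  have hκB : 0 ≤ (κ : ℤ) * G.wordBound σ :=
    mul_nonneg (Int.natCast_nonneg κ) (by omega)
  have hW' : 17 * G.arraySize ≤ (G.n + G.m + G.tmax + σ + 2) ^ (32000 * κ + 100) := by
    have : ((17 * G.arraySize : ℕ) : ℤ) ≤ (((G.n + G.m + G.tmax + σ + 2) ^ (32000 * κ + 100) : ℕ) : ℤ) := by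
      refine le_trans ?_ hW
      unfold Arr.count
      push_cast
      omega
    exact_mod_cast this
  obtain ⟨r, t0, hrun, hsim, ht0⟩ := setup_run (G := G) (σ := σ)
    (M := (32000 * κ + 100) * (G.n + G.m + 1)) (by omega) hW'
  obtain ⟨r', t, s', h1, h2, -, ⟨h3, h4⟩, h5⟩ := Cmd.code_run hB hM κ hW Prog.main hκ
    (fun s' => G.Enumerates s'.out (G.longClosedActiveCliques σ) ∧
      s'.clk ≤ 20 * G.m + 4 * G.n + 12 + 32000 * ((G.longClosedActiveCliques σ).ncard *
        min (G.maxDegree ^ 5) (G.m ^ 2 * G.maxDegree))) _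
    (wp_main fun s' h h' => ⟨h, h'⟩) (G.start_bdd σ) r hsim
  refine ⟨r', t0 + t, hrun _ _ h1, by rwa [h2.out], ?_⟩
  have h6 : (G.start σ).clk = 0 := rfl
  rw [h6, mul_zero, add_zero] at h5
  set Y := (G.longClosedActiveCliques σ).ncard * min (G.maxDegree ^ 5) (G.m ^ 2 * G.maxDegree)
  have h7 := Nat.mul_le_mul_left κ (h4.trans
    (show _ ≤ 32000 * (G.n + G.m + 1 + Y) by omega))
  have h8 : (32000 * κ + 100) * (G.n + G.m + 1 + Y) =
    κ * (32000 * (G.n + G.m + 1 + Y)) + 100 * (G.n + G.m + 1 + Y) := by ring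
  omega
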